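/- Let $n\ge 0$ and let $(V_{\mathbb Z},t,m)$ be a regular, unimodular polarized hyperplane arrangement: $V_{\mathbb Z}\subset\mathbb Z^n$ is a lattice with real span $V$, whose image in $\mathbb Z^I$ is a direct summand for every $I\subset[n]$; $t\in\mathbb R^n/V$; $m\in V^\vee$; in the affine space $V(t)=V+t\subset\mathbb R^n$ any set $S$ of the hyperplanes $\{x_i=0\}$ with non-empty intersection meets in codimension $|S|$, and $m$ is not constant on any one-dimensional flat of this arrangement. Let $D=(\mathbb C^\times)^n$, let $F$ be the torus with character lattice $V_{\mathbb Z}$ and $G=\ker(D\to F)$, with cocharacter lattice $\mathfrak g_{\mathbb Z}=\{g\in\mathbb Z^n: \sum_i g_iv_i=0\ \forall v\in V_{\mathbb Z}\}$. A sign vector $\alpha\in\{+,-\}^n$ is feasible if the open orthant it defines meets $V(t)$, and bounded if $m$ is bounded above on the intersection of the closed orthant with $V$. Write $\mathcal F$, $\mathcal B$ for the sets of feasible and bounded sign vectors and $\mathcal B^c$ for the complement of $\mathcal B$. Let $Q$ be the quiver with vertices $-,+$ and one arrow in each direction. Let $A_1^{\mathsf{dR}}$ be its path algebra over $\mathbb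 C$, with arrows $u:+\to-$, $v:-\to+$ and central element $d=uv+vu$. Let $A_1^{\mathsf{Bet}}$ be the same path algebra, with arrows written $\ell:+\to-$, $r:-\to+$, localized at the central element $1-(\ell r+r\ell)$. (Products of paths are read from left to right.) Put $A_n^\bullet=(A_1^\bullet)^{\otimes n}$, with idempotents $e_\alpha$ and central elements $d_i$, respectively $m_i=1-(\ell_ir_i+r_i\ell_i)$. Let $A_G^{\mathsf{dR}}=A_n^{\mathsf{dR}}/(\sum_i g_id_i: g\in\mathfrak g_{\mathbb Z})$ and $A_G^{\mathsf{Bet}}=A_n^{\mathsf{Bet}}/(\prod_i m_i^{g_i}-1: g\in\mathfrak g_{\mathbb Z})$. For $\bullet\in\{\mathsf{dR},\mathsf{Bet}\}$ put $e_T=\sum_{\alpha\in T}e_\alpha$, $A_G^\bullet(t,-)=e_{\mathcal F}A_G^\bullet e_{\mathcal F}$ and $$A_G^\bullet(t,m)=A_G^\bullet(t,-)\big/\,A_G^\bullet(t,-)\,e_{\mathcal F\cap\mathcal B^c}\,A_G^\bullet(t,-).$$ Write $\mathsf{Mod}_A$ for the unbounded derived category of right $A$-modules. Let $\mathsf{Mod}_A^{\mathrm{mon}}$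 be its full subcategory of monodromic objects, i.e. those on whose cohomology all $1-m_i$ (Betti case), respectively all $d_i$ (de Rham case), act locally nilpotently. Let $i^\bullet_*:\mathsf{Mod}_{A_G^\bullet(t,m)}\to\mathsf{Mod}_{A_G^\bullet(t,-)}$ be restriction along the projection. (1) With $A=A_G^{\mathsf{Bet}}(t,-)$ and $e=e_{\mathcal F\cap\mathcal B^c}$, the ideal $AeA$ is stratifying, i.e. $i_*^{\mathsf{Bet}}:\mathsf{Mod}_{A_G^{\mathsf{Bet}}(t,m)}\to\mathsf{Mod}_A$ is fully faithful. Moreover $i^{\mathsf{Bet}}_*$ and $j^*:\mathsf{Mod}_A\to\mathsf{Mod}_{eAe}$, $M\mapsto Me$, are part of a recollement: there are adjoints $i^*\dashv i_*\dashv i^!$ and $j_!\dashv j^*\dashv j_*$; the functors $i_*,j_!,j_*$ are fully faithful; $j^*i_*=0$; and for every $X$ the counits and units extend to exact triangles $i_*i^!X\to X\to j_*j^*X\to$ and $j_!j^*X\to X\to i_*i^*X\to$. (2) The inclusions $\mathsf{Mod}^{\mathrm{mon}}_{A_G^{\bullet}(t,m)}\to\mathsf{Mod}_{A_G^{\bullet}(t,m)}$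 are equivalences for $\bullet=\mathsf{Bet}$ and $\bullet=\mathsf{dR}$. (3) Let $I$ be the ideal generated by the $1-m_i$ and $J$ the ideal generated by the $d_i$. For every $k\ge0$ there is a $\mathbb C$-algebra isomorphism $A_n^{\mathsf{Bet}}/I^{k+1}\cong A_n^{\mathsf{dR}}/J^{k+1}$ preserving the idempotents, with $\ell_i\mapsto u_i$ and $r_i\mapsto\frac{1-\exp(2\pi i\,d_i)}{d_i}v_i$ (in the exponent, $i=\sqrt{-1}$). These isomorphisms induce $\mathbb C$-algebra isomorphisms $A_G^{\mathsf{Bet}}(t,-)/I^{k+1}\cong A_G^{\mathsf{dR}}(t,-)/J^{k+1}$ and $A_G^{\mathsf{Bet}}(t,m)\cong A_G^{\mathsf{dR}}(t,m)$. There are $\mathbb C$-linear triangulated equivalences $$RH:\mathsf{Mod}^{\mathrm{mon}}_{A_G^{\mathsf{dR}}(t,-)}\simeq\mathsf{Mod}^{\mathrm{mon}}_{A_G^{\mathsf{Bet}}(t,-)},\qquad RH:\mathsf{Mod}^{\mathrm{mon}}_{A_G^{\mathsf{dR}}(t,m)}\simeq\mathsf{Mod}^{\mathrm{mon}}_{A_G^{\mathsf{Bet}}(t,m)}$$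 which intertwine $i_*^{\mathsf{dR}}$ and $i_*^{\mathsf{Bet}}$. For each $k$, the first is given, up to isomorphism, on objects coming from $\mathsf{Mod}_{A_G^{\mathsf{dR}}(t,-)/J^{k+1}}$ by restriction along the isomorphism above. The second is restriction along $A_G^{\mathsf{Bet}}(t,m)\cong A_G^{\mathsf{dR}}(t,m)$, and this restriction is an equivalence $\mathsf{Mod}_{A_G^{\mathsf{dR}}(t,m)}\simeq\mathsf{Mod}_{A_G^{\mathsf{Bet}}(t,m)}$. -/

import Mathlib

open CategoryTheory CategoryTheory.Limits CategoryTheory.Pretriangulated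
open scoped TensorProduct

noncomputable section

namespace HypertoricO

/-! ### Polarized hyperplane arrangements -/

/-- A sign vector; `true` stands for `+` and `false` for `-`. -/
abbrev SignVector (n : ℕ) : Type := Fin n → Bool

/-- The real subspace of `ℝⁿ` spanned by a lattice `V ⊆ ℤⁿ`. -/
def realSpan {n : ℕ} (V : Submodule ℤ (Fin n → ℤ)) : Submodule ℝ (Fin n → ℝ) :=
  Submodule.span ℝ ((fun v i => (v i : ℝ)) '' (V : Set (Fin n → ℤ)))

/-- The image of `V ⊆ ℤⁿ → ℤᴵ` is a direct summand of `ℤᴵ` for every `I ⊆ [n]`. -/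
def IsUnimodular {n : ℕ} (V : Submodule ℤ (Fin n → ℤ)) : Prop :=
  ∀ I : Set (Fin n), IsComplemented (V.map (LinearMap.funLeft ℤ ℤ (Subtype.val : I → Fin n)))

/-- A polarized hyperplane arrangement indexed by `[n]`: a lattice `V ⊆ ℤⁿ`, a translation
parameter `t ∈ ℝⁿ / V_ℝ` and a linear functional `m` on `V_ℝ`. -/
structure PolarizedArrangement (n : ℕ) where
  V : Submodule ℤ (Fin n → ℤ)
  t : (Fin n → ℝ) ⧸ realSpan V
  m : Module.Dual ℝ (realSpan V)

namespace PolarizedArrangement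

variable {n : ℕ} (P : PolarizedArrangement n)

/-- The affine space `V(t) = V_ℝ + t ⊆ ℝⁿ`. -/
def affineSpace : Set (Fin n → ℝ) :=
  {x | Submodule.Quotient.mk x = P.t}

/-- The flat `H_S ⊆ V(t)` cut out by the hyperplanes `x_i = 0`, `i ∈ S`. -/
def flat (S : Finset (Fin n)) : Set (Fin n → ℝ) :=
  {x | x ∈ P.affineSpace ∧ ∀ i ∈ S, x i = 0}

/-- The linear space of directions of the flat `H_S` (when the latter is nonempty). -/
def flatDirection (S : Finset (Fin n)) : Submodule ℝ (realSpan P.V) where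
  carrier := {v | ∀ i ∈ S, (v : Fin n → ℝ) i = 0}
  add_mem' ha hb i hi := by simp [ha i hi, hb i hi]
  zero_mem' i _ := by simp
  smul_mem' c v hv i hi := by simp [hv i hi]

/-- `t` is regular: the arrangement in `V(t)` is simple, that is, any set `S` of hyperplanes with
nonempty intersection meets in codimension `|S|`. -/
def TRegular : Prop :=
  ∀ S : Finset (Fin n), (P.flat S).Nonempty →
    Module.finrank ℝ (P.flatDirection S) + S.card = Module.finrank ℝ (realSpan P.V)

/-- `m` is regular: it is not constant on any one-dimensional flat. -/
def MRegular : Prop :=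
  ∀ S : Finset (Fin n), (P.flat S).Nonempty → Module.finrank ℝ (P.flatDirection S) = 1 →
    ∃ v ∈ P.flatDirection S, P.m v ≠ 0

/-- `α` is feasible if the corresponding chamber of `ℝⁿ` meets `V(t)`. -/
def Feasible (α : SignVector n) : Prop :=
  ∃ x ∈ P.affineSpace, ∀ i, if α i then 0 < x i else x i < 0

/-- `α` is bounded if `m` is bounded above on the corresponding closed chamber in `V_ℝ`. -/
def Bounded (α : SignVector n) : Prop :=
  BddAbove (P.m '' {v | ∀ i, if α i then 0 ≤ (v : Fin n → ℝ) i else (v : Fin n → ℝ) i ≤ 0})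

/-- The cocharacter lattice of `G = ker (D → F)`, where `D = (ℂˣ)ⁿ` and `F` is the torus with
character lattice `V`: the integral vectors orthogonal to `V`. -/
def cocharG : Set (Fin n → ℤ) :=
  {g | ∀ v ∈ P.V, ∑ i, g i * v i = 0}

end PolarizedArrangement

/-- A hypertoric category `𝒪` datum: a regular and unimodular polarized arrangement. -/
structure CategoryODatum (n : ℕ) extends PolarizedArrangement n where
  unimodular : IsUnimodular V
  tRegular : toPolarizedArrangement.TRegular
  mRegular : toPolarizedArrangement.MRegular

/-! ### Quotients by two-sided ideals, corners -/

section Quotient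

variable {A : Type} [Ring A] [Algebra ℂ A]

/-- The quotient of `A` by the two-sided ideal generated by `S`. -/
def QuotientBy (S : Set A) : Type := (TwoSidedIdeal.span S).ringCon.Quotient

instance (S : Set A) : Ring (QuotientBy S) :=
  inferInstanceAs (Ring (TwoSidedIdeal.span S).ringCon.Quotient)

instance (S : Set A) : Algebra ℂ (QuotientBy S) :=
  inferInstanceAs (Algebra ℂ (TwoSidedIdeal.span S).ringCon.Quotient)

/-- The projection onto the quotient by the two-sided ideal generated by `S`. -/
def QuotientBy.mk (S : Set A) : A →ₐ[ℂ] QuotientBy S :=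
  (TwoSidedIdeal.span S).ringCon.mkₐ ℂ

lemma QuotientBy.mk_eq_zero {S : Set A} {a : A} (ha : a ∈ S) : QuotientBy.mk S a = 0 := by
  have h : a ∈ TwoSidedIdeal.span S := TwoSidedIdeal.subset_span ha
  rw [TwoSidedIdeal.mem_iff] at h
  exact Quotient.sound' h

instance cornerModule {e : A} (he : IsIdempotentElem e) : Module ℂ he.Corner :=
  letI : SMul ℂ he.Corner := ⟨fun c x => ⟨c • x.1, by
    obtain ⟨r, hr⟩ := x.2
    exact ⟨c • r, by simp only at hr ⊢; rw [← hr]; simp⟩⟩⟩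
  Function.Injective.module ℂ
    (⟨⟨fun x => x.1, rfl⟩, fun _ _ => rfl⟩ : he.Corner →+ A) Subtype.val_injective
    (fun _ _ => rfl)

instance cornerAlgebra {e : A} (he : IsIdempotentElem e) : Algebra ℂ he.Corner :=
  Algebra.ofModule
    (fun c x y => Subtype.ext (smul_mul_assoc c x.1 y.1))
    (fun c x y => Subtype.ext (mul_smul_comm c x.1 y.1))

/-- The element `e a e` of the corner algebra `e A e`. -/
def toCorner {e : A} (he : IsIdempotentElem e) (a : A) : he.Corner := ⟨e * a * e, a, rfl⟩

end Quotient

/-! ### The algebras attached to a family of idempotents -/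

section Arrangement

variable {n : ℕ} {A : Type} [Ring A]

open Classical in
/-- The sum `e_T` of the idempotents `e_α` with `α ∈ T`. -/
def sumIdem (E : SignVector n → A) (T : Set (SignVector n)) : A :=
  ∑ α with α ∈ T, E α

lemma sumIdem_idem {E : SignVector n → A} (hE : OrthogonalIdempotents E)
    (T : Set (SignVector n)) : IsIdempotentElem (sumIdem E T) :=
  hE.isIdempotentElem_sum

lemma sumIdem_mul {E : SignVector n → A} (hE : OrthogonalIdempotents E)
    {T U : Set (SignVector n)} (h : U ⊆ T) : sumIdem E T * sumIdem E U = sumIdem E U := by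
  classical
  unfold sumIdem
  rw [Finset.mul_sum]
  refine Finset.sum_congr rfl fun β hβ => ?_
  simp only [Finset.sum_mul, hE.mul_eq]
  rw [Finset.sum_ite_eq', if_pos]
  simp only [Finset.mem_filter, Finset.mem_univ, true_and] at hβ ⊢
  exact h hβ

lemma mul_sumIdem {E : SignVector n → A} (hE : OrthogonalIdempotents E)
    {T U : Set (SignVector n)} (h : U ⊆ T) : sumIdem E U * sumIdem E T = sumIdem E U := by
  classical
  unfold sumIdem
  rw [Finset.sum_mul]
  refine Finset.sum_congr rfl fun β hβ => ?_
  simp only [Finset.mul_sum, hE.mul_eq]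
  rw [Finset.sum_ite_eq, if_pos]
  simp only [Finset.mem_filter, Finset.mem_univ, true_and] at hβ ⊢
  exact h hβ

/-- The algebra `A(t,-) = e_ℱ A e_ℱ`, where `ℱ` is the set of feasible sign vectors. -/
abbrev FeasibleAlg (P : PolarizedArrangement n) {E : SignVector n → A}
    (hE : OrthogonalIdempotents E) : Type :=
  (sumIdem_idem hE {α | P.Feasible α}).Corner

variable (P : PolarizedArrangement n) {E : SignVector n → A} (hE : OrthogonalIdempotents E)

/-- The element `e_ℱ a e_ℱ` of `A(t,-)`. -/
def toFeasible (a : A) : FeasibleAlg P hE :=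
  toCorner (sumIdem_idem hE {α | P.Feasible α}) a

/-- The idempotent `e_{ℱ ∩ ℬᶜ}` of `A(t,-)` given by the feasible unbounded sign vectors. -/
def unboundedIdem : FeasibleAlg P hE :=
  toFeasible P hE (sumIdem E {α | P.Feasible α ∧ ¬ P.Bounded α})

lemma unboundedIdem_val :
    (unboundedIdem P hE).1 = sumIdem E {α | P.Feasible α ∧ ¬ P.Bounded α} := by
  have h : {α | P.Feasible α ∧ ¬ P.Bounded α} ⊆ {α | P.Feasible α} := fun _ h => h.1
  change _ * _ * _ = _
  rw [sumIdem_mul hE h, mul_sumIdem hE h]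

lemma unboundedIdem_idem : IsIdempotentElem (unboundedIdem P hE) := by
  apply Subtype.ext
  change (unboundedIdem P hE).1 * (unboundedIdem P hE).1 = _
  rw [unboundedIdem_val]
  exact sumIdem_idem hE _

variable [Algebra ℂ A]

/-- The algebra `A(t,m)`: the (underived) quotient of `A(t,-)` by the two-sided ideal generated
by `e_{ℱ ∩ ℬᶜ}`. -/
abbrev BoundedAlg : Type := QuotientBy {unboundedIdem P hE}

/-- The class of `e_ℱ a e_ℱ` in `A(t,m)`. -/
def toBounded (a : A) : BoundedAlg P hE := QuotientBy.mk _ (toFeasible P hE a)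

end Arrangement

/-! ### The path algebra of the quiver with vertices `-`, `+` and one arrow in each direction -/

/-- Vertices and arrows of the quiver: `down : + → -` and `up : - → +`. -/
inductive QuiverGen : Type
  | vertex (s : Bool)
  | down
  | up

open QuiverGen in
/-- The relations of the path algebra; paths are composed from left to right. -/
inductive PathRel : FreeAlgebra ℂ QuiverGen → FreeAlgebra ℂ QuiverGen → Prop
  | idem (s : Bool) :
      PathRel (FreeAlgebra.ι ℂ (vertex s) * FreeAlgebra.ι ℂ (vertex s)) (FreeAlgebra.ι ℂ (vertex s))
  | ortho (s s' : Bool) (h : s ≠ s') :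
      PathRel (FreeAlgebra.ι ℂ (vertex s) * FreeAlgebra.ι ℂ (vertex s')) 0
  | complete : PathRel (FreeAlgebra.ι ℂ (vertex true) + FreeAlgebra.ι ℂ (vertex false)) 1
  | down_source : PathRel (FreeAlgebra.ι ℂ (vertex true) * FreeAlgebra.ι ℂ down) (FreeAlgebra.ι ℂ down)
  | down_target : PathRel (FreeAlgebra.ι ℂ down * FreeAlgebra.ι ℂ (vertex false)) (FreeAlgebra.ι ℂ down)
  | up_source : PathRel (FreeAlgebra.ι ℂ (vertex false) * FreeAlgebra.ι ℂ up) (FreeAlgebra.ι ℂ up)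
  | up_target : PathRel (FreeAlgebra.ι ℂ up * FreeAlgebra.ι ℂ (vertex true)) (FreeAlgebra.ι ℂ up)

/-- The path algebra over `ℂ`. -/
def PathAlg : Type := RingQuot PathRel

instance : Ring PathAlg := inferInstanceAs (Ring (RingQuot PathRel))
instance : Algebra ℂ PathAlg := inferInstanceAs (Algebra ℂ (RingQuot PathRel))

namespace PathAlg

/-- The class of a generator. -/
def gen (x : QuiverGen) : PathAlg := RingQuot.mkAlgHom ℂ PathRel (FreeAlgebra.ι ℂ x)

/-- The idempotents `e_+ = e true` and `e_- = e false`. -/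
def e (s : Bool) : PathAlg := gen (.vertex s)

/-- The arrow from `+` to `-` (called `u` in the de Rham and `ℓ` in the Betti setting). -/
def down : PathAlg := gen .down

/-- The arrow from `-` to `+` (called `v` in the de Rham and `r` in the Betti setting). -/
def up : PathAlg := gen .up

/-- The central element `down * up + up * down`. -/
def loop : PathAlg := down * up + up * down

lemma e_orthogonal : OrthogonalIdempotents e where
  idem s := by
    have := RingQuot.mkAlgHom_rel ℂ (PathRel.idem s)
    rw [map_mul] at this
    exact this
  ortho s s' h := by
    have := RingQuot.mkAlgHom_rel ℂ (PathRel.ortho s s' h)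
    rw [map_mul, map_zero] at this
    exact this

end PathAlg

/-! ### Tensor powers -/

section TensorPower

variable (n : ℕ) (B : Type) [Ring B] [Algebra ℂ B]

/-- The `n`-th tensor power of the algebra `B` over `ℂ`. -/
def TensorPower : Type := ⨂[ℂ] _ : Fin n, B

instance : Ring (TensorPower n B) := inferInstanceAs (Ring (⨂[ℂ] _ : Fin n, B))
instance : Algebra ℂ (TensorPower n B) := inferInstanceAs (Algebra ℂ (⨂[ℂ] _ : Fin n, B))

variable {n B}

/-- The pure tensor `b_1 ⊗ ⋯ ⊗ b_n`. -/
def pureTensor (b : Fin n → B) : TensorPower n B := PiTensorProduct.tprod ℂ b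

/-- The element `1 ⊗ ⋯ ⊗ b ⊗ ⋯ ⊗ 1` with `b` at the position `i`. -/
def inFactor (i : Fin n) (b : B) : TensorPower n B := pureTensor (Function.update 1 i b)

lemma pureTensor_mul (b c : Fin n → B) : pureTensor b * pureTensor c = pureTensor (b * c) :=
  PiTensorProduct.tprod_mul_tprod b c

lemma pureTensor_orthogonal {e : Bool → B} (he : OrthogonalIdempotents e) :
    OrthogonalIdempotents fun α : SignVector n => pureTensor fun i => e (α i) where
  idem α := by
    rw [IsIdempotentElem, pureTensor_mul]
    congr 1
    funext i
    exact he.idem _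
  ortho α β h := by
    obtain ⟨i, hi⟩ := Function.ne_iff.1 h
    rw [pureTensor_mul]
    exact (PiTensorProduct.tprod ℂ).map_coord_zero i (he.ortho hi)

end TensorPower

/-! ### The de Rham algebras -/

section DeRham

variable {n : ℕ}

/-- `A^dR_n`, the `n`-th tensor power of the path algebra. -/
abbrev AdR (n : ℕ) : Type := TensorPower n PathAlg

/-- The idempotent `e_α` of `A^dR_n`. -/
def idemdR (α : SignVector n) : AdR n := pureTensor fun i => PathAlg.e (α i)

/-- The central element `d_i = u_i v_i + v_i u_i` of `A^dR_n`. -/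
def paramdR (i : Fin n) : AdR n := inFactor i PathAlg.loop

lemma idemdR_orthogonal : OrthogonalIdempotents (idemdR (n := n)) :=
  pureTensor_orthogonal PathAlg.e_orthogonal

variable (P : PolarizedArrangement n)

/-- The algebra `A^dR_G = A^dR_n ⊗_{Sym 𝔤} ℂ`: the quotient of `A^dR_n` by the elements
`∑ g_i d_i` with `g` in the cocharacter lattice of `G` (which spans `𝔤` over `ℂ`). -/
abbrev AdRG : Type := QuotientBy {x : AdR n | ∃ g ∈ P.cocharG, x = ∑ i, g i • paramdR i}

/-- The projection `A^dR_n → A^dR_G`. -/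
def projdR : AdR n →ₐ[ℂ] AdRG P := QuotientBy.mk _

lemma projdR_orthogonal : OrthogonalIdempotents (projdR P ∘ idemdR) :=
  idemdR_orthogonal.map (projdR P).toRingHom

/-- The algebra `A^dR_G(t,-)`. -/
abbrev AdRt : Type := FeasibleAlg P (projdR_orthogonal P)

/-- The algebra `A^dR_G(t,m)`. -/
abbrev AdRtm : Type := BoundedAlg P (projdR_orthogonal P)

end DeRham

/-! ### The Betti algebras -/

section Betti

variable {n : ℕ}

/-- The element `m x - 1` of `P_ℂ(Q)[x]`, where `m = 1 - (ℓr + rℓ)`. -/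
def localizationRel : Polynomial PathAlg :=
  Polynomial.C (1 - PathAlg.loop) * Polynomial.X - 1

/-- The localization `P_ℂ(Q)[m⁻¹]` of the path algebra at the central element `m = 1 - (ℓr + rℓ)`,
presented as `P_ℂ(Q)[x] / (m x - 1)`. -/
abbrev ABet1 : Type := QuotientBy {localizationRel}

/-- The localization map `P_ℂ(Q) → P_ℂ(Q)[m⁻¹]`. -/
def toABet1 : PathAlg →ₐ[ℂ] ABet1 := (QuotientBy.mk _).comp Polynomial.CAlgHom

lemma mk_localizationRel :
    QuotientBy.mk {localizationRel} (Polynomial.C (1 - PathAlg.loop) * Polynomial.X) = 1 := by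
  have h := QuotientBy.mk_eq_zero (Set.mem_singleton localizationRel)
  have h' : Polynomial.C (1 - PathAlg.loop) * Polynomial.X = localizationRel + 1 := by
    rw [localizationRel, sub_add_cancel]
  rw [h', map_add, h, map_one, zero_add]

/-- The element `m` as a unit of `A^Bet_1`. -/
def monodromyUnit : ABet1ˣ where
  val := toABet1 (1 - PathAlg.loop)
  inv := QuotientBy.mk _ Polynomial.X
  val_inv := by
    have h := mk_localizationRel
    rwa [map_mul] at h
  inv_val := by
    have h := mk_localizationRel
    rwa [← Polynomial.X_mul_C, map_mul] at h

/-- `A^Bet_n`, the `n`-th tensor power of `A^Bet_1`. -/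
abbrev ABet (n : ℕ) : Type := TensorPower n ABet1

/-- The idempotent `e_α` of `A^Bet_n`. -/
def idemBet (α : SignVector n) : ABet n := pureTensor fun i => toABet1 (PathAlg.e (α i))

/-- The central element `1 - m_i = ℓ_i r_i + r_i ℓ_i` of `A^Bet_n`. -/
def paramBet (i : Fin n) : ABet n := 1 - inFactor i (monodromyUnit : ABet1)

lemma idemBet_orthogonal : OrthogonalIdempotents (idemBet (n := n)) :=
  pureTensor_orthogonal (PathAlg.e_orthogonal.map toABet1.toRingHom)

variable (P : PolarizedArrangement n)

/-- The algebra `A^Bet_G = A^Bet_n ⊗_{ℂ[G^L]} ℂ`: the quotient of `A^Bet_n` by the elements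
`m_1^{g_1} ⋯ m_n^{g_n} - 1` with `g` in the cocharacter lattice of `G`. -/
abbrev ABetG : Type :=
  QuotientBy {x : ABet n | ∃ g ∈ P.cocharG,
    x = pureTensor (fun i => ((monodromyUnit ^ g i : ABet1ˣ) : ABet1)) - 1}

/-- The projection `A^Bet_n → A^Bet_G`. -/
def projBet : ABet n →ₐ[ℂ] ABetG P := QuotientBy.mk _

lemma projBet_orthogonal : OrthogonalIdempotents (projBet P ∘ idemBet) :=
  idemBet_orthogonal.map (projBet P).toRingHom

/-- The algebra `A^Bet_G(t,-)`. -/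
abbrev ABett : Type := FeasibleAlg P (projBet_orthogonal P)

/-- The algebra `A^Bet_G(t,m)`. -/
abbrev ABettm : Type := BoundedAlg P (projBet_orthogonal P)

end Betti

/-! ### Infinitesimal neighbourhoods and Malgrange's isomorphisms -/

section Neighbourhood

variable {n : ℕ} {A : Type} [Ring A] [Algebra ℂ A]

/-- The monomials of degree `k` in the elements `z_1, …, z_n`. -/
def monomials (z : Fin n → A) (k : ℕ) : Set A :=
  Set.range fun s : Fin k → Fin n => (List.ofFn fun j => z (s j)).prod

/-- The quotient `A / I^{k+1}`, where `I` is the two-sided ideal generated by the central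
elements `z_1, …, z_n`. -/
abbrev Nbhd (z : Fin n → A) (k : ℕ) : Type := QuotientBy (monomials z (k + 1))

/-- The power series `(1 - exp (2πi x)) / x`, truncated after degree `k`. -/
def malgrangeSeries (k : ℕ) (x : A) : A :=
  -∑ j ∈ Finset.range (k + 1),
    ((2 * Real.pi * Complex.I) ^ (j + 1) / (Nat.factorial (j + 1) : ℂ)) • x ^ j

end Neighbourhood

/-! ### Derived categories of right modules -/

section Derived

/-- The category of right modules over `A`. -/
abbrev RMod (A : Type) [Ring A] : Type 1 := ModuleCat.{0} Aᵐᵒᵖ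

instance (A : Type) [Ring A] : HasDerivedCategory.{1} (RMod A) := HasDerivedCategory.standard _

/-- The (unbounded) derived category of right modules over `A`. -/
abbrev DMod (A : Type) [Ring A] : Type 1 := DerivedCategory (RMod A)

variable {A B : Type} [Ring A] [Ring B]

instance (f : A →+* B) : PreservesFiniteLimits (ModuleCat.restrictScalars.{0} f) :=
  ⟨fun _ _ _ => ⟨inferInstance⟩⟩

instance (f : A →+* B) : PreservesFiniteColimits (ModuleCat.restrictScalars.{0} f) :=
  ⟨fun _ _ _ => ⟨inferInstance⟩⟩

/-- The restriction functor `D(B) ⥤ D(A)` along `f : A → B`. -/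
def res (f : A →+* B) : DMod B ⥤ DMod A :=
  (ModuleCat.restrictScalars.{0} (RingHom.op f)).mapDerivedCategory

/-- For an idempotent `e` of `A`, the additive subgroup `M e` of the right module `M`. -/
def cornerSubgroup (e : A) (M : RMod A) : AddSubgroup M where
  carrier := {x | MulOpposite.op e • x = x}
  add_mem' ha hb := by
    simp only [Set.mem_ofPred_eq] at ha hb ⊢
    rw [smul_add, ha, hb]
  zero_mem' := smul_zero _
  neg_mem' ha := by
    simp only [Set.mem_ofPred_eq] at ha ⊢
    rw [smul_neg, ha]

instance cornerSubgroupModule {e : A} (he : IsIdempotentElem e) (M : RMod A) :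
    Module he.Cornerᵐᵒᵖ (cornerSubgroup e M) where
  smul c x := ⟨MulOpposite.op c.unop.1 • x.1, by
    have h := ((Subsemigroup.mem_corner_iff he).1 c.unop.2).2
    change MulOpposite.op e • (MulOpposite.op c.unop.1 • x.1) = _
    rw [← mul_smul, ← MulOpposite.op_mul, h]⟩
  one_smul x := Subtype.ext x.2
  mul_smul c d x := Subtype.ext (mul_smul (MulOpposite.op c.unop.1) (MulOpposite.op d.unop.1) x.1)
  smul_zero c := Subtype.ext (smul_zero (MulOpposite.op c.unop.1))
  smul_add c x y := Subtype.ext (smul_add (MulOpposite.op c.unop.1) x.1 y.1)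
  add_smul c d x := Subtype.ext
    (add_smul (MulOpposite.op c.unop.1) (MulOpposite.op d.unop.1) x.1)
  zero_smul x := Subtype.ext (zero_smul Aᵐᵒᵖ x.1)

/-- The functor `M ↦ M e = Hom_A (eA, M)` from right `A`-modules to right `eAe`-modules. -/
def cornerFunctor {e : A} (he : IsIdempotentElem e) : RMod A ⥤ RMod he.Corner where
  obj M := ModuleCat.of he.Cornerᵐᵒᵖ (cornerSubgroup e M)
  map {M N} f := ModuleCat.ofHom
    { toFun := fun x => ⟨f.hom x.1, by
        change MulOpposite.op e • f.hom x.1 = _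
        rw [← map_smul, show MulOpposite.op e • x.1 = x.1 from x.2]⟩
      map_add' := fun x y => Subtype.ext (map_add f.hom x.1 y.1)
      map_smul' := fun c x => Subtype.ext (map_smul f.hom (MulOpposite.op c.unop.1) x.1) }

instance {e : A} (he : IsIdempotentElem e) : (cornerFunctor he).Additive where

instance {e : A} (he : IsIdempotentElem e) : (cornerFunctor he).PreservesHomology := by
  have h : ∀ (S : ShortComplex (RMod A)), S.Exact → (S.map (cornerFunctor he)).Exact := by
    intro S hS
    rw [ShortComplex.moduleCat_exact_iff] at hS ⊢
    intro x hx
    obtain ⟨y, hy⟩ := hS x.1 (congrArg Subtype.val hx)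
    refine ⟨⟨MulOpposite.op e • y, ?_⟩, Subtype.ext ?_⟩
    · change MulOpposite.op e • (MulOpposite.op e • y) = _
      rw [← mul_smul, ← MulOpposite.op_mul, he.eq]
    · change S.f.hom (MulOpposite.op e • y) = x.1
      rw [map_smul]
      exact (congrArg _ hy).trans x.2
  exact ((cornerFunctor he).exact_tfae.out 1 2).1 h

instance {e : A} (he : IsIdempotentElem e) : PreservesFiniteLimits (cornerFunctor he) :=
  (cornerFunctor he).preservesFiniteLimits_of_preservesHomology

instance {e : A} (he : IsIdempotentElem e) : PreservesFiniteColimits (cornerFunctor he) :=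
  (cornerFunctor he).preservesFiniteColimits_of_preservesHomology

/-- The functor `D(A) ⥤ D(eAe)`, `M ↦ M e`. -/
def cornerRes {e : A} (he : IsIdempotentElem e) : DMod A ⥤ DMod he.Corner :=
  (cornerFunctor he).mapDerivedCategory

instance (f : A →+* B) : (res f).CommShift ℤ :=
  inferInstanceAs (Functor.CommShift (Functor.mapDerivedCategory _) ℤ)

instance (f : A →+* B) : (res f).IsTriangulated :=
  inferInstanceAs (Functor.IsTriangulated (Functor.mapDerivedCategory _))

/-- The cohomology of the restriction is the restriction of the cohomology. -/
lemma homology_res (f : A →+* B) (X : DMod B) (k : ℤ) :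
    Nonempty ((DerivedCategory.homologyFunctor (RMod A) k).obj ((res f).obj X) ≅
      (ModuleCat.restrictScalars.{0} (RingHom.op f)).obj
        ((DerivedCategory.homologyFunctor (RMod B) k).obj X)) := by
  let F := ModuleCat.restrictScalars.{0} (RingHom.op f)
  let K := DerivedCategory.Q.objPreimage X
  let e : DerivedCategory.Q.obj K ≅ X := DerivedCategory.Q.objObjPreimageIso X
  refine ⟨(DerivedCategory.homologyFunctor (RMod A) k).mapIso ((res f).mapIso e.symm) ≪≫ ?_ ≪≫
    F.mapIso ((DerivedCategory.homologyFunctor (RMod B) k).mapIso e)⟩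
  exact (DerivedCategory.homologyFunctor (RMod A) k).mapIso (F.mapDerivedCategoryFactors.app K) ≪≫
    (DerivedCategory.homologyFunctorFactors (RMod A) k).app _ ≪≫
    ShortComplex.mapHomologyIso (K.sc k) F ≪≫
    F.mapIso ((DerivedCategory.homologyFunctorFactors (RMod B) k).app K).symm

/-! ### Monodromic objects -/

variable {n : ℕ}

/-- A right module is monodromic if the elements `z_1, …, z_n` act locally nilpotently. -/
def IsMonodromicModule (z : Fin n → A) : ObjectProperty (RMod A) := fun M =>
  ∀ (x : M) (i : Fin n), ∃ N : ℕ, MulOpposite.op (z i ^ N) • x = 0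

/-- An object of `D(A)` is monodromic if its cohomology modules are: for `A` over
`ℂ[F^L]` this means that the object is set-theoretically supported at the point where all `z_i`
vanish. -/
def IsMonodromic (z : Fin n → A) : ObjectProperty (DMod A) := fun X =>
  ∀ k : ℤ, IsMonodromicModule z ((DerivedCategory.homologyFunctor (RMod A) k).obj X)

lemma IsMonodromicModule.of_injective {z : Fin n → A} {M N : RMod A} (f : M ⟶ N)
    (hf : Function.Injective f.hom) (hN : IsMonodromicModule z N) : IsMonodromicModule z M := by
  intro x i
  obtain ⟨k, hk⟩ := hN (f.hom x) i
  refine ⟨k, hf ?_⟩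
  rw [map_smul, hk, map_zero]

lemma IsMonodromicModule.of_exact {z : Fin n → A} {S : ShortComplex (RMod A)} (hS : S.Exact)
    (h₁ : IsMonodromicModule z S.X₁) (h₃ : IsMonodromicModule z S.X₃) :
    IsMonodromicModule z S.X₂ := by
  rw [ShortComplex.moduleCat_exact_iff] at hS
  intro x i
  obtain ⟨k, hk⟩ := h₃ (S.g.hom x) i
  rw [← map_smul] at hk
  obtain ⟨y, hy⟩ := hS _ hk
  obtain ⟨l, hl⟩ := h₁ y i
  refine ⟨k + l, ?_⟩
  rw [pow_add, MulOpposite.op_mul, mul_smul]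
  have h := map_smul S.f.hom (MulOpposite.op (z i ^ l)) y
  rw [hl, map_zero] at h
  exact (congrArg _ hy.symm).trans h.symm

lemma IsMonodromicModule.of_iso {z : Fin n → A} {M N : RMod A} (e : M ≅ N)
    (hN : IsMonodromicModule z N) : IsMonodromicModule z M :=
  .of_injective e.hom e.toLinearEquiv.injective hN

instance (z : Fin n → A) : (IsMonodromic z).IsClosedUnderIsomorphisms where
  of_iso e h k := .of_iso ((DerivedCategory.homologyFunctor (RMod A) k).mapIso e.symm) (h k)

instance (z : Fin n → A) : (IsMonodromic z).IsTriangulated where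
  exists_zero := by
    obtain ⟨Z, hZ⟩ := HasZeroObject.zero (C := DMod A)
    refine ⟨Z, hZ, fun k x i => ⟨0, ?_⟩⟩
    have h := (DerivedCategory.homologyFunctor (RMod A) k).map_isZero hZ
    have := ModuleCat.subsingleton_of_isZero h
    exact Subsingleton.elim _ _
  isStableUnderShiftBy a :=
    { le_shift := fun X hX k => .of_iso
        (((DerivedCategory.homologyFunctor (RMod A) 0).shiftIso a k (a + k) rfl).app X)
        (hX (a + k)) }
  toIsTriangulatedClosed₂ := .mk' fun T hT h₁ h₃ k => .of_exact
    ((DerivedCategory.homologyFunctor (RMod A) k).map_distinguished_exact T hT) (h₁ k) (h₃ k)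

/-- The category `D(A)^mon` of monodromic objects, a triangulated subcategory of `D(A)`. -/
abbrev MonDMod (z : Fin n → A) : Type 1 := (IsMonodromic z).FullSubcategory

lemma isMonodromic_res (f : A →+* B) {z : Fin n → A} {w : Fin n → B}
    (hw : ∀ i, f (z i) = w i) {X : DMod B} (hX : IsMonodromic w X) :
    IsMonodromic z ((res f).obj X) := by
  intro k
  refine .of_iso (homology_res f X k).some fun x i => ?_
  obtain ⟨N, hN⟩ := hX k x i
  refine ⟨N, ?_⟩
  rw [← hw, ← map_pow] at hN
  exact hN

/-- Restriction along `f`, as a functor between categories of monodromic objects. -/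
def monRes (f : A →+* B) {z : Fin n → A} {w : Fin n → B} (hw : ∀ i, f (z i) = w i) :
    MonDMod w ⥤ MonDMod z :=
  (IsMonodromic z).lift ((IsMonodromic w).ι ⋙ res f) fun X => isMonodromic_res f hw X.property

lemma isMonodromic_of_pow_eq_zero {z : Fin n → A} (N : ℕ) (h : ∀ i, z i ^ N = 0) (X : DMod A) :
    IsMonodromic z X := fun k x i => ⟨N, by rw [h, MulOpposite.op_zero, zero_smul]⟩

end Derived

/-! ### Recollements and stratifying ideals -/

/-- A recollement of triangulated categories `D' → D → D''` with given functors `i_*` and `j^*`. -/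
structure Recollement {D' D D'' : Type 1} [Category.{1} D'] [Category.{1} D] [Category.{1} D'']
    [HasZeroObject D] [HasZeroObject D''] [Preadditive D] [HasShift D ℤ]
    [∀ a : ℤ, (shiftFunctor D a).Additive] [Pretriangulated D]
    (iLow : D' ⥤ D) (jUp : D ⥤ D'') where
  /-- the left adjoint `i^*` of `i_*` -/
  iUp : D ⥤ D'
  /-- the right adjoint `i^!` of `i_* = i_!` -/
  iUpShriek : D ⥤ D'
  /-- the left adjoint `j_!` of `j^! = j^*` -/
  jLowShriek : D'' ⥤ D
  /-- the right adjoint `j_*` of `j^*` -/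
  jLow : D'' ⥤ D
  adjI : iUp ⊣ iLow
  adjIShriek : iLow ⊣ iUpShriek
  adjJShriek : jLowShriek ⊣ jUp
  adjJ : jUp ⊣ jLow
  iLow_full : iLow.Full
  iLow_faithful : iLow.Faithful
  jLowShriek_full : jLowShriek.Full
  jLowShriek_faithful : jLowShriek.Faithful
  jLow_full : jLow.Full
  jLow_faithful : jLow.Faithful
  isZero_comp : ∀ X : D', IsZero (jUp.obj (iLow.obj X))
  /-- the triangle `i_* i^! X → X → j_* j^* X → i_* i^! X[1]` -/
  triangle₁ : ∀ X : D, ∃ δ : jLow.obj (jUp.obj X) ⟶ (shiftFunctor D (1 : ℤ)).obj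
      (iLow.obj (iUpShriek.obj X)),
    Triangle.mk (adjIShriek.counit.app X) (adjJ.unit.app X) δ ∈ distTriang D
  /-- the triangle `j_! j^* X → X → i_* i^* X → j_! j^* X[1]` -/
  triangle₂ : ∀ X : D, ∃ δ : iLow.obj (iUp.obj X) ⟶ (shiftFunctor D (1 : ℤ)).obj
      (jLowShriek.obj (jUp.obj X)),
    Triangle.mk (adjJShriek.counit.app X) (adjI.unit.app X) δ ∈ distTriang D

section Stratifying

variable {A : Type} [Ring A] [Algebra ℂ A]

/-- The ideal `A e A` is stratifying: restriction `D(A / A e A) ⥤ D(A)` is fully faithful. -/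
def IsStratifying (e : A) : Prop :=
  (res (QuotientBy.mk {e}).toRingHom).Full ∧ (res (QuotientBy.mk {e}).toRingHom).Faithful

end Stratifying

/-! ### The Riemann-Hilbert correspondence -/

section NbhdRes

variable {n : ℕ} {A : Type} [Ring A] [Algebra ℂ A]

lemma Nbhd.pow_eq_zero (z : Fin n → A) (k : ℕ) (i : Fin n) :
    (QuotientBy.mk (monomials z (k + 1)) (z i)) ^ (k + 1) = 0 := by
  rw [← map_pow]
  refine QuotientBy.mk_eq_zero ⟨fun _ => i, ?_⟩
  simp only [List.ofFn_const, List.prod_replicate]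

/-- The restriction functor from the derived category of `A / I^{k+1}` to the category of monodromic
objects of `D(A)`. -/
def nbhdRes (z : Fin n → A) (k : ℕ) : DMod (Nbhd z k) ⥤ MonDMod z :=
  (IsMonodromic z).lift (res (QuotientBy.mk (monomials z (k + 1))).toRingHom) fun X =>
    isMonodromic_res _ (w := fun i => QuotientBy.mk _ (z i)) (fun _ => rfl)
      (isMonodromic_of_pow_eq_zero (k + 1) (Nbhd.pow_eq_zero z k) X)

end NbhdRes

section RiemannHilbert

variable {n : ℕ} (P : PolarizedArrangement n)

/-- The elements `d_i` of `A^dR_G(t,-)`. -/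
def paramdRt (i : Fin n) : AdRt P := toFeasible P (projdR_orthogonal P) (projdR P (paramdR i))

/-- The elements `d_i` of `A^dR_G(t,m)`. -/
def paramdRtm (i : Fin n) : AdRtm P := toBounded P (projdR_orthogonal P) (projdR P (paramdR i))

/-- The elements `1 - m_i` of `A^Bet_G(t,-)`. -/
def paramBett (i : Fin n) : ABett P := toFeasible P (projBet_orthogonal P) (projBet P (paramBet i))

/-- The elements `1 - m_i` of `A^Bet_G(t,m)`. -/
def paramBettm (i : Fin n) : ABettm P := toBounded P (projBet_orthogonal P) (projBet P (paramBet i))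

/-- The idempotent `e_{ℱ ∩ ℬᶜ}` of `A^Bet_G(t,-)`. -/
abbrev idemUBet : ABett P := unboundedIdem P (projBet_orthogonal P)

/-- The projection `i^dR : A^dR_G(t,-) → A^dR_G(t,m)`. -/
def idR : AdRt P →+* AdRtm P := (QuotientBy.mk {unboundedIdem P (projdR_orthogonal P)}).toRingHom

/-- The projection `i^Bet : A^Bet_G(t,-) → A^Bet_G(t,m)`. -/
def iBet : ABett P →+* ABettm P := (QuotientBy.mk {idemUBet P}).toRingHom

/-- The functor `i^dR_*` between the categories of monodromic objects. -/
def idRMon : MonDMod (paramdRtm P) ⥤ MonDMod (paramdRt P) := monRes (idR P) fun _ => rfl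

/-- The functor `i^Bet_*` between the categories of monodromic objects. -/
def iBetMon : MonDMod (paramBettm P) ⥤ MonDMod (paramBett P) := monRes (iBet P) fun _ => rfl

/-- A `ℂ`-linear triangulated equivalence between categories of monodromic objects. -/
structure MonEquiv {A B : Type} [Ring A] [Algebra ℂ A] [Ring B] [Algebra ℂ B]
    (z : Fin n → A) (w : Fin n → B) where
  equiv : MonDMod z ≌ MonDMod w
  commShift : equiv.functor.CommShift ℤ
  isTriangulated : equiv.functor.IsTriangulated
  linear : equiv.functor.Linear ℂ

/-- The algebraic Riemann-Hilbert correspondence for the arrangement `P`. -/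
structure RiemannHilbert where
  /-- Malgrange's isomorphisms `A^Bet_n / I^{k+1} ≃ A^dR_n / J^{k+1}` -/
  rh (k : ℕ) : Nbhd (paramBet (n := n)) k ≃ₐ[ℂ] Nbhd (paramdR (n := n)) k
  rh_vertex (k : ℕ) (i : Fin n) (s : Bool) :
    rh k (QuotientBy.mk _ (inFactor i (toABet1 (PathAlg.e s)))) =
      QuotientBy.mk _ (inFactor i (PathAlg.e s))
  rh_down (k : ℕ) (i : Fin n) :
    rh k (QuotientBy.mk _ (inFactor i (toABet1 PathAlg.down))) =
      QuotientBy.mk _ (inFactor i PathAlg.down)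
  rh_up (k : ℕ) (i : Fin n) :
    rh k (QuotientBy.mk _ (inFactor i (toABet1 PathAlg.up))) =
      QuotientBy.mk _ (malgrangeSeries k (paramdR i) * inFactor i PathAlg.up)
  /-- the isomorphisms induced by `rh` on the algebras `A(t,-)` -/
  rht (k : ℕ) : Nbhd (paramBett P) k ≃ₐ[ℂ] Nbhd (paramdRt P) k
  rht_compat (k : ℕ) (x : ABet n) (y : AdR n) (h : rh k (QuotientBy.mk _ x) = QuotientBy.mk _ y) :
    rht k (QuotientBy.mk _ (toFeasible P (projBet_orthogonal P) (projBet P x))) =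
      QuotientBy.mk _ (toFeasible P (projdR_orthogonal P) (projdR P y))
  /-- the isomorphism induced by `rh` on the algebras `A(t,m)` -/
  rhtm : ABettm P ≃ₐ[ℂ] AdRtm P
  rhtm_compat (k : ℕ) (x : ABet n) (y : AdR n) (h : rh k (QuotientBy.mk _ x) = QuotientBy.mk _ y) :
    QuotientBy.mk (monomials (paramdRtm P) (k + 1))
        (rhtm (toBounded P (projBet_orthogonal P) (projBet P x))) =
      QuotientBy.mk (monomials (paramdRtm P) (k + 1))
        (toBounded P (projdR_orthogonal P) (projdR P y))
  /-- the equivalence `D(A^dR_G(t,-))^mon ≌ D(A^Bet_G(t,-))^mon` -/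
  RHt : MonEquiv (paramdRt P) (paramBett P)
  /-- the equivalence `D(A^dR_G(t,m))^mon ≌ D(A^Bet_G(t,m))^mon` -/
  RHtm : MonEquiv (paramdRtm P) (paramBettm P)
  /-- the Riemann-Hilbert equivalences intertwine `i^dR_*` and `i^Bet_*` -/
  square : RHtm.equiv.functor ⋙ iBetMon P ≅ idRMon P ⋙ RHt.equiv.functor
  /-- on modules over `A^dR_G(t,-) / J^{k+1}` the equivalence `RHt` is restriction along `rht k` -/
  RHt_nbhd (k : ℕ) : nbhdRes (paramdRt P) k ⋙ RHt.equiv.functor ≅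
    res (rht k).toAlgHom.toRingHom ⋙ nbhdRes (paramBett P) k
  /-- the equivalence `RHtm` is restriction along `rhtm` -/
  RHtm_iso : RHtm.equiv.functor ⋙ (IsMonodromic (paramBettm P)).ι ≅
    (IsMonodromic (paramdRtm P)).ι ⋙ res rhtm.toAlgHom.toRingHom
  /-- the resulting equivalence `D(A^dR_G(t,m)) ≌ D(A^Bet_G(t,m))` -/
  isEquivalence : (res rhtm.toAlgHom.toRingHom).IsEquivalence

end RiemannHilbert

end HypertoricO

end

/-!
The Betti algebra is a matrix ring. In `A^Bet_n` put `t_i = m_i` and let `bettiPath α β` be the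
straight path between two vertices of the cube. These paths form matrix units up to a cocycle: the
product of `bettiPath α β` and `bettiPath β γ` is `bettiPath α γ` times the product of the `1 - t_i`
over the hyperplanes which separate `β` from both `α` and `γ` (`signCocycle`). So `A^Bet_n` is a
twisted matrix ring over the Laurent polynomials in the `t_i` (`bettiHom`, `bettiInv`), `A^Bet_G` is
its base change to the functions on the subtorus cut out by the relations of `G`, and `A^Bet_G(t,-)` is the block of the feasible
sign vectors (`feasibleHom`).

Stratification. Killing the idempotent `e_α` of a twisted matrix ring is stratifying when the entry
ideals of the vertices killed before have a simple form in row and column `α` (`isStrat_insert`):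
then `eA` and `Ae` are free over `eAe`, the functors `M e ⊗ eA` and `Hom (Ae, M e)` are exact, and
they provide the approximations from which all adjoints are built (`IsStrat.of_frames`). This
condition holds along a shelling (`Shelling.isStrat`), where `α` has a set of walls such that the
vertices before `α` are exactly separated from `α` by them: modulo these vertices, the diagonal entry
at `α` is the ring of functions on the subtorus `t_i = 1` for the walls of `α`. Such a shelling
exists by convexity (`exists_shelling`): order the feasible chambers by their distance to a point
`p`, and let the walls of a chamber be the hyperplanes through its point nearest to `p` which have
nonzero Lagrange multiplier. If `p` is far in the direction of the gradient of `m`, then the chambers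
on which `m` is unbounded come first (`eventually_sqDist_lt`). Killing these is therefore stratifying
(`isStrat_iBet_of_tRegular`), and the recollement follows because `M ↦ M e` is a localization
(`IsStrat.recollement`).

Nilpotence. At a prime of the ring of parameters in the support of `e_α`, with `α` feasible, let `S`
be the set of parameters which vanish. If some direction of the arrangement has zero coordinates in
`S`, then regularity of `m` gives such a direction along which `m` grows, hence an unbounded chamber
which is separated from `α` only by hyperplanes outside `S`; going there and back is multiplication
by a product of units and factors through a killed idempotent, a contradiction. So the coordinates
in `S` are jointly injective, and by unimodularity the relations force all other parameters to vanish
too (`mem_radical_of_arrangement`). Hence all `1 - m_i` and `d_i` are nilpotent on the algebras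
`A(t,m)` (`exists_pow_paramBettm`, `exists_pow_paramdRtm`), and every object is monodromic.

Riemann-Hilbert. Where the parameters are nilpotent, `m_i = exp (2πi d_i)` can be inverted by a
polynomial `logPoly`; this gives the isomorphisms `rhEquiv`, which match the relations of the Betti
and the de Rham algebras (`logHom_deRhamRel`: an element with nilpotent image and trivial exponential
is zero) and descend to `A(t,-)` (`exists_rht`) and to `A(t,m)` (`exists_rhtm`). Both algebras
`A(t,-)` thus have the same completion. They are finite over noetherian central subrings, so that the
completion is a base change (`exists_completion_equiv`), flat and trivial on modules on which the
parameters are locally nilpotent; the derived adjunction of base change and restriction identifies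
the monodromic objects over each algebra with those over the completion
(`isEquivalence_monRes_feasible`). The composite `rhMon` of these two equivalences is computed on any
object coming from a quotient of the completion by `rhMonIso`, which yields both compatibilities
(`nonempty_riemannHilbert`).
-/

noncomputable section

open Finset (sum_congr sum_eq_single mem_univ mul_sum mem_filter sum_mul sum_add_distrib sum_eq_zero sum_comm univ sum_smul smul_sum sum_nonneg sum_sub_distrib prod_congr prod_insert prod_ite_zero sum_insert sum_const_zero prod_mul_distrib mem_insert prod_empty ne_of_mem_erase prod_const_one)
open TwoSidedIdeal (span mem_mk' subset_span mem_comap mem_ker mk')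
open MulOpposite (op unop op_mul)
open Category (assoc comp_id id_comp)
open Function (update update_of_ne update_self Surjective Bijective)
open ModuleCat (restrictScalars ofHom)
open Submodule (smul_mem smul_mem_smul span_induction smul_induction_on)
open Polynomial (aeval aeval_X aeval_algHom_apply)
open HomologicalComplex (quasiIso)
open List (ofFn map_ofFn)
open Subalgebra (mem_centralizer_iff)
open DerivedCategory AddMonoidAlgebra

set_option linter.unusedSectionVars false
set_option linter.unusedDecidableInType false

namespace HypertoricO

/-! ### Exact functors and derived categories -/

section ExactFunctors

/-- A full triangulated functor that reflects zero objects is faithful. -/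
lemma faithful_of_full_of_isZero {T1 T2 : Type*} [Category T1] [Category T2]
    [HasZeroObject T1] [Preadditive T1] [HasShift T1 ℤ] [∀ n : ℤ, (shiftFunctor T1 n).Additive]
    [Pretriangulated T1] [HasZeroObject T2] [Preadditive T2] [HasShift T2 ℤ]
    [∀ n : ℤ, (shiftFunctor T2 n).Additive] [Pretriangulated T2]
    (F : T1 ⥤ T2) [F.CommShift ℤ] [F.IsTriangulated] [F.Full]
    (hF : ∀ X, IsZero (F.obj X) → IsZero X) : F.Faithful := by
  have hiso : ∀ {X Y : T1} (f : X ⟶ Y), IsIso (F.map f) → IsIso f := by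
    intro X Y f hf
    obtain ⟨Z, g, h, hT⟩ := distinguished_cocone_triangle f
    have h1 := (Triangle.isZero₃_iff_isIso₁ _ (F.map_distinguished _ hT)).2 hf
    exact (Triangle.isZero₃_iff_isIso₁ _ hT).1 (hF _ h1)
  have hzero : ∀ {X Y : T1} (f : X ⟶ Y), F.map f = 0 → f = 0 := by
    intro X Y f hf
    obtain ⟨Z, g, h, hT⟩ := distinguished_cocone_triangle f
    obtain ⟨s, hs⟩ : ∃ s : F.obj Z ⟶ F.obj Y, 𝟙 _ = F.map g ≫ s :=
      Triangle.yoneda_exact₂ _ (F.map_distinguished _ hT) (𝟙 (F.obj Y))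
        (show F.map f ≫ 𝟙 _ = 0 by rw [hf, zero_comp])
    obtain ⟨t, rfl⟩ := F.map_surjective s
    have hgt : IsIso (g ≫ t) := hiso _ (by
      rw [F.map_comp]
      exact hs ▸ inferInstanceAs (IsIso (𝟙 _)))
    have h0 : f ≫ g = 0 := comp_distTriang_mor_zero₁₂ _ hT
    rw [← cancel_mono (g ≫ t), ← assoc, h0, zero_comp, zero_comp]
  exact ⟨fun {X Y} f g h => sub_eq_zero.1 (hzero _ (by rw [F.map_sub, h, sub_self]))⟩

universe w1 w2 w3 v1 v2 v3 u1 u2 u3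

variable {C : Type u1} [Category.{v1} C] [Abelian C] [HasDerivedCategory.{w1} C]
  {D : Type u2} [Category.{v2} D] [Abelian D] [HasDerivedCategory.{w2} D]
  {E : Type u3} [Category.{v3} E] [Abelian E] [HasDerivedCategory.{w3} E]

/-- The functor induced by an exact functor on cochain complexes. -/
abbrev cpx (F : C ⥤ D) [F.Additive] : CochainComplex C ℤ ⥤ CochainComplex D ℤ :=
  F.mapHomologicalComplex (.up ℤ)

/-- A criterion for the functor induced by an exact functor on derived categories to be full: every
roof between complexes in the image can be refined to one which comes from the source. -/
lemma mapDerivedCategory_full (F : C ⥤ D) [F.Additive] [PreservesFiniteLimits F]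
    [PreservesFiniteColimits F]
    (H : ∀ (X Y : CochainComplex C ℤ) (M : CochainComplex D ℤ) (s : M ⟶ (cpx F).obj X)
      (g : M ⟶ (cpx F).obj Y), QuasiIso s →
      ∃ (N : CochainComplex C ℤ) (M' : CochainComplex D ℤ) (t : M' ⟶ M) (q : M' ⟶ (cpx F).obj N)
        (s' : N ⟶ X) (g' : N ⟶ Y), QuasiIso q ∧ QuasiIso s' ∧ QuasiIso t ∧
          t ≫ s = q ≫ (cpx F).map s' ∧ t ≫ g = q ≫ (cpx F).map g') :
    F.mapDerivedCategory.Full := by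
  suffices h : ∀ (X Y : CochainComplex C ℤ)
      (f : F.mapDerivedCategory.obj (Q.obj X) ⟶ F.mapDerivedCategory.obj (Q.obj Y)),
      ∃ f', F.mapDerivedCategory.map f' = f by
    refine ⟨fun {X Y} f => ?_⟩
    let eX := Q.objObjPreimageIso X
    let eY := Q.objObjPreimageIso Y
    obtain ⟨f', hf'⟩ := h _ _ (F.mapDerivedCategory.map eX.hom ≫ f ≫
      F.mapDerivedCategory.map eY.inv)
    refine ⟨eX.inv ≫ f' ≫ eY.hom, ?_⟩
    rw [F.mapDerivedCategory.map_comp, F.mapDerivedCategory.map_comp, hf']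
    simp [← Functor.map_comp, ← Functor.map_comp_assoc]
  intro X Y f
  let φ := F.mapDerivedCategoryFactors
  obtain ⟨M, s, hs, g, hfac⟩ := right_fac
    (X := (cpx F).obj X) (Y := (cpx F).obj Y) (φ.inv.app X ≫ f ≫ φ.hom.app Y)
  obtain ⟨N, M', t, q, s', g', hq, hs', ht, h1, h2⟩ := H X Y M s g
    ((isIso_Q_map_iff_quasiIso _ _).1 hs)
  refine ⟨inv (Q.map s') ≫ Q.map g', ?_⟩
  have e1 := congrArg Q.map h1
  have e2 := congrArg Q.map h2
  rw [Functor.map_comp, Functor.map_comp] at e1 e2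
  have hf : f = φ.hom.app X ≫ (inv (Q.map s) ≫ Q.map g) ≫
      φ.inv.app Y := by
    rw [← hfac]
    simp [φ]
  have nat : ∀ {K L : CochainComplex C ℤ} (a : K ⟶ L),
      F.mapDerivedCategory.map (Q.map a) = φ.hom.app K ≫ Q.map ((cpx F).map a) ≫ φ.inv.app L := by
    intro K L a
    have := F.mapDerivedCategoryFactors_hom_naturality a
    rw [← assoc, ← this]
    simp [φ]
  rw [Functor.map_comp, Functor.map_inv, IsIso.inv_comp_eq, hf, nat, nat]
  have : IsIso (Q.map s) := hs
  have hs'' : Q.map ((cpx F).map s') =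
      inv (Q.map q) ≫ Q.map t ≫ Q.map s := by
    rw [e1, IsIso.inv_hom_id_assoc]
  have hg'' : Q.map ((cpx F).map g') =
      inv (Q.map q) ≫ Q.map t ≫ Q.map g := by
    rw [e2, IsIso.inv_hom_id_assoc]
  rw [hs'', hg'']
  simp

/-- The natural transformation on cochain complexes induced by `ε : G ⟶ 𝟭`. -/
def cpxCounit {G : C ⥤ C} [G.Additive] (ε : G ⟶ 𝟭 C) : cpx G ⟶ 𝟭 (CochainComplex C ℤ) where
  app X :=
    { f := fun n => ε.app (X.X n)
      comm' := fun i j _ => (ε.naturality (X.d i j)).symm }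
  naturality X Y f := by
    ext n
    exact ε.naturality (f.f n)

/-- The natural transformation on cochain complexes induced by `η : 𝟭 ⟶ H`. -/
def cpxUnit {H : C ⥤ C} [H.Additive] (η : 𝟭 C ⟶ H) : 𝟭 (CochainComplex C ℤ) ⟶ cpx H where
  app X :=
    { f := fun n => η.app (X.X n)
      comm' := fun i j _ => (η.naturality (X.d i j)).symm }
  naturality X Y f := by
    ext n
    exact η.naturality (f.f n)

/-- Let `ε : G ⟶ 𝟭` be a natural transformation from an exact functor. There are no nonzero
morphisms from `G X` to a complex `Z` with `G Z` acyclic, provided `ε` is invertible at `G X`. -/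
lemma eq_zero_of_counit (G : C ⥤ C) [G.Additive] [PreservesFiniteLimits G]
    [PreservesFiniteColimits G] (ε : G ⟶ 𝟭 C) (X Z : CochainComplex C ℤ)
    (hX : QuasiIso ((cpxCounit ε).app ((cpx G).obj X)))
    (hZ : IsZero (Q.obj ((cpx G).obj Z)))
    (f : Q.obj ((cpx G).obj X) ⟶ Q.obj Z) : f = 0 := by
  obtain ⟨W, s, hs, g, rfl⟩ := right_fac f
  have hs' : QuasiIso s := (isIso_Q_map_iff_quasiIso _ _).1 hs
  let i : (cpx G).obj W ⟶ W := (cpxCounit ε).app W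
  have h1 : (cpx G).map g ≫ (cpxCounit ε).app Z = i ≫ g := (cpxCounit ε).naturality g
  have h2 : (cpx G).map s ≫ (cpxCounit ε).app _ = i ≫ s := (cpxCounit ε).naturality s
  have h₁' : Q.map i ≫ Q.map g = 0 := by
    rw [← Functor.map_comp, ← h1, Functor.map_comp,
      hZ.eq_of_tgt (Q.map ((cpx G).map g)) 0, zero_comp]
  have h₂' : IsIso (Q.map i ≫ Q.map s) := by
    rw [← Functor.map_comp, ← h2]
    have := (isIso_Q_map_iff_quasiIso _ _).2 hX
    have h3 : QuasiIso ((cpx G).map s) := inferInstance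
    rw [Functor.map_comp]
    exact IsIso.comp_isIso' inferInstance this
  rw [← cancel_epi (Q.map i ≫ Q.map s), comp_zero, assoc, IsIso.hom_inv_id_assoc]
  exact h₁'

/-- Let `η : 𝟭 ⟶ H` be a natural transformation to an exact functor. There are no nonzero
morphisms to `H X` from a complex `Z` with `H Z` acyclic, provided `η` is invertible at `H X`. -/
lemma eq_zero_of_unit (H : C ⥤ C) [H.Additive] [PreservesFiniteLimits H]
    [PreservesFiniteColimits H] (η : 𝟭 C ⟶ H) (X Z : CochainComplex C ℤ)
    (hX : QuasiIso ((cpxUnit η).app ((cpx H).obj X)))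
    (hZ : IsZero (Q.obj ((cpx H).obj Z)))
    (f : Q.obj Z ⟶ Q.obj ((cpx H).obj X)) : f = 0 := by
  obtain ⟨W, g, s, hs, rfl⟩ := left_fac f
  have hs' : QuasiIso s := (isIso_Q_map_iff_quasiIso _ _).1 hs
  let i : W ⟶ (cpx H).obj W := (cpxUnit η).app W
  have h1 : g ≫ i = (cpxUnit η).app Z ≫ (cpx H).map g := (cpxUnit η).naturality g
  have h2 : s ≫ i = (cpxUnit η).app _ ≫ (cpx H).map s := (cpxUnit η).naturality s
  have h₁' : Q.map g ≫ Q.map i = 0 := by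
    rw [← Functor.map_comp, h1, Functor.map_comp, hZ.eq_of_src (Q.map ((cpx H).map g)) 0, comp_zero]
  have h₂' : IsIso (Q.map s ≫ Q.map i) := by
    rw [← Functor.map_comp, h2]
    have := (isIso_Q_map_iff_quasiIso _ _).2 hX
    have h3 : QuasiIso ((cpx H).map s) := inferInstance
    rw [Functor.map_comp]
    exact IsIso.comp_isIso' this inferInstance
  rw [← cancel_mono (Q.map s ≫ Q.map i), zero_comp, assoc, IsIso.inv_hom_id_assoc]
  exact h₁'

/-- The functor on derived categories induced by a composition. -/
def mapDerivedCategoryComp (F : C ⥤ D) (G : D ⥤ E) (K : C ⥤ E) (e : F ⋙ G ≅ K)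
    [F.Additive] [PreservesFiniteLimits F] [PreservesFiniteColimits F]
    [G.Additive] [PreservesFiniteLimits G] [PreservesFiniteColimits G]
    [K.Additive] [PreservesFiniteLimits K] [PreservesFiniteColimits K] :
    F.mapDerivedCategory ⋙ G.mapDerivedCategory ≅ K.mapDerivedCategory :=
  letI : Localization.Lifting Q
      (quasiIso C (.up ℤ))
      (cpx F ⋙ cpx G ⋙ Q) (F.mapDerivedCategory ⋙ G.mapDerivedCategory) :=
    ⟨(Functor.associator _ _ _).symm ≪≫
      Functor.isoWhiskerRight F.mapDerivedCategoryFactors _ ≪≫ Functor.associator _ _ _ ≪≫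
      Functor.isoWhiskerLeft _ G.mapDerivedCategoryFactors⟩
  Localization.liftNatIso Q
    (quasiIso C (.up ℤ))
    (cpx F ⋙ cpx G ⋙ Q) (cpx K ⋙ Q) _ _
    (Functor.isoWhiskerRight (NatIso.mapHomologicalComplex e (.up ℤ)) Q)

end ExactFunctors

/-! ### Affine heredity idempotents -/

lemma op_finsetSum {R ι : Type} [AddCommMonoid R] (s : Finset ι) (f : ι → R) :
    op (∑ i ∈ s, f i) = ∑ i ∈ s, op (f i) :=
  map_sum MulOpposite.opAddEquiv f s

section Row

variable {A C : Type} [Ring A] [Ring C] {ι : Type} [Fintype ι] [DecidableEq ι]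

/-- Row vectors with entries in a right `C`-module `N`, as a right module over a ring `A` which acts
through a homomorphism from `A` to matrices over `C`. -/
def Row (_ρ : A →+* Matrix ι ι C) (N : RMod C) : Type := ι → N

instance (ρ : A →+* Matrix ι ι C) (N : RMod C) : AddCommGroup (Row ρ N) :=
  inferInstanceAs (AddCommGroup (ι → N))

instance (ρ : A →+* Matrix ι ι C) (N : RMod C) : Module Aᵐᵒᵖ (Row ρ N) where
  smul a x := fun k => ∑ j, op (ρ a.unop j k) • x j
  one_smul x := by
    funext k
    change ∑ j, op (ρ 1 j k) • x j = x k
    rw [map_one, sum_eq_single k]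
    · simp
    · intro j _ hj
      simp [Matrix.one_apply_ne hj]
    · simp
  mul_smul a b x := by
    funext k
    change ∑ j, op (ρ (b.unop * a.unop) j k) • x j =
      ∑ l, op (ρ a.unop l k) • ∑ j, op (ρ b.unop j l) • x j
    simp only [map_mul, Matrix.mul_apply, op_finsetSum, op_mul, sum_smul, smul_sum, mul_smul]
    exact sum_comm
  smul_zero a := by
    funext k
    exact sum_eq_zero fun j _ => smul_zero _
  smul_add a x y := by
    funext k
    exact (sum_congr rfl fun j _ => smul_add _ (x j) (y j)).trans sum_add_distrib
  add_smul a b x := by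
    funext k
    change ∑ j, op (ρ (a.unop + b.unop) j k) • x j = _
    simp only [map_add, Matrix.add_apply, MulOpposite.op_add, add_smul]
    exact sum_add_distrib
  zero_smul x := by
    funext k
    change ∑ j, op (ρ 0 j k) • x j = 0
    simp

/-- Row vectors of right `C`-modules, as a functor to right `A`-modules. -/
def rowFunctor (ρ : A →+* Matrix ι ι C) : RMod C ⥤ RMod A where
  obj N := ModuleCat.of Aᵐᵒᵖ (Row ρ N)
  map {N N'} f := ofHom (X := Row ρ N) (Y := Row ρ N')
    { toFun := fun x j => f.hom (x j)
      map_add' := fun x y => funext fun j => map_add f.hom (x j) (y j)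
      map_smul' := fun a x => funext fun k => by
        change f.hom (∑ j, op (ρ a.unop j k) • x j) = ∑ j, op (ρ a.unop j k) • f.hom (x j)
        rw [map_sum]
        exact sum_congr rfl fun j _ => map_smul f.hom _ _ }

instance (ρ : A →+* Matrix ι ι C) : (rowFunctor ρ).Additive where

instance (ρ : A →+* Matrix ι ι C) : (rowFunctor ρ).PreservesHomology := by
  have h : ∀ (S : ShortComplex (RMod C)), S.Exact → (S.map (rowFunctor ρ)).Exact := by
    intro S hS
    rw [ShortComplex.moduleCat_exact_iff] at hS ⊢
    intro x hx
    choose y hy using fun j => hS (x j) (congrFun hx j)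
    exact ⟨y, funext hy⟩
  exact ((rowFunctor ρ).exact_tfae.out 1 2).1 h

instance (ρ : A →+* Matrix ι ι C) : PreservesFiniteLimits (rowFunctor ρ) :=
  (rowFunctor ρ).preservesFiniteLimits_of_preservesHomology

instance (ρ : A →+* Matrix ι ι C) : PreservesFiniteColimits (rowFunctor ρ) :=
  (rowFunctor ρ).preservesFiniteColimits_of_preservesHomology

end Row

section Heredity

variable {A : Type} [Ring A] {e : A} (he : IsIdempotentElem e)

lemma corner_mul_left (c : he.Corner) : e * c.1 = c.1 := ((Subsemigroup.mem_corner_iff he).1 c.2).1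

lemma corner_mul_right (c : he.Corner) : c.1 * e = c.1 := ((Subsemigroup.mem_corner_iff he).1 c.2).2

/-- The inclusion of the corner, as an additive homomorphism. -/
def cornerVal : he.Corner →+ A := ⟨⟨fun x => x.1, rfl⟩, fun _ _ => rfl⟩

lemma corner_sum_val {ι : Type} (s : Finset ι) (c : ι → he.Corner) :
    (∑ j ∈ s, c j).1 = ∑ j ∈ s, (c j).1 := map_sum (cornerVal he) c s

/-- The element `x` of `eAe` as an element of the corner ring. -/
def mkCorner {e : A} (he : IsIdempotentElem e) (x : A) (h1 : e * x = x) (h2 : x * e = x) :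
    he.Corner := ⟨x, (Subsemigroup.mem_corner_iff he).2 ⟨h1, h2⟩⟩

/-- A finite family of elements of `eA` which exhibits `eA` as a free left `eAe`-module and for
which the multiplication `Ae ⊗ eA → A` is injective. -/
structure LeftFrame (ι : Type) [Fintype ι] where
  b : ι → A
  mul_b : ∀ j, e * b j = b j
  span : ∀ x, e * x = x → ∃ c : ι → he.Corner, x = ∑ j, (c j).1 * b j
  indep : ∀ x : ι → A, (∀ j, x j * e = x j) → ∑ j, x j * b j = 0 → ∀ j, x j = 0

/-- A finite family of elements of `Ae` which exhibits `Ae` as a free right `eAe`-module. -/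
structure RightFrame (ι : Type) [Fintype ι] where
  a : ι → A
  a_mul : ∀ j, a j * e = a j
  span : ∀ x, x * e = x → ∃ c : ι → he.Corner, x = ∑ j, a j * (c j).1
  indep : ∀ c : ι → he.Corner, ∑ j, a j * (c j).1 = 0 → ∀ j, c j = 0

variable {he} {ι : Type} [Fintype ι] [DecidableEq ι]

lemma Row.smul_val (ρ : A →+* Matrix ι ι he.Corner) (M : RMod A) (a : A)
    (x : Row ρ ((cornerFunctor he).obj M)) (k : ι) :
    ((op a • x) k : cornerSubgroup e M).1 = ∑ j, op (ρ a j k).1 • (x j : cornerSubgroup e M).1 :=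
  map_sum (AddSubgroup.subtype (cornerSubgroup e M)) (fun j => op (ρ a j k) • x j) _

lemma isIso_of_bijective {M N : RMod A} {f : M ⟶ N} (h : ∀ x, f.hom x = 0 → x = 0)
    (h' : ∀ y, ∃ x, f.hom x = y) : IsIso f :=
  (ConcreteCategory.isIso_iff_bijective f).2 ⟨(injective_iff_map_eq_zero f.hom).2 h, h'⟩

namespace LeftFrame

variable (L : LeftFrame he ι)

lemma ext_coeff {x y : ι → A} (hx : ∀ j, x j * e = x j) (hy : ∀ j, y j * e = y j)
    (h : ∑ j, x j * L.b j = ∑ j, y j * L.b j) : x = y := by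
  funext j
  refine sub_eq_zero.1 (L.indep (fun j => x j - y j) (fun j => ?_) ?_ j)
  · rw [sub_mul, hx, hy]
  · simp only [sub_mul, sum_sub_distrib, h, sub_self]

/-- The structure constants of the right multiplication on `eA` in the given basis. -/
def coeff (a : A) (j : ι) : ι → he.Corner :=
  (L.span (L.b j * a) (by rw [← mul_assoc, L.mul_b])).choose

lemma coeff_spec (a : A) (j : ι) : L.b j * a = ∑ k, (L.coeff a j k).1 * L.b k :=
  (L.span (L.b j * a) (by rw [← mul_assoc, L.mul_b])).choose_spec

lemma coeff_eq {a : A} {j : ι} {c : ι → he.Corner} (h : L.b j * a = ∑ k, (c k).1 * L.b k) :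
    L.coeff a j = c := by
  have := L.ext_coeff (fun k => corner_mul_right he (L.coeff a j k))
    (fun k => corner_mul_right he (c k)) ((L.coeff_spec a j).symm.trans h)
  exact funext fun k => Subtype.ext (congrFun this k)

/-- The action of `A` on `eA` by matrices over `eAe`. -/
def rep : A →+* Matrix ι ι he.Corner := RingHom.mk' {
  toFun a := Matrix.of (L.coeff a)
  map_one' := by
    ext1 j k
    refine congrFun (L.coeff_eq (c := (1 : Matrix ι ι he.Corner) j) ?_) k
    rw [sum_eq_single j]
    · rw [Matrix.one_apply_eq, mul_one]
      exact (L.mul_b j).symm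
    · intro k _ hk
      rw [Matrix.one_apply_ne hk.symm]
      exact zero_mul _
    · simp
  map_mul' a b := by
    ext1 j k
    refine congrFun (L.coeff_eq
      (c := (Matrix.of (L.coeff a) * Matrix.of (L.coeff b) : Matrix ι ι he.Corner) j) ?_) k
    rw [← mul_assoc, coeff_spec, sum_mul]
    simp only [mul_assoc, L.coeff_spec b]
    simp only [Matrix.mul_apply, corner_sum_val, sum_mul, mul_sum, Matrix.of_apply]
    rw [sum_comm]
    exact sum_congr rfl fun _ _ => sum_congr rfl fun _ _ => (mul_assoc _ _ _).symm }
  fun a b => by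
    ext1 j k
    refine congrFun (L.coeff_eq (c := L.coeff a j + L.coeff b j) ?_) k
    rw [mul_add, coeff_spec, coeff_spec, ← sum_add_distrib]
    exact sum_congr rfl fun k _ => (add_mul _ _ _).symm

lemma rep_spec (a : A) (j : ι) : L.b j * a = ∑ k, (L.rep a j k).1 * L.b k := L.coeff_spec a j

/-- The exact functor `M ↦ M e ⊗ eA`. -/
abbrev functor : RMod A ⥤ RMod A := cornerFunctor he ⋙ rowFunctor L.rep

/-- The multiplication `M e ⊗ eA → M`. -/
def counit : L.functor ⟶ 𝟭 (RMod A) where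
  app M := ofHom (X := Row L.rep ((cornerFunctor he).obj M)) (Y := M)
    { toFun := fun x => ∑ j, op (L.b j) • (x j).1
      map_add' := fun x y => by
        rw [← sum_add_distrib]
        exact sum_congr rfl fun j _ => smul_add _ _ _
      map_smul' := fun a x => by
        have h : ∀ k, ((a • x) k).1 = ∑ j, op (L.rep a.unop j k).1 • (x j).1 :=
          Row.smul_val L.rep M a.unop x
        simp only [h, smul_sum, ← mul_smul, ← op_mul]
        rw [sum_comm]
        refine sum_congr rfl fun j _ => ?_
        rw [← sum_smul, ← op_finsetSum, ← L.rep_spec]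
        rfl }
  naturality M N f := by
    ext x
    change ∑ j, op (L.b j) • f.hom (x j).1 = f.hom (∑ j, op (L.b j) • (x j).1)
    rw [map_sum]
    exact sum_congr rfl fun j _ => (map_smul f.hom _ _).symm

lemma counit_apply (M : RMod A) (x : Row L.rep ((cornerFunctor he).obj M)) :
    (L.counit.app M).hom x = ∑ j, op (L.b j) • (x j).1 := rfl

/-- The coefficients of `e` in the given basis of `eA`. -/
def β : ι → he.Corner := (L.span e he).choose

lemma β_spec : e = ∑ k, (L.β k).1 * L.b k := (L.span e he).choose_spec

lemma rep_e (j k : ι) : (L.rep e j k).1 = L.b j * e * (L.β k).1 := by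
  refine congrFun (L.ext_coeff (x := fun k => (L.rep e j k).1)
    (y := fun k => L.b j * e * (L.β k).1) (fun k => corner_mul_right he _) (fun k => ?_) ?_) k
  · rw [mul_assoc, corner_mul_right]
  · rw [← L.rep_spec]
    simp only [mul_assoc, ← mul_sum]
    rw [← L.β_spec, he.eq]

lemma sum_β_rep (j k : ι) :
    ∑ l, (L.β l).1 * (L.rep (L.b j) l k).1 = if k = j then e else 0 := by
  refine congrFun (L.ext_coeff (x := fun k => ∑ l, (L.β l).1 * (L.rep (L.b j) l k).1)
    (y := fun k => if k = j then e else 0) (fun k => ?_) (fun k => ?_) ?_) k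
  · rw [sum_mul]
    exact sum_congr rfl fun l _ => by rw [mul_assoc, corner_mul_right]
  · split_ifs
    · exact he
    · exact zero_mul e
  · simp only [sum_mul, ite_mul, zero_mul, Finset.sum_ite_eq', mem_univ, if_true]
    rw [sum_comm]
    simp only [mul_assoc, ← mul_sum, ← L.rep_spec]
    simp only [← mul_assoc, ← sum_mul]
    rw [← L.β_spec]

variable (M : RMod A)

/-- The element `m ⊗ e` of `M e ⊗ eA`. -/
def unitVec (m : cornerSubgroup e M) : Row L.rep ((cornerFunctor he).obj M) :=
  fun k => op (L.β k) • m

lemma smul_e (x : Row L.rep ((cornerFunctor he).obj M)) :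
    op e • x = L.unitVec M ⟨op e • (L.counit.app M).hom x, by
      change op e • (op e • _) = _
      rw [← mul_smul, ← op_mul, he.eq]⟩ := by
  funext k
  apply Subtype.ext
  refine (Row.smul_val _ M e x k).trans ?_
  change ∑ j, op (L.rep e j k).1 • (x j).1 = op (L.β k).1 • op e • ∑ j, op (L.b j) • (x j).1
  simp only [smul_sum, rep_e, op_mul, mul_smul]

lemma smul_b_unitVec (j : ι) (m : cornerSubgroup e M) :
    (op (L.b j) • L.unitVec M m : Row L.rep ((cornerFunctor he).obj M)) =
      fun k => if k = j then m else 0 := by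
  funext k
  apply Subtype.ext
  refine (Row.smul_val _ M (L.b j) _ k).trans ?_
  change ∑ l, op (L.rep (L.b j) l k).1 • op (L.β l).1 • m.1 = _
  simp only [← mul_smul, ← op_mul]
  rw [← sum_smul, ← op_finsetSum, sum_β_rep]
  split_ifs
  · exact m.2
  · rw [MulOpposite.op_zero, zero_smul]
    rfl

lemma counit_unitVec (m : cornerSubgroup e M) : (L.counit.app M).hom (L.unitVec M m) = m.1 := by
  rw [counit_apply]
  change ∑ j, op (L.b j) • op (L.β j).1 • m.1 = _
  simp only [← mul_smul, ← op_mul]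
  rw [← sum_smul, ← op_finsetSum, ← L.β_spec]
  exact m.2

lemma isIso_corner_counit : IsIso ((cornerFunctor he).map (L.counit.app M)) := by
  refine isIso_of_bijective (fun x hx => ?_) fun m => ?_
  · apply Subtype.ext
    have h1 : op e • x.1 = x.1 := x.2
    have h2 : (L.counit.app M).hom x.1 = 0 := congrArg Subtype.val hx
    refine h1.symm.trans ((L.smul_e M x.1).trans ?_)
    funext k
    apply Subtype.ext
    change op (L.β k).1 • op e • (L.counit.app M).hom x.1 = 0
    rw [h2, smul_zero, smul_zero]
  · refine ⟨⟨(op e • L.unitVec M m : Row L.rep ((cornerFunctor he).obj M)), ?_⟩, Subtype.ext ?_⟩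
    · refine (mul_smul (op e) (op e)
        (L.unitVec M m : Row L.rep ((cornerFunctor he).obj M))).symm.trans ?_
      rw [← op_mul, he.eq]
    · change (L.counit.app M).hom (op e • L.unitVec M m) = m.1
      exact (map_smul _ _ _).trans ((congrArg _ (L.counit_unitVec M m)).trans m.2)

lemma unitVec_mem (m : cornerSubgroup e M) :
    op e • L.unitVec M m = L.unitVec M m := by
  rw [smul_e]
  congr 1
  apply Subtype.ext
  change op e • (L.counit.app M).hom (L.unitVec M m) = m.1
  rw [counit_unitVec]
  exact m.2

lemma isIso_counit_functor : IsIso (L.counit.app (L.functor.obj M)) := by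
  have key : ∀ m : ι → cornerSubgroup e M,
      ∑ j, op (L.b j) • L.unitVec M (m j) = m := by
    intro m
    simp only [smul_b_unitVec]
    funext k
    refine (Finset.sum_apply k _ _).trans ?_
    simp
  refine isIso_of_bijective (fun x hx => ?_) fun m =>
    ⟨fun j => ⟨L.unitVec M (m j), L.unitVec_mem M (m j)⟩, key m⟩
  · let m : ι → cornerSubgroup e M := fun j =>
      ⟨op e • (L.counit.app M).hom (x j).1, by
        change op e • (op e • _) = _
        rw [← mul_smul, ← op_mul, he.eq]⟩
    have hm : ∀ j, (x j).1 = L.unitVec M (m j) := fun j =>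
      (show op e • (x j).1 = (x j).1 from (x j).2).symm.trans (L.smul_e M (x j).1)
    have h0 : m = 0 := by
      rw [← key m]
      refine Eq.trans ?_ hx
      exact sum_congr rfl fun j _ => congrArg _ (hm j).symm
    funext j
    apply Subtype.ext
    rw [hm j, h0]
    funext k
    exact smul_zero _

end LeftFrame

namespace RightFrame

variable (R : RightFrame he ι)

lemma ext_coeff {c d : ι → he.Corner} (h : ∑ j, R.a j * (c j).1 = ∑ j, R.a j * (d j).1) :
    c = d := by
  funext j
  refine sub_eq_zero.1 (R.indep (fun j => c j - d j) ?_ j)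
  refine Eq.trans ?_ (sub_eq_zero.2 h)
  rw [← sum_sub_distrib]
  exact sum_congr rfl fun j _ => mul_sub _ _ _

/-- The structure constants of the left multiplication on `Ae` in the given basis. -/
def coeff (x : A) (j : ι) : ι → he.Corner :=
  (R.span (x * R.a j) (by rw [mul_assoc, R.a_mul])).choose

lemma coeff_spec (x : A) (j : ι) : x * R.a j = ∑ k, R.a k * (R.coeff x j k).1 :=
  (R.span (x * R.a j) (by rw [mul_assoc, R.a_mul])).choose_spec

lemma coeff_eq {x : A} {j : ι} {c : ι → he.Corner} (h : x * R.a j = ∑ k, R.a k * (c k).1) :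
    R.coeff x j = c :=
  R.ext_coeff ((R.coeff_spec x j).symm.trans h)

/-- The action of `A` on `Ae` by matrices over `eAe`. -/
def rep : A →+* Matrix ι ι he.Corner := RingHom.mk' {
  toFun x := Matrix.of fun k j => R.coeff x j k
  map_one' := by
    ext1 k j
    refine congrFun (R.coeff_eq (c := fun k => (1 : Matrix ι ι he.Corner) k j) ?_) k
    rw [sum_eq_single j]
    · rw [Matrix.one_apply_eq, one_mul]
      exact (R.a_mul j).symm
    · intro k _ hk
      rw [Matrix.one_apply_ne hk]
      exact mul_zero _
    · simp
  map_mul' x y := by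
    ext1 k j
    refine congrFun (R.coeff_eq
      (c := fun k => ((Matrix.of fun k j => R.coeff x j k) * (Matrix.of fun k j => R.coeff y j k) :
        Matrix ι ι he.Corner) k j) ?_) k
    rw [mul_assoc, coeff_spec, mul_sum]
    simp only [← mul_assoc, R.coeff_spec x]
    simp only [Matrix.mul_apply, corner_sum_val, sum_mul, mul_sum, Matrix.of_apply]
    rw [sum_comm]
    exact sum_congr rfl fun _ _ => sum_congr rfl fun _ _ => mul_assoc _ _ _ }
  fun x y => by
    ext1 k j
    refine congrFun (R.coeff_eq (c := R.coeff x j + R.coeff y j) ?_) k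
    rw [add_mul, coeff_spec, coeff_spec, ← sum_add_distrib]
    exact sum_congr rfl fun k _ => (mul_add _ _ _).symm

lemma rep_spec (x : A) (j : ι) : x * R.a j = ∑ k, R.a k * (R.rep x k j).1 := R.coeff_spec x j

lemma rep_eq {x : A} {j : ι} {c : ι → he.Corner} (h : x * R.a j = ∑ k, R.a k * (c k).1) (k : ι) :
    R.rep x k j = c k := congrFun (R.coeff_eq h) k

/-- The exact functor `M ↦ Hom (Ae, M e)`. -/
abbrev functor : RMod A ⥤ RMod A := cornerFunctor he ⋙ rowFunctor R.rep

/-- The map `M → Hom (Ae, M e)` which sends `m` to the multiplication by `m`. -/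
def unit : 𝟭 (RMod A) ⟶ R.functor where
  app M := ofHom (X := M) (Y := Row R.rep ((cornerFunctor he).obj M))
    { toFun := fun m j => ⟨op (R.a j) • m, by
        change op e • op (R.a j) • m = _
        rw [← mul_smul, ← op_mul, R.a_mul]⟩
      map_add' := fun x y => funext fun j => Subtype.ext (smul_add _ _ _)
      map_smul' := fun x m => funext fun j => Subtype.ext (by
        refine Eq.trans ?_ (Row.smul_val R.rep M x.unop _ j).symm
        change op (R.a j) • x • m = ∑ k, op (R.rep x.unop k j).1 • op (R.a k) • m
        simp only [← mul_smul, ← op_mul]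
        rw [← sum_smul, ← op_finsetSum, ← R.rep_spec]
        rfl) }
  naturality M N f := by
    ext m
    funext j
    exact Subtype.ext (map_smul f.hom (op (R.a j)) m).symm

/-- The coefficients of `e` in the given basis of `Ae`. -/
def α : ι → he.Corner := (R.span e he).choose

lemma α_spec : e = ∑ k, R.a k * (R.α k).1 := (R.span e he).choose_spec

lemma rep_e (k j : ι) : (R.rep e k j).1 = (R.α k).1 * R.a j := by
  have h : R.rep e k j = mkCorner he ((R.α k).1 * R.a j)
      (by rw [← mul_assoc, corner_mul_left]) (by rw [mul_assoc, R.a_mul]) := by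
    refine R.rep_eq (c := fun k => mkCorner he ((R.α k).1 * R.a j)
      (by rw [← mul_assoc, corner_mul_left]) (by rw [mul_assoc, R.a_mul])) ?_ k
    change e * R.a j = ∑ k, R.a k * ((R.α k).1 * R.a j)
    simp only [← mul_assoc, ← sum_mul]
    rw [← R.α_spec]
  rw [h]
  rfl

lemma rep_a (i k j : ι) : (R.rep (R.a i) k j).1 = if k = i then e * R.a j else 0 := by
  have h : R.rep (R.a i) k j = if k = i then mkCorner he (e * R.a j)
      (by rw [← mul_assoc, he.eq]) (by rw [mul_assoc, R.a_mul]) else 0 := by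
    refine R.rep_eq (c := fun k => if k = i then mkCorner he (e * R.a j)
      (by rw [← mul_assoc, he.eq]) (by rw [mul_assoc, R.a_mul]) else 0) ?_ k
    rw [sum_eq_single i]
    · rw [if_pos rfl]
      change _ = R.a i * (e * R.a j)
      rw [← mul_assoc, R.a_mul]
    · intro k _ hk
      rw [if_neg hk]
      exact mul_zero _
    · simp
  rw [h]
  split_ifs <;> rfl

variable (M : RMod A)

lemma smul_e (φ : Row R.rep ((cornerFunctor he).obj M)) :
    ∃ m : cornerSubgroup e M, op e • φ = (R.unit.app M).hom m.1 := by
  refine ⟨∑ k, op (R.α k) • (φ k : cornerSubgroup e M), ?_⟩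
  funext j
  apply Subtype.ext
  refine (Row.smul_val _ M e φ j).trans ?_
  refine Eq.trans ?_ (congrArg (fun y : M => op (R.a j) • y)
    (map_sum (AddSubgroup.subtype (cornerSubgroup e M))
      (fun k => op (R.α k) • (φ k : cornerSubgroup e M)) _).symm)
  change ∑ k, op (R.rep e k j).1 • (φ k).1 = op (R.a j) • ∑ k, op (R.α k).1 • (φ k).1
  simp only [smul_sum, rep_e, op_mul, mul_smul]

lemma unit_injective (m : cornerSubgroup e M) (h : (R.unit.app M).hom m.1 = 0) : m = 0 := by
  apply Subtype.ext
  have h1 : op e • m.1 = m.1 := m.2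
  have h2 : ∀ k, op (R.a k) • m.1 = 0 := fun k => congrArg Subtype.val (congrFun h k)
  have h3 : ∀ x : M, (∀ k, op (R.a k) • x = 0) → op e • x = 0 := by
    intro x hx
    refine (congrArg (fun a : A => op a • x) R.α_spec).trans ?_
    rw [op_finsetSum, sum_smul]
    refine sum_eq_zero fun k _ => ?_
    rw [op_mul, mul_smul, hx, smul_zero]
  exact h1.symm.trans (h3 _ h2)

lemma isIso_corner_unit : IsIso ((cornerFunctor he).map (R.unit.app M)) := by
  refine isIso_of_bijective (fun m hm => R.unit_injective M m (congrArg Subtype.val hm)) fun φ => ?_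
  obtain ⟨m, hm⟩ := R.smul_e M φ.1
  exact ⟨m, Subtype.ext (hm.symm.trans φ.2)⟩

lemma isIso_unit_functor : IsIso (R.unit.app (R.functor.obj M)) := by
  have key : ∀ (φ : Row R.rep ((cornerFunctor he).obj M)) (j : ι),
      (op (R.a j) • (φ : Row R.rep ((cornerFunctor he).obj M)) :
        Row R.rep ((cornerFunctor he).obj M)) =
        (R.unit.app M).hom (φ j : cornerSubgroup e M).1 := by
    intro φ j
    funext k
    apply Subtype.ext
    refine (Row.smul_val _ M (R.a j) φ k).trans ?_
    change ∑ l, op (R.rep (R.a j) l k).1 • (φ l).1 = op (R.a k) • (φ j : cornerSubgroup e M).1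
    rw [sum_eq_single j]
    · rw [rep_a, if_pos rfl, op_mul, mul_smul, show op e • (φ j).1 = (φ j).1 from (φ j).2]
    · intro l _ hl
      rw [rep_a, if_neg hl, MulOpposite.op_zero, zero_smul]
    · simp
  refine isIso_of_bijective (fun φ hφ => funext fun j => R.unit_injective M (φ j)
    ((key φ j).symm.trans (congrArg Subtype.val (congrFun hφ j)))) fun ψ => ?_
  choose m hm using fun j => R.smul_e M (ψ j).1
  exact ⟨m, funext fun j => Subtype.ext ((key m j).trans ((hm j).symm.trans (ψ j).2))⟩

end RightFrame

end Heredity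

/-! ### Derived categories of modules killed by an idempotent -/

section Homology

universe w1 w2 v1 v2 u1 u2

variable {C : Type u1} [Category.{v1} C] [Abelian C] [HasDerivedCategory.{w1} C]
  {D : Type u2} [Category.{v2} D] [Abelian D] [HasDerivedCategory.{w2} D]

lemma isZero_iff_homology (X : DerivedCategory C) :
    IsZero X ↔ ∀ k, IsZero ((homologyFunctor C k).obj X) := by
  refine ⟨fun h k => (homologyFunctor C k).map_isZero h, fun h => ?_⟩
  obtain ⟨Z, hZ⟩ := HasZeroObject.zero (C := DerivedCategory C)
  have : IsIso (0 : X ⟶ Z) := (isIso_iff C _).2 fun k =>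
    ⟨0, (h k).eq_of_src _ _, ((homologyFunctor C k).map_isZero hZ).eq_of_src _ _⟩
  exact hZ.of_iso (asIso (0 : X ⟶ Z))

variable (F : C ⥤ D) [F.Additive] [PreservesFiniteLimits F] [PreservesFiniteColimits F]

/-- Exact functors commute with cohomology. -/
lemma homology_mapDerivedCategory (X : DerivedCategory C) (k : ℤ) :
    Nonempty ((homologyFunctor D k).obj (F.mapDerivedCategory.obj X) ≅
      F.obj ((homologyFunctor C k).obj X)) := by
  let K := Q.objPreimage X
  let e : Q.obj K ≅ X := Q.objObjPreimageIso X
  refine ⟨(homologyFunctor D k).mapIso (F.mapDerivedCategory.mapIso e.symm) ≪≫ ?_ ≪≫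
    F.mapIso ((homologyFunctor C k).mapIso e)⟩
  exact (homologyFunctor D k).mapIso (F.mapDerivedCategoryFactors.app K) ≪≫
    (homologyFunctorFactors D k).app _ ≪≫
    ShortComplex.mapHomologyIso (K.sc k) F ≪≫
    F.mapIso ((homologyFunctorFactors C k).app K).symm

lemma isZero_mapDerivedCategory_iff (X : DerivedCategory C) :
    IsZero (F.mapDerivedCategory.obj X) ↔ ∀ k, IsZero (F.obj ((homologyFunctor C k).obj X)) := by
  rw [isZero_iff_homology]
  exact forall_congr' fun k => (homology_mapDerivedCategory F X k).some.isZero_iff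

/-- A complex with terms in the essential image of a fully faithful functor is in the essential
image of the induced functor. -/
lemma exists_cpx_iso [F.Full] [F.Faithful] (K : CochainComplex D ℤ)
    (h : ∀ n, F.essImage (K.X n)) :
    ∃ N : CochainComplex C ℤ, Nonempty ((cpx F).obj N ≅ K) := by
  choose N e using h
  let e' : ∀ n, F.obj (N n) ≅ K.X n := fun n => (e n).some
  refine ⟨{
    X := N
    d := fun i j => F.preimage ((e' i).hom ≫ K.d i j ≫ (e' j).inv)
    shape := fun i j hij => F.map_injective (by simp [K.shape i j hij])
    d_comp_d' := fun i j k _ _ => F.map_injective (by simp) }, ⟨HomologicalComplex.Hom.isoOfComponents e' ?_⟩⟩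
  intro i j _
  change _ = F.map (F.preimage _) ≫ _
  rw [F.map_preimage]
  simp only [assoc, Iso.inv_hom_id, comp_id]
  rfl

end Homology

section Step

universe w1 w2 w3 v1 v2 v3 u1 u2 u3

variable {C : Type u1} [Category.{v1} C] [Abelian C] [HasDerivedCategory.{w1} C]
  {D : Type u2} [Category.{v2} D] [Abelian D] [HasDerivedCategory.{w2} D]
  {E : Type u3} [Category.{v3} E] [Abelian E] [HasDerivedCategory.{w3} E]
  (F : D ⥤ C) [F.Additive] [PreservesFiniteLimits F] [PreservesFiniteColimits F]
  [F.Full] [F.Faithful]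
  (J : C ⥤ E) [J.Additive] [PreservesFiniteLimits J] [PreservesFiniteColimits J]

/-- The fully faithful functor `F` identifies its source with the kernel of `J`. -/
structure IsKernel : Prop where
  isZero : ∀ N, IsZero (J.obj (F.obj N))
  essImage : ∀ M, IsZero (J.obj M) → F.essImage M

/-- An exact endofunctor `G` which factors through `J`, with a natural transformation to the
identity which becomes invertible after applying `J`. -/
structure IsLeftApprox (G : C ⥤ C) (ε : G ⟶ 𝟭 C) : Prop where
  isZero : ∀ M, IsZero (J.obj M) → IsZero (G.obj M)
  isIso_map : ∀ M, IsIso (J.map (ε.app M))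
  isIso_app : ∀ M, IsIso (ε.app (G.obj M))

/-- An exact endofunctor `H` which factors through `J`, with a natural transformation from the
identity which becomes invertible after applying `J`. -/
structure IsRightApprox (H : C ⥤ C) (η : 𝟭 C ⟶ H) : Prop where
  isZero : ∀ M, IsZero (J.obj M) → IsZero (H.obj M)
  isIso_map : ∀ M, IsIso (J.map (η.app M))
  isIso_app : ∀ M, IsIso (η.app (H.obj M))

variable {F J} {G : C ⥤ C} [G.Additive] [PreservesFiniteLimits G] [PreservesFiniteColimits G]
  {ε : G ⟶ 𝟭 C} {H : C ⥤ C} [H.Additive] [PreservesFiniteLimits H] [PreservesFiniteColimits H]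
  {η : 𝟭 C ⟶ H}

lemma quasiIso_of_isIso {K L : CochainComplex C ℤ} (f : K ⟶ L) (h : ∀ n, IsIso (f.f n)) :
    QuasiIso f := by
  have := HomologicalComplex.Hom.isIso_of_components f
  infer_instance

lemma isZero_Q_of_isZero_J (hG : ∀ M, IsZero (J.obj M) → IsZero (G.obj M))
    (K : CochainComplex C ℤ) (hK : IsZero (J.mapDerivedCategory.obj (Q.obj K))) :
    IsZero (Q.obj ((cpx G).obj K)) := by
  refine IsZero.of_iso ?_ (G.mapDerivedCategoryFactors.app K).symm
  exact (isZero_mapDerivedCategory_iff G _).2 fun k =>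
    hG _ ((isZero_mapDerivedCategory_iff J _).1 hK k)

lemma IsKernel.isZero_derived (hF : IsKernel F J) (X : DerivedCategory D) :
    IsZero (J.mapDerivedCategory.obj (F.mapDerivedCategory.obj X)) := by
  refine (isZero_mapDerivedCategory_iff J _).2 fun k => ?_
  exact (hF.isZero _).of_iso (J.mapIso (homology_mapDerivedCategory F X k).some)

/-- A complex of objects for which the counit is injective and on which `J` vanishes is
quasi-isomorphic to its largest quotient killed by `J`. -/
lemma exists_resolution (hF : IsKernel F J) (hG : IsLeftApprox J G ε) (P : CochainComplex C ℤ)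
    (hP : ∀ n, Mono (ε.app (P.X n)))
    (h0 : IsZero (J.mapDerivedCategory.obj (Q.obj P))) :
    ∃ (N : CochainComplex D ℤ) (q : P ⟶ (cpx F).obj N), QuasiIso q ∧
      ∀ (Y : CochainComplex D ℤ) (g : P ⟶ (cpx F).obj Y), ∃ g' : N ⟶ Y, g = q ≫ (cpx F).map g' := by
  let i : (cpx G).obj P ⟶ P := (cpxCounit ε).app P
  have hi : Mono i := HomologicalComplex.mono_of_mono_f _ hP
  let S : ShortComplex (CochainComplex C ℤ) := ShortComplex.mk i (cokernel.π i) (cokernel.condition i)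
  have hS : S.ShortExact := { exact := ShortComplex.exact_cokernel i }
  have hker : ∀ n, IsZero (J.obj ((cokernel i).X n)) := by
    intro n
    have h1 : IsIso (J.map (i.f n)) := hG.isIso_map (P.X n)
    have h2 : Epi (J.map ((cokernel.π i).f n)) := inferInstance
    have h3 : J.map ((cokernel.π i).f n) = 0 := by
      rw [← cancel_epi (J.map (i.f n)), ← J.map_comp, ← HomologicalComplex.comp_f,
        cokernel.condition, HomologicalComplex.zero_f, J.map_zero, comp_zero]
    rw [IsZero.iff_id_eq_zero, ← cancel_epi (J.map ((cokernel.π i).f n)), h3, zero_comp, zero_comp]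
  obtain ⟨N, ⟨e⟩⟩ := exists_cpx_iso F (cokernel i) fun n => hF.essImage _ (hker n)
  refine ⟨N, cokernel.π i ≫ e.inv, ?_, fun Y g => ?_⟩
  · have hz : IsZero (Q.obj ((cpx G).obj P)) := isZero_Q_of_isZero_J hG.isZero P h0
    have hT := triangleOfSES_distinguished hS
    have h1 : IsIso (Q.map (cokernel.π i)) := (Triangle.isZero₁_iff_isIso₂ _ hT).1 hz
    have h2 : QuasiIso (cokernel.π i) := (isIso_Q_map_iff_quasiIso _ _).1 h1
    infer_instance
  · have h : i ≫ g = 0 := by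
      refine ((cpxCounit ε).naturality g).symm.trans ?_
      have : (cpx G).map g = 0 := by
        ext n
        exact (hG.isZero _ (hF.isZero (Y.X n))).eq_of_tgt _ _
      rw [this, zero_comp]
    refine ⟨(cpx F).preimage (e.hom ≫ cokernel.desc i g h), ?_⟩
    simp

/-- If every complex has a resolution for which the counit is injective, then the derived category
of the kernel of `J` is a full subcategory. -/
lemma step_full (hF : IsKernel F J) (hG : IsLeftApprox J G ε)
    (hgood : ∀ K : CochainComplex C ℤ, ∃ (P : CochainComplex C ℤ) (t : P ⟶ K), QuasiIso t ∧
      ∀ n, Mono (ε.app (P.X n))) : F.mapDerivedCategory.Full := by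
  refine mapDerivedCategory_full F fun X Y M s g hs => ?_
  obtain ⟨P, t, ht, hP⟩ := hgood M
  have h0 : IsZero (J.mapDerivedCategory.obj (Q.obj P)) := by
    have h1 : IsIso (Q.map (t ≫ s)) := (isIso_Q_map_iff_quasiIso _ _).2 inferInstance
    refine (hF.isZero_derived (Q.obj X)).of_iso (J.mapDerivedCategory.mapIso ?_)
    exact asIso (Q.map (t ≫ s)) ≪≫ (F.mapDerivedCategoryFactors.app X).symm
  obtain ⟨N, q, hq, hN⟩ := exists_resolution hF hG P hP h0
  obtain ⟨s', hs'⟩ := hN X (t ≫ s)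
  obtain ⟨g', hg'⟩ := hN Y (t ≫ g)
  refine ⟨N, P, t, q, s', g', hq, ?_, ht, hs', hg'⟩
  have h1 : QuasiIso (q ≫ (cpx F).map s') := hs' ▸ inferInstance
  have h2 : QuasiIso ((cpx F).map s') := quasiIso_of_comp_left q _
  exact (HomologicalComplex.quasiIso_map_iff_of_preservesHomology s' F).1 h2

lemma isZero_of_isZero_map (X : DerivedCategory D) (h : IsZero (F.mapDerivedCategory.obj X)) :
    IsZero X := by
  rw [isZero_mapDerivedCategory_iff] at h
  refine (isZero_iff_homology X).2 fun k => ?_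
  rw [IsZero.iff_id_eq_zero]
  exact F.map_injective ((h k).eq_of_src _ _)

lemma step_essImage (hF : IsKernel F J) (hG : IsLeftApprox J G ε)
    (hgood : ∀ K : CochainComplex C ℤ, ∃ (P : CochainComplex C ℤ) (t : P ⟶ K), QuasiIso t ∧
      ∀ n, Mono (ε.app (P.X n))) (X : DerivedCategory C)
    (hX : IsZero (J.mapDerivedCategory.obj X)) : F.mapDerivedCategory.essImage X := by
  let e : Q.obj (Q.objPreimage X) ≅ X := Q.objObjPreimageIso X
  obtain ⟨P, t, ht, hP⟩ := hgood (Q.objPreimage X)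
  have h1 : IsIso (Q.map t) := (isIso_Q_map_iff_quasiIso _ _).2 inferInstance
  obtain ⟨N, q, hq, -⟩ := exists_resolution hF hG P hP
    (hX.of_iso (J.mapDerivedCategory.mapIso (asIso (Q.map t) ≪≫ e)))
  have h2 : IsIso (Q.map q) := (isIso_Q_map_iff_quasiIso _ _).2 inferInstance
  exact ⟨Q.obj N, ⟨F.mapDerivedCategoryFactors.app N ≪≫
    (asIso (Q.map q)).symm ≪≫ asIso (Q.map t) ≪≫ e⟩⟩

end Step

/-! ### Approximations and recollements -/

section Approximation

universe v v1 v2 u u1 u2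

variable {T : Type u} [Category.{v} T] [HasZeroObject T] [Preadditive T] [HasShift T ℤ]
  [∀ a : ℤ, (shiftFunctor T a).Additive] [Pretriangulated T]

/-- Every object receives a map from an object which is left orthogonal to `P`, with cone in `P`. -/
def HasLeftApprox (P : ObjectProperty T) : Prop :=
  ∀ X : T, ∃ (A : T) (f : A ⟶ X), P.leftOrthogonal A ∧ P.trW f

/-- Every object has a map to an object which is right orthogonal to `P`, with cone in `P`. -/
def HasRightApprox (P : ObjectProperty T) : Prop :=
  ∀ X : T, ∃ (A : T) (f : X ⟶ A), P.rightOrthogonal A ∧ P.trW f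

section Exactness

variable {X Y Z : T} {f : X ⟶ Y} {g : Y ⟶ Z} {h : Z ⟶ X⟦(1 : ℤ)⟧}
  (hT : Triangle.mk f g h ∈ distTriang T)
include hT

lemma exists_desc₂ {W : T} (φ : Y ⟶ W) (hφ : f ≫ φ = 0) : ∃ ψ : Z ⟶ W, φ = g ≫ ψ :=
  Triangle.yoneda_exact₂ _ hT φ hφ

lemma exists_desc₃ {W : T} (φ : Z ⟶ W) (hφ : g ≫ φ = 0) : ∃ ψ : X⟦(1 : ℤ)⟧ ⟶ W, φ = h ≫ ψ :=
  Triangle.yoneda_exact₃ _ hT φ hφ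

lemma exists_lift₂ {W : T} (φ : W ⟶ Y) (hφ : φ ≫ g = 0) : ∃ ψ : W ⟶ X, φ = ψ ≫ f :=
  Triangle.coyoneda_exact₂ _ hT φ hφ

lemma exists_lift₃ {W : T} (φ : W ⟶ Z) (hφ : φ ≫ h = 0) : ∃ ψ : W ⟶ Y, φ = ψ ≫ g :=
  Triangle.coyoneda_exact₃ _ hT φ hφ

lemma exists_lift₁ {W : T} (φ : W ⟶ X) (hφ : φ ≫ f = 0) :
    ∃ (ψ : W ⟶ Z⟦(-1 : ℤ)⟧) (k : Z⟦(-1 : ℤ)⟧ ⟶ X), φ = ψ ≫ k := by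
  obtain ⟨ψ, hψ⟩ := Triangle.coyoneda_exact₂ _ (inv_rot_of_distTriang _ hT) φ hφ
  exact ⟨ψ, _, hψ⟩

lemma exists_desc_shift {W : T} (φ : X⟦(1 : ℤ)⟧ ⟶ W) (hφ : h ≫ φ = 0) :
    ∃ ψ : Y⟦(1 : ℤ)⟧ ⟶ W, φ = -f⟦(1 : ℤ)⟧' ≫ ψ := by
  obtain ⟨ψ, hψ⟩ := Triangle.yoneda_exact₃ _ (rot_of_distTriang _ hT) φ hφ
  exact ⟨ψ, hψ.trans (Preadditive.neg_comp _ _)⟩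

end Exactness

section Adjunctions

universe v' u'

variable {C : Type u} [Category.{v} C] {D : Type u'} [Category.{v'} D] {l : C ⥤ D} {r : D ⥤ C}
  (adj : l ⊣ r)

/-- The unit of an adjunction. -/
def unitAt (X : C) : X ⟶ r.obj (l.obj X) := adj.unit.app X

/-- The counit of an adjunction. -/
def counitAt (Y : D) : l.obj (r.obj Y) ⟶ Y := adj.counit.app Y

lemma unitAt_symm {X : C} {Y : D} (φ : X ⟶ r.obj Y) :
    unitAt adj X ≫ r.map ((adj.homEquiv X Y).symm φ) = φ :=
  (adj.homEquiv_unit _ _ _).symm.trans (Equiv.apply_symm_apply _ _)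

lemma counitAt_homEquiv {X : C} {Y : D} (φ : l.obj X ⟶ Y) :
    l.map (adj.homEquiv X Y φ) ≫ counitAt adj Y = φ :=
  (adj.homEquiv_counit _ _ _).symm.trans (Equiv.symm_apply_apply _ _)

lemma unitAt_cancel {X : C} {Y : D} {a b : l.obj X ⟶ Y}
    (h : unitAt adj X ≫ r.map a = unitAt adj X ≫ r.map b) : a = b :=
  (adj.homEquiv X Y).injective
    ((adj.homEquiv_unit _ _ _).trans (h.trans (adj.homEquiv_unit _ _ _).symm))

lemma counitAt_cancel {X : C} {Y : D} {a b : X ⟶ r.obj Y}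
    (h : l.map a ≫ counitAt adj Y = l.map b ≫ counitAt adj Y) : a = b :=
  (adj.homEquiv X Y).symm.injective
    ((adj.homEquiv_counit _ _ _).trans (h.trans (adj.homEquiv_counit _ _ _).symm))

lemma isRightAdjoint_of_universal (r : D ⥤ C)
    (h : ∀ X, ∃ (W : D) (u : X ⟶ r.obj W), ∀ W', Bijective fun a : W ⟶ W' => u ≫ r.map a) :
    r.IsRightAdjoint := by
  refine r.isRightAdjoint_of_leftAdjointObjIsDefined_eq_top ?_
  ext X
  obtain ⟨W, u, hu⟩ := h X
  exact ⟨fun _ => trivial, fun _ => Functor.CorepresentableBy.isCorepresentable (X := W)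
    { homEquiv := Equiv.ofBijective _ (hu _), homEquiv_comp := fun g f => by simp }⟩

lemma isLeftAdjoint_of_universal (l : C ⥤ D)
    (h : ∀ Y, ∃ (W : C) (u : l.obj W ⟶ Y), ∀ W', Bijective fun a : W' ⟶ W => l.map a ≫ u) :
    l.IsLeftAdjoint := by
  refine l.isLeftAdjoint_of_rightAdjointObjIsDefined_eq_top ?_
  ext Y
  obtain ⟨W, u, hu⟩ := h Y
  exact ⟨fun _ => trivial, fun _ => Functor.RepresentableBy.isRepresentable (Y := W)
    { homEquiv := Equiv.ofBijective _ (hu _), homEquiv_comp := fun g f => by simp }⟩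

lemma bijective_unitAt_comp [r.Full] [r.Faithful] (X : C) {Y : C} (hY : r.essImage Y) :
    Bijective fun ψ : r.obj (l.obj X) ⟶ Y => unitAt adj X ≫ ψ := by
  obtain ⟨W, ⟨e⟩⟩ := hY
  refine ⟨fun a b h => ?_, fun φ => ⟨r.map ((adj.homEquiv X W).symm (φ ≫ e.inv)) ≫ e.hom, ?_⟩⟩
  · rw [← cancel_mono e.inv]
    obtain ⟨⟨a', ha⟩, b', hb⟩ := And.intro (r.map_surjective (a ≫ e.inv))
      (r.map_surjective (b ≫ e.inv))
    rw [← ha, ← hb, unitAt_cancel adj (a := a') (b := b')]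
    rw [ha, hb, ← assoc, ← assoc]
    exact congrArg (· ≫ e.inv) h
  · dsimp only
    rw [← assoc, unitAt_symm, assoc, e.inv_hom_id, comp_id]

lemma bijective_comp_counitAt [l.Full] [l.Faithful] (X : D) {Y : D} (hY : l.essImage Y) :
    Bijective fun ψ : Y ⟶ l.obj (r.obj X) => ψ ≫ counitAt adj X := by
  obtain ⟨W, ⟨e⟩⟩ := hY
  refine ⟨fun a b h => ?_, fun φ => ⟨e.inv ≫ l.map (adj.homEquiv W X (e.hom ≫ φ)), ?_⟩⟩
  · rw [← cancel_epi e.hom]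
    obtain ⟨⟨a', ha⟩, b', hb⟩ := And.intro (l.map_surjective (e.hom ≫ a))
      (l.map_surjective (e.hom ≫ b))
    rw [← ha, ← hb, counitAt_cancel adj (a := a') (b := b')]
    rw [ha, hb, assoc, assoc]
    exact congrArg (e.hom ≫ ·) h
  · dsimp only
    rw [assoc, counitAt_homEquiv, ← assoc, e.inv_hom_id, id_comp]

end Adjunctions

variable {P : ObjectProperty T} [P.IsTriangulated]
  {T1 : Type u1} [Category.{v1} T1] (i : T1 ⥤ T) [i.Full] [i.Faithful]

lemma isRightAdjoint_of_leftApprox (hP : ∀ X, P X ↔ i.essImage X) (h : HasLeftApprox P) :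
    i.IsRightAdjoint := by
  refine isRightAdjoint_of_universal i fun X => ?_
  obtain ⟨A, f, hA, Z, g, δ, hT, hZ⟩ := h X
  obtain ⟨W, ⟨e⟩⟩ := (hP Z).1 hZ
  refine ⟨W, g ≫ e.inv, fun W' => ⟨fun a b hab => i.map_injective ?_, fun φ => ?_⟩⟩
  · rw [← cancel_epi e.inv, ← sub_eq_zero]
    obtain ⟨c, hc⟩ := exists_desc₃ hT (e.inv ≫ i.map a - e.inv ≫ i.map b) (by
      rw [Preadditive.comp_sub, sub_eq_zero]
      simpa using hab)
    rw [hc, P.leftOrthogonal.le_shift 1 A hA c ((hP _).2 (i.obj_mem_essImage W')), comp_zero]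
  · obtain ⟨ψ, rfl⟩ := exists_desc₂ hT φ (hA _ ((hP _).2 (i.obj_mem_essImage W')))
    exact ⟨i.preimage (e.hom ≫ ψ), by simp⟩

lemma isLeftAdjoint_of_rightApprox (hP : ∀ X, P X ↔ i.essImage X) (h : HasRightApprox P) :
    i.IsLeftAdjoint := by
  refine isLeftAdjoint_of_universal i fun X => ?_
  obtain ⟨A, f, hA, hf⟩ := h X
  obtain ⟨Z, g, δ, hT, hZ⟩ := (P.trW_iff' _).1 hf
  obtain ⟨W, ⟨e⟩⟩ := (hP Z).1 hZ
  refine ⟨W, e.hom ≫ g, fun W' => ⟨fun a b hab => i.map_injective ?_, fun φ => ?_⟩⟩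
  · rw [← cancel_mono e.hom, ← sub_eq_zero]
    obtain ⟨c, k, hc⟩ := exists_lift₁ hT (i.map a ≫ e.hom - i.map b ≫ e.hom) (by
      rw [Preadditive.sub_comp, sub_eq_zero]
      simpa using hab)
    rw [hc, P.rightOrthogonal.le_shift (-1) A hA c ((hP _).2 (i.obj_mem_essImage W')), zero_comp]
  · obtain ⟨ψ, rfl⟩ := exists_lift₂ hT φ (hA _ ((hP _).2 (i.obj_mem_essImage W')))
    exact ⟨i.preimage (ψ ≫ e.inv), by simp⟩

/-- The fibre of the unit of an adjunction is left orthogonal to the reflective subcategory. -/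
lemma hasLeftApprox_of_isRightAdjoint (hP : ∀ X, P X ↔ i.essImage X) [i.IsRightAdjoint] :
    HasLeftApprox P := by
  intro X
  let adj := Adjunction.ofIsRightAdjoint i
  have hbij := fun {Y} (hY : P Y) => bijective_unitAt_comp adj X ((hP Y).1 hY)
  obtain ⟨A, f, δ, hT⟩ := distinguished_cocone_triangle₁ (unitAt adj X)
  refine ⟨A, f, fun Y g hY => ?_, _, _, _, hT, (hP _).2 (i.obj_mem_essImage _)⟩
  apply (shiftFunctor T (1 : ℤ)).map_injective
  have h1 : δ ≫ g⟦(1 : ℤ)⟧' = 0 := (hbij (P.le_shift 1 _ hY)).1 (by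
    have h2 : unitAt adj X ≫ δ = 0 := comp_distTriang_mor_zero₂₃ _ hT
    dsimp only
    rw [← assoc, h2, zero_comp, comp_zero])
  obtain ⟨k, hk⟩ := exists_desc_shift hT (g⟦(1 : ℤ)⟧') h1
  obtain ⟨l, rfl⟩ := (shiftFunctor T (1 : ℤ)).map_surjective k
  obtain ⟨l', rfl⟩ := (hbij hY).2 l
  have h2 : f ≫ unitAt adj X = 0 := comp_distTriang_mor_zero₁₂ _ hT
  rw [hk, ← Functor.map_comp, ← assoc, h2, zero_comp, Functor.map_zero, neg_zero]

/-- The cone of the counit of an adjunction is right orthogonal to the coreflective subcategory. -/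
lemma hasRightApprox_of_isLeftAdjoint (hP : ∀ X, P X ↔ i.essImage X) [i.IsLeftAdjoint] :
    HasRightApprox P := by
  intro X
  let adj := Adjunction.ofIsLeftAdjoint i
  have hbij := fun {Y} (hY : P Y) => bijective_comp_counitAt adj X ((hP Y).1 hY)
  obtain ⟨A, f, δ, hT⟩ := distinguished_cocone_triangle (counitAt adj X)
  refine ⟨A, f, fun Y g hY => ?_, (P.trW_iff' _).2 ⟨_, _, _, hT, (hP _).2 (i.obj_mem_essImage _)⟩⟩
  have h1 : g ≫ δ = 0 := by
    have h0 : P (Y⟦(-1 : ℤ)⟧) := P.le_shift _ _ hY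
    have h3 : δ ≫ (counitAt adj X)⟦(1 : ℤ)⟧' = 0 := comp_distTriang_mor_zero₃₁ _ hT
    let s : (Y⟦(-1 : ℤ)⟧)⟦(1 : ℤ)⟧ ≅ Y := (shiftFunctorCompIsoId T (-1 : ℤ) 1 (by simp)).app Y
    obtain ⟨k, hk⟩ := (shiftFunctor T (1 : ℤ)).map_surjective (s.hom ≫ g ≫ δ)
    have h4 : k = 0 := (hbij h0).1 (by
      refine (shiftFunctor T (1 : ℤ)).map_injective ?_
      dsimp only
      rw [Functor.map_comp, hk, zero_comp, Functor.map_zero, assoc, assoc, h3, comp_zero, comp_zero])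
    rw [← cancel_epi s.hom, ← hk, h4, Functor.map_zero, comp_zero]
  obtain ⟨k, rfl⟩ := exists_lift₃ hT g h1
  obtain ⟨l', hl⟩ := (hbij hY).2 k
  have h2 : counitAt adj X ≫ f = 0 := comp_distTriang_mor_zero₁₂ _ hT
  rw [← hl, assoc, h2, comp_zero]

variable {T2 : Type u2} [Category.{v2} T2] (j : T ⥤ T2) [IsTriangulated T]
  [j.IsLocalization P.trW]

lemma isRightAdjoint_of_localization (h : HasLeftApprox P) : j.IsRightAdjoint := by
  have := Localization.essSurj j P.trW
  refine isRightAdjoint_of_universal j fun Y => ?_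
  obtain ⟨A, f, hA, hf⟩ := h (j.objPreimage Y)
  have : IsIso (j.map f) := Localization.inverts j P.trW f hf
  let e : Y ≅ j.obj A := (j.objObjPreimageIso Y).symm ≪≫ (asIso (j.map f)).symm
  refine ⟨A, e.hom, fun W => ?_⟩
  convert (Iso.homCongr e.symm (Iso.refl _)).bijective.comp (hA.map_bijective_of_isTriangulated j W)
  simp

lemma isLeftAdjoint_of_localization (h : HasRightApprox P) : j.IsLeftAdjoint := by
  have := Localization.essSurj j P.trW
  refine isLeftAdjoint_of_universal j fun Y => ?_
  obtain ⟨A, f, hA, hf⟩ := h (j.objPreimage Y)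
  have : IsIso (j.map f) := Localization.inverts j P.trW f hf
  let e : j.obj A ≅ Y := (asIso (j.map f)).symm ≪≫ (j.objObjPreimageIso Y)
  refine ⟨A, e.hom, fun W => ?_⟩
  convert (Iso.homCongr (Iso.refl _) e).bijective.comp (hA.map_bijective_of_isTriangulated j W)
  simp

variable {j}

lemma leftOrthogonal_leftAdjoint {l : T2 ⥤ T} (adj : l ⊣ j) (hP : ∀ X, P X → IsZero (j.obj X))
    (Y : T2) : P.leftOrthogonal (l.obj Y) := fun Z _ hZ =>
  (adj.homEquiv Y Z).injective ((hP Z hZ).eq_of_tgt _ _)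

lemma rightOrthogonal_rightAdjoint {r : T2 ⥤ T} (adj : j ⊣ r) (hP : ∀ X, P X → IsZero (j.obj X))
    (Y : T2) : P.rightOrthogonal (r.obj Y) := fun Z _ hZ =>
  (adj.homEquiv Z Y).symm.injective ((hP Z hZ).eq_of_src _ _)

lemma isIso_unit_of_localization {l : T2 ⥤ T} (adj : l ⊣ j) (hP : ∀ X, P X → IsZero (j.obj X))
    (Y : T2) : IsIso (unitAt adj Y) := by
  have := Localization.essSurj j P.trW
  have hbij := fun X => (leftOrthogonal_leftAdjoint adj hP Y).map_bijective_of_isTriangulated j X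
  obtain ⟨f, hf⟩ : ∃ f : j.obj (l.obj Y) ⟶ Y, unitAt adj Y ≫ f = 𝟙 Y := by
    let e := j.objObjPreimageIso Y
    refine ⟨j.map ((adj.homEquiv _ _).symm e.inv) ≫ e.hom, ?_⟩
    rw [← assoc, unitAt_symm, e.inv_hom_id]
  refine ⟨f, hf, ?_⟩
  obtain ⟨k, hk⟩ := (hbij _).2 (f ≫ unitAt adj Y)
  have h1 : k = 𝟙 _ := by
    apply unitAt_cancel adj
    rw [hk, j.map_id, ← assoc, hf, id_comp, comp_id]
  rw [← hk, h1, j.map_id]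

lemma isIso_counit_of_localization {r : T2 ⥤ T} (adj : j ⊣ r)
    (hP : ∀ X, P X → IsZero (j.obj X)) (Y : T2) : IsIso (counitAt adj Y) := by
  have := Localization.essSurj j P.trW
  have hbij := fun X => (rightOrthogonal_rightAdjoint adj hP Y).map_bijective_of_isTriangulated j X
  obtain ⟨f, hf⟩ : ∃ f : Y ⟶ j.obj (r.obj Y), f ≫ counitAt adj Y = 𝟙 Y := by
    let e := j.objObjPreimageIso Y
    refine ⟨e.inv ≫ j.map (adj.homEquiv _ _ e.hom), ?_⟩
    rw [assoc, counitAt_homEquiv, e.inv_hom_id]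
  refine ⟨f, ?_, hf⟩
  obtain ⟨k, hk⟩ := (hbij _).2 (counitAt adj Y ≫ f)
  have h1 : k = 𝟙 _ := by
    apply counitAt_cancel adj
    rw [hk, j.map_id, assoc, hf, id_comp, comp_id]
  rw [← hk, h1, j.map_id]

end Approximation

section Recollement

variable {D' D D'' : Type 1} [Category.{1} D'] [Category.{1} D] [Category.{1} D'']
    [HasZeroObject D] [HasZeroObject D''] [Preadditive D] [HasShift D ℤ]
    [∀ a : ℤ, (shiftFunctor D a).Additive] [Pretriangulated D] [IsTriangulated D]
    [Preadditive D''] [HasShift D'' ℤ]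
    [∀ a : ℤ, (shiftFunctor D'' a).Additive] [Pretriangulated D'']
    (i : D' ⥤ D) [i.Full] [i.Faithful] [i.IsRightAdjoint] [i.IsLeftAdjoint]
    (j : D ⥤ D'') [j.CommShift ℤ] [j.IsTriangulated]

/-- A fully faithful functor with both adjoints, together with a triangulated functor which is a
localization and whose kernel is the essential image of the former, forms a recollement. -/
lemma nonempty_recollement (P : ObjectProperty D) [P.IsTriangulated]
    [j.IsLocalization P.trW] (hi : ∀ X, P X ↔ i.essImage X)
    (hj : ∀ X, P X ↔ IsZero (j.obj X)) : Nonempty (Recollement i j) := by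
  have := isRightAdjoint_of_localization j (hasLeftApprox_of_isRightAdjoint i hi)
  have := isLeftAdjoint_of_localization j (hasRightApprox_of_isLeftAdjoint i hi)
  let adjI := Adjunction.ofIsRightAdjoint i
  let adjI' := Adjunction.ofIsLeftAdjoint i
  let adjJ' := Adjunction.ofIsRightAdjoint j
  let adjJ := Adjunction.ofIsLeftAdjoint j
  have h1 := fun Y => isIso_unit_of_localization adjJ' (fun X => (hj X).1) Y
  have h2 := fun Y => isIso_counit_of_localization adjJ (fun X => (hj X).1) Y
  have : ∀ Y, IsIso (adjJ'.unit.app Y) := h1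
  have : ∀ Y, IsIso (adjJ.counit.app Y) := h2
  have : IsIso adjJ'.unit := NatIso.isIso_of_isIso_app _
  have : IsIso adjJ.counit := NatIso.isIso_of_isIso_app _
  have hL := fun Y => leftOrthogonal_leftAdjoint adjJ' (fun X => (hj X).1) Y
  have hR := fun Y => rightOrthogonal_rightAdjoint adjJ (fun X => (hj X).1) Y
  have hPi : ∀ W, P (i.obj W) := fun W => (hi _).2 (i.obj_mem_essImage W)
  refine ⟨{
    iUp := i.leftAdjoint
    iUpShriek := i.rightAdjoint
    jLowShriek := j.leftAdjoint
    jLow := j.rightAdjoint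
    adjI := adjI
    adjIShriek := adjI'
    adjJShriek := adjJ'
    adjJ := adjJ
    iLow_full := inferInstance
    iLow_faithful := inferInstance
    jLowShriek_full := adjJ'.fullyFaithfulLOfIsIsoUnit.full
    jLowShriek_faithful := adjJ'.fullyFaithfulLOfIsIsoUnit.faithful
    jLow_full := adjJ.fullyFaithfulROfIsIsoCounit.full
    jLow_faithful := adjJ.fullyFaithfulROfIsIsoCounit.faithful
    isZero_comp := fun X => (hj _).1 (hPi X)
    triangle₁ := fun X => ?_
    triangle₂ := fun X => ?_ }⟩
  · have hu : IsIso (j.map (unitAt adjJ X)) := by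
      have : j.map (unitAt adjJ X) ≫ counitAt adjJ (j.obj X) = 𝟙 (j.obj X) :=
        adjJ.left_triangle_components X
      exact IsIso.of_isIso_fac_right this
    obtain ⟨Z, a, δ, hT⟩ := distinguished_cocone_triangle₁ (unitAt adjJ X)
    have hZ : P Z := (hj _).2 ((Triangle.isZero₁_iff_isIso₂ _ (j.map_distinguished _ hT)).2 hu)
    let c := counitAt adjI' X
    obtain ⟨φ, hφ⟩ : ∃ φ : i.obj (i.rightAdjoint.obj X) ⟶ Z, c = φ ≫ a :=
      exists_lift₂ hT c (hR _ _ (hPi _))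
    obtain ⟨ψ, hψ : ψ ≫ c = a⟩ := (bijective_comp_counitAt adjI' X ((hi Z).1 hZ)).2 a
    have h3 : ψ ≫ φ = 𝟙 Z := by
      rw [← sub_eq_zero]
      obtain ⟨d, k, hd⟩ := exists_lift₁ hT (ψ ≫ φ - 𝟙 Z) (by
        rw [Preadditive.sub_comp, assoc, ← hφ, hψ, id_comp, sub_self])
      rw [hd, P.rightOrthogonal.le_shift (-1) _ (hR _) d hZ, zero_comp]
    have h4 : φ ≫ ψ = 𝟙 _ := (bijective_comp_counitAt adjI' X (i.obj_mem_essImage _)).1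
      ((assoc _ _ _).trans ((congrArg (φ ≫ ·) hψ).trans (hφ.symm.trans (id_comp c).symm)))
    let E : i.obj (i.rightAdjoint.obj X) ≅ Z := ⟨φ, ψ, h4, h3⟩
    refine ⟨δ ≫ ψ⟦(1 : ℤ)⟧', isomorphic_distinguished _ hT _
      (Triangle.isoMk _ _ E (Iso.refl _) (Iso.refl _) ?_ ?_ ?_)⟩
    · exact (comp_id _).trans hφ
    · exact (comp_id _).trans (id_comp _).symm
    · change (δ ≫ ψ⟦(1 : ℤ)⟧') ≫ φ⟦(1 : ℤ)⟧' = 𝟙 _ ≫ δ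
      rw [assoc, ← Functor.map_comp, h3, CategoryTheory.Functor.map_id, comp_id, id_comp]
  · have hu : IsIso (j.map (counitAt adjJ' X)) := by
      have : unitAt adjJ' (j.obj X) ≫ j.map (counitAt adjJ' X) = 𝟙 (j.obj X) :=
        adjJ'.right_triangle_components X
      exact IsIso.of_isIso_fac_left this
    obtain ⟨Z, a, δ, hT⟩ := distinguished_cocone_triangle (counitAt adjJ' X)
    have hZ : P Z := (hj _).2 ((Triangle.isZero₃_iff_isIso₁ _ (j.map_distinguished _ hT)).2 hu)
    let c := unitAt adjI X
    obtain ⟨φ, hφ⟩ : ∃ φ : Z ⟶ i.obj (i.leftAdjoint.obj X), c = a ≫ φ :=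
      exists_desc₂ hT c (hL _ _ (hPi _))
    obtain ⟨ψ, hψ : c ≫ ψ = a⟩ := (bijective_unitAt_comp adjI X ((hi Z).1 hZ)).2 a
    have h3 : φ ≫ ψ = 𝟙 Z := by
      rw [← sub_eq_zero]
      obtain ⟨d, hd⟩ := exists_desc₃ hT (φ ≫ ψ - 𝟙 Z) (by
        rw [Preadditive.comp_sub, ← assoc, ← hφ, hψ, comp_id, sub_self])
      rw [hd, P.leftOrthogonal.le_shift 1 _ (hL _) d hZ, comp_zero]
    have h4 : ψ ≫ φ = 𝟙 _ := (bijective_unitAt_comp adjI X (i.obj_mem_essImage _)).1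
      ((assoc _ _ _).symm.trans ((congrArg (· ≫ φ) hψ).trans (hφ.symm.trans (comp_id c).symm)))
    let E : i.obj (i.leftAdjoint.obj X) ≅ Z := ⟨ψ, φ, h4, h3⟩
    refine ⟨ψ ≫ δ, isomorphic_distinguished _ hT _
      (Triangle.isoMk _ _ (Iso.refl _) (Iso.refl _) E ?_ ?_ ?_)⟩
    · exact (comp_id _).trans (id_comp _).symm
    · exact hψ.trans (id_comp _).symm
    · change (ψ ≫ δ) ≫ (𝟙 _)⟦(1 : ℤ)⟧' = ψ ≫ δ
      rw [CategoryTheory.Functor.map_id, comp_id]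

end Recollement

section KernelObjects

variable {T1 T2 : Type*} [Category T1] [Category T2]
    [HasZeroObject T1] [Preadditive T1] [HasShift T1 ℤ] [∀ n : ℤ, (shiftFunctor T1 n).Additive]
    [Pretriangulated T1] [HasZeroObject T2] [Preadditive T2] [HasShift T2 ℤ]
    [∀ n : ℤ, (shiftFunctor T2 n).Additive] [Pretriangulated T2]
    (F : T1 ⥤ T2) [F.CommShift ℤ] [F.IsTriangulated]

/-- The objects killed by a functor. -/
def kernelObjects {C D : Type*} [Category C] [Category D] (F : C ⥤ D) : ObjectProperty C :=
  fun X => IsZero (F.obj X)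

instance : (kernelObjects F).IsClosedUnderIsomorphisms where
  of_iso e h := IsZero.of_iso h (F.mapIso e.symm)

instance : (kernelObjects F).IsTriangulated where
  exists_zero := by
    obtain ⟨Z, hZ⟩ := HasZeroObject.zero (C := T1)
    exact ⟨Z, hZ, F.map_isZero hZ⟩
  isStableUnderShiftBy a :=
    { le_shift := fun X hX =>
        ((shiftFunctor T2 a).map_isZero hX).of_iso ((F.commShiftIso a).app X) }
  toIsTriangulatedClosed₂ := .mk' fun T hT h1 h3 => by
    have h := F.map_distinguished T hT
    exact (Triangle.isZero₂_iff _ h).2 ⟨IsZero.eq_of_src h1 _ _, IsZero.eq_of_tgt h3 _ _⟩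

lemma kernelObjects_trW_iff {X Y : T1} (f : X ⟶ Y) :
    (kernelObjects F).trW f ↔ IsIso (F.map f) := by
  constructor
  · rintro ⟨Z, g, h, hT, hZ⟩
    exact (Triangle.isZero₃_iff_isIso₁ _ (F.map_distinguished _ hT)).1 hZ
  · intro hf
    obtain ⟨Z, g, h, hT⟩ := distinguished_cocone_triangle f
    exact ⟨Z, g, h, hT, (Triangle.isZero₃_iff_isIso₁ _ (F.map_distinguished _ hT)).2 hf⟩

end KernelObjects

section Step

universe w1 w2 w3 v1 v2 v3 u1 u2 u3

variable {C : Type u1} [Category.{v1} C] [Abelian C] [HasDerivedCategory.{w1} C]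
  {E : Type u3} [Category.{v3} E] [Abelian E] [HasDerivedCategory.{w3} E]
  {J : C ⥤ E} [J.Additive] [PreservesFiniteLimits J] [PreservesFiniteColimits J]
  {G : C ⥤ C} [G.Additive] [PreservesFiniteLimits G] [PreservesFiniteColimits G]
  {ε : G ⟶ 𝟭 C} {H : C ⥤ C} [H.Additive] [PreservesFiniteLimits H] [PreservesFiniteColimits H]
  {η : 𝟭 C ⟶ H}

lemma isIso_map_Q (F : C ⥤ E) [F.Additive] [PreservesFiniteLimits F] [PreservesFiniteColimits F]
    {K L : CochainComplex C ℤ} (f : K ⟶ L) (h : QuasiIso ((cpx F).map f)) :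
    IsIso (F.mapDerivedCategory.map (Q.map f)) := by
  have h1 : IsIso (Q.map ((cpx F).map f)) := (isIso_Q_map_iff_quasiIso _ _).2 h
  have h2 := F.mapDerivedCategoryFactors_hom_naturality f
  have h3 : F.mapDerivedCategory.map (Q.map f) =
      F.mapDerivedCategoryFactors.hom.app K ≫ Q.map ((cpx F).map f) ≫
        F.mapDerivedCategoryFactors.inv.app L := by
    rw [← assoc, ← h2]
    simp
  rw [h3]
  infer_instance

lemma IsLeftApprox.hasLeftApprox (hG : IsLeftApprox J G ε) :
    HasLeftApprox (kernelObjects J.mapDerivedCategory) := by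
  intro X
  let e : Q.obj (Q.objPreimage X) ≅ X := Q.objObjPreimageIso X
  let K := Q.objPreimage X
  refine ⟨Q.obj ((cpx G).obj K), Q.map ((cpxCounit ε).app K) ≫ e.hom, fun Y f hY => ?_, ?_⟩
  · let e' : Q.obj (Q.objPreimage Y) ≅ Y := Q.objObjPreimageIso Y
    rw [← cancel_mono e'.inv, zero_comp]
    exact eq_zero_of_counit G ε K _ (quasiIso_of_isIso _ fun n => hG.isIso_app _)
      (isZero_Q_of_isZero_J hG.isZero _ (IsZero.of_iso hY (J.mapDerivedCategory.mapIso e'))) _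
  · rw [kernelObjects_trW_iff, Functor.map_comp]
    have := isIso_map_Q J ((cpxCounit ε).app K) (quasiIso_of_isIso _ fun n => hG.isIso_map _)
    exact IsIso.comp_isIso' this inferInstance

lemma IsRightApprox.hasRightApprox (hH : IsRightApprox J H η) :
    HasRightApprox (kernelObjects J.mapDerivedCategory) := by
  intro X
  let e : Q.obj (Q.objPreimage X) ≅ X := Q.objObjPreimageIso X
  let K := Q.objPreimage X
  refine ⟨Q.obj ((cpx H).obj K), e.inv ≫ Q.map ((cpxUnit η).app K), fun Y f hY => ?_, ?_⟩
  · let e' : Q.obj (Q.objPreimage Y) ≅ Y := Q.objObjPreimageIso Y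
    rw [← cancel_epi e'.hom, comp_zero]
    exact eq_zero_of_unit H η K _ (quasiIso_of_isIso _ fun n => hH.isIso_app _)
      (isZero_Q_of_isZero_J hH.isZero _ (IsZero.of_iso hY (J.mapDerivedCategory.mapIso e'))) _
  · rw [kernelObjects_trW_iff, Functor.map_comp]
    have := isIso_map_Q J ((cpxUnit η).app K) (quasiIso_of_isIso _ fun n => hH.isIso_map _)
    exact IsIso.comp_isIso' inferInstance this

end Step

section Pointed

variable {R : Type} [Ring R]

open Classical in
/-- The basis element attached to an element of `M`, where `0` is sent to `0`. -/
def pointedBasis (M : ModuleCat.{0} R) (x : M) : {x : M // x ≠ 0} →₀ R :=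
  if h : x = 0 then 0 else Finsupp.single ⟨x, h⟩ 1

lemma pointedBasis_zero (M : ModuleCat.{0} R) : pointedBasis M (0 : M) = 0 := dif_pos rfl

lemma pointedBasis_coe (M : ModuleCat.{0} R) (x : {x : M // x ≠ 0}) :
    pointedBasis M x.1 = Finsupp.single x 1 := dif_neg x.2

/-- The linear map out of the free module on the nonzero elements of `M`. -/
def pointedLift (M : ModuleCat.{0} R) {N : Type} [AddCommGroup N] [Module R N] (g : M → N) :
    ({x : M // x ≠ 0} →₀ R) →ₗ[R] N :=
  Finsupp.linearCombination R fun x => g x.1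

lemma pointedLift_basis (M : ModuleCat.{0} R) {N : Type} [AddCommGroup N] [Module R N] (g : M → N)
    (hg : g 0 = 0) (x : M) : pointedLift M g (pointedBasis M x) = g x := by
  by_cases h : x = 0
  · rw [h, pointedBasis_zero, map_zero, hg]
  · have := pointedBasis_coe M ⟨x, h⟩
    simp only at this
    rw [this, pointedLift, Finsupp.linearCombination_single, one_smul]

lemma pointed_hom_ext (M : ModuleCat.{0} R) {N : Type} [AddCommGroup N] [Module R N]
    {f g : ({x : M // x ≠ 0} →₀ R) →ₗ[R] N}
    (h : ∀ x : M, f (pointedBasis M x) = g (pointedBasis M x)) : f = g := by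
  refine Finsupp.lhom_ext' fun x => LinearMap.ext_ring ?_
  have := h x.1
  rwa [pointedBasis_coe] at this

/-- The linear map induced by a linear map on the free modules on the nonzero elements. -/
def pointedMap {M N : ModuleCat.{0} R} (f : M ⟶ N) :
    ({x : M // x ≠ 0} →₀ R) →ₗ[R] ({x : N // x ≠ 0} →₀ R) :=
  pointedLift M fun x => pointedBasis N (f.hom x)

lemma pointedMap_basis {M N : ModuleCat.{0} R} (f : M ⟶ N) (x : M) :
    pointedMap f (pointedBasis M x) = pointedBasis N (f.hom x) :=
  pointedLift_basis M (fun x => pointedBasis N (f.hom x)) (by rw [map_zero, pointedBasis_zero]) x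

/-- The functor which sends a module to the free module on its nonzero elements. It preserves zero
morphisms. -/
def pointedFree (R : Type) [Ring R] : ModuleCat.{0} R ⥤ ModuleCat.{0} R where
  obj M := ModuleCat.of R ({x : M // x ≠ 0} →₀ R)
  map f := ofHom (pointedMap f)
  map_id M := ModuleCat.hom_ext (pointed_hom_ext M (pointedMap_basis (𝟙 M)))
  map_comp {L M N} f g := by
    refine ModuleCat.hom_ext (pointed_hom_ext L fun x => ?_)
    refine (pointedMap_basis (f ≫ g) x).trans ?_
    refine Eq.trans ?_ (congrArg (pointedMap g) (pointedMap_basis f x).symm)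
    exact (pointedMap_basis g (f.hom x)).symm

instance : (pointedFree R).PreservesZeroMorphisms where
  map_zero M N := by
    refine ModuleCat.hom_ext (pointed_hom_ext M fun x => ?_)
    exact (pointedMap_basis (0 : M ⟶ N) x).trans (pointedBasis_zero N)

/-- The canonical surjection from the free module on the nonzero elements. -/
def pointedFreeπ (R : Type) [Ring R] : pointedFree R ⟶ 𝟭 (ModuleCat.{0} R) where
  app M := ofHom (X := {x : M // x ≠ 0} →₀ R) (Y := M) (pointedLift M fun x => x)
  naturality M N f := by
    refine ModuleCat.hom_ext (pointed_hom_ext M fun x => ?_)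
    refine (congrArg (pointedLift N fun x => x) (pointedMap_basis f x)).trans ?_
    refine (pointedLift_basis N (fun x => x) rfl _).trans ?_
    exact (congrArg f.hom (pointedLift_basis M (fun x => x) rfl x)).symm

lemma pointedFreeπ_surjective (M : ModuleCat.{0} R) :
    Surjective ((pointedFreeπ R).app M).hom := fun x =>
  ⟨pointedBasis M x, pointedLift_basis M (fun x => x) rfl x⟩

/-- Every complex of modules is quasi-isomorphic to one with terms `K ⊞ P`, where `P` is free and
`K` is a submodule of a free module. -/
lemma exists_torsionless_resolution {G : ModuleCat.{0} R ⥤ ModuleCat.{0} R} [G.Additive]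
    (ε : G ⟶ 𝟭 _) (hε : ∀ (S : Type) (N : ModuleCat.{0} R)
      (f : N ⟶ ModuleCat.of R (S →₀ R)), Mono f → Mono (ε.app N))
    (K : CochainComplex (ModuleCat.{0} R) ℤ) :
    ∃ (P : CochainComplex (ModuleCat.{0} R) ℤ) (t : P ⟶ K), QuasiIso t ∧
      ∀ n, Mono (ε.app (P.X n)) := by
  let F : CochainComplex (ModuleCat.{0} R) ℤ :=
    ((pointedFree R).mapHomologicalComplex (.up ℤ)).obj K
  let p : F ⟶ K :=
    { f := fun n => (pointedFreeπ R).app (K.X n)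
      comm' := fun i j _ => ((pointedFreeπ R).naturality (K.d i j)).symm }
  have hp : Epi p := HomologicalComplex.epi_of_epi_f _ fun n =>
    (ModuleCat.epi_iff_surjective _).2 (pointedFreeπ_surjective (K.X n))
  let S : ShortComplex (CochainComplex (ModuleCat.{0} R) ℤ) :=
    ShortComplex.mk (kernel.ι p) p (kernel.condition p)
  have hS : S.ShortExact := { exact := ShortComplex.exact_kernel p }
  refine ⟨CochainComplex.mappingCone S.f, CochainComplex.mappingCone.descShortComplex S,
    CochainComplex.mappingCone.quasiIso_descShortComplex hS, fun n => ?_⟩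
  have h1 : Mono (ε.app (S.X₂.X n)) := hε {x : K.X n // x ≠ 0} _
    (𝟙 (F.X n)) (inferInstanceAs (Mono (𝟙 (F.X n))))
  have h0 : Mono ((kernel.ι p).f (n + 1)) := inferInstance
  have h2 : Mono (ε.app (S.X₁.X (n + 1))) := hε {x : K.X (n + 1) // x ≠ 0} _
    ((kernel.ι p).f (n + 1)) h0
  rw [Preadditive.mono_iff_cancel_zero]
  intro Z x hx
  have hfst : x ≫ G.map ((CochainComplex.mappingCone.fst S.f).1.v n (n + 1) rfl) = 0 := by
    rw [← cancel_mono (ε.app (S.X₁.X (n + 1))), assoc, ε.naturality, ← assoc, hx,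
      zero_comp, zero_comp]
  have hsnd : x ≫ G.map ((CochainComplex.mappingCone.snd S.f).v n n (add_zero n)) = 0 := by
    rw [← cancel_mono (ε.app (S.X₂.X n)), assoc, ε.naturality, ← assoc, hx, zero_comp, zero_comp]
  have hid := CochainComplex.mappingCone.id_X S.f n (n + 1) rfl
  have := congrArg G.map hid
  rw [G.map_add, G.map_comp, G.map_comp, G.map_id] at this
  rw [← comp_id x, ← this, Preadditive.comp_add, ← assoc, hfst, zero_comp,
    ← assoc, hsnd, zero_comp, add_zero]

end Pointed

/-! ### Stratifying surjections -/

section Restriction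

variable {A B C : Type} [Ring A] [Ring B] [Ring C]

/-- Restriction is compatible with composition. -/
def resComp (f : A →+* B) (g : B →+* C) : res g ⋙ res f ≅ res (g.comp f) :=
  mapDerivedCategoryComp _ _ _ (ModuleCat.restrictScalarsComp.{0} (RingHom.op f) (RingHom.op g)).symm

/-- Restriction along the identity. -/
def resId (A : Type) [Ring A] : res (RingHom.id A) ≅ 𝟭 (DMod A) :=
  let F := restrictScalars.{0} (RingHom.op (RingHom.id A))
  letI : Localization.Lifting Q
      (quasiIso (RMod A) (.up ℤ))
      Q (𝟭 (DMod A)) := ⟨Functor.rightUnitor _⟩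
  Localization.liftNatIso Q
    (quasiIso (RMod A) (.up ℤ))
    (cpx (restrictScalars.{0} (RingHom.op (RingHom.id A))) ⋙ Q)
    Q F.mapDerivedCategory _
    (Functor.isoWhiskerRight (NatIso.mapHomologicalComplex
      (ModuleCat.restrictScalarsId.{0} Aᵐᵒᵖ) (.up ℤ)) Q ≪≫
      Functor.isoWhiskerRight (Functor.mapHomologicalComplexIdIso (RMod A) (.up ℤ)) _ ≪≫
      Functor.leftUnitor _)

lemma isEquivalence_res (f : A →+* B) (hf : Bijective f) : (res f).IsEquivalence := by
  let e : A ≃+* B := RingEquiv.ofBijective f hf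
  have h1 : (e.symm : B →+* A).comp f = RingHom.id A := RingHom.ext fun a => e.symm_apply_apply a
  have h2 : f.comp (e.symm : B →+* A) = RingHom.id B := RingHom.ext fun a => e.apply_symm_apply a
  let E : DMod B ≌ DMod A := CategoryTheory.Equivalence.mk (res f) (res (e.symm : B →+* A))
    ((resComp (e.symm : B →+* A) f ≪≫ eqToIso (congrArg res h2) ≪≫ resId B).symm)
    (resComp f (e.symm : B →+* A) ≪≫ eqToIso (congrArg res h1) ≪≫ resId A)
  exact E.isEquivalence_functor

variable (f : A →+* B)

lemma restrictScalars_full (hf : Surjective f) :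
    (restrictScalars.{0} (RingHom.op f)).Full where
  map_surjective {M N} g := by
    refine ⟨ofHom
      { toFun := fun x => g.hom x
        map_add' := fun x y => map_add g.hom x y
        map_smul' := fun b x => ?_ }, rfl⟩
    obtain ⟨a, ha⟩ := hf b.unop
    have hb : b = op (f a) := by rw [ha, MulOpposite.op_unop]
    subst hb
    exact g.hom.map_smul' (op a) x

/-- A module killed by the kernel of a surjection is a module over the target. -/
lemma mem_essImage_restrictScalars (hf : Surjective f) (M : RMod A)
    (h : ∀ a, f a = 0 → ∀ x : M, op a • x = 0) :
    (restrictScalars.{0} (RingHom.op f)).essImage M := by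
  have hs : Surjective (RingHom.op f) := fun b => by
    obtain ⟨a, ha⟩ := hf b.unop
    exact ⟨op a, congrArg op ha⟩
  let φ : Bᵐᵒᵖ →+* AddMonoid.End M := (RingHom.liftOfSurjective (RingHom.op f) hs)
    ⟨Module.toAddMonoidEnd Aᵐᵒᵖ M, fun a ha => by
      rw [RingHom.mem_ker] at ha ⊢
      ext x
      exact h a.unop (congrArg unop ha) x⟩
  have hφ : ∀ a, φ (RingHom.op f a) = Module.toAddMonoidEnd Aᵐᵒᵖ M a := fun a =>
    RingHom.liftOfSurjective_comp_apply (RingHom.op f) hs _ a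
  let : Module Bᵐᵒᵖ M := Module.compHom M φ
  let N : RMod B := ModuleCat.of Bᵐᵒᵖ M
  let l : (restrictScalars.{0} (RingHom.op f)).obj N →ₗ[Aᵐᵒᵖ] M :=
    { toFun := fun x => x
      map_add' := fun _ _ => rfl
      map_smul' := fun a x => DFunLike.congr_fun (hφ a) x }
  have hl : Bijective l := ⟨fun _ _ h => h, fun x => ⟨x, rfl⟩⟩
  exact ⟨N, ⟨LinearEquiv.toModuleIso (LinearEquiv.ofBijective l hl)⟩⟩

end Restriction

section IsStrat

variable {A B C : Type} [Ring A] [Ring B] [Ring C]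

/-- A surjective ring homomorphism such that restriction of scalars identifies the derived category
of the target with the objects whose cohomology is killed by the kernel, and has both adjoints. -/
structure IsStrat (f : A →+* B) : Prop where
  surjective : Surjective f
  full : (res f).Full
  faithful : (res f).Faithful
  isRightAdjoint : (res f).IsRightAdjoint
  isLeftAdjoint : (res f).IsLeftAdjoint
  mem_essImage : ∀ X : DMod A,
    (∀ (k : ℤ) (x : (homologyFunctor (RMod A) k).obj X) (a : A), f a = 0 →
      op a • x = 0) → (res f).essImage X

lemma IsStrat.of_bijective (f : A →+* B) (hf : Bijective f) : IsStrat f := by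
  have := isEquivalence_res f hf
  exact ⟨hf.2, inferInstance, inferInstance, inferInstance, inferInstance,
    fun X _ => ⟨(res f).objPreimage X, ⟨(res f).objObjPreimageIso X⟩⟩⟩

lemma IsStrat.comp {f : A →+* B} {g : B →+* C} (hf : IsStrat f) (hg : IsStrat g) :
    IsStrat (g.comp f) := by
  have := hf.full
  have := hf.faithful
  have := hf.isRightAdjoint
  have := hf.isLeftAdjoint
  have := hg.full
  have := hg.faithful
  have := hg.isRightAdjoint
  have := hg.isLeftAdjoint
  let e := resComp f g
  refine ⟨hg.surjective.comp hf.surjective, .of_iso e, .of_iso e,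
    Functor.isRightAdjoint_of_iso e, Functor.isLeftAdjoint_of_iso e, fun X hX => ?_⟩
  obtain ⟨Y, ⟨i⟩⟩ := hf.mem_essImage X fun k x a ha => hX k x a (by
    rw [RingHom.comp_apply, ha, map_zero])
  obtain ⟨Z, ⟨j⟩⟩ := hg.mem_essImage Y fun k y b hb => by
    obtain ⟨a, rfl⟩ := hf.surjective b
    let s := ((homology_res f Y k).some.symm ≪≫ (homologyFunctor (RMod A) k).mapIso i).toLinearEquiv
    apply s.injective
    refine Eq.trans ?_ (map_zero s).symm
    exact (s.toLinearMap.map_smul' (op a) y).trans (hX k _ a hb)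
  exact ⟨Z, ⟨e.symm.app Z ≪≫ (res f).mapIso j ≪≫ i⟩⟩

variable {e : A} {he : IsIdempotentElem e} {ι ι' : Type} [Fintype ι] [DecidableEq ι]
  [Fintype ι'] [DecidableEq ι']

lemma isZero_corner_iff (M : RMod A) :
    IsZero ((cornerFunctor he).obj M) ↔ ∀ x : M, op e • x = 0 := by
  constructor
  · intro h x
    have : Subsingleton (cornerSubgroup e M) := ModuleCat.subsingleton_of_isZero h
    have hx : op e • (op e • x) = op e • x := by rw [← mul_smul, ← op_mul, he.eq]
    exact congrArg Subtype.val (Subsingleton.elim (α := cornerSubgroup e M) ⟨_, hx⟩ 0)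
  · intro h
    refine ModuleCat.isZero_of_iff_subsingleton.2 ⟨fun x y => Subtype.ext ?_⟩
    exact (x.2.symm.trans (h _)).trans (y.2.symm.trans (h _)).symm

lemma smul_eq_zero_of_mem_span (M : RMod A) (h : ∀ x : M, op e • x = 0) {a : A}
    (ha : a ∈ span {e}) (x : M) : op a • x = 0 := by
  let I : TwoSidedIdeal A := mk' {a | ∀ x : M, op a • x = 0}
    (fun x => by rw [MulOpposite.op_zero, zero_smul])
    (fun {a b} ha hb x => by rw [MulOpposite.op_add, add_smul, ha, hb, add_zero])
    (fun {a} ha x => by rw [MulOpposite.op_neg, neg_smul, ha, neg_zero])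
    (fun {a b} hb x => by rw [op_mul, mul_smul, hb])
    (fun {a b} ha x => by rw [op_mul, mul_smul, ha, smul_zero])
  have h1 : span {e} ≤ I := TwoSidedIdeal.span_le.2 (by
    rintro _ rfl
    exact (mem_mk' _ _ _ _ _ _ _).2 h)
  exact (mem_mk' _ _ _ _ _ _ _).1 (h1 ha) x

lemma isZero_rowFunctor (ρ : A →+* Matrix ι ι he.Corner) (M : RMod A)
    (h : IsZero ((cornerFunctor he).obj M)) :
    IsZero ((cornerFunctor he ⋙ rowFunctor ρ).obj M) :=
  (rowFunctor ρ).map_isZero h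

lemma LeftFrame.mono_counit (L : LeftFrame he ι) (S : Type) (N : RMod A)
    (f : N ⟶ ModuleCat.of Aᵐᵒᵖ (S →₀ Aᵐᵒᵖ)) (hf : Mono f) : Mono (L.counit.app N) := by
  rw [ModuleCat.mono_iff_injective] at hf ⊢
  rw [injective_iff_map_eq_zero]
  intro x hx
  have hx' : ∑ j, op (L.b j) • (x j).1 = 0 := hx
  funext j
  apply Subtype.ext
  apply hf
  refine Eq.trans ?_ (map_zero f.hom).symm
  refine Finsupp.ext fun s => MulOpposite.unop_injective ?_
  refine L.indep (fun j => (show S →₀ Aᵐᵒᵖ from f.hom (x j).1) s |>.unop) (fun j => ?_) ?_ j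
  · have h1 : op e • (x j).1 = (x j).1 := (x j).2
    have h2 := congrArg (fun y => ((show S →₀ Aᵐᵒᵖ from f.hom y) s).unop) h1
    refine Eq.trans ?_ h2
    dsimp only
    rw [map_smul]
    rfl
  · have h2 := congrArg (fun y => ((show S →₀ Aᵐᵒᵖ from f.hom y) s).unop) hx'
    dsimp only at h2
    rw [map_sum, map_zero] at h2
    refine Eq.trans ?_ h2
    have h3 : ∀ t : ι → (S →₀ Aᵐᵒᵖ), ((∑ j, t j) s).unop = ∑ j, ((t j) s).unop := fun t => by
      rw [Finsupp.finsetSum_apply]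
      exact map_sum MulOpposite.opAddEquiv.symm _ _
    refine Eq.trans ?_ (h3 _).symm
    refine sum_congr rfl fun j _ => ?_
    rw [map_smul]
    rfl

/-- The quotient by an idempotent ideal `AeA` such that `eA` and `Ae` are free of finite rank over
`eAe` and the multiplication `Ae ⊗ eA → A` is injective. -/
theorem IsStrat.of_frames (f : A →+* B) (hf : Surjective f)
    (hker : ∀ a, f a = 0 ↔ a ∈ span {e}) (L : LeftFrame he ι)
    (R : RightFrame he ι') : IsStrat f := by
  have := restrictScalars_full f hf
  let F := restrictScalars.{0} (RingHom.op f)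
  have hF : IsKernel F (cornerFunctor he) :=
    { isZero := fun N => (isZero_corner_iff _).2 fun x => by
        have h : f e = 0 := (hker e).2 (subset_span rfl)
        change op (f e) • (show N from x) = 0
        rw [h, MulOpposite.op_zero, zero_smul]
      essImage := fun M hM => mem_essImage_restrictScalars f hf M fun a ha x =>
        smul_eq_zero_of_mem_span M ((isZero_corner_iff M).1 hM) ((hker a).1 ha) x }
  have hG : IsLeftApprox (cornerFunctor he) L.functor L.counit :=
    ⟨isZero_rowFunctor _, L.isIso_corner_counit, L.isIso_counit_functor⟩
  have hH : IsRightApprox (cornerFunctor he) R.functor R.unit :=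
    ⟨isZero_rowFunctor _, R.isIso_corner_unit, R.isIso_unit_functor⟩
  have hgood := exists_torsionless_resolution L.counit L.mono_counit
  have hfull : (res f).Full := step_full hF hG hgood
  have hfaith : (res f).Faithful := faithful_of_full_of_isZero (res f) fun X hX =>
    isZero_of_isZero_map (F := F) X hX
  have hP : ∀ X, kernelObjects (cornerFunctor he).mapDerivedCategory X ↔ (res f).essImage X :=
    fun X => ⟨fun h => step_essImage hF hG hgood X h, fun ⟨Y, ⟨i⟩⟩ =>
      (hF.isZero_derived Y).of_iso ((cornerFunctor he).mapDerivedCategory.mapIso i.symm)⟩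
  refine ⟨hf, hfull, hfaith, isRightAdjoint_of_leftApprox _ hP hG.hasLeftApprox,
    isLeftAdjoint_of_rightApprox _ hP hH.hasRightApprox, fun X hX => (hP X).1 ?_⟩
  refine (isZero_mapDerivedCategory_iff _ X).2 fun k => (isZero_corner_iff _).2 fun x => ?_
  exact hX k x e ((hker e).2 (subset_span rfl))

end IsStrat

/-! ### The functor `M ↦ M e` is a localization -/

section Localization

universe w1 w2 v1 v2 u1 u2

variable {C : Type u1} [Category.{v1} C] [Abelian C] [HasDerivedCategory.{w1} C]
  {E : Type u2} [Category.{v2} E] [Abelian E] [HasDerivedCategory.{w2} E]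
  {J : C ⥤ E} [J.Additive]
  {R : E ⥤ C} [R.Additive]

/-- The adjunction between categories of complexes induced by an adjunction. -/
def cpxAdj (adj : J ⊣ R) : cpx J ⊣ cpx R :=
  Adjunction.mkOfUnitCounit
    { unit :=
        { app := fun K =>
            { f := fun n => adj.unit.app (K.X n)
              comm' := fun i j _ => (adj.unit.naturality (K.d i j)).symm }
          naturality := fun K L f => by
            ext n
            exact adj.unit.naturality (f.f n) }
      counit :=
        { app := fun K =>
            { f := fun n => adj.counit.app (K.X n)
              comm' := fun i j _ => (adj.counit.naturality (K.d i j)).symm }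
          naturality := fun K L f => by
            ext n
            exact adj.counit.naturality (f.f n) }
      left_triangle := by
        ext K n
        simp only [NatTrans.comp_app, HomologicalComplex.comp_f]
        exact (congrArg (J.map (adj.unit.app (K.X n)) ≫ ·) (id_comp _)).trans
          (adj.left_triangle_components (K.X n))
      right_triangle := by
        ext K n
        simp only [NatTrans.comp_app, HomologicalComplex.comp_f]
        exact (congrArg (adj.unit.app (R.obj (K.X n)) ≫ ·) (id_comp _)).trans
          (adj.right_triangle_components (K.X n)) }

variable [PreservesFiniteLimits J] [PreservesFiniteColimits J]

/-- An exact functor with a fully faithful right adjoint induces a localization of derived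
categories. -/
lemma isLocalization_mapDerivedCategory (adj : J ⊣ R) [R.Full] [R.Faithful] :
    J.mapDerivedCategory.IsLocalization (kernelObjects J.mapDerivedCategory).trW := by
  have h1 : (cpx J).IsLocalization
      ((MorphismProperty.isomorphisms (CochainComplex E ℤ)).inverseImage (cpx J)) :=
    (cpxAdj adj).isLocalization
  let W : MorphismProperty (CochainComplex C ℤ) :=
    (quasiIso E (.up ℤ)).inverseImage (cpx J)
  have hcounit : ∀ K, IsIso ((cpxAdj adj).counit.app K) := fun K => inferInstance
  have h2 : (cpx J ⋙ Q).IsLocalization W := by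
    refine Functor.IsLocalization.comp (cpx J) Q
      ((MorphismProperty.isomorphisms (CochainComplex E ℤ)).inverseImage (cpx J))
      (quasiIso E (.up ℤ)) W ?_ ?_ ?_
    · intro X Y f hf
      exact (isIso_Q_map_iff_quasiIso _ _).2 hf
    · intro X Y f hf
      have : IsIso ((cpx J).map f) := hf
      change QuasiIso ((cpx J).map f)
      infer_instance
    · intro X Y f hf
      have hf' : QuasiIso f := hf
      have e : Arrow.mk ((cpx J).map ((cpx R).map f)) ≅ Arrow.mk f :=
        Arrow.isoMk (asIso ((cpxAdj adj).counit.app X)) (asIso ((cpxAdj adj).counit.app Y))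
          ((cpxAdj adj).counit.naturality f).symm
      refine ((W.map (cpx J)).arrow_mk_iso_iff e).1 (W.map_mem_map _ _ ?_)
      exact ((quasiIso E (.up ℤ)).arrow_mk_iso_iff e).2 hf
  have h3 : (Q ⋙ J.mapDerivedCategory).IsLocalization W :=
    Functor.IsLocalization.of_iso W J.mapDerivedCategoryFactors.symm
  have hW : ∀ {X Y : CochainComplex C ℤ} (f : X ⟶ Y),
      W f ↔ IsIso (J.mapDerivedCategory.map (Q.map f)) := by
    intro X Y f
    refine ⟨fun hf => isIso_map_Q J f hf, fun hf => ?_⟩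
    refine (isIso_Q_map_iff_quasiIso _ _).1 ?_
    exact (NatIso.isIso_map_iff J.mapDerivedCategoryFactors f).1 hf
  refine Functor.IsLocalization.of_comp Q J.mapDerivedCategory
    (quasiIso C (.up ℤ)) _ W ?_ ?_
  · intro X Y f hf
    have hf' : QuasiIso f := hf
    change QuasiIso ((cpx J).map f)
    infer_instance
  · ext X Y f
    rw [kernelObjects_trW_iff]
    constructor
    · intro hf
      let eX := Q.objObjPreimageIso X
      let eY := Q.objObjPreimageIso Y
      obtain ⟨K, s, hs, g, hfac⟩ := right_fac (eX.hom ≫ f ≫ eY.inv)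
      have h4 : f = eX.inv ≫ (inv (Q.map s) ≫ Q.map g) ≫ eY.hom := by
        rw [← hfac]
        simp
      have e : Arrow.mk (Q.map g) ≅ Arrow.mk f :=
        Arrow.isoMk (asIso (Q.map s) ≪≫ eX) eY (by
          rw [h4]
          simp)
      refine ((W.map Q).arrow_mk_iso_iff e).1 (W.map_mem_map _ _ ((hW g).2 ?_))
      exact ((MorphismProperty.isomorphisms _).arrow_mk_iso_iff
        (J.mapDerivedCategory.mapArrow.mapIso e)).2 hf
    · rintro ⟨K, L, g, hg, ⟨e⟩⟩
      exact ((MorphismProperty.isomorphisms _).arrow_mk_iso_iff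
        (J.mapDerivedCategory.mapArrow.mapIso e)).1 ((hW g).1 hg)

end Localization

section CoInduction

variable {A : Type} [Ring A] {e : A} (he : IsIdempotentElem e)

/-- The right `eAe`-linear maps from `Ae` to `N`, extended by zero to `A (1 - e)`. -/
def coIndSubgroup (N : RMod he.Corner) : AddSubgroup (A →+ N) where
  carrier := {φ | (∀ a, φ (a * e) = φ a) ∧ ∀ (a : A) (c : he.Corner), φ (a * c.1) = op c • φ a}
  add_mem' hφ hψ := by simp_all
  zero_mem' := by simp
  neg_mem' hφ := by simp_all

instance (N : RMod he.Corner) : Module Aᵐᵒᵖ (coIndSubgroup he N) where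
  smul x φ := ⟨φ.1.comp (AddMonoidHom.mulLeft x.unop), fun a => by
    change φ.1 (x.unop * (a * e)) = φ.1 (x.unop * a)
    rw [← mul_assoc, φ.2.1], fun a c => by
    change φ.1 (x.unop * (a * c.1)) = op c • φ.1 (x.unop * a)
    rw [← mul_assoc, φ.2.2]⟩
  one_smul φ := Subtype.ext (AddMonoidHom.ext fun a => congrArg φ.1 (one_mul a))
  mul_smul x y φ := Subtype.ext (AddMonoidHom.ext fun a => congrArg φ.1 (mul_assoc y.unop x.unop a))
  smul_zero x := rfl
  smul_add x φ ψ := rfl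
  add_smul x y φ := Subtype.ext (AddMonoidHom.ext fun a =>
    (congrArg φ.1 (add_mul x.unop y.unop a)).trans (map_add φ.1 _ _))
  zero_smul φ := Subtype.ext (AddMonoidHom.ext fun a =>
    (congrArg φ.1 (zero_mul a)).trans (map_zero φ.1))

/-- Coinduction from `eAe` to `A`. -/
def coInd : RMod he.Corner ⥤ RMod A where
  obj N := ModuleCat.of Aᵐᵒᵖ (coIndSubgroup he N)
  map {N N'} f := ofHom
    { toFun := fun φ => ⟨f.hom.toAddMonoidHom.comp φ.1,
        fun a => congrArg f.hom (φ.2.1 a),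
        fun a c => (congrArg f.hom (φ.2.2 a c)).trans (map_smul f.hom _ _)⟩
      map_add' := fun φ ψ => Subtype.ext (AddMonoidHom.ext fun a => map_add f.hom _ _)
      map_smul' := fun x φ => rfl }

instance : (coInd he).Additive where

/-- The unit `M → Hom (Ae, M e)`. -/
def coIndUnit : 𝟭 (RMod A) ⟶ cornerFunctor he ⋙ coInd he where
  app M := ofHom (X := M) (Y := coIndSubgroup he ((cornerFunctor he).obj M))
    { toFun := fun m => ⟨
        { toFun := fun a => ⟨op (a * e) • m, by
            change op e • op (a * e) • m = _
            rw [← mul_smul, ← op_mul, mul_assoc, he.eq]⟩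
          map_zero' := Subtype.ext (by
            change op (0 * e) • m = 0
            rw [zero_mul, MulOpposite.op_zero, zero_smul])
          map_add' := fun a b => Subtype.ext (by
            change op ((a + b) * e) • m = op (a * e) • m + op (b * e) • m
            rw [add_mul, MulOpposite.op_add, add_smul]) },
        fun a => Subtype.ext (by
          change op (a * e * e) • m = op (a * e) • m
          rw [mul_assoc, he.eq]),
        fun a c => Subtype.ext (by
          change op (a * c.1 * e) • m = op c.1 • op (a * e) • m
          rw [← mul_smul, ← op_mul, mul_assoc, mul_assoc, corner_mul_right, corner_mul_left])⟩
      map_add' := fun x y => Subtype.ext (AddMonoidHom.ext fun a => Subtype.ext (smul_add _ _ _))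
      map_smul' := fun x m => Subtype.ext (AddMonoidHom.ext fun a => Subtype.ext (by
        change op (a * e) • x • m = op (x.unop * a * e) • m
        rw [← mul_smul, mul_assoc, op_mul]
        rfl)) }
  naturality M N f := by
    ext m
    refine Subtype.ext (AddMonoidHom.ext fun a => Subtype.ext ?_)
    exact (map_smul f.hom (op (a * e)) m).symm

/-- The evaluation `Hom (Ae, N) e → N`. -/
def coIndCounit : coInd he ⋙ cornerFunctor he ⟶ 𝟭 (RMod he.Corner) where
  app N := ofHom (X := cornerSubgroup e ((coInd he).obj N)) (Y := N)
    { toFun := fun φ => (show coIndSubgroup he N from φ.1).1 e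
      map_add' := fun φ ψ => rfl
      map_smul' := fun c φ => by
        let φ' : coIndSubgroup he N := φ.1
        change φ'.1 (c.unop.1 * e) = c • φ'.1 e
        rw [corner_mul_right, ← corner_mul_left he c.unop]
        exact φ'.2.2 e c.unop }
  naturality N N' f := by
    ext φ
    rfl

/-- Coinduction is right adjoint to `M ↦ M e`. -/
def cornerAdj : cornerFunctor he ⊣ coInd he :=
  Adjunction.mkOfUnitCounit
    { unit := coIndUnit he
      counit := coIndCounit he
      left_triangle := by
        ext M m
        apply Subtype.ext
        change op (e * e) • m.1 = m.1
        rw [he.eq]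
        exact m.2
      right_triangle := by
        ext N φ
        refine Subtype.ext (AddMonoidHom.ext fun a => ?_)
        let φ' : coIndSubgroup he N := φ
        change φ'.1 (a * e * e) = φ'.1 a
        rw [φ'.2.1, φ'.2.1] }

lemma toCorner_one : toCorner he 1 = 1 := Subtype.ext (by
  change e * 1 * e = e
  rw [mul_one, he.eq])

lemma toCorner_val (x : he.Corner) : toCorner he x.1 = x := by
  obtain ⟨h1, h2⟩ := (Subsemigroup.mem_corner_iff he).1 x.2
  refine Subtype.ext ?_
  change e * x.1 * e = x.1
  rw [h1, h2]

lemma toCorner_surjective : Surjective (toCorner he) := fun x => ⟨x.1, toCorner_val he x⟩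

lemma toCorner_add (a b : A) : toCorner he (a + b) = toCorner he a + toCorner he b :=
  Subtype.ext (by
    change e * (a + b) * e = e * a * e + e * b * e
    rw [mul_add, add_mul])

lemma isIso_coIndCounit (N : RMod he.Corner) : IsIso ((coIndCounit he).app N) := by
  rw [ConcreteCategory.isIso_iff_bijective]
  constructor
  · intro φ ψ h
    let φ' : coIndSubgroup he N := φ.1
    let ψ' : coIndSubgroup he N := ψ.1
    have h' : φ'.1 e = ψ'.1 e := h
    refine Subtype.ext (Subtype.ext (AddMonoidHom.ext fun a => ?_))
    have key : ∀ χ : cornerSubgroup e ((coInd he).obj N),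
        (show coIndSubgroup he N from χ.1).1 a =
          op (toCorner he a) • (show coIndSubgroup he N from χ.1).1 e := by
      intro χ
      let χ' : coIndSubgroup he N := χ.1
      have h1 : χ'.1 (e * a) = χ'.1 a := congrArg (fun χ : coIndSubgroup he N => χ.1 a) χ.2
      change χ'.1 a = op (toCorner he a) • χ'.1 e
      rw [← h1, ← χ'.2.1, ← χ'.2.2]
      congr 1
      change e * a * e = e * (e * a * e)
      rw [← mul_assoc, ← mul_assoc, he.eq]
    exact (key φ).trans ((congrArg _ h').trans (key ψ).symm)
  · intro x
    let φ : coIndSubgroup he N := ⟨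
      AddMonoidHom.mk' (fun a => op (toCorner he a) • x) fun a b => by
        rw [toCorner_add, MulOpposite.op_add, add_smul],
      fun a => by
        change op (toCorner he (a * e)) • x = op (toCorner he a) • x
        congr 2
        refine Subtype.ext ?_
        change e * (a * e) * e = e * a * e
        rw [mul_assoc, mul_assoc, he.eq, ← mul_assoc],
      fun a c => by
        change op (toCorner he (a * c.1)) • x = op c • op (toCorner he a) • x
        rw [← mul_smul, ← op_mul]
        congr 2
        refine Subtype.ext ?_
        change e * (a * c.1) * e = e * a * e * c.1
        rw [mul_assoc, mul_assoc, corner_mul_right, mul_assoc, mul_assoc, corner_mul_left]⟩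
    refine ⟨⟨φ, ?_⟩, ?_⟩
    · refine Subtype.ext (AddMonoidHom.ext fun a => ?_)
      change op (toCorner he (e * a)) • x = op (toCorner he a) • x
      congr 2
      refine Subtype.ext ?_
      change e * (e * a) * e = e * a * e
      rw [← mul_assoc, he.eq]
    · change op (toCorner he e) • x = x
      rw [show toCorner he e = 1 from toCorner_val he 1, MulOpposite.op_one, one_smul]

instance : (cornerRes he).CommShift ℤ :=
  inferInstanceAs (Functor.CommShift (Functor.mapDerivedCategory _) ℤ)

instance : (cornerRes he).IsTriangulated :=
  inferInstanceAs (Functor.IsTriangulated (Functor.mapDerivedCategory _))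

lemma isLocalization_cornerRes :
    (cornerRes he).IsLocalization (kernelObjects (cornerRes he)).trW := by
  have : ∀ N, IsIso ((cornerAdj he).counit.app N) := isIso_coIndCounit he
  have : IsIso (cornerAdj he).counit := NatIso.isIso_of_isIso_app _
  have := (cornerAdj he).fullyFaithfulROfIsIsoCounit.full
  have := (cornerAdj he).fullyFaithfulROfIsIsoCounit.faithful
  exact isLocalization_mapDerivedCategory (cornerAdj he)

/-- A stratifying quotient by the ideal `AeA` yields a recollement. -/
theorem IsStrat.recollement {B : Type} [Ring B] {f : A →+* B} (hf : IsStrat f)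
    (hker : ∀ a, f a = 0 ↔ a ∈ span {e}) :
    Nonempty (Recollement (res f) (cornerRes he)) := by
  have := hf.full
  have := hf.faithful
  have := hf.isRightAdjoint
  have := hf.isLeftAdjoint
  have := isLocalization_cornerRes he
  refine nonempty_recollement (res f) (cornerRes he) (kernelObjects (cornerRes he))
    (fun X => ⟨fun hX => hf.mem_essImage X fun k x a ha => ?_, ?_⟩) fun X => Iff.rfl
  · have h := (isZero_corner_iff (he := he) _).1
      ((isZero_mapDerivedCategory_iff (cornerFunctor he) X).1 hX k)
    exact smul_eq_zero_of_mem_span _ h ((hker a).1 ha) x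
  · rintro ⟨Y, ⟨i⟩⟩
    refine IsZero.of_iso ?_ ((cornerRes he).mapIso i.symm)
    refine (isZero_mapDerivedCategory_iff (cornerFunctor he) _).2 fun k => ?_
    refine IsZero.of_iso ?_ ((cornerFunctor he).mapIso (homology_res f Y k).some)
    refine (isZero_corner_iff _).2 fun x => ?_
    have h : f e = 0 := (hker e).2 (subset_span rfl)
    change op (f e) • (show (homologyFunctor (RMod B) k).obj Y from x) = 0
    rw [h, MulOpposite.op_zero, zero_smul]

end CoInduction

section CongrKer

variable {A B C : Type} [Ring A] [Ring B] [Ring C]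

/-- Being stratifying only depends on the kernel. -/
lemma IsStrat.congr_ker {f : A →+* B} (hf : IsStrat f) (g : A →+* C)
    (hg : Surjective g) (h : ∀ a, f a = 0 ↔ g a = 0) : IsStrat g := by
  let φ : B →+* C := (RingHom.liftOfSurjective f hf.surjective)
    ⟨g, fun a ha => by rw [RingHom.mem_ker] at ha ⊢; exact (h a).1 ha⟩
  have hφ : ∀ a, φ (f a) = g a := fun a => RingHom.liftOfSurjective_comp_apply f hf.surjective _ a
  have h1 : φ.comp f = g := RingHom.ext hφ
  rw [← h1]
  refine hf.comp (.of_bijective φ ⟨(injective_iff_map_eq_zero φ).2 fun b hb => ?_, fun c => ?_⟩)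
  · obtain ⟨a, rfl⟩ := hf.surjective b
    rw [hφ] at hb
    exact (h a).2 hb
  · obtain ⟨a, rfl⟩ := hg c
    exact ⟨f a, hφ a⟩

end CongrKer

/-! ### Matrix rings twisted by a cocycle -/

/-- A normalized 2-cocycle on the pair groupoid of `I` with values in the multiplicative monoid
of `R`. -/
structure Cocycle (I R : Type) [CommRing R] where
  val : I → I → I → R
  left : ∀ a b, val a a b = 1
  right : ∀ a b, val a b b = 1
  assoc : ∀ a b c d, val a b c * val a c d = val b c d * val a b d

/-- Matrices over `R` with the product `(x y)_{ac} = ∑_b κ(a,b,c) x_{ab} y_{bc}`. -/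
def TwMat {I R : Type} [CommRing R] (_κ : Cocycle I R) : Type := I → I → R

namespace TwMat

variable {I R : Type} [CommRing R] [Fintype I] [DecidableEq I] {κ : Cocycle I R}

@[ext]
lemma ext {x y : TwMat κ} (h : ∀ a b, x a b = y a b) : x = y := funext fun a => funext (h a)

instance : AddCommGroup (TwMat κ) := inferInstanceAs (AddCommGroup (I → I → R))

instance : Mul (TwMat κ) := ⟨fun x y a c => ∑ b, κ.val a b c * (x a b * y b c)⟩

instance : One (TwMat κ) := ⟨fun a b => if a = b then 1 else 0⟩

lemma add_apply (x y : TwMat κ) (a b : I) : (x + y) a b = x a b + y a b := rfl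

lemma zero_apply (a b : I) : (0 : TwMat κ) a b = 0 := rfl

lemma one_apply (a b : I) : (1 : TwMat κ) a b = if a = b then 1 else 0 := rfl

lemma mul_apply (x y : TwMat κ) (a c : I) : (x * y) a c = ∑ b, κ.val a b c * (x a b * y b c) := rfl

lemma sum_apply {J : Type} (s : Finset J) (x : J → TwMat κ) (a b : I) :
    (∑ j ∈ s, x j) a b = ∑ j ∈ s, x j a b := by
  classical
  induction s using Finset.induction_on with
  | empty => rfl
  | insert j s hj h => rw [sum_insert hj, sum_insert hj, add_apply, h]

instance : Ring (TwMat κ) :=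
  { (inferInstance : AddCommGroup (TwMat κ)) with
    left_distrib := fun x y z => by
      ext a b
      simp only [mul_apply, add_apply, mul_add, sum_add_distrib]
    right_distrib := fun x y z => by
      ext a b
      simp only [mul_apply, add_apply, mul_add, add_mul, sum_add_distrib]
    zero_mul := fun x => by
      ext a b
      simp only [mul_apply, zero_apply, zero_mul, mul_zero, sum_const_zero]
    mul_zero := fun x => by
      ext a b
      simp only [mul_apply, zero_apply, mul_zero, sum_const_zero]
    mul_assoc := fun x y z => by
      ext a d
      simp only [mul_apply, mul_sum, sum_mul]
      rw [sum_comm]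
      refine sum_congr rfl fun b _ => sum_congr rfl fun c _ => ?_
      linear_combination (x a b * y b c * z c d) * κ.assoc a b c d
    one_mul := fun x => by
      ext a b
      simp only [mul_apply, one_apply]
      rw [sum_eq_single a]
      · rw [if_pos rfl, κ.left, one_mul, one_mul]
      · intro c _ hc
        rw [if_neg hc.symm, zero_mul, mul_zero]
      · simp
    mul_one := fun x => by
      ext a b
      simp only [mul_apply, one_apply]
      rw [sum_eq_single b]
      · rw [if_pos rfl, κ.right, one_mul, mul_one]
      · intro c _ hc
        rw [if_neg hc, mul_zero, mul_zero]
      · simp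
    zsmul := fun k x => k • x
    zsmul_zero' := fun x => zero_zsmul x
    zsmul_succ' := fun k x => SubNegMonoid.zsmul_succ' k x
    zsmul_neg' := fun k x => SubNegMonoid.zsmul_neg' k x
    nsmul := fun k x => k • x
    nsmul_zero := fun x => zero_nsmul x
    nsmul_succ := fun k x => AddMonoid.nsmul_succ k x }

/-- The scalar matrices. -/
def scalar (κ : Cocycle I R) : R →+* TwMat κ where
  toFun r := (fun a b => if a = b then r else 0 : I → I → R)
  map_one' := rfl
  map_zero' := by ext a b; exact ite_self _
  map_add' r s := by
    ext a b
    change (if a = b then r + s else 0) = (if a = b then r else 0) + (if a = b then s else 0)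
    split_ifs <;> simp
  map_mul' r s := by
    ext a b
    change (if a = b then r * s else 0) =
      ∑ c, κ.val a c b * ((if a = c then r else 0) * (if c = b then s else 0))
    rw [sum_eq_single a]
    · rw [if_pos rfl, κ.left]
      split_ifs <;> simp
    · intro c _ hc
      rw [if_neg hc.symm, zero_mul, mul_zero]
    · simp

lemma scalar_apply (r : R) (a b : I) : scalar κ r a b = if a = b then r else 0 := rfl

lemma scalar_mul_apply (r : R) (x : TwMat κ) (a b : I) : (scalar κ r * x) a b = r * x a b := by
  rw [mul_apply, sum_eq_single a]
  · rw [scalar_apply, if_pos rfl, κ.left, one_mul]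
  · intro c _ hc
    rw [scalar_apply, if_neg hc.symm, zero_mul, mul_zero]
  · simp

lemma mul_scalar_apply (r : R) (x : TwMat κ) (a b : I) : (x * scalar κ r) a b = r * x a b := by
  rw [mul_apply, sum_eq_single b]
  · rw [scalar_apply, if_pos rfl, κ.right, one_mul, mul_comm]
  · intro c _ hc
    rw [scalar_apply, if_neg hc, mul_zero, mul_zero]
  · simp

instance [Algebra ℂ R] : Algebra ℂ (TwMat κ) :=
  ((scalar κ).comp (algebraMap ℂ R)).toAlgebra' fun c x => by
    ext a b
    exact (scalar_mul_apply _ x a b).trans (mul_scalar_apply _ x a b).symm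

lemma algebraMap_eq [Algebra ℂ R] (c : ℂ) :
    algebraMap ℂ (TwMat κ) c = scalar κ (algebraMap ℂ R c) := rfl

lemma smul_apply [Algebra ℂ R] (c : ℂ) (x : TwMat κ) (a b : I) : (c • x) a b = c • x a b := by
  rw [Algebra.smul_def, algebraMap_eq, scalar_mul_apply, ← Algebra.smul_def]

/-- The matrix with the only nonzero entry `r` at `(a, b)`. -/
def single (a b : I) (r : R) : TwMat κ := fun a' b' => if a = a' ∧ b = b' then r else 0

lemma single_apply (a b a' b' : I) (r : R) :
    (single a b r : TwMat κ) a' b' = if a = a' ∧ b = b' then r else 0 := rfl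

lemma single_mul_apply (a b a' c : I) (r : R) (x : TwMat κ) :
    ((single a b r : TwMat κ) * x) a' c = if a = a' then κ.val a b c * (r * x b c) else 0 := by
  rw [mul_apply, sum_eq_single b]
  · rw [single_apply]
    by_cases h : a = a'
    · subst h
      simp
    · simp [h]
  · intro d _ hd
    rw [single_apply, if_neg fun h => hd h.2.symm, zero_mul, mul_zero]
  · simp

lemma mul_single_apply (a b c c' : I) (r : R) (x : TwMat κ) :
    (x * (single b c r : TwMat κ)) a c' = if c = c' then κ.val a b c * (x a b * r) else 0 := by
  rw [mul_apply, sum_eq_single b]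
  · rw [single_apply]
    by_cases h : c = c'
    · subst h
      simp
    · simp [h]
  · intro d _ hd
    rw [single_apply, if_neg fun h => hd h.1.symm, mul_zero, mul_zero]
  · simp

lemma single_mul_single (a b c : I) (r s : R) :
    (single a b r * single b c s : TwMat κ) = single a c (κ.val a b c * (r * s)) := by
  ext a' c'
  rw [single_mul_apply, single_apply, single_apply]
  by_cases h : a = a'
  · subst h
    by_cases h' : c = c'
    · subst h'
      simp
    · simp [h']
  · simp [h]

lemma eq_sum_single (x : TwMat κ) : x = ∑ a, ∑ b, single a b (x a b) := by
  ext a b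
  rw [sum_apply, sum_eq_single a, sum_apply, sum_eq_single b]
  · rw [single_apply, if_pos ⟨rfl, rfl⟩]
  · intro c _ hc
    rw [single_apply, if_neg fun h => hc h.2]
  · simp
  · intro c _ hc
    rw [sum_apply]
    exact sum_eq_zero fun d _ => by rw [single_apply, if_neg fun h => hc h.1]
  · simp

lemma single_zero (a b : I) : (single a b 0 : TwMat κ) = 0 := by ext; exact ite_self _

lemma single_add (a b : I) (r s : R) :
    (single a b (r + s) : TwMat κ) = single a b r + single a b s := by
  ext a' b'
  rw [add_apply, single_apply, single_apply, single_apply]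
  split_ifs <;> simp

variable (κ) in
/-- The ideal of the entries at `(a, b)` of the matrices which factor through `U`. -/
def entryIdeal (U : Set I) (a b : I) : Ideal R := Ideal.span ((fun δ => κ.val a δ b) '' U)

lemma entryIdeal_mono {U U' : Set I} (h : U ⊆ U') (a b : I) :
    entryIdeal κ U a b ≤ entryIdeal κ U' a b := Ideal.span_mono (Set.image_mono h)

lemma mul_mem_entryIdeal_left {U : Set I} {a b c : I} {r : R} (hr : r ∈ entryIdeal κ U b c) :
    κ.val a b c * r ∈ entryIdeal κ U a c := by
  refine span_induction (p := fun r _ => κ.val a b c * r ∈ entryIdeal κ U a c) ?_ ?_ ?_ ?_ hr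
  · rintro _ ⟨δ, hδ, rfl⟩
    rw [mul_comm, ← κ.assoc]
    exact Ideal.mul_mem_left _ _ (Ideal.subset_span ⟨δ, hδ, rfl⟩)
  · rw [mul_zero]
    exact zero_mem _
  · intro x y _ _ hx hy
    rw [mul_add]
    exact add_mem hx hy
  · intro s x _ hx
    rw [smul_eq_mul, mul_left_comm]
    exact Ideal.mul_mem_left _ _ hx

lemma mul_mem_entryIdeal_right {U : Set I} {a b c : I} {r : R} (hr : r ∈ entryIdeal κ U a b) :
    κ.val a b c * r ∈ entryIdeal κ U a c := by
  refine span_induction (p := fun r _ => κ.val a b c * r ∈ entryIdeal κ U a c) ?_ ?_ ?_ ?_ hr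
  · rintro _ ⟨δ, hδ, rfl⟩
    rw [mul_comm, κ.assoc]
    exact Ideal.mul_mem_left _ _ (Ideal.subset_span ⟨δ, hδ, rfl⟩)
  · rw [mul_zero]
    exact zero_mem _
  · intro x y _ _ hx hy
    rw [mul_add]
    exact add_mem hx hy
  · intro s x _ hx
    rw [smul_eq_mul, mul_left_comm]
    exact Ideal.mul_mem_left _ _ hx

variable (κ) in
/-- The two-sided ideal of the matrices which factor through `U`. -/
def idealOf (U : Set I) : TwoSidedIdeal (TwMat κ) :=
  mk' {x | ∀ a b, x a b ∈ entryIdeal κ U a b}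
    (fun _ _ => zero_mem _)
    (fun hx hy a b => add_mem (hx a b) (hy a b))
    (fun hx a b => neg_mem (hx a b))
    (fun {x y} hy a c => by
      rw [mul_apply]
      refine Ideal.sum_mem _ fun b _ => ?_
      rw [mul_left_comm]
      exact Ideal.mul_mem_left _ _ (mul_mem_entryIdeal_left (hy b c)))
    (fun {x y} hx a c => by
      rw [mul_apply]
      refine Ideal.sum_mem _ fun b _ => ?_
      rw [← mul_assoc]
      exact Ideal.mul_mem_right _ _ (mul_mem_entryIdeal_right (hx a b)))

lemma mem_idealOf {U : Set I} {x : TwMat κ} :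
    x ∈ idealOf κ U ↔ ∀ a b, x a b ∈ entryIdeal κ U a b :=
  mem_mk' _ _ _ _ _ _ _

lemma single_mem_idealOf {U : Set I} {δ : I} (h : δ ∈ U) :
    (single δ δ 1 : TwMat κ) ∈ idealOf κ U := by
  refine mem_idealOf.2 fun a b => ?_
  rw [single_apply]
  split_ifs with h'
  · obtain ⟨rfl, rfl⟩ := h'
    exact Ideal.subset_span ⟨δ, h, κ.left _ _⟩
  · exact zero_mem _

lemma idealOf_le {U : Set I} {T : TwoSidedIdeal (TwMat κ)}
    (h : ∀ δ ∈ U, (single δ δ 1 : TwMat κ) ∈ T) : idealOf κ U ≤ T := by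
  intro x hx
  rw [mem_idealOf] at hx
  rw [eq_sum_single x]
  refine sum_mem fun a _ => sum_mem fun b _ => ?_
  refine span_induction (p := fun r _ => (single a b r : TwMat κ) ∈ T) ?_ ?_ ?_ ?_ (hx a b)
  · rintro _ ⟨δ, hδ, rfl⟩
    have h1 : (single a b (κ.val a δ b) : TwMat κ) =
        single a δ 1 * (single δ δ 1 * single δ b 1) := by
      rw [single_mul_single, single_mul_single, κ.left, one_mul, one_mul, mul_one, mul_one]
    dsimp only
    rw [h1]
    exact T.mul_mem_left _ _ (T.mul_mem_right _ _ (h δ hδ))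
  · rw [single_zero]
    exact T.zero_mem
  · intro r s _ _ hr hs
    rw [single_add]
    exact T.add_mem hr hs
  · intro r s _ hs
    have h1 : (single a b (r * s) : TwMat κ) = single a a r * single a b s := by
      rw [single_mul_single, κ.left, one_mul]
    rw [smul_eq_mul, h1]
    exact T.mul_mem_left _ _ hs

variable (κ) in
/-- The quotient by the matrices which factor through `U`. -/
abbrev Stage (U : Set I) : Type := (idealOf κ U).ringCon.Quotient

variable (κ) in
/-- The projection to the quotient by the matrices which factor through `U`. -/
def toStage (U : Set I) : TwMat κ →+* Stage κ U := (idealOf κ U).ringCon.mk'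

lemma toStage_surjective (U : Set I) : Surjective (toStage κ U) := RingCon.mk'_surjective _

lemma toStage_eq_zero {U : Set I} {x : TwMat κ} : toStage κ U x = 0 ↔ x ∈ idealOf κ U := by
  rw [TwoSidedIdeal.mem_iff]
  exact (idealOf κ U).ringCon.eq (a := x) (b := 0)

lemma toStage_eq {U : Set I} {x y : TwMat κ} :
    toStage κ U x = toStage κ U y ↔ ∀ a b, x a b - y a b ∈ entryIdeal κ U a b := by
  rw [← sub_eq_zero, ← map_sub, toStage_eq_zero, mem_idealOf]
  rfl

end TwMat

open TwMat (entryIdeal scalar scalar_apply toStage)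

namespace TwMat

variable {I R : Type} [CommRing R] [Fintype I] [DecidableEq I] {κ : Cocycle I R}

section Step

variable {U : Set I} {α : I}

lemma toStage_idem (a : I) : IsIdempotentElem (toStage κ U (single a a 1)) := by
  rw [IsIdempotentElem, ← map_mul, single_mul_single, κ.left, one_mul, one_mul]

lemma sum_single_mul_single_apply {cone : Finset I} (r : cone → TwMat κ) (a b : I) :
    (∑ β : cone, r β * (single α β 1 : TwMat κ)) a b =
      if h : b ∈ cone then κ.val a α b * r ⟨b, h⟩ a α else 0 := by
  rw [sum_apply]
  by_cases h : b ∈ cone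
  · rw [dif_pos h, sum_eq_single ⟨b, h⟩]
    · rw [mul_single_apply, if_pos rfl, mul_one]
    · intro β _ hβ
      rw [mul_single_apply, if_neg fun h' => hβ (Subtype.ext h')]
    · simp
  · rw [dif_neg h]
    refine sum_eq_zero fun β _ => ?_
    rw [mul_single_apply, if_neg fun h' : β.1 = b => h (h' ▸ β.2)]

lemma sum_single_mul_apply {cone : Finset I} (r : cone → TwMat κ) (a b : I) :
    (∑ β : cone, (single β.1 α 1 : TwMat κ) * r β) a b =
      if h : a ∈ cone then κ.val a α b * r ⟨a, h⟩ α b else 0 := by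
  rw [sum_apply]
  by_cases h : a ∈ cone
  · rw [dif_pos h, sum_eq_single ⟨a, h⟩]
    · rw [single_mul_apply, if_pos rfl, one_mul]
    · intro β _ hβ
      rw [single_mul_apply, if_neg fun h' => hβ (Subtype.ext h')]
    · simp
  · rw [dif_neg h]
    refine sum_eq_zero fun β _ => ?_
    rw [single_mul_apply, if_neg fun h' : β.1 = a => h (h' ▸ β.2)]

lemma mem_entryIdeal_of_one_mem {a b : I} (h : (1 : R) ∈ entryIdeal κ U a b) (r : R) :
    r ∈ entryIdeal κ U a b := by
  rw [(Ideal.eq_top_iff_one _).2 h]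
  trivial

/-- The class of a diagonal matrix unit, as an element of the corner ring. -/
def cornerSingle (U : Set I) (α : I) (r : R) : (toStage_idem (κ := κ) (U := U) α).Corner :=
  mkCorner _ (toStage κ U (single α α r))
    (by rw [← map_mul, single_mul_single, κ.left, one_mul, one_mul])
    (by rw [← map_mul, single_mul_single, κ.left, one_mul, mul_one])

/-- The classes of the matrix units in row `α`, with column in the cone of `α`. -/
def leftFrame (cone : Finset I) (h1 : ∀ β ∉ cone, (1 : R) ∈ entryIdeal κ U α β)
    (h2 : ∀ γ, ∀ β ∈ cone, ∀ f : R, κ.val γ α β * f ∈ entryIdeal κ U γ β → f ∈ entryIdeal κ U γ α) :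
    LeftFrame (toStage_idem (κ := κ) (U := U) α) cone where
  b β := toStage κ U (single α β 1)
  mul_b β := by rw [← map_mul, single_mul_single, κ.left, one_mul, one_mul]
  span x hx := by
    obtain ⟨x, rfl⟩ := toStage_surjective U x
    refine ⟨fun β => cornerSingle U α (x α β), ?_⟩
    rw [← hx]
    change _ = ∑ β : cone, toStage κ U (single α α (x α β)) * toStage κ U (single α β 1)
    simp only [← map_mul, ← map_sum]
    refine toStage_eq.2 fun a b => ?_
    rw [sum_single_mul_single_apply (fun β : cone => (single α α (x α β) : TwMat κ)),
      single_mul_apply]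
    by_cases ha : α = a
    · subst ha
      by_cases hb : b ∈ cone
      · rw [if_pos rfl, dif_pos hb, single_apply, if_pos ⟨rfl, rfl⟩, one_mul, sub_self]
        exact zero_mem _
      · exact mem_entryIdeal_of_one_mem (h1 b hb) _
    · rw [if_neg ha]
      split_ifs <;> simp [single_apply, ha]
  indep x hx h := by
    choose y hy using fun β => toStage_surjective U (x β)
    obtain rfl : (fun β => toStage κ U (y β)) = x := funext hy
    have h' : toStage κ U (∑ β : cone, y β * (single α β 1 : TwMat κ)) = toStage κ U 0 := by
      rw [map_sum, map_zero]
      simp only [map_mul]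
      exact h
    rw [toStage_eq] at h'
    intro β
    dsimp only at hx ⊢
    rw [← hx β, ← map_mul, ← map_zero (toStage κ U)]
    refine toStage_eq.2 fun a b => ?_
    rw [mul_single_apply, zero_apply, sub_zero]
    split_ifs with hb
    · subst hb
      rw [κ.right, one_mul, mul_one]
      have h3 := h' a β
      rw [sum_single_mul_single_apply, dif_pos β.2, zero_apply, sub_zero] at h3
      exact h2 a β β.2 _ h3
    · exact zero_mem _

/-- The classes of the matrix units in column `α`, with row in the cone of `α`. -/
def rightFrame (cone : Finset I) (h1 : ∀ β ∉ cone, (1 : R) ∈ entryIdeal κ U β α)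
    (h2 : ∀ β ∈ cone, ∀ f : R, f ∈ entryIdeal κ U β α → f ∈ entryIdeal κ U α α) :
    RightFrame (toStage_idem (κ := κ) (U := U) α) cone where
  a β := toStage κ U (single β α 1)
  a_mul β := by rw [← map_mul, single_mul_single, κ.right, one_mul, one_mul]
  span x hx := by
    obtain ⟨x, rfl⟩ := toStage_surjective U x
    refine ⟨fun β => cornerSingle U α (x β α), ?_⟩
    rw [← hx]
    change _ = ∑ β : cone, toStage κ U (single β α 1) * toStage κ U (single α α (x β α))
    simp only [← map_mul, ← map_sum]
    refine toStage_eq.2 fun a b => ?_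
    rw [sum_single_mul_apply (fun β : cone => (single α α (x β α) : TwMat κ)), mul_single_apply]
    by_cases hb : α = b
    · subst hb
      by_cases ha : a ∈ cone
      · rw [if_pos rfl, dif_pos ha, single_apply, if_pos ⟨rfl, rfl⟩, mul_one, sub_self]
        exact zero_mem _
      · exact mem_entryIdeal_of_one_mem (h1 a ha) _
    · rw [if_neg hb]
      split_ifs <;> simp [single_apply, hb]
  indep c h := by
    choose y hy using fun β => toStage_surjective U (c β).1
    have h' : toStage κ U (∑ β : cone, (single β.1 α 1 : TwMat κ) * y β) = toStage κ U 0 := by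
      rw [map_sum, map_zero]
      simp only [map_mul, hy]
      exact h
    rw [toStage_eq] at h'
    intro β
    apply Subtype.ext
    change (c β).1 = 0
    have hc : toStage κ U (single α α 1 * (y β * single α α 1)) = (c β).1 := by
      rw [map_mul, map_mul, hy, corner_mul_right, corner_mul_left]
    rw [← hc, ← map_zero (toStage κ U)]
    refine toStage_eq.2 fun a b => ?_
    rw [single_mul_apply, mul_single_apply, zero_apply, sub_zero]
    split_ifs with ha hb
    · subst ha hb
      rw [κ.left, one_mul, one_mul, one_mul, mul_one]
      have h3 := h' β α
      rw [sum_single_mul_apply, dif_pos β.2, zero_apply, sub_zero, κ.right, one_mul] at h3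
      exact h2 β β.2 _ h3
    · rw [mul_zero, mul_zero]
      exact zero_mem _
    · exact zero_mem _

lemma single_mem_of_mem_insert {δ : I} (h : δ ∈ insert α U) :
    toStage κ U (single δ δ 1) ∈ span {toStage κ U (single α α 1)} := by
  rcases h with rfl | h
  · exact subset_span rfl
  · rw [toStage_eq_zero.2 (single_mem_idealOf h)]
    exact TwoSidedIdeal.zero_mem _

/-- The projection which kills the matrix unit at `α`. -/
def stageStep (κ : Cocycle I R) (U : Set I) (α : I) : Stage κ U →+* Stage κ (insert α U) :=
  (RingHom.liftOfSurjective (toStage κ U) (toStage_surjective U)) ⟨toStage κ (insert α U),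
    fun x hx => by
      rw [RingHom.mem_ker, toStage_eq_zero, mem_idealOf] at hx ⊢
      exact fun a b => entryIdeal_mono (Set.subset_insert α U) a b (hx a b)⟩

lemma stageStep_toStage (x : TwMat κ) :
    stageStep κ U α (toStage κ U x) = toStage κ (insert α U) x :=
  RingHom.liftOfSurjective_comp_apply (toStage κ U) (toStage_surjective U) _ x

lemma stageStep_comp : (stageStep κ U α).comp (toStage κ U) = toStage κ (insert α U) :=
  RingHom.ext stageStep_toStage

lemma stageStep_eq_zero (x : Stage κ U) :
    stageStep κ U α x = 0 ↔ x ∈ span {toStage κ U (single α α 1)} := by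
  constructor
  · intro h
    obtain ⟨x, rfl⟩ := toStage_surjective U x
    rw [stageStep_toStage, toStage_eq_zero] at h
    let T := span {toStage κ U (single α α 1)}
    have h1 : idealOf κ (insert α U) ≤ T.comap (toStage κ U) :=
      idealOf_le fun δ hδ => (mem_comap _).2 (single_mem_of_mem_insert hδ)
    exact (mem_comap _).1 (h1 h)
  · intro h
    have h1 : span {toStage κ U (single α α 1)} ≤
        TwoSidedIdeal.ker (stageStep κ U α) := TwoSidedIdeal.span_le.2 (by
      rintro _ rfl
      refine (mem_ker _).2 ?_
      rw [stageStep_toStage]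
      exact toStage_eq_zero.2 (single_mem_idealOf (Set.mem_insert _ _)))
    exact (mem_ker _).1 (h1 h)

/-- Killing one more vertex `α` is stratifying as soon as the entry ideals behave well on a set of
vertices, the cone of `α`, outside of which row and column `α` are already killed. -/
theorem isStrat_insert (cone : Finset I)
    (h1 : ∀ β ∉ cone, (1 : R) ∈ entryIdeal κ U α β ∧ (1 : R) ∈ entryIdeal κ U β α)
    (h2 : ∀ γ, ∀ β ∈ cone, ∀ f : R, κ.val γ α β * f ∈ entryIdeal κ U γ β → f ∈ entryIdeal κ U γ α)
    (h3 : ∀ β ∈ cone, ∀ f : R, f ∈ entryIdeal κ U β α → f ∈ entryIdeal κ U α α)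
    (hU : IsStrat (toStage κ U)) : IsStrat (toStage κ (insert α U)) := by
  have hs : Surjective (stageStep κ U α) := fun x => by
    obtain ⟨x, rfl⟩ := toStage_surjective _ x
    exact ⟨_, stageStep_toStage x⟩
  rw [← stageStep_comp]
  exact hU.comp (.of_frames (he := toStage_idem α) _ hs stageStep_eq_zero
    (leftFrame cone (fun β hβ => (h1 β hβ).1) h2) (rightFrame cone (fun β hβ => (h1 β hβ).2) h3))

end Step

lemma isStrat_toStage_empty : IsStrat (toStage κ ∅) := by
  refine .of_bijective _ ⟨(injective_iff_map_eq_zero _).2 fun x hx => ?_, toStage_surjective _⟩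
  rw [toStage_eq_zero, mem_idealOf] at hx
  ext a b
  have := hx a b
  rwa [entryIdeal, Set.image_empty, Ideal.span_empty] at this

lemma insert_rank_lt {J : Type} {rank : J → ℕ} (hr : Function.Injective rank) (α : J) :
    insert α {β | rank β < rank α} = {β | rank β < rank α + 1} := by
  ext β
  simp only [Set.mem_ofPred_eq, Set.mem_insert_iff, Nat.lt_succ_iff_lt_or_eq]
  rw [or_comm, hr.eq_iff]

lemma rank_lt_succ {J : Type} {rank : J → ℕ} {N : ℕ} (hN : ¬∃ α, rank α = N) :
    {β | rank β < N + 1} = {β | rank β < N} := by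
  ext β
  simp only [Set.mem_ofPred_eq, Nat.lt_succ_iff_lt_or_eq]
  exact or_iff_left fun h => hN ⟨β, h⟩

/-- Induction along an enumeration of the vertices. -/
lemma isStrat_toStage_of_rank (rank : I → ℕ) (hr : Function.Injective rank)
    (h : ∀ α, IsStrat (toStage κ {β | rank β < rank α}) →
      IsStrat (toStage κ (insert α {β | rank β < rank α}))) (N : ℕ) :
    IsStrat (toStage κ {α | rank α < N}) := by
  induction N with
  | zero =>
    rw [show {α | rank α < 0} = ∅ from Set.eq_empty_of_forall_notMem fun a => by simp]
    exact isStrat_toStage_empty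
  | succ N ih =>
    by_cases hN : ∃ α, rank α = N
    · obtain ⟨α, rfl⟩ := hN
      rw [← insert_rank_lt hr]
      exact h α ih
    · rwa [rank_lt_succ hN]

end TwMat

/-! ### Purity for the sign cocycle -/

section SignCocycle

variable {n : ℕ} {I R : Type} [CommRing R]

/-- The product of the `z i` over the hyperplanes which separate `β` from both `α` and `γ`. -/
def signVal (z : Fin n → R) (α β γ : SignVector n) : R :=
  ∏ i, if α i = γ i ∧ β i ≠ α i then z i else 1

lemma signVal_eq_prod (z : Fin n → R) (α β γ : SignVector n) :
    signVal z α β γ = ∏ i with α i = γ i ∧ β i ≠ α i, z i :=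
  (Finset.prod_filter _ _).symm

lemma signVal_left (z : Fin n → R) (α β : SignVector n) : signVal z α α β = 1 :=
  Finset.prod_eq_one fun _ _ => if_neg fun h => h.2 rfl

lemma signVal_right (z : Fin n → R) (α β : SignVector n) : signVal z α β β = 1 :=
  Finset.prod_eq_one fun _ _ => if_neg fun h => h.2 h.1.symm

lemma signVal_assoc (z : Fin n → R) (α β γ δ : SignVector n) :
    signVal z α β γ * signVal z α γ δ = signVal z β γ δ * signVal z α β δ := by
  unfold signVal
  rw [← prod_mul_distrib, ← prod_mul_distrib]
  refine prod_congr rfl fun i _ => ?_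
  generalize α i = a
  generalize β i = b
  generalize γ i = c
  generalize δ i = d
  cases a <;> cases b <;> cases c <;> cases d <;> simp

/-- The cocycle of the multiplication of the straight paths between vertices of a cube. -/
def signCocycle (z : Fin n → R) (σ : I → SignVector n) : Cocycle I R where
  val a b c := signVal z (σ a) (σ b) (σ c)
  left _ _ := signVal_left _ _ _
  right _ _ := signVal_right _ _ _
  assoc _ _ _ _ := signVal_assoc _ _ _ _ _

/-- The entry ideals of the sign cocycle. -/
abbrev signIdeal (z : Fin n → R) (σ : I → SignVector n) := entryIdeal (signCocycle z σ)

/-- The sign vector `α` with the `i`-th sign reversed. -/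
def flipAt (α : SignVector n) (i : Fin n) : SignVector n := update α i (!α i)

lemma flipAt_self (α : SignVector n) (i : Fin n) : flipAt α i i = !α i := update_self _ _ _

lemma flipAt_of_ne (α : SignVector n) {i j : Fin n} (h : j ≠ i) : flipAt α i j = α j :=
  update_of_ne h _ _

lemma signVal_flipAt_of_eq (z : Fin n → R) {α β γ : SignVector n} {i : Fin n} (h1 : γ i = α i)
    (h2 : β i = α i) : signVal z γ (flipAt α i) β = z i * signVal z γ α β := by
  unfold signVal
  rw [← Finset.mul_prod_erase _ _ (mem_univ i),
    ← Finset.mul_prod_erase _ (fun j => if γ j = β j ∧ α j ≠ γ j then z j else 1)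
      (mem_univ i), if_pos, if_neg, one_mul]
  · congr 1
    refine prod_congr rfl fun j hj => ?_
    rw [flipAt_of_ne α (ne_of_mem_erase hj)]
  · exact fun h => h.2 h1.symm
  · refine ⟨h1.trans h2.symm, ?_⟩
    rw [flipAt_self, h1]
    simp

lemma signVal_flipAt_dvd (z : Fin n → R) {α β γ : SignVector n} {i : Fin n}
    (h : γ i ≠ α i ∨ β i ≠ α i) : signVal z γ (flipAt α i) β ∣ signVal z γ α β := by
  refine Finset.prod_dvd_prod_of_dvd _ _ fun j _ => ?_
  by_cases hj : j = i
  · subst hj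
    rw [if_neg]
    · exact one_dvd _
    · rintro ⟨h1, h2⟩
      rw [flipAt_self] at h2
      rcases h with h | h
      · exact h2 (by revert h; generalize α j = a; generalize γ j = b; revert a b; decide)
      · exact h2 (by
          rw [← h1] at h
          revert h; generalize α j = a; generalize γ j = b; revert a b; decide)
  · rw [flipAt_of_ne α hj]

lemma dvd_signVal (z : Fin n → R) {α β γ : SignVector n} {i : Fin n} (h1 : α i = γ i)
    (h2 : β i ≠ α i) : z i ∣ signVal z α β γ := by
  rw [signVal_eq_prod]
  exact Finset.dvd_prod_of_mem _ (mem_filter.2 ⟨mem_univ i, h1, h2⟩)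

/-- A shelling of a set of sign vectors: a total order, and for each sign vector `α` a set of
walls such that the sign vectors before `α` are exactly separated from `α` by these walls. -/
structure Shelling (σ : I → SignVector n) where
  rank : I → ℕ
  rank_injective : Function.Injective rank
  walls : I → Finset (Fin n)
  exists_flip : ∀ α, ∀ i ∈ walls α, ∃ δ, rank δ < rank α ∧ σ δ = flipAt (σ α) i
  exists_wall : ∀ α δ, rank δ < rank α → ∃ i ∈ walls α, σ δ i ≠ σ α i

namespace Shelling

variable {σ : I → SignVector n} (D : Shelling σ) (z : Fin n → R)

/-- The sign vectors before `α`. -/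
def before (α : I) : Set I := {β | D.rank β < D.rank α}

/-- The ideal generated by the `z i` for the walls of `α`. -/
def wallIdeal (α : I) : Ideal R := Ideal.span (z '' D.walls α)

lemma entryIdeal_le_wallIdeal {α γ β : I} (hγ : ∀ i ∈ D.walls α, σ γ i = σ α i)
    (hβ : ∀ i ∈ D.walls α, σ β i = σ α i) :
    signIdeal z σ (D.before α) γ β ≤ D.wallIdeal z α := by
  refine Ideal.span_le.2 ?_
  rintro _ ⟨δ, hδ, rfl⟩
  obtain ⟨i, hi, h⟩ := D.exists_wall α δ hδ
  refine Ideal.mem_of_dvd _ (dvd_signVal z (i := i) ?_ ?_)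
    (Ideal.subset_span (Set.mem_image_of_mem z hi))
  · rw [hγ i hi, hβ i hi]
  · rwa [hγ i hi]

lemma mul_mem_entryIdeal {α γ β : I} {i : Fin n} (hi : i ∈ D.walls α)
    (hγ : σ γ i = σ α i) (hβ : σ β i = σ α i) :
    z i * signVal z (σ γ) (σ α) (σ β) ∈ signIdeal z σ (D.before α) γ β := by
  obtain ⟨δ, hδ, h⟩ := D.exists_flip α i hi
  refine Ideal.subset_span ⟨δ, hδ, ?_⟩
  change signVal z (σ γ) (σ δ) (σ β) = _
  rw [h, signVal_flipAt_of_eq z hγ hβ]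

lemma signVal_mem_entryIdeal {α γ β : I} {i : Fin n} (hi : i ∈ D.walls α)
    (h : σ γ i ≠ σ α i ∨ σ β i ≠ σ α i) :
    signVal z (σ γ) (σ α) (σ β) ∈ signIdeal z σ (D.before α) γ β := by
  obtain ⟨δ, hδ, h'⟩ := D.exists_flip α i hi
  refine Ideal.mem_of_dvd _ ?_ (Ideal.subset_span ⟨δ, hδ, rfl⟩)
  change signVal z (σ γ) (σ δ) (σ β) ∣ _
  rw [h']
  exact signVal_flipAt_dvd z h

lemma entryIdeal_insert (α γ β : I) :
    signIdeal z σ (insert α (D.before α)) γ β =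
      Ideal.span {signVal z (σ γ) (σ α) (σ β)} ⊔ signIdeal z σ (D.before α) γ β := by
  unfold signIdeal entryIdeal
  rw [Set.image_insert_eq, Ideal.span_insert]
  rfl

variable (𝔞 : Ideal R)

/-- The entry ideals are transversal to `𝔞`. -/
def Pure (U : Set I) : Prop :=
  ∀ γ β, signIdeal z σ U γ β ⊓ 𝔞 ≤ signIdeal z σ U γ β * 𝔞

/-- The variables outside `walls α` are regular modulo the wall ideal of `α`, which is transversal
to `𝔞`. -/
structure Transversal : Prop where
  mem_of_mul : ∀ α, ∀ i ∉ D.walls α, ∀ f, z i * f ∈ D.wallIdeal z α → f ∈ D.wallIdeal z α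
  inf_le : ∀ α, D.wallIdeal z α ⊓ 𝔞 ≤ D.wallIdeal z α * 𝔞

variable {z 𝔞}

lemma mem_wallIdeal_of_signVal_mul (hD : D.Transversal z 𝔞) {α γ β : I} (hγ : ∀ i ∈ D.walls α, σ γ i = σ α i) (f : R)
    (h : signVal z (σ γ) (σ α) (σ β) * f ∈ D.wallIdeal z α) : f ∈ D.wallIdeal z α := by
  rw [signVal_eq_prod] at h
  have hs : ∀ s : Finset (Fin n), Disjoint s (D.walls α) →
      (∏ i ∈ s, z i) * f ∈ D.wallIdeal z α → f ∈ D.wallIdeal z α := by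
    intro s
    induction s using Finset.induction_on with
    | empty => rw [prod_empty, one_mul]; exact fun _ h => h
    | insert i s hi ih =>
      intro hd hf
      rw [Finset.disjoint_insert_left] at hd
      rw [prod_insert hi, mul_assoc] at hf
      exact ih hd.2 (hD.mem_of_mul α i hd.1 _ hf)
  refine hs _ (Finset.disjoint_left.2 fun i hi hi' => ?_) h
  rw [mem_filter] at hi
  exact hi.2.2 (hγ i hi').symm

lemma pure_before
    (hD : D.Transversal z 𝔞) (α : I)
    (h : Pure (σ := σ) z 𝔞 (insert α (D.before α))) :
    Pure (σ := σ) z 𝔞 (D.before α) := by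
  intro γ β
  have h0 := h γ β
  rw [D.entryIdeal_insert] at h0
  by_cases hc : ∃ i ∈ D.walls α, σ γ i ≠ σ α i ∨ σ β i ≠ σ α i
  · obtain ⟨i, hi, hi'⟩ := hc
    rwa [sup_eq_right.2 ((Ideal.span_singleton_le_iff_mem _).2
      (D.signVal_mem_entryIdeal z hi hi'))] at h0
  · push Not at hc
    have hγ := fun i hi => (hc i hi).1
    have hβ := fun i hi => (hc i hi).2
    rintro x ⟨hx, hxa⟩
    have h1 := h0 ⟨Ideal.mem_sup_right hx, hxa⟩
    rw [Ideal.sup_mul] at h1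
    obtain ⟨y, hy, w, hw, rfl⟩ := Submodule.mem_sup.1 h1
    obtain ⟨a, ha, rfl⟩ := Ideal.mem_span_singleton_mul.1 hy
    refine add_mem ?_ hw
    have hw' : w ∈ signIdeal z σ (D.before α) γ β := Ideal.mul_le_left hw
    have h2 : signVal z (σ γ) (σ α) (σ β) * a ∈ D.wallIdeal z α :=
      D.entryIdeal_le_wallIdeal z hγ hβ ((Ideal.add_mem_iff_left _ hw').1 hx)
    have h3 := hD.inf_le α ⟨D.mem_wallIdeal_of_signVal_mul hD hγ a h2, ha⟩
    have h4 : Ideal.span {signVal z (σ γ) (σ α) (σ β)} * D.wallIdeal z α ≤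
        signIdeal z σ (D.before α) γ β := by
      rw [wallIdeal, Ideal.span_mul_span', Ideal.span_le]
      rintro _ ⟨_, rfl, _, ⟨i, hi, rfl⟩, rfl⟩
      dsimp only
      rw [mul_comm]
      exact D.mul_mem_entryIdeal z hi (hγ i hi) (hβ i hi)
    refine Ideal.mul_mono_left h4 ?_
    rw [mul_assoc]
    exact Ideal.mul_mem_mul (Ideal.mem_span_singleton_self _) h3

lemma pure_all [Finite I]
    (hD : D.Transversal z 𝔞) (N : ℕ) :
    Pure (σ := σ) z 𝔞 {β | D.rank β < N} := by
  obtain ⟨M, hM⟩ := (Set.finite_range D.rank).bddAbove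
  have htop : ∀ N, M < N → Pure (σ := σ) z 𝔞 {β | D.rank β < N} := fun N hN γ β => by
    have h : signIdeal z σ {β | D.rank β < N} γ β = ⊤ :=
      (Ideal.eq_top_iff_one _).2 (Ideal.subset_span
        ⟨γ, (hM ⟨γ, rfl⟩).trans_lt hN, signVal_left _ _ _⟩)
    rw [h, Ideal.top_mul]
    exact inf_le_right
  have hstep : ∀ k N, M < N + k → Pure (σ := σ) z 𝔞 {β | D.rank β < N} := by
    intro k
    induction k with
    | zero => exact htop
    | succ k ih =>
      intro N hN
      have h := ih (N + 1) (by omega)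
      by_cases hα : ∃ α, D.rank α = N
      · obtain ⟨α, rfl⟩ := hα
        refine D.pure_before hD α ?_
        rwa [before, TwMat.insert_rank_lt D.rank_injective]
      · rwa [TwMat.rank_lt_succ hα] at h
  exact hstep (M + 1) N (by omega)

local notation "𝔮" => Ideal.Quotient.mk 𝔞

lemma mk_signVal (α β γ : SignVector n) :
    signVal (fun i => 𝔮 (z i)) α β γ = 𝔮 (signVal z α β γ) := by
  unfold signVal
  rw [map_prod]
  refine prod_congr rfl fun i _ => ?_
  split_ifs <;> simp

lemma mk_mem_entryIdeal {U : Set I} {γ β : I} {f : R} :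
    𝔮 f ∈ signIdeal (fun i => 𝔮 (z i)) σ U γ β ↔
    f ∈ signIdeal z σ U γ β ⊔ 𝔞 := by
  rw [← Ideal.mem_quotient_iff_mem_sup]
  unfold signIdeal entryIdeal
  rw [Ideal.map_span, Set.image_image]
  simp only [signCocycle, mk_signVal]

/-- Right multiplication by the straight path from `α` to `β` is injective, modulo the sign vectors
before `α`, on the entries in column `α`. -/
lemma mem_wallIdeal_sup [Finite I]
    (hD : D.Transversal z 𝔞) {α γ β : I}
    (hγ : ∀ i ∈ D.walls α, σ γ i = σ α i) (hβ : ∀ i ∈ D.walls α, σ β i = σ α i) (f : R)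
    (h : signVal z (σ γ) (σ α) (σ β) * f ∈
      signIdeal z σ (D.before α) γ β ⊔ 𝔞) : f ∈ D.wallIdeal z α ⊔ 𝔞 := by
  obtain ⟨j, hj, a, ha, hja⟩ := Submodule.mem_sup.1 h
  have hpure : Pure (σ := σ) z 𝔞 (insert α (D.before α)) :=
    TwMat.insert_rank_lt D.rank_injective α ▸ D.pure_all hD _
  have h0 := hpure γ β
  rw [D.entryIdeal_insert] at h0
  have h1 : a ∈ Ideal.span {signVal z (σ γ) (σ α) (σ β)} ⊔
      signIdeal z σ (D.before α) γ β := by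
    rw [show a = signVal z (σ γ) (σ α) (σ β) * f - j by rw [← hja, add_sub_cancel_left]]
    exact sub_mem (Ideal.mem_sup_left (Ideal.mul_mem_right _ _
      (Ideal.mem_span_singleton_self _))) (Ideal.mem_sup_right hj)
  have h2 := h0 ⟨h1, ha⟩
  rw [Ideal.sup_mul] at h2
  obtain ⟨y, hy, w, hw, rfl⟩ := Submodule.mem_sup.1 h2
  obtain ⟨b, hb, rfl⟩ := Ideal.mem_span_singleton_mul.1 hy
  have hw' : w ∈ signIdeal z σ (D.before α) γ β := Ideal.mul_le_left hw
  have h3 : signVal z (σ γ) (σ α) (σ β) * (f - b) ∈ D.wallIdeal z α := by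
    rw [show signVal z (σ γ) (σ α) (σ β) * (f - b) = j + w by linear_combination -hja]
    exact D.entryIdeal_le_wallIdeal z hγ hβ (add_mem hj hw')
  rw [show f = (f - b) + b by ring]
  exact add_mem (Ideal.mem_sup_left (D.mem_wallIdeal_of_signVal_mul hD hγ _ h3))
    (Ideal.mem_sup_right hb)

lemma mk_signVal_mem {α γ β : I} (h : ∃ i ∈ D.walls α, σ γ i ≠ σ α i ∨ σ β i ≠ σ α i) :
    𝔮 (signVal z (σ γ) (σ α) (σ β)) ∈
      signIdeal (fun i => 𝔮 (z i)) σ (D.before α) γ β := by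
  obtain ⟨i, hi, h⟩ := h
  exact mk_mem_entryIdeal.2 (Ideal.mem_sup_left (D.signVal_mem_entryIdeal z hi h))

lemma wallIdeal_le {α γ : I} (hγ : ∀ i ∈ D.walls α, σ γ i = σ α i) :
    D.wallIdeal z α ≤ signIdeal z σ (D.before α) γ α := by
  refine Ideal.span_le.2 ?_
  rintro _ ⟨i, hi, rfl⟩
  have := D.mul_mem_entryIdeal z hi (hγ i hi) rfl
  rwa [signVal_right, mul_one] at this

/-- The chain of quotients defined by a shelling is stratifying over any base `R / 𝔞` to which the
wall ideals are transversal. -/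
theorem isStrat [Fintype I] [DecidableEq I]
    (hD : D.Transversal z 𝔞) (N : ℕ) :
    IsStrat (toStage (signCocycle (fun i => 𝔮 (z i)) σ) {β | D.rank β < N}) := by
  classical
  refine TwMat.isStrat_toStage_of_rank D.rank D.rank_injective (fun α hα => ?_) N
  let cone : Finset I := univ.filter fun β => ∀ i ∈ D.walls α, σ β i = σ α i
  have hcone : ∀ β, β ∈ cone ↔ ∀ i ∈ D.walls α, σ β i = σ α i := fun β => by
    rw [mem_filter]
    exact and_iff_right (mem_univ β)
  refine TwMat.isStrat_insert cone (fun β hβ => ?_) (fun γ β hβ f h => ?_) (fun β hβ f h => ?_) hα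
  · rw [hcone] at hβ
    push Not at hβ
    obtain ⟨i, hi, h⟩ := hβ
    have h1 := D.mk_signVal_mem (z := z) (𝔞 := 𝔞) (γ := α) (β := β) ⟨i, hi, .inr h⟩
    have h2 := D.mk_signVal_mem (z := z) (𝔞 := 𝔞) (γ := β) (β := α) ⟨i, hi, .inl h⟩
    rw [signVal_left, map_one] at h1
    rw [signVal_right, map_one] at h2
    exact ⟨h1, h2⟩
  · rw [hcone] at hβ
    by_cases hγ : ∃ i ∈ D.walls α, σ γ i ≠ σ α i
    · obtain ⟨i, hi, hγ⟩ := hγ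
      have h1 := D.mk_signVal_mem (z := z) (𝔞 := 𝔞) (γ := γ) (β := α) ⟨i, hi, .inl hγ⟩
      rw [signVal_right, map_one] at h1
      exact TwMat.mem_entryIdeal_of_one_mem h1 _
    · push Not at hγ
      obtain ⟨f, rfl⟩ := Ideal.Quotient.mk_surjective f
      have h' : signVal (fun i => 𝔮 (z i)) (σ γ) (σ α) (σ β) *
          𝔮 f ∈ entryIdeal
            (signCocycle (fun i => 𝔮 (z i)) σ) (D.before α) γ β := h
      rw [mk_signVal, ← map_mul, mk_mem_entryIdeal] at h'
      exact mk_mem_entryIdeal.2 (sup_le_sup_right (D.wallIdeal_le hγ) 𝔞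
        (D.mem_wallIdeal_sup hD hγ hβ f h'))
  · rw [hcone] at hβ
    obtain ⟨f, rfl⟩ := Ideal.Quotient.mk_surjective f
    have h' := mk_mem_entryIdeal.1 h
    exact mk_mem_entryIdeal.2 (sup_le_sup_right ((D.entryIdeal_le_wallIdeal z hβ
      fun _ _ => rfl).trans (D.wallIdeal_le fun _ _ => rfl)) 𝔞 h')

end Shelling

end SignCocycle

/-! ### Augmentation ideals of subgroups in a Laurent polynomial ring -/

section Laurent

variable {G : Type} [AddCommGroup G]

/-- The ideal of the group algebra generated by the `[g] - 1` for `g` in a subgroup. -/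
def augIdeal (K : AddSubgroup G) : Ideal (AddMonoidAlgebra ℂ G) :=
  Ideal.span {x | ∃ g ∈ K, x = single g 1 - 1}

lemma single_sub_mem_augIdeal {K : AddSubgroup G} {g h : G} (hk : g - h ∈ K) (c : ℂ) :
    (single g c - single h c : AddMonoidAlgebra ℂ G) ∈
      augIdeal K := by
  have : (single g c - single h c : AddMonoidAlgebra ℂ G) =
      single h c * (single (g - h) 1 - 1) := by
    rw [mul_sub, single_mul_single, mul_one, mul_one, add_sub_cancel]
  rw [this]
  exact Ideal.mul_mem_left _ _ (Ideal.subset_span ⟨_, hk, rfl⟩)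

/-- `mapDomain` as an additive map. -/
def domMap (f : G → G) : AddMonoidAlgebra ℂ G →+ AddMonoidAlgebra ℂ G where
  toFun := mapDomain f
  map_zero' := mapDomain_zero f
  map_add' := mapDomain_add f

lemma domMap_single (f : G → G) (g : G) (c : ℂ) :
    domMap f (single g c) = single (f g) c :=
  mapDomain_single

lemma domMap_eq_zero {K : AddSubgroup G} {f : G → G} (hf : ∀ g, ∀ k ∈ K, f (g + k) = f g)
    {x : AddMonoidAlgebra ℂ G} (hx : x ∈ augIdeal K) : domMap f x = 0 := by
  suffices h : ∀ r, domMap f (r * x) = 0 by simpa using h 1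
  refine span_induction (p := fun x _ => ∀ r, domMap f (r * x) = 0) ?_ ?_ ?_ ?_ hx
  · rintro _ ⟨k, hk, rfl⟩ r
    induction r using induction_linear with
    | zero => rw [zero_mul, map_zero]
    | add r s hr hs => rw [add_mul, map_add, hr, hs, add_zero]
    | single g c =>
      rw [mul_sub, single_mul_single, mul_one, mul_one, map_sub, domMap_single,
        domMap_single, hf g k hk, sub_self]
  · intro r
    rw [mul_zero, map_zero]
  · intro x y _ _ hx hy r
    rw [mul_add, map_add, hx, hy, add_zero]
  · intro s x _ hx r
    rw [smul_eq_mul, ← mul_assoc]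
    exact hx _

/-- Representatives of the cosets of `K ⊕ L` split every element into its parts along `K` and `L`
and a remainder, compatibly with translations. -/
lemma exists_coset_splitting {K L : AddSubgroup G} (h : Disjoint K L) :
    ∃ k l : G → G, (∀ g, k g ∈ K) ∧ (∀ g, l g ∈ L) ∧ (∀ g, ∀ x ∈ K, k (g + x) = k g + x) ∧
      (∀ g, ∀ y ∈ L, k (g + y) = k g) ∧ (∀ g, ∀ y ∈ L, l (g + y) = l g + y) := by
  let r : G → G := fun g => (QuotientAddGroup.mk g : G ⧸ (K ⊔ L)).out
  have hr : ∀ g, ∃ k ∈ K, ∃ l ∈ L, k + l = g - r g := fun g => by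
    refine AddSubgroup.mem_sup.1 ?_
    have := (QuotientAddGroup.mk_out_eq_add (K ⊔ L) g)
    obtain ⟨m, hm⟩ := this
    change r g = g + m at hm
    rw [hm, sub_add_cancel_left]
    exact neg_mem m.2
  have hinv : ∀ g, ∀ m ∈ K ⊔ L, r (g + m) = r g := fun g m hm => by
    have : (QuotientAddGroup.mk (g + m) : G ⧸ (K ⊔ L)) = QuotientAddGroup.mk g := by
      rw [QuotientAddGroup.eq, neg_add_rev, add_assoc, neg_add_cancel, add_zero]
      exact neg_mem hm
    exact congrArg Quotient.out this
  choose k hk l hl hkl using hr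
  have huniq : ∀ {x x' y y' : G}, x ∈ K → x' ∈ K → y ∈ L → y' ∈ L → x + y = x' + y' →
      x = x' ∧ y = y' := fun {x x' y y'} hx hx' hy hy' e => by
    have e1 : x - x' = y' - y := by rw [sub_eq_sub_iff_add_eq_add, e, add_comm]
    have e2 : x - x' = 0 := AddSubgroup.disjoint_def.1 h (sub_mem hx hx') (e1 ▸ sub_mem hy' hy)
    exact ⟨sub_eq_zero.1 e2, (sub_eq_zero.1 (e1.symm.trans e2)).symm⟩
  refine ⟨k, l, hk, hl, fun g x hx => ?_, fun g y hy => ?_, fun g y hy => ?_⟩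
  · refine (huniq (hk _) (add_mem (hk g) hx) (hl (g + x)) (hl g) ?_).1
    rw [hkl, hinv g x (AddSubgroup.mem_sup_left hx), add_right_comm, hkl]
    abel
  · refine (huniq (hk _) (hk g) (hl (g + y)) (add_mem (hl g) hy) ?_).1
    rw [hkl, hinv g y (AddSubgroup.mem_sup_right hy), ← add_assoc, hkl]
    abel
  · refine (huniq (hk (g + y)) (hk g) (hl _) (add_mem (hl g) hy) ?_).2
    rw [hkl, hinv g y (AddSubgroup.mem_sup_right hy), ← add_assoc, hkl]
    abel

/-- The augmentation ideals of independent subgroups are transversal. -/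
theorem augIdeal_inf_le {K L : AddSubgroup G} (h : Disjoint K L) :
    augIdeal K ⊓ augIdeal L ≤ augIdeal K * augIdeal L := by
  obtain ⟨k, l, hk, hl, hkk, hkl, hll⟩ := exists_coset_splitting h
  rintro x ⟨hxK, hxL⟩
  let p := domMap fun g => g - k g
  let q := domMap fun g => g - l g
  have hp : p x = 0 := domMap_eq_zero (fun g y hy => by rw [hkk g y hy]; abel) hxK
  have hq : q x = 0 := domMap_eq_zero (fun g y hy => by rw [hll g y hy]; abel) hxL
  have hx : x = (x - q x) - p (x - q x) := by rw [hq, sub_zero, hp, sub_zero]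
  rw [hx]
  generalize x = y
  clear hx hp hq hxK hxL x
  induction y using induction_linear with
  | zero => simp
  | add y z hy hz =>
    have : y + z - q (y + z) - p (y + z - q (y + z)) =
        (y - q y - p (y - q y)) + (z - q z - p (z - q z)) := by
      simp only [map_add, map_sub]
      abel
    rw [this]
    exact add_mem hy hz
  | single g c =>
    have h1 : k (g - l g) = k g := by
      rw [sub_eq_add_neg]
      exact hkl g _ (neg_mem (hl g))
    have h2 : single g c - q (single g c) -
        p (single g c - q (single g c)) =
        (single (g - l g) c - single (g - l g - k g) c) * (single (l g) 1 - 1) := by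
      simp only [p, q, map_sub, domMap_single, h1, sub_mul, mul_sub, mul_one, single_mul_single]
      rw [show g - l g - k g + l g = g - k g by abel, sub_add_cancel]
      abel
    rw [h2]
    refine Ideal.mul_mem_mul (single_sub_mem_augIdeal ?_ c) (Ideal.subset_span ⟨_, hl g, rfl⟩)
    rw [sub_sub_cancel]
    exact hk g

variable {n : ℕ}

/-- The ring of functions on the torus `(ℂˣ)ⁿ`. -/
abbrev Laurent (n : ℕ) : Type := AddMonoidAlgebra ℂ (Fin n → ℤ)

/-- The function `1 - t_i` on the torus `(ℂˣ)ⁿ`. -/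
def coordZ (i : Fin n) : Laurent n := 1 - single (Pi.single i 1) 1

/-- The integral vectors supported on `S`. -/
def suppSubgroup (S : Finset (Fin n)) : AddSubgroup (Fin n → ℤ) where
  carrier := {g | ∀ i ∉ S, g i = 0}
  zero_mem' _ _ := rfl
  add_mem' ha hb i hi := by simp [ha i hi, hb i hi]
  neg_mem' ha i hi := by simp [ha i hi]

/-- The characters of the torus which become trivial modulo `J`. -/
def trivialChars (J : Ideal (Laurent n)) : AddSubgroup (Fin n → ℤ) :=
  Subgroup.toAddSubgroup' (((Ideal.Quotient.mk J : Laurent n →* Laurent n ⧸ J).comp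
    (of ℂ (Fin n → ℤ))).eqLocus 1)

lemma mem_trivialChars {J : Ideal (Laurent n)} {g : Fin n → ℤ} :
    g ∈ trivialChars J ↔ single g 1 - 1 ∈ J :=
  Ideal.Quotient.eq (I := J) (x := single g 1) (y := 1)

lemma coordZ_mem_iff {J : Ideal (Laurent n)} (i : Fin n) :
    coordZ i ∈ J ↔ Pi.single i 1 ∈ trivialChars J := by
  rw [mem_trivialChars, coordZ, ← neg_mem_iff, neg_sub]

lemma mem_of_forall_single {T : AddSubgroup (Fin n → ℤ)} {g : Fin n → ℤ}
    (h : ∀ i, g i ≠ 0 → Pi.single i 1 ∈ T) : g ∈ T := by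
  rw [← Finset.univ_sum_single g]
  refine sum_mem fun i _ => ?_
  by_cases hi : g i = 0
  · rw [hi, Pi.single_zero]
    exact T.zero_mem
  · have := T.zsmul_mem (h i hi) (g i)
    rwa [← Pi.single_smul, smul_eq_mul, mul_one] at this

lemma span_coordZ (S : Finset (Fin n)) :
    Ideal.span (coordZ '' (S : Set (Fin n))) = augIdeal (suppSubgroup S) := by
  apply le_antisymm
  · refine Ideal.span_le.2 ?_
    rintro _ ⟨i, hi, rfl⟩
    rw [← neg_neg (coordZ i), coordZ, neg_sub]
    refine neg_mem (Ideal.subset_span ⟨Pi.single i 1, fun j hj => ?_, rfl⟩)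
    exact Pi.single_eq_of_ne (fun h : j = i => hj (h ▸ hi)) _
  · refine Ideal.span_le.2 ?_
    rintro _ ⟨g, hg, rfl⟩
    exact mem_trivialChars.1 (mem_of_forall_single fun i hi => (coordZ_mem_iff i).1
      (Ideal.subset_span ⟨i, not_not.1 fun h => hi (hg i h), rfl⟩))

/-- Setting the coordinates in `S` equal to one. -/
def killSupp (S : Finset (Fin n)) : Laurent n →+* Laurent n :=
  mapDomainRingHom ℂ
    ({ toFun := fun g i => if i ∈ S then 0 else g i
       map_zero' := by funext i; exact ite_self _
       map_add' := fun a b => by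
         funext i
         change (if i ∈ S then 0 else a i + b i) =
           (if i ∈ S then 0 else a i) + (if i ∈ S then 0 else b i)
         split_ifs <;> simp } : (Fin n → ℤ) →+ (Fin n → ℤ))

lemma killSupp_single (S : Finset (Fin n)) (g : Fin n → ℤ) (c : ℂ) :
    killSupp S (single g c) = single (fun i => if i ∈ S then 0 else g i) c :=
  mapDomain_single

lemma killSupp_coordZ_of_mem {S : Finset (Fin n)} {i : Fin n} (hi : i ∈ S) :
    killSupp S (coordZ i) = 0 := by
  rw [coordZ, map_sub, map_one, killSupp_single, sub_eq_zero]
  have : (fun j => if j ∈ S then 0 else (Pi.single i 1 : Fin n → ℤ) j) = 0 := by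
    funext j
    by_cases hj : j = i
    · subst hj; rw [if_pos hi]; rfl
    · rw [Pi.single_eq_of_ne hj, ite_self]; rfl
  rw [this]
  rfl

lemma killSupp_coordZ_of_notMem {S : Finset (Fin n)} {i : Fin n} (hi : i ∉ S) :
    killSupp S (coordZ i) = coordZ i := by
  rw [coordZ, map_sub, map_one, killSupp_single]
  congr 2
  funext j
  by_cases hj : j = i
  · subst hj; rw [if_neg hi]
  · rw [Pi.single_eq_of_ne hj, ite_self]

lemma coordZ_ne_zero (i : Fin n) : coordZ i ≠ 0 := by
  rw [coordZ, sub_ne_zero, one_def]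
  intro h
  have h1 := congrArg (fun x : Laurent n => x.coeff 0) h
  simp only [coeff_single] at h1
  rw [Finsupp.single_eq_same, Finsupp.single_eq_of_ne] at h1
  · exact one_ne_zero h1
  · intro h2
    have := congrFun h2 i
    simp at this

lemma mem_span_coordZ_iff (S : Finset (Fin n)) (f : Laurent n) :
    f ∈ Ideal.span (coordZ '' (S : Set (Fin n))) ↔ killSupp S f = 0 := by
  constructor
  · intro h
    have : Ideal.span (coordZ '' (S : Set (Fin n))) ≤ RingHom.ker (killSupp S) := by
      refine Ideal.span_le.2 ?_
      rintro _ ⟨i, hi, rfl⟩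
      exact killSupp_coordZ_of_mem hi
    exact this h
  · intro h
    have : f - killSupp S f ∈ Ideal.span (coordZ '' (S : Set (Fin n))) := by
      clear h
      rw [span_coordZ]
      induction f using induction_linear with
      | zero => simp
      | add x y hx hy =>
        rw [map_add, add_sub_add_comm]
        exact add_mem hx hy
      | single g c =>
        rw [killSupp_single]
        refine single_sub_mem_augIdeal (fun i hi => ?_) c
        rw [Pi.sub_apply, if_neg hi, sub_self]
    rwa [h, sub_zero] at this

/-- The coordinates outside `S` are regular on the subtorus cut out by the coordinates in `S`. -/
lemma mem_span_coordZ_of_mul {S : Finset (Fin n)} {i : Fin n} (hi : i ∉ S) {f : Laurent n}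
    (h : coordZ i * f ∈ Ideal.span (coordZ '' (S : Set (Fin n)))) :
    f ∈ Ideal.span (coordZ '' (S : Set (Fin n))) := by
  rw [mem_span_coordZ_iff] at h ⊢
  rw [map_mul, killSupp_coordZ_of_notMem hi] at h
  exact (mul_eq_zero.1 h).resolve_left (coordZ_ne_zero i)

/-- The shelled chain of quotients over the ring of functions on a subtorus is stratifying, provided
that the wall subtori are transversal to it. -/
theorem Shelling.isStrat_laurent {I : Type} [Fintype I] [DecidableEq I] {σ : I → SignVector n}
    (D : Shelling σ) (L : AddSubgroup (Fin n → ℤ))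
    (hL : ∀ α, Disjoint (suppSubgroup (D.walls α)) L) (N : ℕ) :
    IsStrat (toStage (signCocycle (fun i => Ideal.Quotient.mk (augIdeal L) (coordZ i)) σ)
      {β | D.rank β < N}) := by
  refine D.isStrat ⟨fun α i hi f h => mem_span_coordZ_of_mul hi h, fun α => ?_⟩ N
  rw [wallIdeal, span_coordZ]
  exact augIdeal_inf_le (hL α)

end Laurent

/-! ### Universal properties of the path algebras, their localizations and tensor powers -/

namespace QuotientBy

variable {A B : Type} [Ring A] [Algebra ℂ A] [Ring B] [Algebra ℂ B] {S : Set A}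

lemma mk_surjective (S : Set A) : Surjective (mk S) := RingCon.mk'_surjective (span S).ringCon

lemma mk_eq_zero_iff {a : A} : mk S a = 0 ↔ a ∈ span S := by
  rw [TwoSidedIdeal.mem_iff]
  exact (span S).ringCon.eq (a := a) (b := 0)

lemma map_eq_zero_of_mem (f : A →ₐ[ℂ] B) (h : ∀ s ∈ S, f s = 0) {a : A}
    (ha : a ∈ span S) : f a = 0 := by
  have : span S ≤ TwoSidedIdeal.ker f.toRingHom :=
    TwoSidedIdeal.span_le.2 fun s hs => (mem_ker _).2 (h s hs)
  exact (mem_ker _).1 (this ha)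

/-- The universal property of the quotient by a set of relations. -/
def lift (f : A →ₐ[ℂ] B) (h : ∀ s ∈ S, f s = 0) : QuotientBy S →ₐ[ℂ] B :=
  (span S).ringCon.liftₐ f fun x y hxy => by
    have h1 : mk S (x - y) = 0 := by
      rw [map_sub, sub_eq_zero]
      exact Quotient.sound' hxy
    have h2 := map_eq_zero_of_mem f h (mk_eq_zero_iff.1 h1)
    rwa [map_sub, sub_eq_zero] at h2

lemma hom_ext {f g : QuotientBy S →ₐ[ℂ] B} (h : ∀ a, f (mk S a) = g (mk S a)) : f = g :=
  AlgHom.ext fun x => by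
    obtain ⟨a, rfl⟩ := mk_surjective S x
    exact h a

end QuotientBy

open QuotientBy (mk_surjective mk_eq_zero mk_eq_zero_iff)
open QuotientBy renaming mk → quo

namespace PathAlg

variable {B : Type} [Ring B] [Algebra ℂ B]

lemma adjoin_gen : Algebra.adjoin ℂ (Set.range gen) = ⊤ := by
  have h := congrArg (Subalgebra.map (RingQuot.mkAlgHom ℂ PathRel))
    (FreeAlgebra.adjoin_range_ι ℂ QuiverGen)
  rwa [AlgHom.map_adjoin, ← Set.range_comp, Algebra.map_top,
    (AlgHom.range_eq_top _).2 (RingQuot.mkAlgHom_surjective ℂ PathRel)] at h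

lemma mem_of_gen (S : Subalgebra ℂ PathAlg) (he : ∀ s, e s ∈ S) (hd : down ∈ S) (hu : up ∈ S)
    (x : PathAlg) : x ∈ S := by
  have : (⊤ : Subalgebra ℂ PathAlg) ≤ S := by
    rw [← adjoin_gen]
    refine Algebra.adjoin_le ?_
    rintro _ ⟨x | _ | _, rfl⟩
    exacts [he x, hd, hu]
  exact this trivial

lemma hom_ext {f g : PathAlg →ₐ[ℂ] B} (he : ∀ s, f (e s) = g (e s)) (hd : f down = g down)
    (hu : f up = g up) : f = g :=
  AlgHom.ext fun x => mem_of_gen (AlgHom.equalizer f g) he hd hu x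

/-- The data of a representation of the path algebra. -/
structure Rep (B : Type) [Ring B] where
  e : Bool → B
  down : B
  up : B
  orth : OrthogonalIdempotents e
  complete : e true + e false = 1
  down_source : e true * down = down
  down_target : down * e false = down
  up_source : e false * up = up
  up_target : up * e true = up

namespace Rep

variable (ρ : Rep B)

/-- The images of the generators. -/
def onGen : QuiverGen → B
  | .vertex s => ρ.e s
  | .down => ρ.down
  | .up => ρ.up

/-- The homomorphism defined by a representation. -/
def hom : PathAlg →ₐ[ℂ] B :=
  RingQuot.liftAlgHom ℂ ⟨FreeAlgebra.lift ℂ ρ.onGen, by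
    intro x y h
    induction h with
    | idem s =>
      simp only [map_mul, FreeAlgebra.lift_ι_apply]
      exact ρ.orth.idem s
    | ortho s s' h =>
      simp only [map_mul, map_zero, FreeAlgebra.lift_ι_apply]
      exact ρ.orth.ortho h
    | complete =>
      simp only [map_add, map_one, FreeAlgebra.lift_ι_apply]
      exact ρ.complete
    | down_source =>
      simp only [map_mul, FreeAlgebra.lift_ι_apply]
      exact ρ.down_source
    | down_target =>
      simp only [map_mul, FreeAlgebra.lift_ι_apply]
      exact ρ.down_target
    | up_source =>
      simp only [map_mul, FreeAlgebra.lift_ι_apply]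
      exact ρ.up_source
    | up_target =>
      simp only [map_mul, FreeAlgebra.lift_ι_apply]
      exact ρ.up_target⟩

lemma hom_gen (x : QuiverGen) : ρ.hom (gen x) = ρ.onGen x :=
  (RingQuot.liftAlgHom_mkAlgHom_apply ℂ _ _ _).trans (FreeAlgebra.lift_ι_apply _ _)

lemma hom_e (s : Bool) : ρ.hom (PathAlg.e s) = ρ.e s := ρ.hom_gen _
lemma hom_down : ρ.hom PathAlg.down = ρ.down := ρ.hom_gen _
lemma hom_up : ρ.hom PathAlg.up = ρ.up := ρ.hom_gen _
lemma hom_loop : ρ.hom loop = ρ.down * ρ.up + ρ.up * ρ.down := by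
  rw [loop, map_add, map_mul, map_mul, hom_down, hom_up]

end Rep

lemma e_complete : e true + e false = 1 := by
  have := RingQuot.mkAlgHom_rel ℂ PathRel.complete
  rwa [map_add, map_one] at this

lemma e_mul_down : e true * down = down := by
  have := RingQuot.mkAlgHom_rel ℂ PathRel.down_source
  rwa [map_mul] at this

lemma down_mul_e : down * e false = down := by
  have := RingQuot.mkAlgHom_rel ℂ PathRel.down_target
  rwa [map_mul] at this

lemma e_mul_up : e false * up = up := by
  have := RingQuot.mkAlgHom_rel ℂ PathRel.up_source
  rwa [map_mul] at this

lemma up_mul_e : up * e true = up := by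
  have := RingQuot.mkAlgHom_rel ℂ PathRel.up_target
  rwa [map_mul] at this

/-- The straight path from `s` to `s'`. -/
def arrow : Bool → Bool → PathAlg
  | true, false => down
  | false, true => up
  | s, _ => e s

lemma arrow_self (s : Bool) : arrow s s = e s := by cases s <;> rfl

lemma e_mul_arrow (s s' : Bool) : e s * arrow s s' = arrow s s' := by
  cases s <;> cases s'
  exacts [e_orthogonal.idem _, e_mul_up, e_mul_down, e_orthogonal.idem _]

lemma arrow_mul_e (s s' : Bool) : arrow s s' * e s' = arrow s s' := by
  cases s <;> cases s'
  exacts [e_orthogonal.idem _, up_mul_e, down_mul_e, e_orthogonal.idem _]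

lemma arrow_mul_arrow_of_ne (s t : Bool) {s' t' : Bool} (h : s' ≠ t') :
    arrow s s' * arrow t' t = 0 := by
  rw [← arrow_mul_e, ← e_mul_arrow t' t, mul_assoc, ← mul_assoc (e s'), e_orthogonal.ortho h, zero_mul,
    mul_zero]

lemma down_mul_up : down * up = loop * e true := by
  have h : down * e true = 0 := arrow_mul_arrow_of_ne true true (s' := false) (t' := true) (by simp)
  rw [loop, add_mul, mul_assoc up, h, mul_zero, add_zero, mul_assoc, up_mul_e]

lemma up_mul_down : up * down = loop * e false := by
  have h : up * e false = 0 := arrow_mul_arrow_of_ne false false (s' := true) (t' := false) (by simp)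
  rw [loop, add_mul, mul_assoc down, h, mul_zero, zero_add, mul_assoc, down_mul_e]

lemma loop_comm (x : PathAlg) : Commute loop x := by
  have hd : down * down = 0 := arrow_mul_arrow_of_ne true false (s' := false) (t' := true) (by simp)
  have hu : up * up = 0 := arrow_mul_arrow_of_ne false true (s' := true) (t' := false) (by simp)
  refine (mem_centralizer_iff ℂ).1 (mem_of_gen (Subalgebra.centralizer ℂ {loop})
    (fun s => ?_) ?_ ?_ x) loop rfl
  · rw [mem_centralizer_iff]
    rintro _ rfl
    cases s
    · have h : e false * down = 0 :=
        arrow_mul_arrow_of_ne false false (s' := false) (t' := true) (by simp)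
      rw [← up_mul_down, loop, mul_add, ← mul_assoc, h, zero_mul, zero_add, ← mul_assoc, e_mul_up]
    · have h : e true * up = 0 :=
        arrow_mul_arrow_of_ne true true (s' := true) (t' := false) (by simp)
      rw [← down_mul_up, loop, mul_add, ← mul_assoc, e_mul_down, ← mul_assoc, h, zero_mul, add_zero]
  · rw [mem_centralizer_iff]
    rintro _ rfl
    rw [loop, add_mul, mul_add, mul_assoc up, hd, mul_zero, add_zero, ← mul_assoc down down, hd,
      zero_mul, zero_add, mul_assoc]
  · rw [mem_centralizer_iff]
    rintro _ rfl
    rw [loop, add_mul, mul_add, mul_assoc down, hu, mul_zero, zero_add, ← mul_assoc up up, hu,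
      zero_mul, add_zero, mul_assoc]

lemma arrow_mul_arrow (s t u : Bool) :
    arrow s t * arrow t u = (if s = u ∧ t ≠ s then loop else 1) * arrow s u := by
  cases s <;> cases t <;> cases u
  · rw [if_neg (by decide), one_mul]
    exact e_orthogonal.idem false
  · rw [if_neg (by decide), one_mul]
    exact e_mul_up
  · rw [if_pos (by decide)]
    exact up_mul_down
  · rw [if_neg (by decide), one_mul]
    exact up_mul_e
  · rw [if_neg (by decide), one_mul]
    exact down_mul_e
  · rw [if_pos (by decide)]
    exact down_mul_up
  · rw [if_neg (by decide), one_mul]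
    exact e_mul_down
  · rw [if_neg (by decide), one_mul]
    exact e_orthogonal.idem true

end PathAlg

open PathAlg (loop arrow arrow_self loop_comm e_complete arrow_mul_arrow_of_ne arrow_mul_arrow e_mul_arrow arrow_mul_e)

namespace ABet1

variable {B : Type} [Ring B] [Algebra ℂ B]

lemma toABet1_eq : toABet1 (1 - loop) = (monodromyUnit : ABet1) := rfl

lemma mem_of_gen (S : Subalgebra ℂ ABet1) (h : ∀ x, toABet1 x ∈ S)
    (hinv : ((monodromyUnit⁻¹ : ABet1ˣ) : ABet1) ∈ S) (x : ABet1) : x ∈ S := by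
  obtain ⟨p, rfl⟩ := mk_surjective _ x
  induction p using Polynomial.induction_on' with
  | add p q hp hq => rw [map_add]; exact add_mem hp hq
  | monomial k a =>
    rw [← Polynomial.C_mul_X_pow_eq_monomial, map_mul, map_pow]
    exact mul_mem (h a) (pow_mem hinv k)

lemma hom_ext {f g : ABet1 →ₐ[ℂ] B} (h : ∀ x, f (toABet1 x) = g (toABet1 x)) : f = g := by
  refine AlgHom.ext fun x => mem_of_gen (AlgHom.equalizer f g) h ?_ x
  have h1 := congrArg (fun u : Bˣ => ((u⁻¹ : Bˣ) : B)) (Units.ext (h (1 - loop)) :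
    Units.map f.toMonoidHom monodromyUnit = Units.map g.toMonoidHom monodromyUnit)
  simp only [← map_inv] at h1
  exact h1

/-- The universal property of the localization. -/
def lift (f : PathAlg →ₐ[ℂ] B) (h : IsUnit (f (1 - loop))) : ABet1 →ₐ[ℂ] B :=
  have hc : ∀ a, Commute (f a) ((h.unit⁻¹ : Bˣ) : B) := fun a =>
    Commute.units_inv_right (by
      rw [IsUnit.unit_spec]
      exact ((Commute.one_left a).sub_left (loop_comm a)).symm.map f)
  QuotientBy.lift
    { Polynomial.eval₂RingHom' f.toRingHom _ hc with
      commutes' := fun c => (Polynomial.eval₂_C _ _).trans (f.commutes c) } (by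
    rintro _ rfl
    change Polynomial.eval₂RingHom' f.toRingHom _ hc localizationRel = 0
    rw [localizationRel, map_sub, map_mul, map_one, sub_eq_zero]
    refine (congrArg₂ (· * ·) (Polynomial.eval₂_C _ _) (Polynomial.eval₂_X _ _)).trans ?_
    exact h.mul_val_inv)

lemma lift_toABet1 (f : PathAlg →ₐ[ℂ] B) (h : IsUnit (f (1 - loop))) (x : PathAlg) :
    lift f h (toABet1 x) = f x := Polynomial.eval₂_C _ _

lemma monodromy_comm (x : ABet1) : Commute (monodromyUnit : ABet1) x := by
  refine (mem_centralizer_iff ℂ).1 (mem_of_gen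
    (Subalgebra.centralizer ℂ {(monodromyUnit : ABet1)}) (fun x => ?_) ?_ x) _ rfl
  · rw [mem_centralizer_iff]
    rintro _ rfl
    exact ((Commute.one_left x).sub_left (loop_comm x)).map toABet1
  · rw [mem_centralizer_iff]
    rintro _ rfl
    exact (monodromyUnit.mul_inv).trans monodromyUnit.inv_mul.symm

end ABet1

namespace TensorPower

variable {n : ℕ} {B C : Type} [Ring B] [Algebra ℂ B] [Ring C] [Algebra ℂ C]

/-- The inclusion of the `i`-th tensor factor. -/
def inFactorHom (i : Fin n) : B →ₐ[ℂ] TensorPower n B :=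
  PiTensorProduct.singleAlgHom (R := ℂ) (A := fun _ : Fin n => B) i

lemma inFactorHom_apply (i : Fin n) (b : B) : inFactorHom i b = inFactor i b := rfl

lemma hom_ext {f g : TensorPower n B →ₐ[ℂ] C} (h : ∀ i b, f (inFactor i b) = g (inFactor i b)) :
    f = g :=
  PiTensorProduct.algHom_ext (R := ℂ) (A := fun _ : Fin n => B) fun i => AlgHom.ext (h i)

/-- A multiplicative multilinear map defines a homomorphism on the tensor power. -/
def lift (f : MultilinearMap ℂ (fun _ : Fin n => B) C) (one : f 1 = 1)
    (mul : ∀ x y, f (x * y) = f x * f y) : TensorPower n B →ₐ[ℂ] C :=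
  PiTensorProduct.liftAlgHom f one mul

lemma lift_pureTensor (f : MultilinearMap ℂ (fun _ : Fin n => B) C) (one : f 1 = 1)
    (mul : ∀ x y, f (x * y) = f x * f y) (b : Fin n → B) :
    lift f one mul (pureTensor b) = f b := PiTensorProduct.lift.tprod b

lemma pureTensor_one : pureTensor (1 : Fin n → B) = 1 := rfl

lemma induction_on {p : TensorPower n B → Prop} (x : TensorPower n B)
    (h : ∀ (c : ℂ) b, p (c • pureTensor b)) (hadd : ∀ x y, p x → p y → p (x + y)) : p x :=
  PiTensorProduct.induction_on (motive := p) x h hadd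

lemma pureTensor_mul_eq {x y z : Fin n → B} (h : ∀ i, x i * y i = z i) :
    pureTensor x * pureTensor y = pureTensor z :=
  (pureTensor_mul x y).trans (congrArg pureTensor (funext h))

lemma pureTensor_piecewise_insert (d : Fin n → B) {i : Fin n} {s : Finset (Fin n)} (hi : i ∉ s) :
    pureTensor ((insert i s).piecewise d 1) = inFactor i (d i) * pureTensor (s.piecewise d 1) := by
  refine (pureTensor_mul_eq fun j => ?_).symm
  by_cases hj : j = i
  · subst hj
    simp [hi]
  · by_cases hjs : j ∈ s <;> simp [hj, hjs]

lemma map_pureTensor_congr {B' : Type} [Ring B'] [Algebra ℂ B']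
    {F : TensorPower n B →ₐ[ℂ] C} {G : TensorPower n B' →ₐ[ℂ] C} {b : Fin n → B} {b' : Fin n → B'}
    (h : ∀ i, F (inFactor i (b i)) = G (inFactor i (b' i))) : F (pureTensor b) = G (pureTensor b') := by
  have key : ∀ s : Finset (Fin n),
      F (pureTensor (s.piecewise b 1)) = G (pureTensor (s.piecewise b' 1)) := fun s => by
    induction s using Finset.induction_on with
    | empty => simp only [Finset.piecewise_empty, pureTensor_one, map_one]
    | insert i s hi ih =>
      simp only [pureTensor_piecewise_insert _ hi, map_mul, h, ih]
  simpa only [Finset.piecewise_univ] using key univ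

lemma map_prod_eq_pureTensor {R : Type*} [CommRing R] [Algebra ℂ R] (F : R →ₐ[ℂ] TensorPower n B)
    {z : Fin n → R} {b : Fin n → B} (h : ∀ i, F (z i) = inFactor i (b i)) :
    F (∏ i, z i) = pureTensor b := by
  have key : ∀ s : Finset (Fin n), F (∏ i ∈ s, z i) = pureTensor (s.piecewise b 1) := fun s => by
    induction s using Finset.induction_on with
    | empty => simp only [Finset.piecewise_empty, pureTensor_one, map_one, prod_empty]
    | insert i s hi ih => rw [pureTensor_piecewise_insert _ hi, prod_insert hi, map_mul, h, ih]
  simpa only [Finset.piecewise_univ] using key univ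

lemma commute_pureTensor {b : Fin n → B} (hb : ∀ i c, Commute (b i) c) (x : TensorPower n B) :
    Commute (pureTensor b) x := by
  induction x using induction_on with
  | h c y =>
    refine Commute.smul_right ?_ c
    exact (pureTensor_mul_eq fun i => hb i (y i)).trans (pureTensor_mul y b).symm
  | hadd x y hx hy => exact hx.add_right hy

lemma inFactor_mul_comm {i j : Fin n} (h : i ≠ j) (b c : B) :
    Commute (inFactor i b) (inFactor j c) := by
  refine (pureTensor_mul_eq fun k => ?_).trans (pureTensor_mul _ _).symm
  by_cases hk : k = i
  · subst hk
    simp [update_of_ne h]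
  · simp [update_of_ne hk]

end TensorPower

open HypertoricO.TensorPower (inFactorHom inFactorHom_apply pureTensor_one pureTensor_mul_eq map_pureTensor_congr map_prod_eq_pureTensor)

/-! ### The Betti algebra as a twisted matrix ring -/

namespace TwMat

variable {I R R' A : Type} [CommRing R] [CommRing R'] [Fintype I] [DecidableEq I]
  {κ : Cocycle I R} {κ' : Cocycle I R'} [Ring A] [Algebra ℂ A] [Algebra ℂ R] [Algebra ℂ R']

/-- The homomorphism out of a twisted matrix ring defined by a central action of `R` and a system of
matrix units. -/
def lift (ρ : R →ₐ[ℂ] A) (hρ : ∀ r a, Commute (ρ r) a) (u : I → I → A)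
    (h1 : ∀ a b c, u a b * u b c = ρ (κ.val a b c) * u a c)
    (h2 : ∀ a b b' c, b ≠ b' → u a b * u b' c = 0) (h3 : ∑ a, u a a = 1) : TwMat κ →ₐ[ℂ] A where
  toFun x := ∑ a, ∑ b, ρ (x a b) * u a b
  map_zero' := by simp only [zero_apply, map_zero, zero_mul, sum_const_zero]
  map_add' x y := by simp only [add_apply, map_add, add_mul, sum_add_distrib]
  map_one' := by
    rw [← h3]
    refine sum_congr rfl fun a _ => ?_
    rw [sum_eq_single a]
    · rw [one_apply, if_pos rfl, map_one, one_mul]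
    · intro b _ hb
      rw [one_apply, if_neg hb.symm, map_zero, zero_mul]
    · simp
  map_mul' x y := by
    change (∑ a, ∑ b, ρ ((x * y) a b) * u a b) =
      (∑ a, ∑ b, ρ (x a b) * u a b) * (∑ a, ∑ b, ρ (y a b) * u a b)
    have h : ∀ a b b' c, ρ (x a b) * u a b * (ρ (y b' c) * u b' c) =
        if b = b' then ρ (κ.val a b c * (x a b * y b c)) * u a c else 0 := by
      intro a b b' c
      have : ρ (x a b) * u a b * (ρ (y b' c) * u b' c) =
          ρ (x a b * y b' c) * (u a b * u b' c) := by
        rw [map_mul, mul_assoc, ← mul_assoc (u a b), ← (hρ (y b' c) (u a b)).eq, mul_assoc,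
          mul_assoc]
      rw [this]
      split_ifs with hb
      · subst hb
        rw [h1, ← mul_assoc, ← map_mul, mul_comm (κ.val a b c)]
      · rw [h2 _ _ _ _ hb, mul_zero]
    have h4 : (∑ a, ∑ b, ρ (x a b) * u a b) * (∑ a, ∑ b, ρ (y a b) * u a b) =
        ∑ a, ∑ b, ∑ c, ∑ d, if b = c then ρ (κ.val a b d * (x a b * y b d)) * u a d else 0 := by
      simp only [sum_mul]
      simp only [mul_sum, h]
    rw [h4]
    refine sum_congr rfl fun a _ => ?_
    have h' : ∀ b, (∑ c, ∑ d, if b = c then ρ (κ.val a b d * (x a b * y b d)) * u a d else 0) =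
        ∑ d, ρ (κ.val a b d * (x a b * y b d)) * u a d := fun b => by
      rw [sum_comm]
      simp
    rw [sum_congr rfl fun b _ => h' b, sum_comm]
    refine sum_congr rfl fun b _ => ?_
    rw [mul_apply, map_sum, sum_mul]
  commutes' c := by
    have : ∀ a b, ρ (algebraMap ℂ (TwMat κ) c a b) * u a b =
        if a = b then algebraMap ℂ A c * u a a else 0 := fun a b => by
      rw [algebraMap_eq, scalar_apply]
      split_ifs with h
      · subst h
        rw [AlgHom.commutes]
      · rw [map_zero, zero_mul]
    simp only [this, Finset.sum_ite_eq, mem_univ, if_true]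
    rw [← mul_sum, h3, mul_one]

/-- Change of coefficients. -/
def map (f : R →ₐ[ℂ] R') (h : ∀ a b c, f (κ.val a b c) = κ'.val a b c) : TwMat κ →ₐ[ℂ] TwMat κ' where
  toFun x := (fun a b => f (x a b) : I → I → R')
  map_zero' := by ext a b; exact map_zero f
  map_one' := by
    ext a b
    change f (if a = b then 1 else 0) = if a = b then 1 else 0
    split_ifs <;> simp
  map_add' x y := by ext a b; exact map_add f _ _
  map_mul' x y := by
    ext a b
    change f (∑ c, _) = ∑ c, _
    simp only [map_sum, map_mul, h]
  commutes' c := by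
    ext a b
    change f (if a = b then algebraMap ℂ R c else 0) = if a = b then algebraMap ℂ R' c else 0
    split_ifs <;> simp

lemma map_apply (f : R →ₐ[ℂ] R') (h : ∀ a b c, f (κ.val a b c) = κ'.val a b c) (x : TwMat κ)
    (a b : I) : map f h x a b = f (x a b) := rfl

lemma map_single (f : R →ₐ[ℂ] R') (h : ∀ a b c, f (κ.val a b c) = κ'.val a b c) (a b : I) (r : R) :
    map f h (single a b r) = single a b (f r) := by
  ext a' b'
  rw [map_apply, single_apply, single_apply]
  split_ifs <;> simp

lemma map_scalar (f : R →ₐ[ℂ] R') (h : ∀ a b c, f (κ.val a b c) = κ'.val a b c) (r : R) :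
    map f h (scalar κ r) = scalar κ' (f r) := by
  ext a' b'
  rw [map_apply, scalar_apply, scalar_apply]
  split_ifs <;> simp

end TwMat

section OneFactor

variable {R : Type} [CommRing R] [Algebra ℂ R]

/-- The cocycle of the multiplication of the straight paths between two vertices. -/
def arrowCocycle (z : R) : Cocycle Bool R where
  val a b c := if a = c ∧ b ≠ a then z else 1
  left _ _ := if_neg fun h => h.2 rfl
  right _ _ := if_neg fun h => h.2 h.1.symm
  assoc a b c d := by cases a <;> cases b <;> cases c <;> cases d <;> simp

/-- The representation of the path algebra by twisted matrices. -/
def matrixRep (z : R) : PathAlg.Rep (TwMat (arrowCocycle z)) where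
  e s := TwMat.single s s 1
  down := TwMat.single true false 1
  up := TwMat.single false true 1
  orth :=
    { idem := fun s => by
        rw [IsIdempotentElem, TwMat.single_mul_single, Cocycle.left, one_mul, one_mul]
      ortho := fun s s' h => by
        refine TwMat.ext fun a b => ?_
        rw [TwMat.single_mul_apply, TwMat.single_apply, if_neg (c := s' = s ∧ s' = b) (fun h' => h h'.1.symm),
          mul_zero, mul_zero, ite_self, TwMat.zero_apply] }
  complete := by
    ext a b
    rw [TwMat.add_apply, TwMat.single_apply, TwMat.single_apply, TwMat.one_apply]
    cases a <;> cases b <;> simp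
  down_source := by rw [TwMat.single_mul_single, Cocycle.left, one_mul, one_mul]
  down_target := by rw [TwMat.single_mul_single, Cocycle.right, one_mul, one_mul]
  up_source := by rw [TwMat.single_mul_single, Cocycle.left, one_mul, one_mul]
  up_target := by rw [TwMat.single_mul_single, Cocycle.right, one_mul, one_mul]

lemma matrixRep_arrow (z : R) (s t : Bool) :
    (matrixRep z).hom (arrow s t) = TwMat.single s t 1 := by
  cases s <;> cases t
  exacts [(matrixRep z).hom_e _, (matrixRep z).hom_up, (matrixRep z).hom_down, (matrixRep z).hom_e _]

lemma matrixRep_loop (z : R) :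
    (matrixRep z).hom loop = scalar (arrowCocycle z) z := by
  rw [PathAlg.Rep.hom_loop]
  change TwMat.single true false 1 * TwMat.single false true 1 +
    TwMat.single false true 1 * TwMat.single true false 1 = _
  ext a b
  rw [TwMat.single_mul_single, TwMat.single_mul_single, TwMat.add_apply, TwMat.single_apply,
    TwMat.single_apply, scalar_apply]
  cases a <;> cases b <;> simp [arrowCocycle]

end OneFactor

section Factors

variable {n : ℕ}

/-- The invertible functions `t^g` on the torus. -/
def torusUnits : Multiplicative (Fin n → ℤ) →* (Laurent n)ˣ := (of ℂ (Fin n → ℤ)).toHomUnits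

/-- The representation of the `i`-th factor of the Betti algebra. -/
def factorHom (i : Fin n) : ABet1 →ₐ[ℂ] TwMat (arrowCocycle (coordZ i)) :=
  ABet1.lift (matrixRep (coordZ i)).hom (by
    rw [map_sub, map_one, matrixRep_loop, ← map_one (scalar _), ← map_sub, coordZ, sub_sub_cancel]
    exact (torusUnits (Multiplicative.ofAdd (Pi.single i 1))).isUnit.map
      (scalar (arrowCocycle (coordZ i))))

lemma factorHom_arrow (i : Fin n) (s t : Bool) :
    factorHom i (toABet1 (arrow s t)) = TwMat.single s t 1 :=
  (ABet1.lift_toABet1 _ _ _).trans (matrixRep_arrow _ _ _)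

lemma factorHom_monodromy (i : Fin n) (k : ℤ) :
    factorHom i ((monodromyUnit ^ k : ABet1ˣ) : ABet1) = scalar _ (single (Pi.single i k) 1) := by
  let t : (Laurent n)ˣ := torusUnits (Multiplicative.ofAdd (Pi.single i 1))
  have h1 : Units.map (factorHom i).toMonoidHom monodromyUnit =
      Units.map (scalar (arrowCocycle (coordZ i))).toMonoidHom t := by
    apply Units.ext
    refine (ABet1.lift_toABet1 _ _ (1 - loop)).trans ?_
    rw [map_sub, map_one, matrixRep_loop, ← map_one (scalar _), ← map_sub, coordZ, sub_sub_cancel]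
    rfl
  have h2 := congrArg (fun u => u ^ k) h1
  rw [← map_zpow, ← map_zpow, ← map_zpow torusUnits, ← ofAdd_zsmul] at h2
  have h3 : k • (Pi.single i 1 : Fin n → ℤ) = Pi.single i k := by
    rw [← Pi.single_smul, smul_eq_mul, mul_one]
  rw [h3] at h2
  exact congrArg Units.val h2

/-- The entry `(γ, β)` of the representation of the Betti algebra. -/
def bettiEntry (γ β : SignVector n) : MultilinearMap ℂ (fun _ : Fin n => ABet1) (Laurent n) :=
  (MultilinearMap.mkPiAlgebra ℂ (Fin n) (Laurent n)).compLinearMap fun i =>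
    { toFun := fun b => factorHom i b (γ i) (β i)
      map_add' := fun b c => by rw [map_add, TwMat.add_apply]
      map_smul' := fun c b => by rw [map_smul, TwMat.smul_apply]; rfl }

/-- The matrix of a pure tensor. -/
def bettiMatrix (b : Fin n → ABet1) : TwMat (signCocycle (coordZ (n := n)) id) :=
  (fun γ β => bettiEntry γ β b : SignVector n → SignVector n → Laurent n)

lemma bettiMatrix_apply (b : Fin n → ABet1) (γ β : SignVector n) :
    bettiMatrix b γ β = ∏ i, factorHom i (b i) (γ i) (β i) := rfl

lemma bettiMatrix_smul_apply (c : ℂ) (b : Fin n → ABet1) (γ β : SignVector n) :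
    (c • bettiMatrix b) γ β = c • bettiMatrix b γ β := TwMat.smul_apply c (bettiMatrix b) γ β

/-- The representation of the Betti algebra by twisted matrices, on pure tensors. -/
def bettiMultilinear : MultilinearMap ℂ (fun _ : Fin n => ABet1)
    (TwMat (signCocycle (coordZ (n := n)) id)) where
  toFun := bettiMatrix
  map_update_add' b i x y := TwMat.ext fun γ β => (bettiEntry γ β).map_update_add b i x y
  map_update_smul' b i c x := TwMat.ext fun γ β => by
    refine ((bettiEntry γ β).map_update_smul b i c x).trans ?_
    exact (bettiMatrix_smul_apply c (update b i x) γ β).symm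

/-- The representation of the Betti algebra by twisted matrices over the functions on the torus. -/
def bettiHom : ABet n →ₐ[ℂ] TwMat (signCocycle (coordZ (n := n)) id) :=
  TensorPower.lift bettiMultilinear
    (by
      change bettiMatrix 1 = 1
      refine TwMat.ext fun γ β => ?_
      rw [bettiMatrix_apply, TwMat.one_apply]
      simp only [Pi.one_apply, map_one, TwMat.one_apply]
      rw [prod_ite_zero, prod_const_one]
      simp only [mem_univ, true_implies, funext_iff])
    (fun x y => by
      change bettiMatrix (x * y) = bettiMatrix x * bettiMatrix y
      refine TwMat.ext fun γ β => ?_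
      rw [bettiMatrix_apply, TwMat.mul_apply]
      simp only [Pi.mul_apply, map_mul, TwMat.mul_apply, Finset.prod_univ_sum,
        Fintype.piFinset_univ, prod_mul_distrib]
      rfl)

lemma bettiHom_pureTensor (b : Fin n → ABet1) : bettiHom (pureTensor b) = bettiMatrix b :=
  TensorPower.lift_pureTensor _ _ _ b

/-- The straight path from `γ` to `β` in the cube. -/
def bettiPath (γ β : SignVector n) : ABet n := pureTensor fun i => toABet1 (arrow (γ i) (β i))

lemma bettiPath_self (γ : SignVector n) : bettiPath γ γ = idemBet γ := by
  simp only [bettiPath, idemBet, arrow_self]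

lemma bettiHom_bettiPath (γ β : SignVector n) : bettiHom (bettiPath γ β) = TwMat.single γ β 1 := by
  refine TwMat.ext fun γ' β' => ?_
  rw [bettiPath, bettiHom_pureTensor, bettiMatrix_apply, TwMat.single_apply]
  simp only [factorHom_arrow, TwMat.single_apply]
  rw [prod_ite_zero, prod_const_one]
  simp only [mem_univ, true_implies, funext_iff, forall_and]

lemma bettiHom_monodromy (g : Fin n → ℤ) :
    bettiHom (pureTensor fun i => ((monodromyUnit ^ g i : ABet1ˣ) : ABet1)) =
      scalar _ (single g 1) := by
  refine TwMat.ext fun γ β => ?_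
  rw [bettiHom_pureTensor, bettiMatrix_apply, scalar_apply]
  simp only [factorHom_monodromy, scalar_apply]
  rw [prod_ite_zero]
  simp only [mem_univ, forall_const]
  by_cases hγ : γ = β
  · rw [if_pos hγ, if_pos (congrFun hγ)]
    refine (map_prod (of ℂ (Fin n → ℤ)) (fun i => Multiplicative.ofAdd (Pi.single i (g i)))
      univ).symm.trans ?_
    rw [← ofAdd_sum, Finset.univ_sum_single]
    rfl
  · rw [if_neg hγ, if_neg fun h => hγ (funext h)]

/-- The action of the functions on the torus on the Betti algebra by monodromy. -/
def torusAction : Laurent n →ₐ[ℂ] ABet n :=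
  lift ℂ (ABet n) (Fin n → ℤ)
    { toFun := fun g => pureTensor fun i =>
        ((monodromyUnit ^ (Multiplicative.toAdd g) i : ABet1ˣ) : ABet1)
      map_one' := by
        refine Eq.trans ?_ (pureTensor_one (n := n) (B := ABet1))
        congr 1
      map_mul' := fun g h => by
        refine (pureTensor_mul_eq fun i => ?_).symm
        rw [← Units.val_mul, ← zpow_add]
        rfl }

lemma torusAction_single (g : Fin n → ℤ) :
    torusAction (single g 1) = pureTensor fun i => ((monodromyUnit ^ g i : ABet1ˣ) : ABet1) := by
  rw [torusAction, lift_single, one_smul]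
  rfl

lemma single_eq_smul (g : Fin n → ℤ) (c : ℂ) : (single g c : Laurent n) = c • single g 1 := by
  rw [smul_single, smul_eq_mul, mul_one]

lemma bettiHom_torusAction (f : Laurent n) : bettiHom (torusAction f) = scalar _ f := by
  induction f using induction_linear with
  | zero => rw [map_zero, map_zero, map_zero]
  | add x y hx hy => rw [map_add, map_add, map_add, hx, hy]
  | single g c =>
    rw [single_eq_smul, map_smul, map_smul, torusAction_single, bettiHom_monodromy]
    refine TwMat.ext fun a b => ?_
    rw [TwMat.smul_apply, scalar_apply, scalar_apply]
    split_ifs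
    · rfl
    · rw [smul_zero]

lemma torusAction_comm (f : Laurent n) (x : ABet n) : Commute (torusAction f) x := by
  induction f using induction_linear with
  | zero => rw [map_zero]; exact Commute.zero_left x
  | add f g hf hg => rw [map_add]; exact hf.add_left hg
  | single g c =>
    rw [single_eq_smul, map_smul, torusAction_single]
    refine Commute.smul_left (TensorPower.commute_pureTensor (fun i b => ?_) x) c
    have hu : ∀ k : ℤ, Commute ((monodromyUnit ^ k : ABet1ˣ) : ABet1) b :=
      fun k => (ABet1.monodromy_comm b).symm.units_zpow_right k |>.symm
    exact hu (g i)

end Factors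

section BettiIso

variable {n : ℕ}

lemma sum_pureTensor {B : Type} [Ring B] [Algebra ℂ B] (e : Bool → B) (h : e true + e false = 1) :
    ∑ α : SignVector n, pureTensor (fun i => e (α i)) = 1 := by
  have h1 := (PiTensorProduct.tprod ℂ (s := fun _ : Fin n => B)).map_sum fun _ => e
  simp only [Fintype.sum_bool, h] at h1
  exact h1.symm

lemma sum_idemBet : ∑ α : SignVector n, idemBet α = 1 := by
  refine sum_pureTensor (fun s => toABet1 (PathAlg.e s)) ?_
  rw [← map_add, e_complete, map_one]

lemma torusAction_single_single (i : Fin n) :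
    torusAction (single (Pi.single i 1) 1) = inFactor i (monodromyUnit : ABet1) := by
  refine (torusAction_single _).trans (congrArg pureTensor (funext fun j => ?_))
  by_cases hj : j = i
  · subst hj
    rw [Pi.single_eq_same, zpow_one, update_self]
  · rw [Pi.single_eq_of_ne hj, zpow_zero, update_of_ne hj]
    rfl

lemma torusAction_coordZ (i : Fin n) :
    torusAction (coordZ i) = inFactor i (toABet1 loop) := by
  have h1 : (toABet1 loop : ABet1) = 1 - (monodromyUnit : ABet1) := by
    rw [← ABet1.toABet1_eq, map_sub, map_one, sub_sub_cancel]
  rw [h1, ← inFactorHom_apply, map_sub, map_one, coordZ, map_sub, map_one, torusAction_single_single]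
  rfl

lemma torusAction_coordZ' (i : Fin n) : torusAction (coordZ i) = paramBet i := by
  rw [torusAction_coordZ, paramBet, ← inFactorHom_apply,
    ← inFactorHom_apply, ← ABet1.toABet1_eq, map_sub, map_one, map_sub, map_one,
    sub_sub_cancel]

lemma torusAction_signVal (α β γ : SignVector n) :
    torusAction (signVal coordZ α β γ) = pureTensor fun i =>
      if α i = γ i ∧ β i ≠ α i then toABet1 loop else 1 := by
  refine map_prod_eq_pureTensor _ fun i => ?_
  split_ifs
  · exact torusAction_coordZ i
  · rw [map_one, ← inFactorHom_apply, map_one]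

lemma bettiPath_mul (α β γ : SignVector n) :
    bettiPath α β * bettiPath β γ = torusAction (signVal coordZ α β γ) * bettiPath α γ := by
  rw [torusAction_signVal]
  refine (pureTensor_mul_eq fun i => ?_).trans (pureTensor_mul_eq fun i => rfl).symm
  rw [← map_mul, arrow_mul_arrow, map_mul]
  split_ifs
  · rfl
  · rw [map_one]

lemma bettiPath_mul_of_ne (α β β' γ : SignVector n) (h : β ≠ β') :
    bettiPath α β * bettiPath β' γ = 0 := by
  obtain ⟨i, hi⟩ := Function.ne_iff.1 h
  rw [bettiPath, bettiPath, pureTensor_mul]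
  refine (PiTensorProduct.tprod ℂ).map_coord_zero i ?_
  rw [Pi.mul_apply, ← map_mul, arrow_mul_arrow_of_ne _ _ hi, map_zero]

/-- The inverse of `bettiHom`. -/
def bettiInv : TwMat (signCocycle (coordZ (n := n)) id) →ₐ[ℂ] ABet n :=
  TwMat.lift torusAction torusAction_comm bettiPath bettiPath_mul bettiPath_mul_of_ne
    (by simp only [bettiPath_self, sum_idemBet])

lemma bettiInv_apply (x : TwMat (signCocycle (coordZ (n := n)) id)) :
    bettiInv x = ∑ a, ∑ b, torusAction (x a b) * bettiPath a b := rfl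

lemma idemBet_mul_bettiInv_mul (x : TwMat (signCocycle (coordZ (n := n)) id))
    (γ β : SignVector n) :
    idemBet γ * bettiInv x * idemBet β = torusAction (x γ β) * bettiPath γ β := by
  have h1 : idemBet γ * bettiInv x = ∑ b, torusAction (x γ b) * bettiPath γ b := by
    rw [bettiInv_apply, mul_sum, sum_eq_single γ]
    · rw [mul_sum]
      refine sum_congr rfl fun b _ => ?_
      rw [← mul_assoc, ← (torusAction_comm _ _).eq, mul_assoc, ← bettiPath_self, bettiPath_mul,
        signVal_left, map_one, one_mul]
    · intro a _ ha
      rw [mul_sum]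
      refine sum_eq_zero fun b _ => ?_
      rw [← mul_assoc, ← (torusAction_comm _ _).eq, mul_assoc, ← bettiPath_self,
        bettiPath_mul_of_ne _ _ _ _ ha.symm, mul_zero]
    · simp
  rw [h1, sum_mul, sum_eq_single β]
  · rw [mul_assoc, ← bettiPath_self, bettiPath_mul, signVal_right, map_one, one_mul]
  · intro b _ hb
    rw [mul_assoc, ← bettiPath_self, bettiPath_mul_of_ne _ _ _ _ hb, mul_zero]
  · simp

lemma ext_idemBet {x y : ABet n}
    (h : ∀ γ β, idemBet γ * x * idemBet β = idemBet γ * y * idemBet β) : x = y := by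
  have h1 : ∀ z : ABet n, z = ∑ γ, ∑ β, idemBet γ * z * idemBet β := fun z => by
    simp only [← mul_sum, ← sum_mul, sum_idemBet, one_mul, mul_one]
  rw [h1 x, h1 y]
  simp only [h]

lemma bettiInv_bettiHom_arrow (i : Fin n) (s t : Bool) :
    bettiInv (bettiHom (inFactor i (toABet1 (arrow s t)))) = inFactor i (toABet1 (arrow s t)) := by
  refine ext_idemBet fun γ β => ?_
  rw [idemBet_mul_bettiInv_mul, inFactor, bettiHom_pureTensor, bettiMatrix_apply, idemBet, idemBet,
    pureTensor_mul, pureTensor_mul]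
  have hf : ∀ j, factorHom j ((update 1 i (toABet1 (arrow s t)) : Fin n → ABet1) j)
      (γ j) (β j) = if (if j = i then s = γ j ∧ t = β j else γ j = β j) then 1 else 0 := fun j => by
    by_cases hj : j = i
    · subst hj
      rw [update_self, factorHom_arrow, TwMat.single_apply]
      simp only [if_true]
    · rw [update_of_ne hj, Pi.one_apply, map_one, TwMat.one_apply]
      simp only [hj, if_false]
  simp only [hf]
  rw [prod_ite_zero, prod_const_one]
  simp only [mem_univ, forall_const]
  by_cases h : ∀ j, if j = i then s = γ j ∧ t = β j else γ j = β j
  · rw [if_pos h, map_one, one_mul, bettiPath]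
    congr 1
    funext j
    rw [Pi.mul_apply, Pi.mul_apply]
    have hj' := h j
    by_cases hj : j = i
    · subst hj
      rw [if_pos rfl] at hj'
      rw [update_self, ← map_mul, ← map_mul, ← hj'.1, ← hj'.2, e_mul_arrow, arrow_mul_e]
    · rw [if_neg hj] at hj'
      rw [update_of_ne hj, Pi.one_apply, mul_one, ← map_mul, hj', arrow_self,
        PathAlg.e_orthogonal.idem]
  · rw [if_neg h, map_zero, zero_mul]
    push Not at h
    obtain ⟨j, hj'⟩ := h
    refine ((PiTensorProduct.tprod ℂ).map_coord_zero j ?_).symm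
    rw [Pi.mul_apply, Pi.mul_apply]
    by_cases hj : j = i
    · subst hj
      rw [if_pos rfl] at hj'
      rw [update_self, ← map_mul, ← map_mul]
      by_cases hs : s = γ j
      · have ht : t ≠ β j := fun ht => hj' ⟨hs, ht⟩
        rw [mul_assoc, ← arrow_self (β j), arrow_mul_arrow_of_ne _ _ ht, mul_zero, map_zero]
      · rw [← arrow_self (γ j), arrow_mul_arrow_of_ne _ _ fun h => hs h.symm, zero_mul, map_zero]
    · rw [if_neg hj] at hj'
      rw [update_of_ne hj, Pi.one_apply, mul_one, ← map_mul,
        PathAlg.e_orthogonal.ortho hj', map_zero]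

lemma bettiInv_bettiHom (x : ABet n) : bettiInv (bettiHom x) = x := by
  have h : bettiInv.comp bettiHom = AlgHom.id ℂ (ABet n) := TensorPower.hom_ext fun i b => by
    have h1 : (bettiInv.comp bettiHom).comp (inFactorHom i) =
        (inFactorHom i : ABet1 →ₐ[ℂ] ABet n) := by
      refine ABet1.hom_ext fun x => ?_
      have h2 : ((bettiInv.comp bettiHom).comp (inFactorHom i)).comp toABet1 =
          (inFactorHom i : ABet1 →ₐ[ℂ] ABet n).comp toABet1 := by
        refine PathAlg.hom_ext (fun s => ?_) ?_ ?_
        · rw [← arrow_self]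
          exact bettiInv_bettiHom_arrow i s s
        · exact bettiInv_bettiHom_arrow i true false
        · exact bettiInv_bettiHom_arrow i false true
      exact AlgHom.congr_fun h2 x
    exact AlgHom.congr_fun h1 b
  exact AlgHom.congr_fun h x

variable (P : PolarizedArrangement n)

/-- The cocharacter lattice of `G` as a subgroup. -/
def cocharSubgroup : AddSubgroup (Fin n → ℤ) where
  carrier := P.cocharG
  zero_mem' v _ := by simp
  add_mem' ha hb v hv := by
    simp only [Pi.add_apply, add_mul, sum_add_distrib, ha v hv, hb v hv, add_zero]
  neg_mem' ha v hv := by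
    simp only [Pi.neg_apply, neg_mul, Finset.sum_neg_distrib, ha v hv, neg_zero]

/-- The ring of functions on the dual of `F`. -/
abbrev DualRing : Type := Laurent n ⧸ augIdeal (cocharSubgroup P)

/-- The restrictions of the functions `1 - t_i` to the dual of `F`. -/
def dualZ (i : Fin n) : DualRing P := Ideal.Quotient.mk (augIdeal (cocharSubgroup P)) (coordZ i)

/-- The restriction of functions from the torus to the dual of `F`. -/
def toDualRing : Laurent n →ₐ[ℂ] DualRing P := Ideal.Quotient.mkₐ ℂ (augIdeal (cocharSubgroup P))

lemma toDualRing_surjective : Surjective (toDualRing P) := Ideal.Quotient.mk_surjective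

lemma toDualRing_single {g : Fin n → ℤ} (hg : g ∈ P.cocharG) :
    toDualRing P (single g 1) = 1 := by
  rw [← sub_eq_zero, ← map_one (toDualRing P), ← map_sub]
  exact Ideal.Quotient.eq_zero_iff_mem.2 (Ideal.subset_span ⟨g, hg, rfl⟩)

lemma signCocycle_dualZ_val {I : Type} (σ : I → SignVector n) (a b c : I) :
    (signCocycle (dualZ P) σ).val a b c = toDualRing P (signVal coordZ (σ a) (σ b) (σ c)) :=
  Shelling.mk_signVal (z := coordZ) (𝔞 := augIdeal (cocharSubgroup P)) (σ a) (σ b) (σ c)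

lemma toDualRing_val {I : Type} (σ : I → SignVector n) (a b c : I) :
    toDualRing P ((signCocycle coordZ σ).val a b c) = (signCocycle (dualZ P) σ).val a b c :=
  (signCocycle_dualZ_val P σ a b c).symm

/-- The representation of `A^Bet_n` by twisted matrices over the functions on the dual of `F`. -/
def bettiHomMod : ABet n →ₐ[ℂ] TwMat (signCocycle (dualZ P) id) :=
  (TwMat.map (κ := signCocycle coordZ id) (κ' := signCocycle (dualZ P) id) (toDualRing P)
    (toDualRing_val P id)).comp bettiHom

lemma bettiHomMod_bettiPath (γ β : SignVector n) :
    bettiHomMod P (bettiPath γ β) = TwMat.single γ β 1 := by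
  rw [bettiHomMod, AlgHom.comp_apply, bettiHom_bettiPath, TwMat.map_single, map_one]

lemma bettiHomMod_torusAction (f : Laurent n) :
    bettiHomMod P (torusAction f) = scalar _ (toDualRing P f) := by
  rw [bettiHomMod, AlgHom.comp_apply, bettiHom_torusAction, TwMat.map_scalar]

/-- The representation of `A^Bet_G` by twisted matrices. -/
def bettiHomG : ABetG P →ₐ[ℂ] TwMat (signCocycle (dualZ P) id) :=
  QuotientBy.lift (bettiHomMod P) (by
    rintro _ ⟨g, hg, rfl⟩
    rw [← torusAction_single, map_sub, bettiHomMod_torusAction, toDualRing_single P hg, map_one,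
      map_one, sub_self])

lemma bettiHomG_projBet (x : ABet n) : bettiHomG P (projBet P x) = bettiHomMod P x := rfl

lemma projBet_surjective : Surjective (projBet P) := mk_surjective _

/-- The action of the functions on the dual of `F` on `A^Bet_G`. -/
def dualAction : DualRing P →ₐ[ℂ] ABetG P :=
  Ideal.Quotient.liftₐ (augIdeal (cocharSubgroup P)) ((projBet P).comp torusAction) (by
    intro f hf
    have h : augIdeal (cocharSubgroup P) ≤ RingHom.ker ((projBet P).comp torusAction) := by
      refine Ideal.span_le.2 ?_
      rintro _ ⟨g, hg, rfl⟩
      change projBet P (torusAction _) = 0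
      rw [map_sub, map_one, torusAction_single]
      exact mk_eq_zero ⟨g, hg, rfl⟩
    exact h hf)

lemma dualAction_mk (f : Laurent n) :
    dualAction P (toDualRing P f) = projBet P (torusAction f) := rfl

/-- The inverse of `bettiHomG`. -/
def bettiInvG : TwMat (signCocycle (dualZ P) id) →ₐ[ℂ] ABetG P :=
  TwMat.lift (dualAction P)
    (fun r x => by
      obtain ⟨f, rfl⟩ := toDualRing_surjective P r
      obtain ⟨y, rfl⟩ := projBet_surjective P x
      exact (torusAction_comm f y).map (projBet P))
    (fun γ β => projBet P (bettiPath γ β))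
    (fun a b c => by
      rw [← map_mul, bettiPath_mul, map_mul, signCocycle_dualZ_val, dualAction_mk]
      rfl)
    (fun a b b' c h => by rw [← map_mul, bettiPath_mul_of_ne _ _ _ _ h, map_zero])
    (by simp only [bettiPath_self, ← map_sum, sum_idemBet, map_one])

lemma bettiInvG_bettiHomG (x : ABetG P) : bettiInvG P (bettiHomG P x) = x := by
  obtain ⟨y, rfl⟩ := projBet_surjective P x
  rw [bettiHomG_projBet]
  have h : bettiInvG P (bettiHomMod P y) = projBet P (bettiInv (bettiHom y)) := by
    rw [bettiInv_apply]
    simp only [map_sum, map_mul]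
    rfl
  rw [h, bettiInv_bettiHom]

lemma bettiHomG_bettiInvG (x : TwMat (signCocycle (dualZ P) id)) :
    bettiHomG P (bettiInvG P x) = x := by
  change bettiHomG P (∑ a, ∑ b, dualAction P (x a b) * projBet P (bettiPath a b)) = x
  have h : ∀ a b, bettiHomG P (dualAction P (x a b) * projBet P (bettiPath a b)) =
      TwMat.single a b (x a b) := fun a b => by
    obtain ⟨f, hf⟩ := toDualRing_surjective P (x a b)
    rw [← hf, dualAction_mk, map_mul, bettiHomG_projBet, bettiHomG_projBet,
      bettiHomMod_torusAction, bettiHomMod_bettiPath]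
    refine TwMat.ext fun a' b' => ?_
    rw [TwMat.scalar_mul_apply, TwMat.single_apply, TwMat.single_apply]
    split_ifs <;> simp
  simp only [map_sum, h]
  exact (TwMat.eq_sum_single x).symm

end BettiIso

/-- The set of feasible sign vectors. -/
notation "𝓕" P:max => Set.ofPred fun α => PolarizedArrangement.Feasible P α

section Feasible

variable {n : ℕ} (P : PolarizedArrangement n)

/-- The feasible sign vectors. -/
abbrev FeasibleVec : Type := {α : SignVector n // P.Feasible α}

instance : Fintype (FeasibleVec P) := Fintype.ofFinite _

/-- The matrix with the idempotent entries at the vertices in `T`. -/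
def diag {I R : Type} [CommRing R] [Fintype I] [DecidableEq I] (κ : Cocycle I R)
    (T : Set I) : TwMat κ :=
  open Classical in ∑ a with a ∈ T, TwMat.single a a 1

section Diag

variable {I R : Type} [CommRing R] [Fintype I] [DecidableEq I] {κ : Cocycle I R} {T : Set I}

open Classical in
lemma diag_apply (a b : I) :
    diag κ T a b = if a = b ∧ a ∈ T then 1 else 0 := by
  rw [diag, TwMat.sum_apply]
  simp only [TwMat.single_apply]
  by_cases h : a = b ∧ a ∈ T
  · obtain ⟨rfl, h⟩ := h
    rw [if_pos ⟨rfl, h⟩, sum_eq_single a]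
    · exact if_pos ⟨rfl, rfl⟩
    · intro c _ hc
      exact if_neg fun h => hc h.1
    · intro h'
      exact absurd (mem_filter.2 ⟨mem_univ _, h⟩) h'
  · rw [if_neg h]
    refine sum_eq_zero fun c hc => if_neg ?_
    rintro ⟨rfl, rfl⟩
    exact h ⟨rfl, (mem_filter.1 hc).2⟩

open Classical in
lemma TwMat.mul_diag_apply (x : TwMat κ) (a b : I) :
    (x * diag κ T) a b = if b ∈ T then x a b else 0 := by
  rw [TwMat.mul_apply, sum_eq_single b]
  · rw [diag_apply, κ.right, one_mul]
    by_cases h : b ∈ T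
    · rw [if_pos ⟨rfl, h⟩, if_pos h, mul_one]
    · rw [if_neg fun h' => h h'.2, if_neg h, mul_zero]
  · intro c _ hc
    rw [diag_apply, if_neg fun h => hc h.1, mul_zero, mul_zero]
  · simp

open Classical in
lemma diag_mul_apply (x : TwMat κ) (a b : I) :
    (diag κ T * x) a b = if a ∈ T then x a b else 0 := by
  rw [TwMat.mul_apply, sum_eq_single a]
  · rw [diag_apply, κ.left, one_mul]
    by_cases h : a ∈ T
    · rw [if_pos ⟨rfl, h⟩, if_pos h, one_mul]
    · rw [if_neg fun h' => h h'.2, if_neg h, zero_mul]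
  · intro c _ hc
    rw [diag_apply, if_neg fun h => hc h.1.symm, zero_mul, mul_zero]
  · simp

lemma TwMat.diag_mem_idealOf : diag κ T ∈ TwMat.idealOf κ T := by
  classical
  exact sum_mem fun δ hδ => TwMat.single_mem_idealOf (mem_filter.1 hδ).2

end Diag

lemma bettiHomG_sumIdem (T : Set (SignVector n)) :
    bettiHomG P (sumIdem (projBet P ∘ idemBet) T) = diag _ T := by
  classical
  rw [sumIdem, map_sum, diag]
  refine sum_congr rfl fun α _ => ?_
  rw [Function.comp_apply, bettiHomG_projBet, ← bettiPath_self, bettiHomMod_bettiPath]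

lemma bettiHomG_corner_mul (x : ABett P) :
    bettiHomG P x.1 * diag _ (𝓕 P) = bettiHomG P x.1 := by
  rw [← bettiHomG_sumIdem, ← map_mul, corner_mul_right]

lemma bettiHomG_mul_corner (x : ABett P) :
    diag _ (𝓕 P) * bettiHomG P x.1 = bettiHomG P x.1 := by
  rw [← bettiHomG_sumIdem, ← map_mul, corner_mul_left]

lemma bettiHomG_corner_right (x : ABett P) {a b : SignVector n} (hb : ¬ P.Feasible b) :
    bettiHomG P x.1 a b = 0 := by
  rw [← bettiHomG_corner_mul, TwMat.mul_diag_apply]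
  exact if_neg hb

lemma bettiHomG_corner_left (x : ABett P) {a b : SignVector n} (ha : ¬ P.Feasible a) :
    bettiHomG P x.1 a b = 0 := by
  rw [← bettiHomG_mul_corner, diag_mul_apply]
  exact if_neg ha

/-- The cocycle of the feasible sign vectors. -/
abbrev feasibleCocycle : Cocycle (FeasibleVec P) (DualRing P) := signCocycle (dualZ P) Subtype.val

/-- The block of a matrix at the feasible sign vectors. -/
def feasibleBlock (x : TwMat (signCocycle (dualZ P) id)) : TwMat (feasibleCocycle P) :=
  (fun a b => x a.1 b.1 : FeasibleVec P → FeasibleVec P → DualRing P)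

/-- The representation of `A^Bet_G(t,-)` by twisted matrices. -/
def feasibleHom : ABett P →+* TwMat (feasibleCocycle P) where
  toFun x := feasibleBlock P (bettiHomG P x.1)
  map_zero' := by
    refine TwMat.ext fun a b => ?_
    change bettiHomG P 0 a.1 b.1 = 0
    rw [map_zero, TwMat.zero_apply]
  map_add' x y := by
    refine TwMat.ext fun a b => ?_
    change bettiHomG P (x.1 + y.1) a.1 b.1 = bettiHomG P x.1 a.1 b.1 + bettiHomG P y.1 a.1 b.1
    rw [map_add, TwMat.add_apply]
  map_one' := by
    classical
    refine TwMat.ext fun a b => ?_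
    change bettiHomG P (sumIdem (projBet P ∘ idemBet) (𝓕 P)) a.1 b.1 = _
    rw [bettiHomG_sumIdem, diag_apply, TwMat.one_apply]
    by_cases h : a = b
    · subst h
      rw [if_pos rfl, if_pos ⟨rfl, a.2⟩]
    · rw [if_neg h, if_neg fun h' => h (Subtype.ext h'.1)]
  map_mul' x y := by
    classical
    refine TwMat.ext fun a c => ?_
    change bettiHomG P (x.1 * y.1) a.1 c.1 =
      ∑ b : FeasibleVec P, (signCocycle (dualZ P) id).val a.1 b.1 c.1 *
        (bettiHomG P x.1 a.1 b.1 * bettiHomG P y.1 b.1 c.1)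
    rw [map_mul, TwMat.mul_apply]
    rw [← Finset.sum_subtype (univ.filter P.Feasible) (by simp) fun b =>
      (signCocycle (dualZ P) id).val a.1 b c.1 * (bettiHomG P x.1 a.1 b * bettiHomG P y.1 b c.1)]
    refine (Finset.sum_filter_of_ne fun b _ hb => ?_).symm
    by_contra h
    rw [bettiHomG_corner_right P x h, zero_mul, mul_zero] at hb
    exact hb rfl

lemma feasibleHom_apply (x : ABett P) (a b : FeasibleVec P) :
    feasibleHom P x a b = bettiHomG P x.1 a.1 b.1 := rfl

lemma feasibleHom_bijective : Bijective (feasibleHom P) := by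
  classical
  constructor
  · rw [injective_iff_map_eq_zero]
    intro x hx
    apply Subtype.ext
    rw [← bettiInvG_bettiHomG P x.1]
    have h : bettiHomG P x.1 = 0 := TwMat.ext fun a b => by
      by_cases ha : P.Feasible a
      · by_cases hb : P.Feasible b
        · exact congrFun (congrFun hx ⟨a, ha⟩) ⟨b, hb⟩
        · exact bettiHomG_corner_right P x hb
      · exact bettiHomG_corner_left P x ha
    rw [h, map_zero]
    rfl
  · intro y
    let z : TwMat (signCocycle (dualZ P) id) := (fun a b =>
      if h : P.Feasible a ∧ P.Feasible b then y ⟨a, h.1⟩ ⟨b, h.2⟩ else 0 :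
        SignVector n → SignVector n → DualRing P)
    refine ⟨toCorner _ (bettiInvG P z), TwMat.ext fun a b => ?_⟩
    rw [feasibleHom_apply]
    change bettiHomG P (sumIdem (projBet P ∘ idemBet) (𝓕 P) * bettiInvG P z *
      sumIdem (projBet P ∘ idemBet) (𝓕 P)) a.1 b.1 = _
    rw [map_mul, map_mul, bettiHomG_bettiInvG, bettiHomG_sumIdem, TwMat.mul_diag_apply,
      if_pos (c := _ ∈ (𝓕 P)) b.2, diag_mul_apply,
      if_pos (c := _ ∈ (𝓕 P)) a.2]
    exact dif_pos ⟨a.2, b.2⟩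

lemma feasibleHom_idemUBet :
    feasibleHom P (idemUBet P) = diag _ {α | ¬ P.Bounded α.1} := by
  classical
  refine TwMat.ext fun a b => ?_
  rw [feasibleHom_apply, unboundedIdem_val, bettiHomG_sumIdem, diag_apply, diag_apply]
  by_cases h : a = b ∧ a ∈ {α : FeasibleVec P | ¬ P.Bounded α.1}
  · rw [if_pos h, if_pos ⟨congrArg _ h.1, a.2, h.2⟩]
  · rw [if_neg h, if_neg fun h' => h ⟨Subtype.ext h'.1, h'.2.2⟩]

/-- The kernel of the projection `A^Bet_G(t,-) → A^Bet_G(t,m)` consists of the matrices which factor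
through the unbounded sign vectors. -/
lemma iBet_eq_zero_iff (x : ABett P) :
    toStage (feasibleCocycle P) {α | ¬ P.Bounded α.1} (feasibleHom P x) = 0 ↔ iBet P x = 0 := by
  let e : ABett P ≃+* TwMat (feasibleCocycle P) := .ofBijective _ (feasibleHom_bijective P)
  have h0 : iBet P x = 0 ↔ x ∈ span {idemUBet P} := mk_eq_zero_iff
  rw [h0, TwMat.toStage_eq_zero]
  constructor
  · intro h
    let T := (span {idemUBet P}).comap (e.symm : TwMat (feasibleCocycle P) →+* ABett P)
    have hT : TwMat.idealOf (feasibleCocycle P) {α | ¬ P.Bounded α.1} ≤ T := by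
      refine TwMat.idealOf_le fun δ hδ => (mem_comap _).2 ?_
      have h1 : (TwMat.single δ δ 1 : TwMat (feasibleCocycle P)) =
          e (idemUBet P) * TwMat.single δ δ 1 := by
        classical
        change _ = feasibleHom P (idemUBet P) * TwMat.single δ δ 1
        rw [feasibleHom_idemUBet]
        refine TwMat.ext fun a b => ?_
        rw [diag_mul_apply, TwMat.single_apply]
        by_cases h : δ = a ∧ δ = b
        · rw [if_pos h, if_pos (h.1 ▸ hδ)]
        · rw [if_neg h, ite_self]
      rw [h1, map_mul]
      refine TwoSidedIdeal.mul_mem_right _ _ _ ?_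
      have h2 : (e.symm : TwMat (feasibleCocycle P) →+* ABett P) (e (idemUBet P)) = idemUBet P :=
        e.symm_apply_apply _
      rw [h2]
      exact subset_span rfl
    have h1 := (mem_comap _).1 (hT h)
    have h2 : (e.symm : TwMat (feasibleCocycle P) →+* ABett P) (feasibleHom P x) = x :=
      e.symm_apply_apply _
    rwa [h2] at h1
  · intro h
    let T := (TwMat.idealOf (feasibleCocycle P) {α | ¬ P.Bounded α.1}).comap (feasibleHom P)
    have hT : span {idemUBet P} ≤ T := TwoSidedIdeal.span_le.2 (by
      rintro _ rfl
      refine (mem_comap _).2 ?_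
      rw [feasibleHom_idemUBet]
      exact TwMat.diag_mem_idealOf)
    exact (mem_comap _).1 (hT h)

/-- A shelling of the feasible sign vectors which starts with the unbounded ones, with walls
independent of the cocharacters of `G`, makes `A^Bet_G(t,-) → A^Bet_G(t,m)` stratifying. -/
theorem isStrat_iBet (D : Shelling (Subtype.val : FeasibleVec P → SignVector n)) (N : ℕ)
    (hN : ∀ α, D.rank α < N ↔ ¬ P.Bounded α.1)
    (hwalls : ∀ α, Disjoint (suppSubgroup (D.walls α)) (cocharSubgroup P)) : IsStrat (iBet P) := by
  have h1 := D.isStrat_laurent (cocharSubgroup P) hwalls N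
  have h2 : {α | D.rank α < N} = {α : FeasibleVec P | ¬ P.Bounded α.1} := Set.ext hN
  rw [h2] at h1
  exact ((IsStrat.of_bijective _ (feasibleHom_bijective P)).comp h1).congr_ker (iBet P)
    (mk_surjective _) (iBet_eq_zero_iff P)

end Feasible

/-! ### Shelling the feasible chambers by distance -/

section Combinatorics

open Filter Topology

variable {n : ℕ}

/-- The sign `1` or `-1`. -/
def sgn (b : Bool) : ℝ := if b then 1 else -1

lemma sgn_mul_self (b : Bool) : sgn b * sgn b = 1 := by cases b <;> simp [sgn]

lemma sgn_not (b : Bool) : sgn (!b) = -sgn b := by cases b <;> simp [sgn]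

/-- The square of the Euclidean distance. -/
def sqDist (p x : Fin n → ℝ) : ℝ := ∑ i, (x i - p i) ^ 2

lemma sq_le_sqDist (p x : Fin n → ℝ) (i : Fin n) : (x i - p i) ^ 2 ≤ sqDist p x :=
  Finset.single_le_sum (f := fun i => (x i - p i) ^ 2) (fun _ _ => sq_nonneg _) (mem_univ i)

lemma sqDist_nonneg (p x : Fin n → ℝ) : 0 ≤ sqDist p x := sum_nonneg fun _ _ => sq_nonneg _

lemma continuous_sqDist (p : Fin n → ℝ) : Continuous (sqDist p) := by unfold sqDist; fun_prop

lemma mem_closedBall_of_sqDist {p x : Fin n → ℝ} {r : ℝ} (hr : 0 ≤ r) (h : sqDist p x ≤ r ^ 2) :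
    x ∈ Metric.closedBall p r := by
  rw [Metric.mem_closedBall, dist_pi_le_iff hr]
  intro i
  rw [Real.dist_eq]
  exact abs_le_of_sq_le_sq ((sq_le_sqDist p x i).trans h) hr

lemma exists_min_sqDist (p : Fin n → ℝ) {s : Set (Fin n → ℝ)} (hs : IsClosed s)
    (hne : s.Nonempty) : ∃ μ ∈ s, ∀ x ∈ s, sqDist p μ ≤ sqDist p x := by
  obtain ⟨x1, hx₁⟩ := hne
  let r := Real.sqrt (sqDist p x1)
  have hr : r ^ 2 = sqDist p x1 := Real.sq_sqrt (sqDist_nonneg p x1)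
  have hx₁' : x1 ∈ Metric.closedBall p r := mem_closedBall_of_sqDist (Real.sqrt_nonneg _) hr.ge
  obtain ⟨μ, hμ, hmin⟩ := ((isCompact_closedBall p r).inter_left hs).exists_isMinOn ⟨x1, hx₁, hx₁'⟩
    (continuous_sqDist p).continuousOn
  refine ⟨μ, hμ.1, fun x hx => ?_⟩
  by_cases h : sqDist p x ≤ r ^ 2
  · exact hmin ⟨hx, mem_closedBall_of_sqDist (Real.sqrt_nonneg _) h⟩
  · push Not at h
    exact (hmin ⟨hx₁, hx₁'⟩ : sqDist p μ ≤ sqDist p x1).trans (hr ▸ h.le)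

lemma sqDist_add (p x w : Fin n → ℝ) :
    sqDist p (x + w) = sqDist p x + 2 * ∑ i, (x i - p i) * w i + ∑ i, w i ^ 2 := by
  unfold sqDist
  rw [mul_sum, ← sum_add_distrib, ← sum_add_distrib]
  refine sum_congr rfl fun i _ => ?_
  rw [Pi.add_apply]
  ring

variable (P : PolarizedArrangement n)

lemma add_mem_affineSpace {x w : Fin n → ℝ} (hx : x ∈ P.affineSpace) (hw : w ∈ realSpan P.V) :
    x + w ∈ P.affineSpace := by
  change Submodule.Quotient.mk (x + w) = P.t
  rw [Submodule.Quotient.mk_add, (Submodule.Quotient.mk_eq_zero _).2 hw, add_zero]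
  exact hx

lemma sub_mem_of_mem_affineSpace {x y : Fin n → ℝ} (hx : x ∈ P.affineSpace)
    (hy : y ∈ P.affineSpace) : x - y ∈ realSpan P.V :=
  (Submodule.Quotient.eq _).1 ((show Submodule.Quotient.mk x = P.t from hx).trans
    (show Submodule.Quotient.mk y = P.t from hy).symm)

lemma isClosed_realSpan : IsClosed (realSpan P.V : Set (Fin n → ℝ)) :=
  (realSpan P.V).closed_of_finiteDimensional

/-- The closed chamber of `V(t)` defined by a sign vector. -/
def closedChamber (α : SignVector n) : Set (Fin n → ℝ) :=
  {x | x ∈ P.affineSpace ∧ ∀ i, 0 ≤ sgn (α i) * x i}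

lemma feasible_iff (α : SignVector n) :
    P.Feasible α ↔ ∃ x ∈ P.affineSpace, ∀ i, 0 < sgn (α i) * x i := by
  unfold PolarizedArrangement.Feasible sgn
  refine exists_congr fun x => and_congr_right fun _ => forall_congr' fun i => ?_
  split_ifs <;> simp

lemma isClosed_closedChamber (α : SignVector n) : IsClosed (closedChamber P α) := by
  obtain ⟨x0, hx₀⟩ := Submodule.Quotient.mk_surjective _ P.t
  have h1 : P.affineSpace = (fun x => x - x0) ⁻¹' (realSpan P.V : Set (Fin n → ℝ)) := by
    ext x
    rw [Set.mem_preimage, SetLike.mem_coe, ← Submodule.Quotient.eq, hx₀]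
    rfl
  have h2 : closedChamber P α = P.affineSpace ∩ ⋂ i, {x | 0 ≤ sgn (α i) * x i} := by
    ext x
    simp [closedChamber]
  rw [h2, h1]
  refine ((isClosed_realSpan P).preimage (by fun_prop)).inter (isClosed_iInter fun i => ?_)
  exact isClosed_le (by fun_prop) (by fun_prop)

lemma closedChamber_nonempty {α : SignVector n} (h : P.Feasible α) :
    (closedChamber P α).Nonempty := by
  obtain ⟨x, hx, h⟩ := (feasible_iff P α).1 h
  exact ⟨x, hx, fun i => (h i).le⟩

lemma exists_nearest (p : Fin n → ℝ) (α : FeasibleVec P) :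
    ∃ μ ∈ closedChamber P α.1, ∀ x ∈ closedChamber P α.1, sqDist p μ ≤ sqDist p x :=
  exists_min_sqDist p (isClosed_closedChamber P α.1) (closedChamber_nonempty P α.2)

/-- The point of a closed chamber which is nearest to `p`. -/
def nearest (p : Fin n → ℝ) (α : FeasibleVec P) : Fin n → ℝ := (exists_nearest P p α).choose

lemma nearest_mem (p : Fin n → ℝ) (α : FeasibleVec P) : nearest P p α ∈ closedChamber P α.1 :=
  (exists_nearest P p α).choose_spec.1

lemma nearest_le (p : Fin n → ℝ) (α : FeasibleVec P) {x : Fin n → ℝ}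
    (hx : x ∈ closedChamber P α.1) : sqDist p (nearest P p α) ≤ sqDist p x :=
  (exists_nearest P p α).choose_spec.2 x hx

variable {P}

open Classical in
/-- The hyperplanes through the nearest point. -/
def active (p : Fin n → ℝ) (α : FeasibleVec P) : Finset (Fin n) := {i | nearest P p α i = 0}

lemma mem_active {p : Fin n → ℝ} {α : FeasibleVec P} {i : Fin n} :
    i ∈ active p α ↔ nearest P p α i = 0 := by simp [active]

/-- In a simple arrangement the hyperplanes through a point are independent. -/
lemma exists_prescribed (hP : P.TRegular) (p : Fin n → ℝ) (α : FeasibleVec P) (c : Fin n → ℝ) :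
    ∃ v ∈ realSpan P.V, ∀ i ∈ active p α, v i = c i := by
  let φ : realSpan P.V →ₗ[ℝ] (active p α → ℝ) :=
    (LinearMap.funLeft ℝ ℝ (Subtype.val : active p α → Fin n)).comp (realSpan P.V).subtype
  have hker : LinearMap.ker φ = P.flatDirection (active p α) := by
    ext v
    rw [LinearMap.mem_ker, funext_iff]
    exact ⟨fun h i hi => h ⟨i, hi⟩, fun h i => h i.1 i.2⟩
  have hrange : LinearMap.range φ = ⊤ := by
    apply Submodule.eq_top_of_finrank_eq
    have h1 := LinearMap.finrank_range_add_finrank_ker φ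
    have h2 := hP (active p α) ⟨nearest P p α, (nearest_mem P p α).1, fun _ hi => mem_active.1 hi⟩
    rw [hker] at h1
    rw [Module.finrank_fintype_fun_eq_card, Fintype.card_coe]
    omega
  obtain ⟨v, hv⟩ := LinearMap.range_eq_top.1 hrange fun j => c j
  exact ⟨v.1, v.2, fun j hj => congrFun hv ⟨j, hj⟩⟩

/-- Moving a little from the nearest point keeps the signs of the inactive coordinates. -/
lemma eventually_inactive (p : Fin n → ℝ) (α : FeasibleVec P) (w : Fin n → ℝ) :
    ∀ᶠ s in 𝓝[>] (0 : ℝ), ∀ i ∉ active p α, 0 < sgn (α.1 i) * (nearest P p α + s • w) i := by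
  rw [eventually_all]
  intro i
  by_cases hi : i ∈ active p α
  · simp [hi]
  · have h0 : 0 < sgn (α.1 i) * (nearest P p α + (0 : ℝ) • w) i := by
      rw [zero_smul, add_zero]
      refine lt_of_le_of_ne ((nearest_mem P p α).2 i) fun h => hi (mem_active.2 ?_)
      have := congrArg (sgn (α.1 i) * ·) h
      simp only [mul_zero] at this
      rw [← mul_assoc, sgn_mul_self, one_mul] at this
      exact this.symm
    have hc : Continuous fun s : ℝ => sgn (α.1 i) * (nearest P p α + s • w) i := by
      simp only [Pi.add_apply, Pi.smul_apply]
      fun_prop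
    filter_upwards [nhdsWithin_le_nhds ((hc.tendsto 0).eventually (lt_mem_nhds h0))] with s hs _
    exact hs

/-- The distance to `p` decreases along a vector which has negative product with the gradient. -/
lemma exists_step (p : Fin n → ℝ) (α : FeasibleVec P) {w : Fin n → ℝ}
    (h : ∑ i, (nearest P p α i - p i) * w i < 0) :
    ∃ s : ℝ, 0 < s ∧ sqDist p (nearest P p α + s • w) < sqDist p (nearest P p α) ∧
      ∀ i ∉ active p α, 0 < sgn (α.1 i) * (nearest P p α + s • w) i := by
  have h1 : ∀ᶠ s in 𝓝[>] (0 : ℝ), s * ∑ i, w i ^ 2 < -(2 * ∑ i, (nearest P p α i - p i) * w i) := by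
    have hc : Continuous fun s : ℝ => s * ∑ i, w i ^ 2 := by fun_prop
    refine nhdsWithin_le_nhds ((hc.tendsto 0).eventually (gt_mem_nhds ?_))
    linarith
  obtain ⟨s, ⟨hs₁, hs₂⟩, hs₀ : 0 < s⟩ := ((h1.and (eventually_inactive p α w)).and
    self_mem_nhdsWithin).exists
  refine ⟨s, hs₀, ?_, hs₂⟩
  rw [sqDist_add]
  simp only [Pi.smul_apply, smul_eq_mul, mul_pow, mul_left_comm _ s, ← mul_sum]
  nlinarith

/-- The first order condition at the nearest point. -/
lemma first_order (p : Fin n → ℝ) (α : FeasibleVec P) {w : Fin n → ℝ} (hw : w ∈ realSpan P.V)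
    (h : ∀ i ∈ active p α, 0 ≤ sgn (α.1 i) * w i) :
    0 ≤ ∑ i, (nearest P p α i - p i) * w i := by
  by_contra! hneg
  obtain ⟨s, hs₀, hs₁, hs₂⟩ := exists_step p α hneg
  refine (nearest_le P p α ⟨add_mem_affineSpace P (nearest_mem P p α).1 (smul_mem _ s hw),
    fun i => ?_⟩).not_gt hs₁
  by_cases hi : i ∈ active p α
  · rw [Pi.add_apply, mem_active.1 hi, zero_add, Pi.smul_apply, smul_eq_mul, mul_left_comm]
    exact mul_nonneg hs₀.le (h i hi)
  · exact (hs₂ i hi).le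

/-- The multipliers of the active hyperplanes at the nearest point. -/
lemma exists_multipliers (hP : P.TRegular) (p : Fin n → ℝ) (α : FeasibleVec P) :
    ∃ l : Fin n → ℝ, (∀ i ∈ active p α, 0 ≤ l i) ∧ ∀ w ∈ realSpan P.V,
      ∑ i, (nearest P p α i - p i) * w i = ∑ i ∈ active p α, l i * (sgn (α.1 i) * w i) := by
  classical
  choose w hw hdual using fun i => exists_prescribed hP p α (Pi.single i 1)
  let q : (Fin n → ℝ) →ₗ[ℝ] ℝ := ∑ i, (nearest P p α i - p i) • LinearMap.proj i
  have hq : ∀ v, q v = ∑ i, (nearest P p α i - p i) * v i := fun v => by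
    simp [q, LinearMap.sum_apply]
  refine ⟨fun i => sgn (α.1 i) * q (w i), fun i hi => ?_, fun v hv => ?_⟩
  · have h := first_order p α (smul_mem _ (sgn (α.1 i)) (hw i)) fun j hj => by
      rw [Pi.smul_apply, hdual i j hj, smul_eq_mul, Pi.single_apply]
      split_ifs with h
      · rw [h, mul_one, sgn_mul_self]
        exact zero_le_one
      · simp
    rwa [← hq, map_smul, smul_eq_mul] at h
  · let u := v - ∑ i ∈ active p α, v i • w i
    have hu : u ∈ realSpan P.V := sub_mem hv (sum_mem fun i _ => smul_mem _ _ (hw i))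
    have hu₀ : ∀ j ∈ active p α, u j = 0 := fun j hj => by
      simp only [u, Pi.sub_apply, Finset.sum_apply, Pi.smul_apply, smul_eq_mul]
      rw [sum_eq_single j]
      · rw [hdual j j hj, Pi.single_eq_same, mul_one, sub_self]
      · intro i hi hij
        rw [hdual i j hj, Pi.single_eq_of_ne hij.symm, mul_zero]
      · exact fun h => absurd hj h
    have h1 := first_order p α hu fun j hj => by rw [hu₀ j hj, mul_zero]
    have h2 := first_order p α (neg_mem hu) fun j hj => by
      rw [Pi.neg_apply, hu₀ j hj, neg_zero, mul_zero]
    rw [← hq] at h1 h2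
    rw [map_neg] at h2
    have h3 : q u = 0 := le_antisymm (by linarith) h1
    rw [map_sub, sub_eq_zero, map_sum] at h3
    rw [← hq, h3]
    refine sum_congr rfl fun i _ => ?_
    rw [map_smul, smul_eq_mul]
    linear_combination (-(v i * q (w i))) * sgn_mul_self (α.1 i)

end Combinatorics

section Combinatorics

open Filter Topology

variable {n : ℕ} {P : PolarizedArrangement n}

/-- The number of positive signs. -/
def plusCount (α : SignVector n) : ℕ := (univ.filter fun i => α i = true).card

lemma feasible_flipAt (hP : P.TRegular) (p : Fin n → ℝ) (α : FeasibleVec P) {i : Fin n}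
    (hi : i ∈ active p α) : P.Feasible (flipAt α.1 i) := by
  obtain ⟨v, hv, hva⟩ := exists_prescribed hP p α fun j => sgn (flipAt α.1 i j)
  obtain ⟨s, hs, hs₀⟩ := ((eventually_inactive p α v).and self_mem_nhdsWithin).exists
  refine (feasible_iff P _).2 ⟨nearest P p α + s • v,
    add_mem_affineSpace P (nearest_mem P p α).1 (smul_mem _ s hv), fun j => ?_⟩
  by_cases hj : j ∈ active p α
  · rw [Pi.add_apply, mem_active.1 hj, zero_add, Pi.smul_apply, hva j hj, smul_eq_mul,
      mul_left_comm, sgn_mul_self, mul_one]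
    exact hs₀
  · rw [flipAt_of_ne _ fun h : j = i => hj (h ▸ hi)]
    exact hs j hj

lemma sqDist_flipAt_le (hP : P.TRegular) (p : Fin n → ℝ) (α : FeasibleVec P) {i : Fin n}
    (hi : i ∈ active p α) :
    sqDist p (nearest P p ⟨_, feasible_flipAt hP p α hi⟩) ≤ sqDist p (nearest P p α) := by
  refine nearest_le P p _ ⟨(nearest_mem P p α).1, fun j => ?_⟩
  by_cases hj : j = i
  · rw [hj, mem_active.1 hi, mul_zero]
  · change 0 ≤ sgn (flipAt α.1 i j) * _
    rw [flipAt_of_ne _ hj]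
    exact (nearest_mem P p α).2 j

lemma sqDist_flipAt_lt (hP : P.TRegular) (p : Fin n → ℝ) (α : FeasibleVec P) {l : Fin n → ℝ}
    (hl : ∀ w ∈ realSpan P.V,
      ∑ i, (nearest P p α i - p i) * w i = ∑ i ∈ active p α, l i * (sgn (α.1 i) * w i))
    {i : Fin n} (hi : i ∈ active p α) (hli : 0 < l i) :
    sqDist p (nearest P p ⟨_, feasible_flipAt hP p α hi⟩) < sqDist p (nearest P p α) := by
  obtain ⟨v, hv, hva⟩ := exists_prescribed hP p α (Pi.single i (-sgn (α.1 i)))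
  have hq : ∑ j, (nearest P p α j - p j) * v j = -l i := by
    rw [hl v hv, sum_eq_single i]
    · rw [hva i hi, Pi.single_eq_same]
      linear_combination (-l i) * sgn_mul_self (α.1 i)
    · intro j hj hji
      rw [hva j hj, Pi.single_eq_of_ne hji, mul_zero, mul_zero]
    · exact fun h => absurd hi h
  obtain ⟨s, hs₀, hs₁, hs₂⟩ := exists_step p α (hq.trans_lt (neg_lt_zero.2 hli))
  refine (nearest_le P p ⟨_, feasible_flipAt hP p α hi⟩ ⟨add_mem_affineSpace P
    (nearest_mem P p α).1 (smul_mem _ s hv), fun j => ?_⟩).trans_lt hs₁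
  change 0 ≤ sgn (flipAt α.1 i j) * _
  by_cases hj : j ∈ active p α
  · rw [Pi.add_apply, mem_active.1 hj, zero_add, Pi.smul_apply, hva j hj]
    by_cases h : j = i
    · subst h
      rw [flipAt_self, sgn_not, smul_eq_mul, Pi.single_eq_same, neg_mul, mul_neg, mul_neg, neg_neg,
        mul_left_comm, sgn_mul_self, mul_one]
      exact hs₀.le
    · simp [h]
  · rw [flipAt_of_ne _ fun h : j = i => hj (h ▸ hi)]
    exact (hs₂ j hj).le

/-- A chamber on the same side as `α` of the hyperplanes with nonzero multiplier is at least as far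
from `p` as `α`. -/
lemma sqDist_add_le (p : Fin n → ℝ) (α : FeasibleVec P) {l : Fin n → ℝ}
    (h0 : ∀ i ∈ active p α, 0 ≤ l i) (hl : ∀ w ∈ realSpan P.V,
      ∑ i, (nearest P p α i - p i) * w i = ∑ i ∈ active p α, l i * (sgn (α.1 i) * w i))
    {δ : SignVector n} (hδ : ∀ i ∈ active p α, 0 < l i → δ i = α.1 i) {x : Fin n → ℝ}
    (hx : x ∈ closedChamber P δ) :
    sqDist p (nearest P p α) + ∑ i, (x i - nearest P p α i) ^ 2 ≤ sqDist p x := by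
  have hw := sub_mem_of_mem_affineSpace P hx.1 (nearest_mem P p α).1
  have h1 : x = nearest P p α + (x - nearest P p α) := by abel
  have h2 : 0 ≤ ∑ i, (nearest P p α i - p i) * (x - nearest P p α) i := by
    rw [hl _ hw]
    refine sum_nonneg fun i hi => ?_
    rw [Pi.sub_apply, mem_active.1 hi, sub_zero]
    rcases (h0 i hi).eq_or_lt with h | h
    · rw [← h, zero_mul]
    · rw [← hδ i hi h]
      exact mul_nonneg h.le (hx.2 i)
  have h3 := sqDist_add p (nearest P p α) (x - nearest P p α)
  rw [← h1] at h3
  simp only [Pi.sub_apply] at h2 h3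
  linarith

lemma plusCount_lt {α δ : SignVector n} (h : ∀ i, α i = true → δ i = true) (hne : δ ≠ α) :
    plusCount α < plusCount δ := by
  refine Finset.card_lt_card (Finset.ssubset_iff_subset_ne.2 ⟨fun i hi => ?_, fun he => hne ?_⟩)
  · simp only [mem_filter, mem_univ, true_and] at hi ⊢
    exact h i hi
  · funext i
    have := Finset.ext_iff.1 he i
    simp only [mem_filter, mem_univ, true_and] at this
    exact (Bool.eq_iff_iff.2 this).symm

lemma plusCount_flipAt {α : SignVector n} {i : Fin n} (h : α i = true) :
    plusCount (flipAt α i) < plusCount α := by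
  refine plusCount_lt (fun j hj => ?_) fun he => ?_
  · by_cases hji : j = i
    · rw [hji, h]
    · rwa [flipAt_of_ne _ hji] at hj
  · have := congrFun he i
    rw [flipAt_self, h] at this
    simp at this

/-- Chambers are ordered by their distance to `p`, then by their number of positive signs. -/
def chamberKey (p : Fin n → ℝ) (α : FeasibleVec P) : ℝ ×ₗ ℕ :=
  toLex (sqDist p (nearest P p α), plusCount α.1)

/-- The walls of a chamber: the hyperplanes through its nearest point which have nonzero multiplier,
or which are crossed in decreasing the number of positive signs. -/
lemma exists_walls (hP : P.TRegular) (p : Fin n → ℝ) (α : FeasibleVec P) :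
    ∃ S : Finset (Fin n), S ⊆ active p α ∧
      (∀ i ∈ S, ∃ δ : FeasibleVec P, chamberKey p δ < chamberKey p α ∧ δ.1 = flipAt α.1 i) ∧
      ∀ δ : FeasibleVec P, chamberKey p δ ≤ chamberKey p α → δ ≠ α → ∃ i ∈ S, δ.1 i ≠ α.1 i := by
  classical
  obtain ⟨l, h0, hl⟩ := exists_multipliers hP p α
  refine ⟨(active p α).filter fun i => 0 < l i ∨ α.1 i = true, Finset.filter_subset _ _,
    fun i hi => ?_, fun δ hδ hne => ?_⟩
  · rw [mem_filter] at hi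
    refine ⟨⟨_, feasible_flipAt hP p α hi.1⟩, Prod.Lex.toLex_lt_toLex.2 ?_, rfl⟩
    rcases hi.2 with h | h
    · exact .inl (sqDist_flipAt_lt hP p α hl hi.1 h)
    · rcases (sqDist_flipAt_le hP p α hi.1).lt_or_eq with h' | h'
      · exact .inl h'
      · exact .inr ⟨h', plusCount_flipAt h⟩
  · by_contra hcon
    push Not at hcon
    have hagree : ∀ i ∈ active p α, 0 < l i ∨ α.1 i = true → δ.1 i = α.1 i := fun i hi h =>
      hcon i (mem_filter.2 ⟨hi, h⟩)
    have h1 := sqDist_add_le p α h0 hl (fun i hi h => hagree i hi (.inl h)) (nearest_mem P p δ)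
    have h2 : 0 ≤ ∑ i, (nearest P p δ i - nearest P p α i) ^ 2 := sum_nonneg fun i _ => sq_nonneg _
    rcases Prod.Lex.toLex_le_toLex.1 hδ with h | ⟨h, h'⟩
    · dsimp only at h
      linarith
    · dsimp only at h h'
      have h3 : ∑ i, (nearest P p δ i - nearest P p α i) ^ 2 = 0 := by linarith
      have h4 : ∀ i, nearest P p δ i = nearest P p α i := fun i => by
        have := (Finset.sum_eq_zero_iff_of_nonneg fun i _ => sq_nonneg _).1 h3 i (mem_univ i)
        exact sub_eq_zero.1 (pow_eq_zero_iff two_ne_zero |>.1 this)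
      have h5 : ∀ i, i ∉ active p α → δ.1 i = α.1 i := fun i hi => by
        have ha := (nearest_mem P p α).2 i
        have hd := (nearest_mem P p δ).2 i
        rw [h4 i] at hd
        by_contra hne
        rw [Bool.eq_not_of_ne hne, sgn_not] at hd
        refine hi (mem_active.2 ?_)
        rw [← one_mul (nearest P p α i), ← sgn_mul_self (α.1 i), mul_assoc,
          show sgn (α.1 i) * nearest P p α i = 0 by linarith, mul_zero]
      refine absurd (plusCount_lt (α := α.1) (δ := δ.1) (fun i hi => ?_) fun h =>
        hne (Subtype.ext h)) (not_lt.2 h')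
      by_cases hia : i ∈ active p α
      · rw [hagree i hia (.inr hi), hi]
      · rw [h5 i hia, hi]

lemma disjoint_walls (hP : P.TRegular) (p : Fin n → ℝ) (α : FeasibleVec P)
    {S : Finset (Fin n)} (hS : S ⊆ active p α) :
    Disjoint (suppSubgroup S) (cocharSubgroup P) := by
  rw [AddSubgroup.disjoint_def]
  intro g hg hgc
  have hspan : ∀ w ∈ realSpan P.V, ∑ i, (g i : ℝ) * w i = 0 := fun w hw => by
    refine span_induction (p := fun w _ => ∑ i, (g i : ℝ) * w i = 0) ?_ ?_ ?_ ?_ hw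
    · rintro _ ⟨v, hv, rfl⟩
      have := hgc v hv
      change ∑ i, (g i : ℝ) * (v i : ℝ) = 0
      exact_mod_cast this
    · simp
    · intro x y _ _ hx hy
      simp only [Pi.add_apply, mul_add, sum_add_distrib, hx, hy, add_zero]
    · intro c x _ hx
      simp only [Pi.smul_apply, smul_eq_mul, mul_left_comm _ c, ← mul_sum, hx, mul_zero]
  funext i
  by_cases hi : i ∈ S
  · obtain ⟨w, hw, hdual⟩ := exists_prescribed hP p α (Pi.single i 1)
    have h := hspan w hw
    rw [sum_eq_single i] at h
    · rw [hdual i (hS hi), Pi.single_eq_same, mul_one] at h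
      exact_mod_cast h
    · intro j _ hj
      by_cases hjS : j ∈ S
      · rw [hdual j (hS hjS), Pi.single_eq_of_ne hj, mul_zero]
      · rw [hg j hjS, Int.cast_zero, zero_mul]
    · simp
  · exact hg i hi

lemma exists_rank {ι K : Type*} [Fintype ι] [LinearOrder K] (key : ι → K) :
    ∃ rank : ι → ℕ, ∀ {a b}, rank a < rank b ↔ key a < key b := by
  classical
  let e := (univ.image key).orderIsoOfFin rfl
  exact ⟨fun a => e.symm ⟨key a, Finset.mem_image_of_mem _ (mem_univ a)⟩, e.symm.lt_iff_lt⟩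

/-- A shelling from keys for which the unbounded sign vectors come first. -/
lemma exists_shelling (hP : P.TRegular) (p : Fin n → ℝ)
    (hp : ∀ α β : FeasibleVec P, ¬ P.Bounded α.1 → P.Bounded β.1 →
      chamberKey p α < chamberKey p β) :
    ∃ (D : Shelling (Subtype.val : FeasibleVec P → SignVector n)) (N : ℕ),
      (∀ α, D.rank α < N ↔ ¬ P.Bounded α.1) ∧
      ∀ α, Disjoint (suppSubgroup (D.walls α)) (cocharSubgroup P) := by
  classical
  choose S hS hflip hwall using exists_walls hP p
  let e := Fintype.equivFin (FeasibleVec P)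
  let key : FeasibleVec P → (ℝ ×ₗ ℕ) ×ₗ Fin _ := fun α => toLex (chamberKey p α, e α)
  obtain ⟨rank, hrank⟩ := exists_rank key
  refine ⟨⟨rank, fun α β h => e.injective (Prod.ext_iff.1 (toLex.injective (le_antisymm
    (not_lt.1 fun h' => (hrank.2 h').ne' h) (not_lt.1 fun h' => (hrank.2 h').ne h)))).2, S,
    fun α i hi => ?_, fun α δ h => ?_⟩, (univ.filter fun α : FeasibleVec P => ¬ P.Bounded α.1).sup
    fun α => rank α + 1, fun α => ?_, fun α => disjoint_walls hP p α (hS α)⟩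
  · obtain ⟨δ, hδ, h⟩ := hflip α i hi
    exact ⟨δ, hrank.2 (Prod.Lex.toLex_lt_toLex.2 (.inl hδ)), h⟩
  · refine hwall α δ ?_ fun he => lt_irrefl _ (he ▸ h)
    rcases Prod.Lex.toLex_lt_toLex.1 (hrank.1 h) with h1 | h1
    · exact h1.le
    · exact h1.1.le
  · rw [Finset.lt_sup_iff]
    refine ⟨?_, fun h => ⟨α, mem_filter.2 ⟨mem_univ _, h⟩, Nat.lt_succ_self _⟩⟩
    rintro ⟨β, hβ, h⟩ hb
    exact (Nat.lt_succ_iff.1 h).not_gt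
      (hrank.2 (Prod.Lex.toLex_lt_toLex.2 (.inl (hp β α (mem_filter.1 hβ).2 hb))))

end Combinatorics

/-! ### Unbounded chambers are near to a distant point -/

section Distance

open Filter Topology

variable {n : ℕ} (P : PolarizedArrangement n)

lemma exists_gradient : ∃ c : Fin n → ℝ, ∀ w : realSpan P.V, P.m w = ∑ i, c i * (w : Fin n → ℝ) i := by
  obtain ⟨φ, hφ⟩ := LinearMap.exists_extend P.m
  refine ⟨fun i => φ (Pi.single i 1), fun w => ?_⟩
  rw [← hφ]
  change φ w.1 = _
  rw [LinearMap.pi_apply_eq_sum_univ φ w.1]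
  refine sum_congr rfl fun i _ => ?_
  rw [smul_eq_mul, mul_comm]
  congr 2
  funext j
  simp [Pi.single_apply, eq_comm]

lemma mem_cone_iff (α : SignVector n) (v : Fin n → ℝ) :
    (∀ i, if α i then 0 ≤ v i else v i ≤ 0) ↔ ∀ i, 0 ≤ sgn (α i) * v i := by
  refine forall_congr' fun i => ?_
  unfold sgn
  split_ifs <;> simp

lemma not_bounded_iff (α : SignVector n) : ¬ P.Bounded α ↔
    ∃ v : realSpan P.V, (∀ i, 0 ≤ sgn (α i) * (v : Fin n → ℝ) i) ∧ 0 < P.m v := by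
  have hB : P.Bounded α ↔
      BddAbove (P.m '' {v | ∀ i, 0 ≤ sgn (α i) * (v : Fin n → ℝ) i}) := by
    unfold PolarizedArrangement.Bounded
    simp_rw [mem_cone_iff]
  rw [hB]
  constructor
  · intro h
    by_contra! h'
    refine h ⟨0, ?_⟩
    rintro _ ⟨v, hv, rfl⟩
    exact h' v hv
  · rintro ⟨v, hv, hm⟩ ⟨b, hb⟩
    obtain ⟨k, hk⟩ := exists_nat_gt (b / P.m v)
    rw [div_lt_iff₀ hm] at hk
    refine absurd (hb ⟨(k : ℝ) • v, fun i => ?_, rfl⟩) (not_le.2 ?_)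
    · have h := mul_nonneg (Nat.cast_nonneg (α := ℝ) k) (hv i)
      rwa [mul_left_comm] at h
    · rwa [map_smul, smul_eq_mul]

lemma sqDist_smul (c x : Fin n → ℝ) (k : ℝ) : sqDist (k • c) (k • x) = k ^ 2 * sqDist c x := by
  unfold sqDist
  rw [mul_sum]
  refine sum_congr rfl fun i _ => ?_
  simp only [Pi.smul_apply, smul_eq_mul]
  ring

lemma sqDist_eq (c x : Fin n → ℝ) :
    sqDist c x = ∑ i, c i ^ 2 - 2 * ∑ i, c i * x i + ∑ i, x i ^ 2 := by
  unfold sqDist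
  rw [mul_sum, ← sum_sub_distrib, ← sum_add_distrib]
  exact sum_congr rfl fun i _ => by ring

/-- Seen from a point far away in the direction of the gradient of `m`, an unbounded chamber comes
nearer than a bounded one: after rescaling, the chambers become their recession cones. -/
lemma eventually_sqDist_lt {c : Fin n → ℝ}
    (hc : ∀ w : realSpan P.V, P.m w = ∑ i, c i * (w : Fin n → ℝ) i)
    (α β : FeasibleVec P) (hα : ¬ P.Bounded α.1) (hβ : P.Bounded β.1) :
    ∀ᶠ k : ℕ in atTop, sqDist ((k : ℝ) • c) (nearest P ((k : ℝ) • c) α) <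
      sqDist ((k : ℝ) • c) (nearest P ((k : ℝ) • c) β) := by
  obtain ⟨v, hv, hm⟩ := (not_bounded_iff P _).1 hα
  obtain ⟨a, ha⟩ := closedChamber_nonempty P α.2
  obtain ⟨b, hb⟩ := closedChamber_nonempty P β.2
  have hv0 : 0 < ∑ i, (v : Fin n → ℝ) i ^ 2 := by
    refine (sum_nonneg fun i _ => sq_nonneg _).lt_of_ne fun h => hm.ne' ?_
    rw [hc]
    refine sum_eq_zero fun i _ => ?_
    rw [pow_eq_zero_iff two_ne_zero |>.1
      ((Finset.sum_eq_zero_iff_of_nonneg fun i _ => sq_nonneg _).1 h.symm i (mem_univ i)),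
      mul_zero]
  let σ : ℝ := P.m v / ∑ i, (v : Fin n → ℝ) i ^ 2
  have hσ : 0 < σ := div_pos hm hv0
  have hρ : sqDist c (σ • v.1) < ∑ i, c i ^ 2 := by
    rw [sqDist_eq]
    have h1 : ∑ i, c i * (σ • v.1) i = σ * P.m v := by
      rw [hc, mul_sum]
      exact sum_congr rfl fun i _ => by rw [Pi.smul_apply, smul_eq_mul]; ring
    have h2 : ∑ i, (σ • v.1) i ^ 2 = σ * P.m v := by
      have h3 : σ * ∑ i, (v : Fin n → ℝ) i ^ 2 = P.m v := div_mul_cancel₀ _ hv0.ne'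
      rw [← h3, mul_sum, mul_sum]
      exact sum_congr rfl fun i _ => by rw [Pi.smul_apply, smul_eq_mul]; ring
    rw [h1, h2]
    linarith [mul_pos hσ hm]
  have hlim : ∀ x : Fin n → ℝ, Tendsto (fun k : ℕ => (k : ℝ)⁻¹ • x) atTop (𝓝 0) := fun x => by
    have h := (tendsto_inv_atTop_nhds_zero_nat (𝕜 := ℝ)).smul_const x
    rwa [zero_smul] at h
  have htest : Tendsto (fun k : ℕ => sqDist c ((k : ℝ)⁻¹ • a + σ • v.1)) atTop
      (𝓝 (sqDist c (σ • v.1))) := by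
    have h := (hlim a).add_const (σ • v.1)
    rw [zero_add] at h
    exact ((continuous_sqDist c).tendsto _).comp h
  by_contra hcon
  obtain ⟨φ, hφ, hbad⟩ := extraction_of_frequently_atTop ((not_eventually.1 hcon).and_eventually
    ((htest.eventually (ge_mem_nhds (lt_add_one (sqDist c (σ • v.1))))).and
      (eventually_gt_atTop 0)))
  let y : ℕ → Fin n → ℝ := fun j => ((φ j : ℕ) : ℝ)⁻¹ • nearest P ((φ j : ℝ) • c) β
  have hpos : ∀ j, (0 : ℝ) < φ j := fun j => Nat.cast_pos.2 (hbad j).2.2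
  have hy : ∀ j, sqDist c (y j) ≤ sqDist c ((φ j : ℝ)⁻¹ • a + σ • v.1) := fun j => by
    have hx : a + ((φ j : ℝ) * σ) • v.1 ∈ closedChamber P α.1 :=
      ⟨add_mem_affineSpace P ha.1 (smul_mem _ _ v.2), fun i => by
        have h := mul_nonneg (mul_pos (hpos j) hσ).le (hv i)
        have h' := ha.2 i
        simp only [Pi.add_apply, Pi.smul_apply, smul_eq_mul, mul_add]
        linarith [mul_left_comm (sgn (α.1 i)) ((φ j : ℝ) * σ) (v.1 i)]⟩
    have h := (not_lt.1 (hbad j).1).trans (nearest_le P _ α hx)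
    have h1 : nearest P ((φ j : ℝ) • c) β = (φ j : ℝ) • y j := by
      rw [smul_smul, mul_inv_cancel₀ (hpos j).ne', one_smul]
    have h2 : a + ((φ j : ℝ) * σ) • v.1 = (φ j : ℝ) • ((φ j : ℝ)⁻¹ • a + σ • v.1) := by
      rw [smul_add, smul_smul, smul_smul, mul_inv_cancel₀ (hpos j).ne', one_smul]
    rw [h1, h2, sqDist_smul, sqDist_smul] at h
    exact le_of_mul_le_mul_left h (pow_pos (hpos j) 2)
  let r : ℝ := Real.sqrt (sqDist c (σ • v.1) + 1)
  have hr : r ^ 2 = sqDist c (σ • v.1) + 1 :=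
    Real.sq_sqrt (add_nonneg (sqDist_nonneg _ _) zero_le_one)
  obtain ⟨η, -, ψ, hψ, hη⟩ := (isCompact_closedBall c r).tendsto_subseq (x := y) fun j =>
    mem_closedBall_of_sqDist (Real.sqrt_nonneg _) (((hy j).trans (hbad j).2.1).trans hr.ge)
  have hsub : Tendsto (fun j => φ (ψ j)) atTop atTop := hφ.tendsto_atTop.comp hψ.tendsto_atTop
  have hle : sqDist c η ≤ sqDist c (σ • v.1) :=
    le_of_tendsto_of_tendsto' (((continuous_sqDist c).tendsto η).comp hη) (htest.comp hsub)
      fun j => hy (ψ j)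
  have hmem : η ∈ realSpan P.V := by
    have h : Tendsto (fun j => y (ψ j) - ((φ (ψ j) : ℕ) : ℝ)⁻¹ • b) atTop (𝓝 (η - 0)) :=
      hη.sub ((hlim b).comp hsub)
    rw [sub_zero] at h
    refine (isClosed_realSpan P).mem_of_tendsto h (Eventually.of_forall fun j => ?_)
    rw [SetLike.mem_coe, ← smul_sub]
    exact smul_mem _ _ (sub_mem_of_mem_affineSpace P (nearest_mem P _ β).1 hb.1)
  have hcone : ∀ i, 0 ≤ sgn (β.1 i) * η i := fun i => by
    have h : Tendsto (fun j => sgn (β.1 i) * y (ψ j) i) atTop (𝓝 (sgn (β.1 i) * η i)) :=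
      (((continuous_apply i).tendsto η).comp hη).const_mul _
    refine ge_of_tendsto' h fun j => ?_
    have h' := mul_nonneg (inv_pos.2 (hpos (ψ j))).le ((nearest_mem P ((φ (ψ j) : ℝ) • c) β).2 i)
    rwa [mul_left_comm] at h'
  have hm' : P.m ⟨η, hmem⟩ ≤ 0 := by
    by_contra! h
    exact (not_bounded_iff P _).2 ⟨⟨η, hmem⟩, hcone, h⟩ hβ
  rw [hc] at hm'
  rw [sqDist_eq c η] at hle
  have := sum_nonneg fun i (_ : i ∈ univ) => sq_nonneg (η i)
  linarith

/-- The quotient map from `A(t,-)` to `A(t,m)` in the Betti case is stratifying. -/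
theorem isStrat_iBet_of_tRegular (hP : P.TRegular) : IsStrat (iBet P) := by
  obtain ⟨c, hc⟩ := exists_gradient P
  have h : ∀ᶠ k : ℕ in atTop, ∀ α β : FeasibleVec P, ¬ P.Bounded α.1 → P.Bounded β.1 →
      sqDist ((k : ℝ) • c) (nearest P ((k : ℝ) • c) α) <
        sqDist ((k : ℝ) • c) (nearest P ((k : ℝ) • c) β) := by
    simp only [eventually_all]
    exact fun α β hα hβ => eventually_sqDist_lt P hc α β hα hβ
  obtain ⟨k, hk⟩ := h.exists
  obtain ⟨D, N, hN, hwalls⟩ := exists_shelling hP ((k : ℝ) • c) fun α β hα hβ =>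
    Prod.Lex.toLex_lt_toLex.2 (.inl (hk α β hα hβ))
  exact isStrat_iBet P D N hN hwalls

end Distance

/-! ### Nilpotence of the central parameters on the bounded algebras -/

section Nilpotence

open Filter Topology

variable {n : ℕ} {P : PolarizedArrangement n}

lemma flat_insert_nonempty {T : Finset (Fin n)} (hT : (P.flat T).Nonempty) {v : realSpan P.V}
    (hv : v ∈ P.flatDirection T) {i : Fin n} (hi : v.1 i ≠ 0) : (P.flat (insert i T)).Nonempty := by
  obtain ⟨x, hx, hxT⟩ := hT
  refine ⟨x + (-(x i / v.1 i)) • v.1, add_mem_affineSpace P hx (smul_mem _ _ v.2), ?_⟩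
  intro j hj
  rw [Pi.add_apply, Pi.smul_apply, smul_eq_mul]
  rcases mem_insert.1 hj with rfl | hj
  · field_simp
    ring
  · rw [hxT j hj, hv j hj, mul_zero, add_zero]

lemma affineSpace_nonempty : (P.flat ∅).Nonempty := by
  obtain ⟨x, hx⟩ := Submodule.Quotient.mk_surjective _ P.t
  exact ⟨x, hx, by simp⟩

/-- The polarization does not vanish on a nonzero linear space of directions. -/
lemma exists_m_pos (hm : P.MRegular) {S : Finset (Fin n)}
    (hS : P.flatDirection S ≠ ⊥) : ∃ v ∈ P.flatDirection S, 0 < P.m v := by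
  classical
  obtain ⟨w₀, hw₀, hw₀'⟩ := Submodule.exists_mem_ne_zero_of_ne_bot hS
  -- a minimal flat with a nonzero direction in common with `S` is one-dimensional
  obtain ⟨U, hU, hmax⟩ := Finset.exists_max_image (univ.filter fun U : Finset (Fin n) =>
    (P.flat U).Nonempty ∧ ∃ w ∈ P.flatDirection U, w ∈ P.flatDirection S ∧ w ≠ 0) Finset.card
    ⟨∅, mem_filter.2 ⟨mem_univ _, affineSpace_nonempty, w₀, fun i hi => by simp at hi, hw₀, hw₀'⟩⟩
  simp only [mem_filter, mem_univ, true_and] at hU hmax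
  obtain ⟨hne, w, hwU, hwS, hw0⟩ := hU
  have key : ∀ v ∈ P.flatDirection U, ∀ i, v.1 i ≠ 0 → ∀ u ∈ P.flatDirection U,
      u ∈ P.flatDirection S → u.1 i = 0 → u = 0 := fun v hv i hi u huU huS hui => by
    by_contra hu
    have := hmax (insert i U) ⟨flat_insert_nonempty hne hv hi, u, fun j hj =>
      (mem_insert.1 hj).elim (fun h => h ▸ hui) (huU j), huS, hu⟩
    rw [Finset.card_insert_of_notMem fun h => hi (hv i h)] at this
    omega
  have hle : P.flatDirection U ≤ P.flatDirection S := fun v hv i hi => by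
    by_contra h
    exact hw0 (key v hv i h w hwU hwS (hwS i hi))
  have hone : Module.finrank ℝ (P.flatDirection U) = 1 := by
    obtain ⟨i, hi⟩ := Function.ne_iff.1 (fun h => hw0 (Subtype.ext h) : w.1 ≠ 0)
    refine (finrank_eq_one_iff_of_nonzero' (⟨w, hwU⟩ : P.flatDirection U)
      fun h => hw0 (congrArg Subtype.val h)).2 fun ⟨v, hv⟩ => ⟨v.1 i / w.1 i, Subtype.ext ?_⟩
    have hu : v - (v.1 i / w.1 i) • w ∈ P.flatDirection U := sub_mem hv (smul_mem _ _ hwU)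
    refine (sub_eq_zero.1 (key w hwU i hi _ hu (hle hu) ?_)).symm
    change v.1 i - v.1 i / w.1 i * w.1 i = 0
    rw [div_mul_cancel₀ _ hi, sub_self]
  obtain ⟨v, hv, hmv⟩ := hm U hne hone
  rcases lt_or_gt_of_ne hmv with h | h
  · exact ⟨-v, hle (neg_mem hv), by rw [map_neg]; exact neg_pos.2 h⟩
  · exact ⟨v, hle hv, h⟩

/-- From a feasible chamber one can leave in a direction in which `m` increases. -/
lemma exists_unbounded {α : SignVector n} (hα : P.Feasible α) {v : realSpan P.V}
    (hv : 0 < P.m v) : ∃ γ, P.Feasible γ ∧ ¬ P.Bounded γ ∧ ∀ i, v.1 i = 0 → γ i = α i := by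
  classical
  obtain ⟨x, hx, hxα⟩ := (feasible_iff P α).1 hα
  let γ : SignVector n := fun i => if v.1 i = 0 then α i else decide (0 < v.1 i)
  have hγ : ∀ i, v.1 i ≠ 0 → 0 < sgn (γ i) * v.1 i := fun i hi => by
    simp only [γ, if_neg hi, sgn]
    rcases lt_or_gt_of_ne hi with h | h
    · simp [h.not_gt, h]
    · simp [h]
  have hγ₀ : ∀ i, v.1 i = 0 → γ i = α i := fun i hi => if_pos hi
  refine ⟨γ, (feasible_iff P γ).2 ?_, (not_bounded_iff P γ).2 ⟨v, fun i => ?_, hv⟩, hγ₀⟩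
  · have h : ∀ᶠ k : ℝ in atTop, ∀ i, 0 < sgn (γ i) * (x + k • v.1) i := by
      refine eventually_all.2 fun i => ?_
      by_cases hi : v.1 i = 0
      · refine Eventually.of_forall fun k => ?_
        rw [Pi.add_apply, Pi.smul_apply, hi, smul_zero, add_zero, hγ₀ i hi]
        exact hxα i
      · have ht : Tendsto (fun k : ℝ => sgn (γ i) * x i + k * (sgn (γ i) * v.1 i)) atTop atTop :=
          tendsto_atTop_add_const_left _ _ (tendsto_id.atTop_mul_const (hγ i hi))
        filter_upwards [ht.eventually_gt_atTop 0] with k hk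
        rw [Pi.add_apply, Pi.smul_apply, smul_eq_mul]
        linarith [mul_left_comm (sgn (γ i)) k (v.1 i)]
    obtain ⟨k, hk⟩ := h.exists
    exact ⟨_, add_mem_affineSpace P hx (smul_mem _ k v.2), hk⟩
  · by_cases hi : v.1 i = 0
    · rw [hi, mul_zero]
    · exact (hγ i hi).le

/-- If the coordinates in `S` are jointly injective on the lattice, then by unimodularity every
other coordinate is an integral combination of them. -/
lemma exists_cochar (hu : IsUnimodular P.V) {S : Finset (Fin n)} (hS : P.flatDirection S = ⊥)
    {j : Fin n} (hj : j ∉ S) :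
    ∃ g ∈ P.cocharG, g j = 1 ∧ ∀ i, i ≠ j → g i ≠ 0 → i ∈ S := by
  classical
  let f : (Fin n → ℤ) →ₗ[ℤ] ({i | i ∈ S} → ℤ) := LinearMap.funLeft ℤ ℤ Subtype.val
  let ψ : P.V →ₗ[ℤ] ({i | i ∈ S} → ℤ) := f.comp P.V.subtype
  have hψ : Function.Injective ψ := by
    refine (injective_iff_map_eq_zero ψ).2 fun v hv => Subtype.ext (funext fun i => ?_)
    have hmem : (fun i => (v.1 i : ℝ)) ∈ realSpan P.V := Submodule.subset_span ⟨v.1, v.2, rfl⟩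
    have h : (⟨_, hmem⟩ : realSpan P.V) ∈ P.flatDirection S := fun i hi => by
      have := congrFun hv ⟨i, hi⟩
      exact Int.cast_eq_zero.2 this
    rw [hS, Submodule.mem_bot] at h
    exact Int.cast_eq_zero.1 (congrFun (congrArg Subtype.val h) i)
  have hc : IsComplemented (LinearMap.range ψ) := by
    rw [LinearMap.range_comp, Submodule.range_subtype]
    exact hu {i | i ∈ S}
  obtain ⟨K, hK⟩ := hc
  let χ : ({i | i ∈ S} → ℤ) →ₗ[ℤ] ℤ :=
    ((LinearMap.proj j).comp P.V.subtype).comp (LinearMap.linearProjOfIsCompl K ψ hψ hK)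
  have hχ : ∀ v : P.V, χ (ψ v) = v.1 j := fun v =>
    congrArg (fun v : P.V => v.1 j) (LinearMap.linearProjOfIsCompl_apply_left K ψ hψ hK v)
  let a : Fin n → ℤ := fun i => if h : i ∈ S then χ (Pi.single ⟨i, h⟩ 1) else 0
  have ha : ∀ i ∉ S, a i = 0 := fun i hi => dif_neg hi
  refine ⟨Pi.single j 1 - a, fun v hv => ?_, ?_, fun i hij hi => ?_⟩
  · have h := hχ ⟨v, hv⟩
    rw [LinearMap.pi_apply_eq_sum_univ χ] at h
    change _ = v j at h
    have h2 : ∑ i, a i * v i = v j := by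
      rw [← h, ← Finset.sum_subset (Finset.subset_univ S) fun i _ hi => by rw [ha i hi, zero_mul],
        ← Finset.sum_coe_sort S]
      refine sum_congr rfl fun i _ => ?_
      have h3 : a i.1 = χ (Pi.single i 1) := dif_pos i.2
      rw [h3, smul_eq_mul, mul_comm]
      congr 2
      funext k
      simp [Pi.single_apply, eq_comm]
    simp only [Pi.sub_apply, sub_mul, sum_sub_distrib, h2]
    simp [Pi.single_apply]
  · rw [Pi.sub_apply, Pi.single_eq_same, ha j hj, sub_zero]
  · by_contra h
    rw [Pi.sub_apply, Pi.single_eq_of_ne hij, ha i h, sub_zero] at hi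
    exact hi rfl

/-- The nilpotence criterion: at a prime where not all parameters vanish, either a chamber has an
unbounded neighbour reached by crossing only walls whose parameters are invertible, or the
parameters which vanish generate all others. -/
lemma mem_radical_of_arrangement (D : CategoryODatum n) {R : Type*} [CommRing R] (z : Fin n → R)
    (q : Ideal R) {α : SignVector n} (hα : D.Feasible α)
    (h1 : ∀ γ, D.Feasible γ → ¬ D.Bounded γ → ∏ i with α i ≠ γ i, z i ∈ q)
    (h2 : ∀ p : Ideal R, p.IsPrime → q ≤ p → ∀ g ∈ D.cocharG, ∀ j, g j = 1 →
      (∀ i, i ≠ j → g i ≠ 0 → z i ∈ p) → z j ∈ p) (j : Fin n) : z j ∈ q.radical := by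
  classical
  rw [Ideal.radical_eq_sInf, Ideal.mem_sInf]
  rintro p ⟨hqp, hp⟩
  let S : Finset (Fin n) := {i | z i ∈ p}
  by_cases hS : D.flatDirection S = ⊥
  · by_cases hj : j ∈ S
    · exact (mem_filter.1 hj).2
    obtain ⟨g, hg, hgj, hgS⟩ := exists_cochar D.unimodular hS hj
    exact h2 p hp hqp g hg j hgj fun i hij hi => (mem_filter.1 (hgS i hij hi)).2
  · obtain ⟨v, hv, hm⟩ := exists_m_pos D.mRegular hS
    obtain ⟨γ, hγ, hγB, hγv⟩ := exists_unbounded hα hm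
    obtain ⟨i, hi, hip⟩ := hp.prod_mem_iff.1 (hqp (h1 γ hγ hγB))
    have hiS : i ∈ S := mem_filter.2 ⟨mem_univ _, hip⟩
    exact absurd (hγv i (hv i hiS)).symm (mem_filter.1 hi).2

/-- The nilpotence criterion for a ring generated by central parameters and paths. -/
lemma exists_pow_eq_zero_of_paths (D : CategoryODatum n) {R B : Type*} [CommRing R] [Ring B]
    (ρ : R →+* B) (z : Fin n → R) (p : SignVector n → SignVector n → B)
    (hp : ∀ α β, D.Feasible α → D.Feasible β → p α β * p β α = ρ (∏ i with α i ≠ β i, z i) * p α α)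
    (hsum : ∑ α, p α α = 1) (hfeas : ∀ α, ¬ D.Feasible α → p α α = 0)
    (hB : ∀ γ β, D.Feasible γ → ¬ D.Bounded γ → p γ β = 0)
    (h : ∀ p : Ideal R, p.IsPrime → RingHom.ker ρ ≤ p → ∀ g ∈ D.cocharG, ∀ j, g j = 1 →
      (∀ i, i ≠ j → g i ≠ 0 → z i ∈ p) → z j ∈ p) : ∃ N, ∀ j, ρ (z j) ^ N = 0 := by
  classical
  have hex : ∀ α j, ∃ N, ρ (z j ^ N) * p α α = 0 := fun α j => by
    by_cases hα : D.Feasible α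
    · let q : Ideal R :=
        { carrier := {r | ρ r * p α α = 0}
          add_mem' := by simp +contextual [add_mul]
          zero_mem' := by simp
          smul_mem' := by simp +contextual [mul_assoc] }
      exact mem_radical_of_arrangement D z q hα
        (fun γ hγ hγB => (hp α γ hα hγ).symm.trans (by rw [hB γ α hγ hγB, mul_zero]))
        (fun I hI hqI => h I hI fun r hr => hqI
          (show ρ r * p α α = 0 by rw [(RingHom.mem_ker).1 hr, zero_mul])) j
    · exact ⟨0, by rw [hfeas α hα, mul_zero]⟩
  choose N hN using hex
  refine ⟨∑ α, ∑ j, N α j, fun j => ?_⟩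
  rw [← mul_one (ρ (z j) ^ _), ← hsum, mul_sum]
  refine sum_eq_zero fun α _ => ?_
  have hle : N α j ≤ ∑ α, ∑ j, N α j :=
    (Finset.single_le_sum (f := fun j => N α j) (fun _ _ => Nat.zero_le _) (mem_univ j)).trans
      (Finset.single_le_sum (f := fun α => ∑ j, N α j) (fun _ _ => Nat.zero_le _) (mem_univ α))
  rw [← Nat.sub_add_cancel hle, pow_add, mul_assoc, ← map_pow ρ (z j) (N α j), hN, mul_zero]

end Nilpotence

section Corner

variable {A : Type} [Ring A] [Algebra ℂ A] {e : A} (he : IsIdempotentElem e)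

/-- The linear map `a ↦ e a e`. -/
def cornerLinear : A →ₗ[ℂ] he.Corner where
  toFun := toCorner he
  map_add' := toCorner_add he
  map_smul' c a := Subtype.ext (by
    change e * (c • a) * e = c • (e * a * e)
    rw [mul_smul_comm, smul_mul_assoc])

lemma cornerLinear_apply (a : A) : cornerLinear he a = toCorner he a := rfl

lemma toCorner_mul {a : A} (ha : Commute a e) (b : A) :
    toCorner he a * toCorner he b = toCorner he (a * b) := Subtype.ext (by
  change e * a * e * (e * b * e) = e * (a * b) * e
  have h : e * a * e = e * a := by rw [mul_assoc, ha.eq, ← mul_assoc, he.eq]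
  have h' : e * a = a * e := ha.eq.symm
  rw [h, h', ← mul_assoc, mul_assoc a e (e * b), ← mul_assoc e e b, he.eq, ← mul_assoc a e b, ← h']
  simp only [mul_assoc])

/-- A homomorphism whose values commute with `e` induces a homomorphism to the corner. -/
def cornerHom {R : Type*} [Ring R] [Algebra ℂ R] (θ : R →ₐ[ℂ] A) (hθ : ∀ r, Commute (θ r) e) :
    R →ₐ[ℂ] he.Corner :=
  AlgHom.ofLinearMap ((cornerLinear he).comp θ.toLinearMap)
    ((congrArg (toCorner he) (map_one θ)).trans (toCorner_one he))
    fun x y => ((toCorner_mul he (hθ x) (θ y)).trans (congrArg (toCorner he) (map_mul θ x y).symm)).symm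

lemma toCorner_comm {w : A} (hw : ∀ a, Commute w a) (x : he.Corner) : Commute (toCorner he w) x := by
  obtain ⟨h1, h2⟩ := (Subsemigroup.mem_corner_iff he).1 x.2
  refine Subtype.ext ?_
  change e * w * e * x.1 = x.1 * (e * w * e)
  rw [mul_assoc _ e, h1, ← mul_assoc, ← mul_assoc, h2, mul_assoc e, (hw x.1).eq, ← mul_assoc, h1,
    mul_assoc, (hw e).eq, ← mul_assoc, h2]

end Corner

section Bounded

variable {n : ℕ} {A : Type} [Ring A] [Algebra ℂ A] {E : SignVector n → A}
  (hE : OrthogonalIdempotents E)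

include hE in
lemma sumIdem_mul_of_mem {T : Set (SignVector n)} {γ : SignVector n} (h : γ ∈ T) :
    sumIdem E T * E γ = E γ := by
  classical
  rw [sumIdem, sum_mul, sum_eq_single γ, (hE.idem γ).eq]
  · exact fun β _ hβ => hE.ortho hβ
  · exact fun h' => absurd (mem_filter.2 ⟨mem_univ _, h⟩) h'

include hE in
lemma mul_sumIdem_of_mem {T : Set (SignVector n)} {γ : SignVector n} (h : γ ∈ T) :
    E γ * sumIdem E T = E γ := by
  classical
  rw [sumIdem, mul_sum, sum_eq_single γ, (hE.idem γ).eq]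
  · exact fun β _ hβ => hE.ortho hβ.symm
  · exact fun h' => absurd (mem_filter.2 ⟨mem_univ _, h⟩) h'

include hE in
lemma sumIdem_mul_of_notMem {T : Set (SignVector n)} {γ : SignVector n} (h : γ ∉ T) :
    sumIdem E T * E γ = 0 := by
  classical
  rw [sumIdem, sum_mul]
  refine sum_eq_zero fun β hβ => hE.ortho fun hβγ => h ?_
  subst hβγ
  exact (mem_filter.1 hβ).2

/-- The central parameters act nilpotently on `A(t,m)`. -/
lemma exists_pow_toBounded_eq_zero (D : CategoryODatum n) (hsum : ∑ α, E α = 1)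
    {R : Type*} [CommRing R] [Algebra ℂ R] (θ : R →ₐ[ℂ] A) (hθ : ∀ r a, Commute (θ r) a)
    (z : Fin n → R) (u : SignVector n → SignVector n → A) (hself : ∀ α, u α α = E α)
    (hleft : ∀ α β, E α * u α β = u α β) (hright : ∀ α β, u α β * E β = u α β)
    (hu : ∀ α β, u α β * u β α = θ (∏ i with α i ≠ β i, z i) * E α)
    (h : ∀ p : Ideal R, p.IsPrime → RingHom.ker θ ≤ p → ∀ g ∈ D.cocharG, ∀ j, g j = 1 →
      (∀ i, i ≠ j → g i ≠ 0 → z i ∈ p) → z j ∈ p) :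
    ∃ N, ∀ j, toBounded D.toPolarizedArrangement hE (θ (z j)) ^ N = 0 := by
  let P := D.toPolarizedArrangement
  let he := sumIdem_idem hE (𝓕 P)
  let ρ0 : R →ₐ[ℂ] FeasibleAlg P hE := cornerHom he θ fun r => hθ r _
  let π : FeasibleAlg P hE →ₐ[ℂ] BoundedAlg P hE := quo _
  refine exists_pow_eq_zero_of_paths D (π.comp ρ0).toRingHom z
    (fun α β => toBounded P hE (u α β)) ?_ ?_ ?_ ?_ fun p hp hker => h p hp fun r hr => hker ?_
  · intro α β hα hβ
    refine Eq.trans (b := π (ρ0 (∏ i with α i ≠ β i, z i) * toFeasible P hE (u α α))) ?_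
      (map_mul π _ _)
    refine (map_mul π _ _).symm.trans (congrArg π ?_)
    refine Eq.trans ?_ (toCorner_mul he (hθ _ _) _).symm
    refine Subtype.ext ?_
    change _ * u α β * _ * (_ * u β α * _) = _ * _ * _
    have h1 : u α β * sumIdem E (𝓕 P) = u α β := by
      rw [← hright α β, mul_assoc, mul_sumIdem_of_mem hE (T := 𝓕 P) hβ]
    have h2 : sumIdem E (𝓕 P) * u β α = u β α := by
      rw [← hleft β α, ← mul_assoc, sumIdem_mul_of_mem hE (T := 𝓕 P) hβ]
    rw [hself, ← hu α β, mul_assoc _ (u α β), h1, h2, ← mul_assoc, ← mul_assoc]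
  · have h1 : ∑ α, toFeasible P hE (u α α) = 1 := by
      simp only [hself]
      exact ((map_sum (cornerLinear he) E univ).symm.trans
        (congrArg (cornerLinear he) hsum)).trans (toCorner_one he)
    exact ((map_sum π _ _).symm.trans (congrArg π h1)).trans (map_one π)
  · intro α hα
    have h1 : toFeasible P hE (u α α) = 0 := Subtype.ext (by
      change sumIdem E (𝓕 P) * u α α * _ = 0
      rw [hself, sumIdem_mul_of_notMem hE (T := 𝓕 P) hα, zero_mul])
    exact (congrArg π h1).trans (map_zero π)
  · intro γ β hγ hγB
    have h1 : toFeasible P hE (u γ β) = unboundedIdem P hE * toFeasible P hE (u γ β) :=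
      Subtype.ext (by
        change sumIdem E (𝓕 P) * u γ β * _ = (unboundedIdem P hE).1 * (_ * u γ β * _)
        rw [unboundedIdem_val, ← hleft, ← mul_assoc,
          sumIdem_mul_of_mem hE (T := 𝓕 P) hγ, ← mul_assoc, ← mul_assoc,
          sumIdem_mul_of_mem hE (T := {α | P.Feasible α ∧ ¬ P.Bounded α}) ⟨hγ, hγB⟩])
    refine (congrArg π h1).trans ((map_mul π _ _).trans ?_)
    have h2 : π (unboundedIdem P hE) = 0 := mk_eq_zero rfl
    rw [h2, zero_mul]
  · change π (toCorner he (θ r)) = 0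
    rw [(RingHom.mem_ker).1 hr, ← cornerLinear_apply, map_zero, map_zero]

/-- The inclusion of monodromic objects is an equivalence if the parameters are nilpotent. -/
lemma isEquivalence_ι_of_pow_eq_zero {z : Fin n → A} (h : ∃ N, ∀ i, z i ^ N = 0) :
    (IsMonodromic z).ι.IsEquivalence := by
  obtain ⟨N, hN⟩ := h
  exact { essSurj := ⟨fun X => ⟨⟨X, isMonodromic_of_pow_eq_zero N hN X⟩, ⟨Iso.refl _⟩⟩⟩ }

end Bounded

section Parameters

variable {n : ℕ}

lemma exists_pow_paramBettm (D : CategoryODatum n) :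
    ∃ N, ∀ i, paramBettm D.toPolarizedArrangement i ^ N = 0 := by
  let P := D.toPolarizedArrangement
  have hcomm : ∀ (r : Laurent n) (a : ABetG P), Commute ((projBet P).comp torusAction r) a := by
    intro r a
    obtain ⟨a, rfl⟩ := projBet_surjective P a
    exact (torusAction_comm r a).map (projBet P)
  refine Exists.imp (fun N hN i => ?_) (exists_pow_toBounded_eq_zero (projBet_orthogonal P) D
    ((map_sum (projBet P) _ _).symm.trans ((congrArg _ sum_idemBet).trans (map_one _)))
    ((projBet P).comp torusAction) hcomm coordZ (fun α β => projBet P (bettiPath α β))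
    (fun α => congrArg _ (bettiPath_self α))
    (fun α β => (map_mul (projBet P) _ _).symm.trans (congrArg _ (pureTensor_mul_eq fun i => ?_)))
    (fun α β => (map_mul (projBet P) _ _).symm.trans (congrArg _ (pureTensor_mul_eq fun i => ?_)))
    (fun α β => ?_) fun p hp hker g hg j hgj hz => ?_)
  · rw [← hN i]
    change toBounded _ _ (projBet P (paramBet i)) ^ N = _
    rw [← torusAction_coordZ']
    rfl
  · rw [← map_mul, e_mul_arrow]
  · rw [← map_mul, arrow_mul_e]
  · refine (map_mul (projBet P) _ _).symm.trans (Eq.trans (congrArg _ ?_) (map_mul (projBet P) _ _))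
    rw [bettiPath_mul, bettiPath_self, signVal_eq_prod]
    simp only [true_and, ne_comm]
    rfl
  · have hgK : g ∈ trivialChars p := mem_trivialChars.2 <| hker <| by
      rw [RingHom.mem_ker, map_sub, map_one]
      have h : projBet P (pureTensor (fun i => ((monodromyUnit ^ g i : ABet1ˣ) : ABet1)) - 1) = 0 :=
        mk_eq_zero ⟨g, hg, rfl⟩
      rwa [← torusAction_single, map_sub, map_one] at h
    have hK : g - Pi.single j 1 ∈ trivialChars p := mem_of_forall_single fun i hi => by
      by_cases hij : i = j
      · subst hij
        simp [hgj] at hi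
      · exact (coordZ_mem_iff i).1 (hz i hij (by simpa [hij] using hi))
    rw [coordZ_mem_iff, ← sub_sub_cancel g (Pi.single j 1)]
    exact sub_mem hgK hK

/-- The straight path from `γ` to `β` in the cube. -/
def deRhamPath (γ β : SignVector n) : AdR n := pureTensor fun i => arrow (γ i) (β i)

lemma paramdR_comm (i : Fin n) (x : AdR n) : Commute (paramdR i) x := by
  refine TensorPower.commute_pureTensor (fun j b => ?_) x
  by_cases hj : j = i
  · subst hj
    rw [update_self]
    exact loop_comm b
  · rw [update_of_ne hj]
    exact Commute.one_left b

/-- The element `d_i` of the center of `A^dR_n`. -/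
def centraldR (i : Fin n) : Subalgebra.center ℂ (AdR n) :=
  ⟨paramdR i, Subalgebra.mem_center_iff.2 fun x => (paramdR_comm i x).eq.symm⟩

lemma exists_pow_paramdRtm (D : CategoryODatum n) :
    ∃ N, ∀ i, paramdRtm D.toPolarizedArrangement i ^ N = 0 := by
  let P := D.toPolarizedArrangement
  let θ : Subalgebra.center ℂ (AdR n) →ₐ[ℂ] AdRG P := (projdR P).comp (Subalgebra.val _)
  have hcomm : ∀ r (a : AdRG P), Commute (θ r) a := by
    intro r a
    obtain ⟨a, rfl⟩ := mk_surjective _ a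
    exact (show Commute (r : AdR n) a from (Subalgebra.mem_center_iff.1 r.2 a).symm).map (projdR P)
  refine Exists.imp (fun N hN i => hN i) (exists_pow_toBounded_eq_zero (projdR_orthogonal P) D
    ((map_sum (projdR P) _ _).symm.trans ((congrArg _ (sum_pureTensor _ e_complete)).trans
      (map_one _)))
    θ hcomm centraldR (fun α β => projdR P (deRhamPath α β))
    (fun α => congrArg _ ?_)
    (fun α β => (map_mul (projdR P) _ _).symm.trans (congrArg _
      (pureTensor_mul_eq fun i => e_mul_arrow _ _)))
    (fun α β => (map_mul (projdR P) _ _).symm.trans (congrArg _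
      (pureTensor_mul_eq fun i => arrow_mul_e _ _)))
    (fun α β => ?_) fun p hp hker g hg j hgj hz => ?_)
  · simp only [deRhamPath, idemdR, arrow_self]
  · refine (map_mul (projdR P) _ _).symm.trans (Eq.trans (congrArg _ ?_) (map_mul (projdR P) _ _))
    change deRhamPath α β * deRhamPath β α = ((∏ i with α i ≠ β i, centraldR i :
      Subalgebra.center ℂ (AdR n)) : AdR n) * idemdR α
    have h : (Subalgebra.val _) (∏ i, if α i ≠ β i then centraldR i else 1) =
        pureTensor fun i => if α i ≠ β i then loop else 1 := map_prod_eq_pureTensor _ fun i => by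
      split_ifs
      · rfl
      · exact (map_one (inFactorHom i)).symm
    rw [Finset.prod_filter]
    refine (pureTensor_mul_eq fun i => ?_).trans ((pureTensor_mul_eq fun i => rfl).symm.trans
      (congrArg (· * idemdR α) h.symm))
    rw [arrow_mul_arrow, arrow_self]
    simp only [true_and, ne_comm]
  · have h : ∑ i, g i • centraldR i ∈ p := hker <| by
      rw [RingHom.mem_ker, map_sum]
      have h1 : projdR P (∑ i, g i • paramdR i) = 0 := mk_eq_zero ⟨g, hg, rfl⟩
      rw [map_sum] at h1
      refine Eq.trans (sum_congr rfl fun i _ => ?_) h1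
      exact (map_zsmul θ _ _).trans (map_zsmul (projdR P) _ _).symm
    rw [← Finset.add_sum_erase _ _ (mem_univ j), hgj, one_smul] at h
    refine (Submodule.add_mem_iff_left p (p.sum_mem fun i hi => ?_)).1 h
    by_cases hi0 : g i = 0
    · rw [hi0, zero_smul]
      exact p.zero_mem
    · exact zsmul_mem (hz i (ne_of_mem_erase hi) hi0) _

end Parameters

/-! ### The exponential on nilpotent elements and its inverse -/

section Exponential

open Polynomial

/-- A polynomial change of coordinates `x ↦ x M(x)` with `M(0) ≠ 0` has an inverse up to any
order. -/
lemma exists_comp_inverse (M : ℂ[X]) (hM : M.coeff 0 ≠ 0) (N : ℕ) :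
    ∃ ψ : ℂ[X], X ^ N ∣ ψ.comp (X * M) * M - 1 := by
  induction N with
  | zero => exact ⟨0, by simp⟩
  | succ N ih =>
    obtain ⟨ψ, r, hr⟩ := ih
    let c : ℂ := -r.coeff 0 / M.coeff 0 ^ (N + 1)
    refine ⟨ψ + C c * X ^ N, ?_⟩
    have h : (ψ + C c * X ^ N).comp (X * M) * M - 1 = X ^ N * (r + C c * M ^ (N + 1)) := by
      rw [add_comp, mul_comp, C_comp, pow_comp, X_comp, mul_add, ← hr]
      ring
    rw [h, pow_succ]
    refine mul_dvd_mul_left _ (X_dvd_iff.2 ?_)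
    rw [Polynomial.coeff_add, coeff_C_mul, coeff_zero_eq_eval_zero (M ^ (N + 1)), eval_pow,
      ← coeff_zero_eq_eval_zero, div_mul_cancel₀ _ (pow_ne_zero _ hM), add_neg_cancel]

variable {A : Type} [Ring A] [Algebra ℂ A]

lemma aeval_eq_zero_of_dvd {x : A} {N : ℕ} (hx : x ^ N = 0) {f : ℂ[X]} (h : X ^ N ∣ f) :
    aeval x f = 0 := by
  obtain ⟨g, rfl⟩ := h
  rw [map_mul, map_pow, aeval_X, hx, zero_mul]

lemma aeval_comm (x : A) (f g : ℂ[X]) : Commute (aeval x f) (aeval x g) := by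
  rw [Commute, SemiconjBy, ← map_mul, mul_comm, map_mul]

lemma mul_aeval_pow {x : A} {N : ℕ} (hx : x ^ N = 0) (f : ℂ[X]) : (x * aeval x f) ^ N = 0 := by
  have h := aeval_comm x X f
  rw [aeval_X] at h
  rw [h.mul_pow, hx, zero_mul]

/-- The coordinate changes `d ↦ d M(d)` and `z ↦ z ψ(z)` on nilpotent elements are inverse to each
other. -/
lemma exists_inverse_on_nilpotents (M : ℂ[X]) (hM : M.coeff 0 ≠ 0) (N : ℕ) :
    ∃ ψ : ℂ[X], ∀ (A : Type) [Ring A] [Algebra ℂ A] (x : A), x ^ N = 0 →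
      aeval (x * aeval x M) ψ * aeval x M = 1 ∧ aeval (x * aeval x ψ) M * aeval x ψ = 1 := by
  have key : ∀ M : ℂ[X], M.coeff 0 ≠ 0 → ∃ ψ : ℂ[X], ψ.coeff 0 ≠ 0 ∧
      ∀ (A : Type) [Ring A] [Algebra ℂ A] (x : A), x ^ N = 0 →
        aeval (x * aeval x M) ψ * aeval x M = 1 := fun M hM => by
    obtain ⟨ψ, hψ⟩ := exists_comp_inverse M hM (N + 1)
    refine ⟨ψ, fun h => ?_, fun A _ _ x hx => ?_⟩
    · have h1 := X_dvd_iff.1 ((dvd_pow_self X N.succ_ne_zero).trans hψ)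
      rw [coeff_zero_eq_eval_zero] at h h1
      simp [h] at h1
    · have h := aeval_eq_zero_of_dvd hx ((pow_dvd_pow X N.le_succ).trans hψ)
      rwa [map_sub, map_one, map_mul, aeval_comp, map_mul, aeval_X, sub_eq_zero] at h
  obtain ⟨ψ, hψ₀, hψ⟩ := key M hM
  obtain ⟨χ, -, hχ⟩ := key ψ hψ₀
  refine ⟨ψ, fun A _ _ x hx => ⟨hψ A x hx, ?_⟩⟩
  -- a left inverse `χ` of `ψ` agrees with the right inverse `M`
  have h1 : ∀ y : A, y ^ N = 0 → y * aeval y M * aeval (y * aeval y M) ψ = y := fun y hy => by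
    have hc := aeval_comm y M (ψ.comp (X * M))
    rw [aeval_comp, map_mul, aeval_X] at hc
    rw [mul_assoc, hc.eq, hψ A y hy, mul_one]
  have h2 : ∀ y : A, y ^ N = 0 → y * aeval y ψ * aeval (y * aeval y ψ) χ = y := fun y hy => by
    have hc := aeval_comm y ψ (χ.comp (X * ψ))
    rw [aeval_comp, map_mul, aeval_X] at hc
    rw [mul_assoc, hc.eq, hχ A y hy, mul_one]
  have hy := mul_aeval_pow hx ψ
  have h3 := h2 _ (mul_aeval_pow hy M)
  rw [h1 _ hy, h2 x hx] at h3
  have h4 := hψ A _ hy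
  rw [← h3] at h4
  have hc := aeval_comm x ψ (M.comp (X * ψ))
  rw [aeval_comp, map_mul, aeval_X] at hc
  rw [← hc.eq]
  exact h4

/-- The polynomial underlying `malgrangeSeries`. -/
def malgrangePoly (k : ℕ) : ℂ[X] := malgrangeSeries k X

lemma aeval_malgrangePoly (k : ℕ) (x : A) : aeval x (malgrangePoly k) = malgrangeSeries k x := by
  simp only [malgrangePoly, malgrangeSeries, map_neg, map_sum, map_smul, map_pow, aeval_X]

lemma malgrangePoly_coeff_zero (k : ℕ) : (malgrangePoly k).coeff 0 ≠ 0 := by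
  have h : (malgrangePoly k).coeff 0 = -(2 * Real.pi * Complex.I) := by
    rw [malgrangePoly, malgrangeSeries, Finset.sum_range_succ', Polynomial.coeff_neg, Polynomial.coeff_add,
      finsetSum_coeff, sum_eq_zero fun j _ => by rw [Polynomial.coeff_smul, coeff_X_pow]; simp]
    simp
  rw [h]
  exact neg_ne_zero.2 Complex.two_pi_I_ne_zero

lemma malgrangeSeries_eq_of_le {k l : ℕ} (h : k ≤ l) {x : A} (hx : x ^ (k + 1) = 0) :
    malgrangeSeries l x = malgrangeSeries k x := by
  rw [malgrangeSeries, malgrangeSeries, neg_inj]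
  refine (Finset.sum_subset (Finset.range_mono (Nat.succ_le_succ h)) fun j _ hj => ?_).symm
  rw [Finset.mem_range, not_lt] at hj
  rw [pow_eq_zero_of_le hj hx, smul_zero]

lemma isUnit_malgrangeSeries {k : ℕ} {x : A} (hx : x ^ (k + 1) = 0) :
    IsUnit (malgrangeSeries k x) := by
  have hX : IsCoprime X (malgrangePoly k) := irreducible_X.coprime_iff_not_dvd.2 fun h =>
    malgrangePoly_coeff_zero k (X_dvd_iff.1 h)
  obtain ⟨a, b, h⟩ := hX.pow_left (m := k + 1)
  have h1 := congrArg (aeval x) h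
  rw [map_add, map_mul, map_mul, map_pow, aeval_X, hx, mul_zero, zero_add, map_one,
    aeval_malgrangePoly] at h1
  have h2 := aeval_comm x b (malgrangePoly k)
  rw [aeval_malgrangePoly] at h2
  exact ⟨⟨_, _, h2.eq.symm.trans h1, h1⟩, rfl⟩

lemma eq_zero_of_mul_malgrangeSeries {k : ℕ} {x : A} (hx : x ^ (k + 1) = 0)
    (h : x * malgrangeSeries k x = 0) : x = 0 :=
  (isUnit_malgrangeSeries hx).mul_left_eq_zero.1 h

/-- The truncated exponential series. -/
def nilExp (x : A) : A :=
  letI : Algebra ℚ A := Algebra.compHom A (algebraMap ℚ ℂ)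
  IsNilpotent.exp x

lemma nilExp_add {x y : A} (hx : IsNilpotent x) (hy : IsNilpotent y) (h : Commute x y) :
    nilExp (x + y) = nilExp x * nilExp y := by
  let _ : Algebra ℚ A := Algebra.compHom A (algebraMap ℚ ℂ)
  exact IsNilpotent.exp_add_of_commute h hx hy

lemma nilExp_zero : nilExp (0 : A) = 1 := by
  let _ : Algebra ℚ A := Algebra.compHom A (algebraMap ℚ ℂ)
  exact IsNilpotent.exp_zero

lemma nilExp_smul {k : ℕ} {x : A} (hx : x ^ (k + 1) = 0) :
    nilExp ((2 * Real.pi * Complex.I : ℂ) • x) = 1 - x * malgrangeSeries k x := by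
  let _ : Algebra ℚ A := Algebra.compHom A (algebraMap ℚ ℂ)
  have h : ((2 * Real.pi * Complex.I : ℂ) • x) ^ (k + 1 + 1) = 0 := by
    rw [_root_.smul_pow, pow_succ x, hx, zero_mul, smul_zero]
  refine (IsNilpotent.exp_eq_sum h).trans ?_
  rw [Finset.sum_range_succ', malgrangeSeries, mul_neg, sub_neg_eq_add, add_comm, mul_sum]
  congr 1
  · simp
  · refine sum_congr rfl fun j _ => ?_
    rw [_root_.smul_pow, mul_smul_comm, ← pow_succ', div_eq_inv_mul, mul_smul]
    change (((((j + 1).factorial : ℚ)⁻¹ : ℚ)) : ℂ) • ((2 * Real.pi * Complex.I : ℂ) ^ (j + 1) •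
      x ^ (j + 1)) = _
    rw [Rat.cast_inv, Rat.cast_natCast]

end Exponential

/-! ### Malgrange's isomorphisms -/

section TensorLift

variable {n : ℕ} {B C : Type} [Ring B] [Algebra ℂ B] [Ring C] [Algebra ℂ C]

/-- The homomorphism on a tensor power given by commuting homomorphisms on the factors. -/
def liftComm (f : Fin n → B →ₐ[ℂ] C)
    (hf : Pairwise fun i j => ∀ b c, Commute (f i b) (f j c)) : TensorPower n B →ₐ[ℂ] C :=
  let φ : (Fin n → B) →* C := MonoidHom.noncommPiCoprod (fun i => ((f i : B →* C))) hf
  have hφ : ∀ [DecidableEq (Fin n)] (m : Fin n → B) i x,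
      φ (update m i x) = f i x * φ (update m i 1) := fun {_} m i x => by
    have h1 : update m i x = Pi.mulSingle i x * update m i 1 := by
      funext j
      by_cases hj : j = i
      · subst hj
        simp
      · simp [hj]
    have h2 : φ (Pi.mulSingle i x) = f i x := by
      convert MonoidHom.noncommPiCoprod_mulSingle (fun i => ((f i : B →* C))) (hcomm := hf) i x
      rfl
    rw [h1, map_mul, h2]
  TensorPower.lift
    { toFun := φ
      map_update_add' := fun m i x y => by rw [hφ m i (x + y), hφ m i x, hφ m i y, map_add, add_mul]
      map_update_smul' := fun m i c x => by
        rw [hφ m i (c • x), hφ m i x, map_smul, smul_mul_assoc] }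
    (map_one φ) (map_mul φ)

lemma liftComm_inFactor (f : Fin n → B →ₐ[ℂ] C)
    (hf : Pairwise fun i j => ∀ b c, Commute (f i b) (f j c)) (i : Fin n) (b : B) :
    liftComm f hf (inFactor i b) = f i b :=
  (TensorPower.lift_pureTensor _ _ _ _).trans
    (MonoidHom.noncommPiCoprod_mulSingle (fun i => ((f i : B →* C))) (hcomm := hf) i b)

lemma prod_ofFn_mul {M : Type*} [Monoid M] {k : ℕ} {a b : Fin k → M}
    (h : ∀ i j, Commute (b i) (a j)) :
    (ofFn fun j => a j * b j).prod = (ofFn a).prod * (ofFn b).prod := by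
  induction k with
  | zero => simp
  | succ k ih =>
    have hc : Commute (b 0) (ofFn fun j : Fin k => a j.succ).prod :=
      Commute.list_prod_right _ _ fun x hx => by
        obtain ⟨j, rfl⟩ := List.mem_ofFn.1 hx
        exact h _ _
    simp only [List.ofFn_succ, List.prod_cons]
    rw [ih fun i j => h _ _, mul_assoc, ← mul_assoc (b 0), hc.eq]
    simp only [mul_assoc]

/-- `f` kills the monomials of degree `k` in the `z_i`. -/
abbrev Kills {A : Type} [Ring A] [Algebra ℂ A] (f : A →ₐ[ℂ] C) (z : Fin n → A) (k : ℕ) : Prop :=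
  ∀ s ∈ monomials z k, f s = 0

/-- A homomorphism killing the monomials in central elements `z_i` also kills the monomials in
multiples of the `z_i`. -/
lemma prod_ofFn_eq_zero {A : Type} [Ring A] [Algebra ℂ A] {k : ℕ} {z x : Fin n → A}
    (hz : ∀ i a, Commute (z i) a) (f : A →ₐ[ℂ] C) (hf : Kills f z k)
    (s : Fin k → Fin n) : (ofFn fun j => f (z (s j) * x (s j))).prod = 0 := by
  have h := map_list_prod f (ofFn fun j => z (s j) * x (s j))
  rw [map_ofFn] at h
  refine h.symm.trans ?_
  rw [prod_ofFn_mul fun i j => (hz (s j) _).symm, map_mul, hf _ ⟨s, rfl⟩, zero_mul]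

lemma pow_eq_zero_of_monomials {A : Type} [Ring A] [Algebra ℂ A] {k : ℕ} {z : Fin n → A}
    (f : A →ₐ[ℂ] C) (hf : Kills f z k) (i : Fin n) : f (z i) ^ k = 0 := by
  rw [← map_pow]
  refine hf _ ⟨fun _ => i, ?_⟩
  simp only [List.ofFn_const, List.prod_replicate]

end TensorLift

section Twist

open Polynomial PathAlg

lemma aeval_loop_comm (φ : ℂ[X]) (x : PathAlg) : Commute (aeval loop φ) x := by
  induction φ using Polynomial.induction_on' with
  | add p q hp hq => rw [map_add]; exact hp.add_left hq
  | monomial k a =>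
    rw [aeval_monomial]
    exact Commute.mul_left (Algebra.commutes a x) ((loop_comm x).pow_left k)

/-- The endomorphism of the path algebra which multiplies the arrow `up` by a polynomial in the
central element `loop`. -/
def twist (φ : ℂ[X]) : PathAlg →ₐ[ℂ] PathAlg :=
  Rep.hom
    { e := e
      down := down
      up := aeval loop φ * up
      orth := e_orthogonal
      complete := e_complete
      down_source := e_mul_down
      down_target := down_mul_e
      up_source := by
        rw [← mul_assoc, ← (aeval_loop_comm φ _).eq, mul_assoc, e_mul_up]
      up_target := by rw [mul_assoc, up_mul_e] }

lemma twist_e (φ : ℂ[X]) (s : Bool) : twist φ (e s) = e s := Rep.hom_e _ s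

lemma twist_down (φ : ℂ[X]) : twist φ down = down := Rep.hom_down _

lemma twist_up (φ : ℂ[X]) : twist φ up = aeval loop φ * up := Rep.hom_up _

lemma twist_loop (φ : ℂ[X]) : twist φ loop = loop * aeval loop φ := by
  have h : twist φ loop = twist φ down * twist φ up + twist φ up * twist φ down := by
    rw [loop, map_add, map_mul, map_mul]
  rw [h, twist_down, twist_up, ← mul_assoc, ← (aeval_loop_comm φ down).eq, mul_assoc, mul_assoc,
    ← mul_add, (aeval_loop_comm φ _).eq]
  rfl

variable {n : ℕ} {C : Type} [Ring C] [Algebra ℂ C]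

lemma aeval_algHom {A B : Type} [Ring A] [Algebra ℂ A] [Ring B] [Algebra ℂ B] (f : A →ₐ[ℂ] B)
    (x : A) (φ : ℂ[X]) : f (aeval x φ) = aeval (f x) φ := (aeval_algHom_apply f x φ).symm

lemma inFactor_toABet1_loop (i : Fin n) : inFactor i (toABet1 loop) = paramBet i :=
  (torusAction_coordZ i).symm.trans (torusAction_coordZ' i)

lemma ABet1.commute_of_forall {g : ABet1 →ₐ[ℂ] C} {x : C} (h : ∀ y, Commute x (g (toABet1 y)))
    (b : ABet1) : Commute x (g b) := by
  refine (mem_centralizer_iff ℂ).1 (ABet1.mem_of_gen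
    ((Subalgebra.centralizer ℂ {x}).comap g) (fun y => ?_) ?_ b) x rfl
  · refine (mem_centralizer_iff ℂ).2 ?_
    intro y' hy'
    rw [Set.mem_singleton_iff.1 hy']
    exact h y
  · refine (mem_centralizer_iff ℂ).2 ?_
    intro y' hy'
    rw [Set.mem_singleton_iff.1 hy']
    have h1 : Commute x ((Units.map g.toMonoidHom monodromyUnit : Cˣ) : C) := h _
    have h2 := h1.units_inv_right
    rwa [← map_inv] at h2

lemma ABet1.commute_of_comp {g g' : ABet1 →ₐ[ℂ] C}
    (h : ∀ x y, Commute (g (toABet1 x)) (g' (toABet1 y))) (b c : ABet1) :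
    Commute (g b) (g' c) :=
  ABet1.commute_of_forall (fun y => (ABet1.commute_of_forall (fun x => (h x y).symm) b).symm) c

/-- Malgrange's homomorphism `u ↦ d`, `r_i ↦ (1 - exp (2πi d_i)) / d_i v_i`, relative to a
homomorphism under which the `d_i` become nilpotent. -/
def malgrangeHom (f : AdR n →ₐ[ℂ] C) (k : ℕ) (hf : ∀ i, f (paramdR i) ^ (k + 1) = 0) :
    ABet n →ₐ[ℂ] C :=
  liftComm
    (fun i => ABet1.lift ((f.comp (inFactorHom i)).comp (twist (malgrangePoly k)))
      (by
        rw [map_sub, map_one]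
        refine IsNilpotent.isUnit_one_sub ⟨k + 1, ?_⟩
        rw [AlgHom.comp_apply, twist_loop, map_mul, aeval_algHom]
        exact mul_aeval_pow (hf i) _))
    fun i j hij => ABet1.commute_of_comp fun x y => by
      rw [ABet1.lift_toABet1, ABet1.lift_toABet1]
      exact (TensorPower.inFactor_mul_comm hij _ _).map f

section Malgrange

variable (f : AdR n →ₐ[ℂ] C) (k : ℕ) (hf : ∀ i, f (paramdR i) ^ (k + 1) = 0)

lemma malgrangeHom_inFactor (i : Fin n) (x : PathAlg) :
    malgrangeHom f k hf (inFactor i (toABet1 x)) = f (inFactor i (twist (malgrangePoly k) x)) :=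
  (liftComm_inFactor _ _ _ _).trans (ABet1.lift_toABet1 _ _ x)

lemma inFactor_aeval {B : Type} [Ring B] [Algebra ℂ B] (i : Fin n) (x : B) (φ : ℂ[X]) :
    inFactor i (aeval x φ) = aeval (inFactor i x) φ :=
  aeval_algHom (inFactorHom i) x φ

lemma malgrangeHom_paramBet (i : Fin n) : malgrangeHom f k hf (paramBet i) =
    f (paramdR i) * malgrangeSeries k (f (paramdR i)) := by
  rw [← inFactor_toABet1_loop, malgrangeHom_inFactor, twist_loop, ← aeval_malgrangePoly,
    ← aeval_algHom, ← map_mul]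
  refine congrArg f ?_
  rw [← inFactorHom_apply, map_mul, aeval_algHom]
  rfl

/-- The monodromy becomes the exponential. -/
lemma malgrangeHom_monodromy (i : Fin n) :
    malgrangeHom f k hf (inFactor i (monodromyUnit : ABet1)) =
      nilExp ((2 * Real.pi * Complex.I : ℂ) • f (paramdR i)) := by
  have h : inFactor i (monodromyUnit : ABet1) = 1 - paramBet i := by rw [paramBet, sub_sub_cancel]
  rw [h, map_sub, map_one, malgrangeHom_paramBet, nilExp_smul (hf i)]

lemma malgrangeHom_zpow (g : Fin n → ℤ) :
    malgrangeHom f k hf (pureTensor fun i => ((monodromyUnit ^ g i : ABet1ˣ) : ABet1)) =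
      nilExp ((2 * Real.pi * Complex.I : ℂ) • f (∑ i, g i • paramdR i)) := by
  have hcomm : ∀ x y : Fin n → ℤ, Commute (∑ i, x i • paramdR i) (∑ i, y i • paramdR i : AdR n) :=
    fun x y => Commute.sum_left _ _ _ fun i _ => (paramdR_comm i _).smul_left (x i)
  have hnil : ∀ x : Fin n → ℤ,
      IsNilpotent ((2 * Real.pi * Complex.I : ℂ) • f (∑ i, x i • paramdR i)) := fun x => by
    rw [map_sum]
    refine IsNilpotent.smul (Commute.isNilpotent_sum (fun i _ => ?_) fun i j _ _ => ?_) _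
    · rw [map_zsmul]
      exact IsNilpotent.smul ⟨k + 1, hf i⟩ _
    · exact (((paramdR_comm i _).smul_left _).smul_right _).map f
  let φ : Multiplicative (Fin n → ℤ) →* C :=
    ((malgrangeHom f k hf).comp torusAction : Laurent n →* C).comp (of ℂ _)
  let χ : Multiplicative (Fin n → ℤ) →* C :=
    { toFun := fun g => nilExp ((2 * Real.pi * Complex.I : ℂ) •
        f (∑ i, Multiplicative.toAdd g i • paramdR i))
      map_one' := by simp [nilExp_zero]
      map_mul' := fun x y => by
        rw [← nilExp_add (hnil _) (hnil _) ((((hcomm _ _).map f).smul_left _).smul_right _),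
          ← smul_add, ← map_add, ← sum_add_distrib]
        simp only [← add_smul]
        rfl }
  have hgen : ∀ i, Multiplicative.ofAdd (Pi.single i 1) ∈ φ.eqLocus χ := fun i => by
    change φ _ = χ _
    refine (congrArg (malgrangeHom f k hf) (torusAction_single_single i)).trans
      ((malgrangeHom_monodromy f k hf i).trans ?_)
    change _ = nilExp ((2 * Real.pi * Complex.I : ℂ) •
        f (∑ j, (Pi.single i (1 : ℤ) : Fin n → ℤ) j • paramdR j))
    rw [sum_eq_single i, Pi.single_eq_same, one_smul]
    · intro j _ hj
      rw [Pi.single_eq_of_ne hj, zero_smul]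
    · simp
  have hmem : g ∈ Subgroup.toAddSubgroup' (φ.eqLocus χ) := mem_of_forall_single fun i _ => hgen i
  rw [← torusAction_single]
  exact hmem

end Malgrange

/-- The homomorphism `u ↦ d`, `v_i ↦ ψ(1 - m_i) r_i`. -/
def logHom (f : ABet n →ₐ[ℂ] C) (ψ : ℂ[X]) : AdR n →ₐ[ℂ] C :=
  liftComm
    (fun i => ((f.comp (inFactorHom i)).comp toABet1).comp (twist ψ))
    fun _ _ hij _ _ => (TensorPower.inFactor_mul_comm hij _ _).map f

lemma logHom_inFactor (f : ABet n →ₐ[ℂ] C) (ψ : ℂ[X]) (i : Fin n) (x : PathAlg) :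
    logHom f ψ (inFactor i x) = f (inFactor i (toABet1 (twist ψ x))) :=
  liftComm_inFactor _ _ _ _

lemma logHom_paramdR (f : ABet n →ₐ[ℂ] C) (ψ : ℂ[X]) (i : Fin n) :
    logHom f ψ (paramdR i) = f (paramBet i) * aeval (f (paramBet i)) ψ := by
  rw [paramdR, logHom_inFactor, twist_loop, ← aeval_algHom, ← map_mul, ← inFactor_toABet1_loop]
  refine congrArg f ?_
  rw [← inFactorHom_apply, map_mul, map_mul, aeval_algHom, aeval_algHom]
  rfl

end Twist

/-! ### Quotients of corners of quotients -/

section CornerQuot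

variable {A : Type} [Ring A] [Algebra ℂ A] (S : Set A) {ε : QuotientBy S}
  (hε : IsIdempotentElem ε) (S2 : Set hε.Corner)

/-- The map `A → ε (A / S) ε / S2`. -/
def cornerQuot : A →ₗ[ℂ] QuotientBy S2 :=
  (quo S2).toLinearMap.comp ((cornerLinear hε).comp (quo S).toLinearMap)

lemma cornerQuot_apply (x : A) : cornerQuot S hε S2 x = quo S2 (toCorner hε (quo S x)) := rfl

lemma cornerQuot_surjective : Surjective (cornerQuot S hε S2) :=
  (mk_surjective S2).comp ((toCorner_surjective hε).comp (mk_surjective S))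

lemma cornerQuot_one : cornerQuot S hε S2 1 = 1 := by
  rw [cornerQuot_apply, map_one, toCorner_one, map_one]

variable {e : A} (he : quo S e = ε)

include he in
lemma cornerQuot_mul (x y : A) :
    cornerQuot S hε S2 x * cornerQuot S hε S2 y = cornerQuot S hε S2 (x * e * y) := by
  rw [cornerQuot_apply, cornerQuot_apply, cornerQuot_apply, ← map_mul]
  refine congrArg _ (Subtype.ext ?_)
  change ε * _ * ε * (ε * _ * ε) = ε * quo S (x * e * y) * ε
  rw [map_mul, map_mul, he]
  simp only [mul_assoc]
  rw [← mul_assoc ε ε, hε.eq]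

include he in
lemma cornerQuot_corner (x : A) : cornerQuot S hε S2 (e * x * e) = cornerQuot S hε S2 x := by
  rw [cornerQuot_apply, cornerQuot_apply, map_mul, map_mul, he]
  refine congrArg _ (Subtype.ext ?_)
  change ε * (ε * _ * ε) * ε = ε * _ * ε
  simp only [mul_assoc]
  rw [hε.eq, ← mul_assoc ε ε, hε.eq]

lemma cornerQuot_mul_of_central {w : A} (hw : ∀ a, Commute w a) (a b : A) :
    cornerQuot S hε S2 (a * w * b) = cornerQuot S hε S2 w * cornerQuot S hε S2 (a * b) := by
  rw [cornerQuot_apply, cornerQuot_apply, cornerQuot_apply, ← map_mul, toCorner_mul,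
    ← map_mul, ← mul_assoc, (hw a).eq]
  obtain ⟨e, rfl⟩ := mk_surjective S ε
  exact (hw e).map _

include he in
/-- The kernel of `cornerQuot`, for a set `T` of lifts of the relations `S2`. -/
lemma cornerQuot_eq_zero_iff {T : Set A}
    (h1 : ∀ c ∈ S2, ∃ t ∈ span (S ∪ T), c = toCorner hε (quo S t))
    (h2 : ∀ t ∈ T, ∀ a b, cornerQuot S hε S2 (a * t * b) = 0) (x : A) :
    cornerQuot S hε S2 x = 0 ↔ e * x * e ∈ span (S ∪ T) := by
  constructor
  · intro h
    let J : TwoSidedIdeal hε.Corner := mk'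
      {c | ∃ t ∈ span (S ∪ T), c = toCorner hε (quo S t)}
      ⟨0, zero_mem _, by rw [map_zero, ← cornerLinear_apply, map_zero]⟩
      (by
        rintro _ _ ⟨t, ht, rfl⟩ ⟨t', ht', rfl⟩
        exact ⟨t + t', add_mem ht ht', by
          rw [map_add]
          exact (map_add (cornerLinear hε) _ _).symm⟩)
      (by
        rintro _ ⟨t, ht, rfl⟩
        exact ⟨-t, neg_mem ht, by
          rw [map_neg]
          exact (map_neg (cornerLinear hε) _).symm⟩)
      (by
        rintro c _ ⟨t, ht, rfl⟩
        obtain ⟨c, rfl⟩ := toCorner_surjective hε c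
        obtain ⟨c, rfl⟩ := mk_surjective S c
        refine ⟨c * e * t, TwoSidedIdeal.mul_mem_left _ _ _ ht, Subtype.ext ?_⟩
        change ε * _ * ε * (ε * _ * ε) = ε * quo S (c * e * t) * ε
        rw [map_mul, map_mul, he]
        simp only [mul_assoc]
        rw [← mul_assoc ε ε, hε.eq])
      (by
        rintro _ c ⟨t, ht, rfl⟩
        obtain ⟨c, rfl⟩ := toCorner_surjective hε c
        obtain ⟨c, rfl⟩ := mk_surjective S c
        refine ⟨t * e * c, TwoSidedIdeal.mul_mem_right _ _ _ (TwoSidedIdeal.mul_mem_right _ _ _ ht),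
          Subtype.ext ?_⟩
        change ε * _ * ε * (ε * _ * ε) = ε * quo S (t * e * c) * ε
        rw [map_mul, map_mul, he]
        simp only [mul_assoc]
        rw [← mul_assoc ε ε, hε.eq])
    have hJ : span S2 ≤ J := TwoSidedIdeal.span_le.2 fun c hc => (mem_mk' _ _ _ _ _ _ _).2 (h1 c hc)
    obtain ⟨t, ht, htx⟩ := (mem_mk' _ _ _ _ _ _ _).1 (hJ (mk_eq_zero_iff.1 h))
    have h3 : quo S (e * x * e - e * t * e) = 0 := by
      rw [map_sub, map_mul, map_mul, map_mul, map_mul, he, sub_eq_zero]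
      exact congrArg Subtype.val htx
    have h4 := TwoSidedIdeal.span_mono Set.subset_union_left (mk_eq_zero_iff.1 h3) (t := S ∪ T)
    have h5 := add_mem h4 (TwoSidedIdeal.mul_mem_right _ _ e (TwoSidedIdeal.mul_mem_left _ e _ ht))
    rwa [sub_add_cancel] at h5
  · intro h
    let J : TwoSidedIdeal A := mk' {x | ∀ a b, cornerQuot S hε S2 (a * x * b) = 0}
      (fun a b => by rw [mul_zero, zero_mul, map_zero])
      (fun {x y} hx hy a b => by rw [mul_add, add_mul, map_add, hx, hy, add_zero])
      (fun {x} hx a b => by rw [mul_neg, neg_mul, map_neg, hx, neg_zero])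
      (fun {x y} hy a b => by rw [← mul_assoc, hy])
      (fun {x y} hx a b => by rw [← mul_assoc, mul_assoc, hx])
    have hJ : span (S ∪ T) ≤ J := TwoSidedIdeal.span_le.2 fun t ht =>
      (mem_mk' _ _ _ _ _ _ _).2 fun a b => by
        rcases ht with ht | ht
        · rw [cornerQuot_apply, map_mul, map_mul, mk_eq_zero ht, mul_zero, zero_mul,
            ← cornerLinear_apply, map_zero, map_zero]
        · exact h2 t ht a b
    have h3 := (mem_mk' _ _ _ _ _ _ _).1 (hJ h) 1 1
    rwa [one_mul, mul_one, cornerQuot_corner S hε S2 he] at h3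

end CornerQuot

section Transport

variable {A A' N N' Q Q' : Type} [Ring A] [Algebra ℂ A] [Ring A'] [Algebra ℂ A'] [Ring N]
  [Algebra ℂ N] [Ring N'] [Algebra ℂ N'] [Ring Q] [Algebra ℂ Q] [Ring Q'] [Algebra ℂ Q']

lemma exists_algHom_of_related {q : A →ₐ[ℂ] N} {q' : A' →ₐ[ℂ] N'}
    (hq' : Surjective q') (r : N ≃ₐ[ℂ] N') {e : A} {e' : A'} (he : r (q e) = q' e')
    {κ : A →ₗ[ℂ] Q} {κ' : A' →ₗ[ℂ] Q'} (hκ : Surjective κ)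
    (hκ₁ : κ 1 = 1) (hκ₁' : κ' 1 = 1) (hmul : ∀ x y, κ x * κ y = κ (x * e * y))
    (hmul' : ∀ x y, κ' x * κ' y = κ' (x * e' * y))
    (h : ∀ x y, r (q x) = q' y → κ x = 0 → κ' y = 0) :
    ∃ Φ : Q →ₐ[ℂ] Q', ∀ x y, r (q x) = q' y → Φ (κ x) = κ' y := by
  choose s hs using hκ
  choose s' hs' using hq'
  let Φ : Q → Q' := fun a => κ' (s' (r (q (s a))))
  have hΦ : ∀ x y, r (q x) = q' y → Φ (κ x) = κ' y := fun x y hxy => by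
    refine sub_eq_zero.1 ?_
    rw [← map_sub]
    refine h (s (κ x) - x) _ ?_ ?_
    · rw [map_sub, map_sub, map_sub, hs', hxy]
    · rw [map_sub, hs, sub_self]
  have hrel : ∀ a, ∃ x y, r (q x) = q' y ∧ κ x = a ∧ Φ a = κ' y := fun a =>
    ⟨s a, s' (r (q (s a))), (hs' _).symm, hs a, rfl⟩
  refine ⟨AlgHom.ofLinearMap
    { toFun := Φ
      map_add' := fun a b => ?_
      map_smul' := fun c a => ?_ } ?_ fun a b => ?_, hΦ⟩
  · obtain ⟨x, y, hxy, rfl, hy⟩ := hrel a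
    obtain ⟨x2, y2, hxy₂, rfl, hy₂⟩ := hrel b
    rw [hy, hy₂, ← map_add, ← map_add]
    exact hΦ _ _ (by rw [map_add, map_add, map_add, hxy, hxy₂])
  · obtain ⟨x, y, hxy, rfl, hy⟩ := hrel a
    rw [hy, ← map_smul, RingHom.id_apply, ← map_smul]
    exact hΦ _ _ (by rw [map_smul, map_smul, map_smul, hxy])
  · change Φ 1 = 1
    rw [← hκ₁, ← hκ₁']
    exact hΦ _ _ (by rw [map_one, map_one, map_one])
  · change Φ (a * b) = Φ a * Φ b
    obtain ⟨x, y, hxy, rfl, hy⟩ := hrel a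
    obtain ⟨x2, y2, hxy₂, rfl, hy₂⟩ := hrel b
    rw [hy, hy₂, hmul, hmul']
    exact hΦ _ _ (by simp only [map_mul, hxy, hxy₂, he])

/-- An isomorphism `r` of quotients of `A` and `A'` induces an isomorphism of further subquotients
whose kernels correspond to each other. -/
lemma exists_algEquiv_of_related {q : A →ₐ[ℂ] N} {q' : A' →ₐ[ℂ] N'} (hq : Surjective q)
    (hq' : Surjective q') (r : N ≃ₐ[ℂ] N') {e : A} {e' : A'} (he : r (q e) = q' e')
    {κ : A →ₗ[ℂ] Q} {κ' : A' →ₗ[ℂ] Q'} (hκ : Surjective κ) (hκ' : Surjective κ')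
    (hκ₁ : κ 1 = 1) (hκ₁' : κ' 1 = 1) (hmul : ∀ x y, κ x * κ y = κ (x * e * y))
    (hmul' : ∀ x y, κ' x * κ' y = κ' (x * e' * y))
    (h : ∀ x y, r (q x) = q' y → (κ x = 0 ↔ κ' y = 0)) :
    ∃ Φ : Q ≃ₐ[ℂ] Q', ∀ x y, r (q x) = q' y → Φ (κ x) = κ' y := by
  obtain ⟨Φ, hΦ⟩ := exists_algHom_of_related hq' r he hκ hκ₁ hκ₁' hmul hmul'
    fun x y hxy => (h x y hxy).1
  refine ⟨AlgEquiv.ofBijective Φ ⟨(injective_iff_map_eq_zero Φ).2 fun a ha => ?_, fun b => ?_⟩, hΦ⟩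
  · obtain ⟨x, rfl⟩ := hκ a
    obtain ⟨y, hy⟩ := hq' (r (q x))
    rw [hΦ x y hy.symm] at ha
    exact (h x y hy.symm).2 ha
  · obtain ⟨y, rfl⟩ := hκ' b
    obtain ⟨x, hx⟩ := hq (r.symm (q' y))
    exact ⟨κ x, hΦ x y (by rw [hx, AlgEquiv.apply_symm_apply])⟩

end Transport

section Feasible

variable {n : ℕ} (P : PolarizedArrangement n) {A : Type} [Ring A] [Algebra ℂ A] {S : Set A}
  {E : SignVector n → A} (hE : OrthogonalIdempotents (quo S ∘ E))

lemma mk_sumIdem (S : Set A) (T : Set (SignVector n)) :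
    quo S (sumIdem E T) = sumIdem (quo S ∘ E) T := by
  rw [sumIdem, map_sum]
  rfl

/-- The class of `e_ℱ x e_ℱ` in the `k`-th infinitesimal neighbourhood of `A(t,-)`. -/
abbrev feasibleNbhd (z : Fin n → A) (k : ℕ) :
    A →ₗ[ℂ] Nbhd (fun i => toFeasible P hE (quo S (z i))) k :=
  cornerQuot S (sumIdem_idem hE (𝓕 P)) _

/-- The class of `e_ℱ x e_ℱ` in `A(t,m)`. -/
abbrev boundedClass : A →ₗ[ℂ] BoundedAlg P hE :=
  cornerQuot S (sumIdem_idem hE (𝓕 P)) {unboundedIdem P hE}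

variable {z : Fin n → A} (hz : ∀ i a, Commute (z i) a)

lemma commute_monomial (hz : ∀ i a, Commute (z i) a) {k : ℕ} {w : A} (hw : w ∈ monomials z k)
    (a : A) : Commute w a := by
  obtain ⟨s, rfl⟩ := hw
  exact Commute.list_prod_left _ _ fun x hx => by
    obtain ⟨j, rfl⟩ := List.mem_ofFn.1 hx
    exact hz _ _

include hz in
lemma toFeasible_monomial {k : ℕ} (s : Fin k → Fin n) :
    (ofFn fun j => toFeasible P hE (quo S (z (s j)))).prod =
      toFeasible P hE (quo S (ofFn fun j => z (s j)).prod) := by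
  have hc : ∀ i, Commute (quo S (z i)) (sumIdem (quo S ∘ E) (𝓕 P)) :=
    fun i => by
      obtain ⟨e, he⟩ := mk_surjective S (sumIdem (quo S ∘ E) (𝓕 P))
      rw [← he]
      exact (hz i e).map _
  induction k with
  | zero =>
    simp only [List.ofFn_zero, List.prod_nil, map_one]
    exact (toCorner_one _).symm
  | succ k ih =>
    simp only [List.ofFn_succ, List.prod_cons, map_mul]
    rw [ih]
    exact toCorner_mul _ (hc _) _

include hz in
lemma feasibleNbhd_eq_zero_iff (k : ℕ) (x : A) : feasibleNbhd P hE z k x = 0 ↔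
    sumIdem E (𝓕 P) * x * sumIdem E (𝓕 P) ∈
      span (S ∪ monomials z (k + 1)) := by
  refine cornerQuot_eq_zero_iff S _ _ (mk_sumIdem S _) ?_ ?_ x
  · rintro _ ⟨s, rfl⟩
    exact ⟨_, subset_span (.inr ⟨s, rfl⟩), toFeasible_monomial P hE hz s⟩
  · intro t ht a b
    rw [cornerQuot_mul_of_central S _ _ (commute_monomial hz ht)]
    obtain ⟨s, rfl⟩ := ht
    rw [cornerQuot_apply, mk_eq_zero, zero_mul]
    exact ⟨s, toFeasible_monomial P hE hz s⟩

include hz in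
lemma toBounded_monomial {k : ℕ} (s : Fin k → Fin n) :
    (ofFn fun j => toBounded P hE (quo S (z (s j)))).prod =
      boundedClass P hE (ofFn fun j => z (s j)).prod := by
  refine Eq.trans ?_ (congrArg (quo {unboundedIdem P hE}) (toFeasible_monomial P hE hz s))
  rw [map_list_prod, map_ofFn]
  rfl

include hz in
lemma boundedClass_monomial {k : ℕ}
    (hk : ∀ w ∈ monomials (fun i => toBounded P hE (quo S (z i))) k, w = 0) {w : A}
    (hw : w ∈ monomials z k) : boundedClass P hE w = 0 := by
  obtain ⟨s, rfl⟩ := hw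
  rw [← toBounded_monomial P hE hz s]
  exact hk _ ⟨s, rfl⟩

include hz in
lemma boundedClass_eq_zero_iff (hE₀ : OrthogonalIdempotents E) {k : ℕ}
    (hk : ∀ w ∈ monomials (fun i => toBounded P hE (quo S (z i))) (k + 1), w = 0) (x : A) :
    boundedClass P hE x = 0 ↔
    sumIdem E (𝓕 P) * x * sumIdem E (𝓕 P) ∈
      span (S ∪ ({sumIdem E {α | P.Feasible α ∧ ¬ P.Bounded α}} ∪ monomials z (k + 1))) := by
  have hsub : {α | P.Feasible α ∧ ¬ P.Bounded α} ⊆ (𝓕 P) := fun _ h => h.1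
  refine cornerQuot_eq_zero_iff S _ _ (mk_sumIdem S _) ?_ ?_ x
  · rintro _ rfl
    refine ⟨_, subset_span (.inr (.inl rfl)), ?_⟩
    rw [mk_sumIdem]
    rfl
  · rintro t (rfl | ht) a b
    · have h : a * sumIdem E {α | P.Feasible α ∧ ¬ P.Bounded α} * b =
          a * sumIdem E (𝓕 P) * sumIdem E {α | P.Feasible α ∧ ¬ P.Bounded α} *
            sumIdem E (𝓕 P) * b := by
        rw [mul_assoc a (sumIdem E (𝓕 P)), sumIdem_mul hE₀ hsub,
          mul_assoc a _ (sumIdem E (𝓕 P)), mul_sumIdem hE₀ hsub]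
      have h0 : cornerQuot S (sumIdem_idem hE (𝓕 P)) {unboundedIdem P hE}
          (sumIdem E {α | P.Feasible α ∧ ¬ P.Bounded α}) = 0 := by
        rw [cornerQuot_apply, mk_sumIdem]
        exact mk_eq_zero rfl
      rw [h, ← cornerQuot_mul S _ _ (mk_sumIdem S _), ← cornerQuot_mul S _ _ (mk_sumIdem S _), h0,
        mul_zero, zero_mul]
    · rw [cornerQuot_mul_of_central S _ _ (commute_monomial hz ht)]
      rw [show cornerQuot S _ _ t = 0 from boundedClass_monomial P hE hz hk ht, zero_mul]

/-- Long monomials in commuting nilpotent elements vanish. -/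
lemma exists_monomials_eq_zero {B : Type} [Ring B] {w : Fin n → B} (hw : ∀ i b, Commute (w i) b)
    (hnil : ∀ i, IsNilpotent (w i)) : ∃ m, ∀ k, m ≤ k → ∀ x ∈ monomials w k, x = 0 := by
  let c : Fin n → Subring.center B := fun i => ⟨w i, Subring.mem_center_iff.2 fun b => (hw i b).eq.symm⟩
  have hc : ∀ i, IsNilpotent (c i) := fun i => by
    obtain ⟨N, hN⟩ := hnil i
    exact ⟨N, Subtype.ext hN⟩
  obtain ⟨m, hm⟩ := Ideal.exists_pow_le_of_le_radical_of_fg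
    (I := Ideal.span (Set.range c)) (J := (⊥ : Ideal (Subring.center B)))
    (Ideal.span_le.2 (by
      rintro _ ⟨i, rfl⟩
      obtain ⟨N, hN⟩ := hc i
      exact ⟨N, hN⟩)) ⟨(Set.finite_range c).toFinset, by simp⟩
  refine ⟨m, fun k hk x hx => ?_⟩
  obtain ⟨s, rfl⟩ := hx
  have hmem : ∀ l : List (Fin n), (l.map c).prod ∈ Ideal.span (Set.range c) ^ l.length := fun l => by
    induction l with
    | nil => simp
    | cons i l ih =>
      rw [List.map_cons, List.prod_cons, List.length_cons, pow_succ']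
      exact Ideal.mul_mem_mul (Ideal.subset_span ⟨i, rfl⟩) ih
  have h := hm (Ideal.pow_le_pow_right (by rwa [List.length_ofFn]) (hmem (ofFn s)))
  have h' := congrArg (Subring.center B).subtype ((Submodule.mem_bot _).1 h)
  rw [map_list_prod, List.map_map, map_ofFn, map_zero] at h'
  exact h'

end Feasible

section Malgrange

open Polynomial

variable {n : ℕ} {C C' : Type} [Ring C] [Algebra ℂ C] [Ring C'] [Algebra ℂ C']

lemma PathAlg.comp_twist_twist (h : PathAlg →ₐ[ℂ] C) {φ ψ : ℂ[X]}
    (hφ : aeval (h loop * aeval (h loop) φ) ψ * aeval (h loop) φ = 1) (x : PathAlg) :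
    h (twist φ (twist ψ x)) = h x := by
  have he : (h.comp (twist φ)).comp (twist ψ) = h := by
    refine PathAlg.hom_ext (fun s => ?_) ?_ ?_
    · rw [AlgHom.comp_apply, AlgHom.comp_apply, twist_e, twist_e]
    · rw [AlgHom.comp_apply, AlgHom.comp_apply, twist_down, twist_down]
    · rw [AlgHom.comp_apply, AlgHom.comp_apply, twist_up, map_mul, twist_up, aeval_algHom,
        twist_loop, map_mul, map_mul, aeval_algHom, map_mul, aeval_algHom, ← mul_assoc, hφ, one_mul]
  exact DFunLike.congr_fun he x

variable (k : ℕ)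

section

variable (f : AdR n →ₐ[ℂ] C) (hf : ∀ i, f (paramdR i) ^ (k + 1) = 0)

lemma comp_malgrangeHom (g : C →ₐ[ℂ] C') {f' : AdR n →ₐ[ℂ] C'} (hgf : ∀ x, g (f x) = f' x)
    (hf' : ∀ i, f' (paramdR i) ^ (k + 1) = 0)
    (x : ABet n) : g (malgrangeHom f k hf x) = malgrangeHom f' k hf' x := by
  obtain rfl : g.comp f = f' := AlgHom.ext hgf
  have h : g.comp (malgrangeHom f k hf) = malgrangeHom (g.comp f) k hf' :=
    TensorPower.hom_ext fun i b => DFunLike.congr_fun (ABet1.hom_ext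
      (f := (g.comp (malgrangeHom f k hf)).comp (inFactorHom i))
      (g := (malgrangeHom (g.comp f) k hf').comp (inFactorHom i)) fun x =>
        (congrArg g (malgrangeHom_inFactor f k hf i x)).trans
          (malgrangeHom_inFactor (g.comp f) k hf' i x).symm) b
  exact DFunLike.congr_fun h x

lemma malgrangeHom_idemBet (α : SignVector n) : malgrangeHom f k hf (idemBet α) = f (idemdR α) :=
  map_pureTensor_congr fun i => by rw [malgrangeHom_inFactor, twist_e]

lemma malgrangeHom_monomial (hm : Kills f paramdR (k + 1))
    {w : ABet n} (hw : w ∈ monomials paramBet (k + 1)) : malgrangeHom f k hf w = 0 := by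
  obtain ⟨s, rfl⟩ := hw
  rw [map_list_prod, map_ofFn]
  refine Eq.trans ?_ (prod_ofFn_eq_zero (x := fun i => malgrangeSeries k (paramdR i))
    paramdR_comm f hm s)
  refine congrArg (fun g => (ofFn g).prod) (funext fun j => ?_)
  refine (malgrangeHom_paramBet f k hf (s j)).trans ?_
  rw [map_mul, ← aeval_malgrangePoly, ← aeval_malgrangePoly, aeval_algHom]

end

section

variable (f : ABet n →ₐ[ℂ] C) (ψ : ℂ[X])

lemma comp_logHom (g : C →ₐ[ℂ] C') {f' : ABet n →ₐ[ℂ] C'} (hgf : ∀ x, g (f x) = f' x) (x : AdR n) :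
    g (logHom f ψ x) = logHom f' ψ x := by
  obtain rfl : g.comp f = f' := AlgHom.ext hgf
  have h : g.comp (logHom f ψ) = logHom (g.comp f) ψ := TensorPower.hom_ext fun i b =>
    (congrArg g (logHom_inFactor f ψ i b)).trans (logHom_inFactor (g.comp f) ψ i b).symm
  exact DFunLike.congr_fun h x

lemma logHom_idemdR (α : SignVector n) : logHom f ψ (idemdR α) = f (idemBet α) :=
  map_pureTensor_congr fun i => by rw [logHom_inFactor, twist_e]

lemma paramBet_comm (i : Fin n) (x : ABet n) : Commute (paramBet i) x := by
  rw [← torusAction_coordZ']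
  exact torusAction_comm _ x

lemma logHom_monomial (hm : Kills f paramBet (k + 1))
    {w : AdR n} (hw : w ∈ monomials paramdR (k + 1)) : logHom f ψ w = 0 := by
  obtain ⟨s, rfl⟩ := hw
  rw [map_list_prod, map_ofFn]
  refine Eq.trans ?_ (prod_ofFn_eq_zero (x := fun i => aeval (paramBet i) ψ) paramBet_comm f hm s)
  refine congrArg (fun g => (ofFn g).prod) (funext fun j => ?_)
  refine (logHom_paramdR f ψ (s j)).trans ?_
  rw [map_mul, aeval_algHom]

end

/-- The inverse of the coordinate change `d ↦ 1 - exp (2πi d)` up to order `k`. -/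
def logPoly : ℂ[X] := (exists_inverse_on_nilpotents _ (malgrangePoly_coeff_zero k) (k + 1)).choose

lemma logPoly_left {x : C} (hx : x ^ (k + 1) = 0) :
    aeval (x * aeval x (malgrangePoly k)) (logPoly k) * aeval x (malgrangePoly k) = 1 :=
  ((exists_inverse_on_nilpotents _ (malgrangePoly_coeff_zero k) (k + 1)).choose_spec C x hx).1

lemma logPoly_right {x : C} (hx : x ^ (k + 1) = 0) :
    aeval (x * aeval x (logPoly k)) (malgrangePoly k) * aeval x (logPoly k) = 1 :=
  ((exists_inverse_on_nilpotents _ (malgrangePoly_coeff_zero k) (k + 1)).choose_spec C x hx).2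

lemma logHom_malgrangeHom (f : AdR n →ₐ[ℂ] C) (hf : ∀ i, f (paramdR i) ^ (k + 1) = 0) :
    logHom (malgrangeHom f k hf) (logPoly k) = f :=
  TensorPower.hom_ext fun i b => by
    rw [logHom_inFactor, malgrangeHom_inFactor]
    exact PathAlg.comp_twist_twist (f.comp (inFactorHom i)) (logPoly_left k (hf i)) b

lemma malgrangeHom_logHom (f : ABet n →ₐ[ℂ] C) (hf : ∀ i, f (paramBet i) ^ (k + 1) = 0)
    (hf' : ∀ i, logHom f (logPoly k) (paramdR i) ^ (k + 1) = 0) :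
    malgrangeHom (logHom f (logPoly k)) k hf' = f :=
  TensorPower.hom_ext fun i b => DFunLike.congr_fun (ABet1.hom_ext
    (f := (malgrangeHom (logHom f (logPoly k)) k hf').comp (inFactorHom i))
    (g := f.comp (inFactorHom i)) fun x => by
      refine (malgrangeHom_inFactor _ k hf' i x).trans ((logHom_inFactor _ _ _ _).trans ?_)
      refine PathAlg.comp_twist_twist ((f.comp (inFactorHom i)).comp toABet1) (logPoly_right k ?_) x
      refine Eq.trans ?_ (hf i)
      rw [← inFactor_toABet1_loop]
      rfl) b

end Malgrange

section MalgrangeIso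

variable {n : ℕ} {C : Type} [Ring C] [Algebra ℂ C] (k : ℕ)

section Nilpotent

variable (f : AdR n →ₐ[ℂ] C) (hm : Kills f paramdR (k + 1))

/-- Malgrange's homomorphism to an algebra in which monomials of degree `k + 1` in the `d_i`
vanish. -/
def nilMalgrange : ABet n →ₐ[ℂ] C := malgrangeHom f k (pow_eq_zero_of_monomials f hm)

lemma nilMalgrange_inFactor (i : Fin n) (x : PathAlg) :
    nilMalgrange k f hm (inFactor i (toABet1 x)) = f (inFactor i (twist (malgrangePoly k) x)) :=
  malgrangeHom_inFactor f k (pow_eq_zero_of_monomials f hm) i x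

lemma nilMalgrange_sumIdem (T : Set (SignVector n)) :
    nilMalgrange k f hm (sumIdem idemBet T) = f (sumIdem idemdR T) := by
  simp only [sumIdem, map_sum]
  exact sum_congr rfl fun α _ => malgrangeHom_idemBet k f (pow_eq_zero_of_monomials f hm) α

end Nilpotent

lemma logHom_sumIdem (f : ABet n →ₐ[ℂ] C) (ψ : Polynomial ℂ) (T : Set (SignVector n)) :
    logHom f ψ (sumIdem idemdR T) = f (sumIdem idemBet T) := by
  simp only [sumIdem, map_sum]
  exact sum_congr rfl fun α _ => logHom_idemdR f ψ α

lemma mk_monomials {A : Type} [Ring A] [Algebra ℂ A] {T : Set A} {z : Fin n → A}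
    (h : monomials z (k + 1) ⊆ T) : Kills (quo T) z (k + 1) :=
  fun _ hs => mk_eq_zero (h hs)

/-- Malgrange's homomorphism to `A^dR_n / J^{k+1}`. -/
abbrev malgrange : ABet n →ₐ[ℂ] Nbhd (paramdR (n := n)) k :=
  nilMalgrange k (quo _) (mk_monomials k subset_rfl)

/-- The homomorphism `A^Bet_n / I^{k+1} → A^dR_n / J^{k+1}`. -/
def rhFun : Nbhd (paramBet (n := n)) k →ₐ[ℂ] Nbhd (paramdR (n := n)) k :=
  QuotientBy.lift (malgrange k) fun _ hs => malgrangeHom_monomial k _ _ (mk_monomials k subset_rfl) hs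

/-- The homomorphism `A^dR_n / J^{k+1} → A^Bet_n / I^{k+1}`. -/
def rhInv : Nbhd (paramdR (n := n)) k →ₐ[ℂ] Nbhd (paramBet (n := n)) k :=
  QuotientBy.lift (logHom (quo _) (logPoly k)) fun _ hs =>
    logHom_monomial k _ _ (mk_monomials k subset_rfl) hs

/-- Malgrange's isomorphism. -/
def rhEquiv : Nbhd (paramBet (n := n)) k ≃ₐ[ℂ] Nbhd (paramdR (n := n)) k :=
  AlgEquiv.ofAlgHom (rhFun k) (rhInv k)
    (QuotientBy.hom_ext fun x => by
      refine (comp_logHom _ _ (rhFun k) (f' := malgrange k) (fun _ => rfl) x).trans ?_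
      exact DFunLike.congr_fun (logHom_malgrangeHom k (quo _)
        (pow_eq_zero_of_monomials _ (mk_monomials k subset_rfl))) x)
    (QuotientBy.hom_ext fun x => by
      have h := pow_eq_zero_of_monomials _ (mk_monomials (z := paramdR (n := n)) k subset_rfl)
      have h' := pow_eq_zero_of_monomials (logHom (quo _) (logPoly k)) fun _ hs =>
        logHom_monomial k _ _ (mk_monomials (z := paramBet (n := n)) k subset_rfl) hs
      refine (comp_malgrangeHom k (quo _) h (rhInv k) (fun _ => rfl) h' x).trans ?_
      exact DFunLike.congr_fun (malgrangeHom_logHom k (quo _)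
        (pow_eq_zero_of_monomials _ (mk_monomials k subset_rfl)) h') x)

/-- `x` and `y` correspond to each other under Malgrange's isomorphism. -/
abbrev Related (x : ABet n) (y : AdR n) : Prop := rhEquiv k (quo _ x) = quo _ y

lemma rhEquiv_mk (x : ABet n) : rhEquiv k (quo _ x) = malgrange k x := rfl

lemma rhEquiv_symm_mk (x : AdR n) : (rhEquiv k).symm (quo _ x) = logHom (quo _) (logPoly k) x := rfl

/-- The homomorphism on `A^Bet_n` defined by `f` factors through Malgrange's isomorphism. -/
lemma nilMalgrange_eq_of_related (f : AdR n →ₐ[ℂ] C)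
    (hm : Kills f paramdR (k + 1)) {x : ABet n} {y : AdR n}
    (h : Related k x y) : nilMalgrange k f hm x = f y := by
  have h1 := congrArg (QuotientBy.lift f hm) h
  rw [rhEquiv_mk] at h1
  exact (comp_malgrangeHom k _ _ (QuotientBy.lift f hm) (fun _ => rfl) (pow_eq_zero_of_monomials _ hm) x).symm.trans
    h1

lemma logHom_eq_of_related (f : ABet n →ₐ[ℂ] C)
    (hm : Kills f paramBet (k + 1)) {x : ABet n} {y : AdR n}
    (h : Related k x y) : logHom f (logPoly k) y = f x := by
  have h1 := congrArg (QuotientBy.lift f hm) ((rhEquiv k).symm_apply_eq.2 h.symm)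
  rw [rhEquiv_symm_mk] at h1
  exact (comp_logHom _ _ (QuotientBy.lift f hm) (fun _ => rfl) y).symm.trans h1

/-- Malgrange's isomorphisms identify the ideals generated by corresponding relations. -/
lemma mem_span_iff_of_related {T : Set (ABet n)} {T' : Set (AdR n)}
    (hT : monomials paramBet (k + 1) ⊆ T) (hT' : monomials paramdR (k + 1) ⊆ T')
    (h1 : ∀ t ∈ T, nilMalgrange k (quo T') (mk_monomials k hT') t = 0)
    (h2 : ∀ t ∈ T', logHom (quo T) (logPoly k) t = 0) {x : ABet n} {y : AdR n}
    (h : Related k x y) :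
    x ∈ span T ↔ y ∈ span T' := by
  constructor
  · intro hx
    rw [← mk_eq_zero_iff, ← nilMalgrange_eq_of_related k (quo T') (mk_monomials k hT') h]
    exact QuotientBy.map_eq_zero_of_mem _ h1 hx
  · intro hy
    rw [← mk_eq_zero_iff, ← logHom_eq_of_related k (quo T) (mk_monomials k hT) h]
    exact QuotientBy.map_eq_zero_of_mem _ h2 hy

lemma rhEquiv_sumIdem (T : Set (SignVector n)) :
    Related k (sumIdem idemBet T) (sumIdem idemdR T) :=
  nilMalgrange_sumIdem k _ (mk_monomials k subset_rfl) T

lemma rhEquiv_corner {x : ABet n} {y : AdR n} (T : Set (SignVector n))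
    (h : Related k x y) :
    Related k (sumIdem idemBet T * x * sumIdem idemBet T)
      (sumIdem idemdR T * y * sumIdem idemdR T) := by
  rw [Related, map_mul, map_mul, map_mul, map_mul, map_mul, map_mul, h, rhEquiv_sumIdem]

lemma mk_monomials_of_le {A : Type} [Ring A] [Algebra ℂ A] {z : Fin n → A} {k l : ℕ} (hkl : k ≤ l) :
    ∀ s ∈ monomials z (l + 1), quo (monomials z (k + 1)) s = 0 := by
  rintro _ ⟨s, rfl⟩
  obtain ⟨m, rfl⟩ := Nat.exists_eq_add_of_le hkl
  change quo _ (ofFn fun j => z (s j)).prod = 0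
  rw [List.ofFn_congr (show k + m + 1 = (k + 1) + m by omega), List.ofFn_add, List.prod_append, map_mul, mk_eq_zero, zero_mul]
  exact ⟨_, rfl⟩

/-- The isomorphisms for different `k` are compatible. -/
lemma rhEquiv_of_le {k l : ℕ} (hkl : k ≤ l) {x : ABet n} {y : AdR n}
    (h : Related l x y) : Related k x y := by
  have hmon := mk_monomials_of_le (z := paramdR (n := n)) hkl
  rw [Related, ← nilMalgrange_eq_of_related l (quo (monomials (paramdR (n := n)) (k + 1))) hmon h]
  refine DFunLike.congr_fun (TensorPower.hom_ext (f := malgrange k)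
    (g := nilMalgrange l (quo _) hmon) fun i b => ?_) x
  refine DFunLike.congr_fun (ABet1.hom_ext (f := (malgrange k).comp (inFactorHom i))
    (g := (nilMalgrange l _ hmon).comp (inFactorHom i)) fun x => ?_) b
  refine (nilMalgrange_inFactor k _ (mk_monomials k subset_rfl) i x).trans
    (Eq.trans ?_ (nilMalgrange_inFactor l _ hmon i x).symm)
  let p := (quo (monomials (paramdR (n := n)) (k + 1))).comp (inFactorHom i)
  refine DFunLike.congr_fun (PathAlg.hom_ext (f := p.comp (twist (malgrangePoly k)))
    (g := p.comp (twist (malgrangePoly l))) (fun s => ?_) ?_ ?_) x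
  · simp only [AlgHom.comp_apply, twist_e]
  · simp only [AlgHom.comp_apply, twist_down]
  · have hs : ∀ m, p (aeval loop (malgrangePoly m)) =
        malgrangeSeries m (quo _ (paramdR i)) := fun m =>
      (aeval_algHom p _ _).trans (aeval_malgrangePoly _ _)
    change p (twist _ _) = p (twist _ _)
    rw [twist_up, twist_up, map_mul, map_mul, hs, hs,
      malgrangeSeries_eq_of_le hkl (pow_eq_zero_of_monomials _ (mk_monomials k subset_rfl) i)]

variable (P : PolarizedArrangement n)

/-- The relations defining `A^Bet_G`. -/
abbrev bettiRel : Set (ABet n) := {x | ∃ g ∈ P.cocharG,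
  x = pureTensor (fun i => ((monodromyUnit ^ g i : ABet1ˣ) : ABet1)) - 1}

/-- The relations defining `A^dR_G`. -/
abbrev deRhamRel : Set (AdR n) := {x | ∃ g ∈ P.cocharG, x = ∑ i, g i • paramdR i}

lemma nilMalgrange_bettiRel (f : AdR n →ₐ[ℂ] C)
    (hm : Kills f paramdR (k + 1))
    (hf : ∀ s ∈ deRhamRel P, f s = 0) {x : ABet n} (hx : x ∈ bettiRel P) :
    nilMalgrange k f hm x = 0 := by
  obtain ⟨g, hg, rfl⟩ := hx
  rw [map_sub, map_one, nilMalgrange, malgrangeHom_zpow, hf _ ⟨g, hg, rfl⟩, smul_zero, nilExp_zero,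
    sub_self]

lemma logHom_deRhamRel (f : ABet n →ₐ[ℂ] C)
    (hm : Kills f paramBet (k + 1))
    (hf : ∀ s ∈ bettiRel P, f s = 0) {x : AdR n} (hx : x ∈ deRhamRel P) :
    logHom f (logPoly k) x = 0 := by
  obtain ⟨g, hg, rfl⟩ := hx
  have hm' : Kills (logHom f (logPoly k)) paramdR (k + 1) :=
    fun s hs => logHom_monomial k _ _ hm hs
  have hpow := pow_eq_zero_of_monomials _ hm'
  -- the exponential of the image of the relation is the image of the monodromy relation
  have h1 := malgrangeHom_zpow (logHom f (logPoly k)) k hpow g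
  rw [malgrangeHom_logHom k f (pow_eq_zero_of_monomials f hm) hpow] at h1
  have h2 := hf _ ⟨g, hg, rfl⟩
  rw [map_sub, map_one, h1, sub_eq_zero] at h2
  have hnil : IsNilpotent (logHom f (logPoly k) (∑ i, g i • paramdR i)) := by
    rw [map_sum]
    refine Commute.isNilpotent_sum (fun i _ => ?_) fun i j _ _ => ?_
    · rw [map_zsmul]
      exact IsNilpotent.smul ⟨k + 1, hpow i⟩ _
    · exact (((paramdR_comm i _).smul_left _).smul_right _).map _
  obtain ⟨N, hN⟩ := hnil
  have hN' : logHom f (logPoly k) (∑ i, g i • paramdR i) ^ (N + 1) = 0 := by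
    rw [pow_succ, hN, zero_mul]
  rw [nilExp_smul hN', sub_eq_self] at h2
  exact eq_zero_of_mul_malgrangeSeries hN' h2

/-- The ideals of relations of `A^Bet_G(t,-) / I^{k+1}` and `A^dR_G(t,-) / J^{k+1}`, possibly with
further idempotents killed, correspond to each other. -/
lemma mem_span_rel_iff {T : Set (ABet n)} {T' : Set (AdR n)}
    (h1 : ∀ f : AdR n →ₐ[ℂ] QuotientBy (deRhamRel P ∪ (T' ∪ monomials paramdR (k + 1))),
      ∀ hm, (∀ t ∈ T', f t = 0) → ∀ t ∈ T, nilMalgrange k f hm t = 0)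
    (h2 : ∀ f : ABet n →ₐ[ℂ] QuotientBy (bettiRel P ∪ (T ∪ monomials paramBet (k + 1))),
      (∀ t ∈ T, f t = 0) → ∀ t ∈ T', logHom f (logPoly k) t = 0) {x : ABet n} {y : AdR n}
    (h : Related k x y) :
    x ∈ span (bettiRel P ∪ (T ∪ monomials paramBet (k + 1))) ↔
      y ∈ span (deRhamRel P ∪ (T' ∪ monomials paramdR (k + 1))) := by
  have hT : monomials paramBet (k + 1) ⊆ bettiRel P ∪ (T ∪ monomials paramBet (k + 1)) :=
    Set.subset_union_right.trans Set.subset_union_right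
  have hT' : monomials paramdR (k + 1) ⊆ deRhamRel P ∪ (T' ∪ monomials paramdR (k + 1)) :=
    Set.subset_union_right.trans Set.subset_union_right
  refine mem_span_iff_of_related k hT hT' ?_ ?_ h
  · rintro t (ht | ht | ht)
    · exact nilMalgrange_bettiRel k P _ _ (fun s hs => mk_eq_zero (.inl hs)) ht
    · exact h1 _ _ (fun s hs => mk_eq_zero (.inr (.inl hs))) t ht
    · exact malgrangeHom_monomial k _ _ (mk_monomials k hT') ht
  · rintro t (ht | ht | ht)
    · exact logHom_deRhamRel k P _ (mk_monomials k hT) (fun s hs => mk_eq_zero (.inl hs)) ht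
    · exact h2 _ (fun s hs => mk_eq_zero (.inr (.inl hs))) t ht
    · exact logHom_monomial k _ _ (mk_monomials k hT) ht

/-- Corresponding quotients of the algebras `A(t,-)` are isomorphic. -/
lemma exists_cornerQuot_equiv {T : Set (ABett P)} {T' : Set (AdRt P)}
    (h : ∀ x y, Related k x y →
      (cornerQuot _ (sumIdem_idem (projBet_orthogonal P) (𝓕 P)) T x = 0 ↔
        cornerQuot _ (sumIdem_idem (projdR_orthogonal P) (𝓕 P)) T' y = 0)) :
    ∃ Φ : QuotientBy T ≃ₐ[ℂ] QuotientBy T', ∀ x y, Related k x y →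
      Φ (cornerQuot _ (sumIdem_idem (projBet_orthogonal P) (𝓕 P)) T x) =
        cornerQuot _ (sumIdem_idem (projdR_orthogonal P) (𝓕 P)) T' y :=
  exists_algEquiv_of_related (mk_surjective _) (mk_surjective _)
    (rhEquiv k) (rhEquiv_sumIdem k (𝓕 P)) (cornerQuot_surjective _ _ _)
    (cornerQuot_surjective _ _ _) (cornerQuot_one _ _ _) (cornerQuot_one _ _ _)
    (cornerQuot_mul _ _ _ (mk_sumIdem _ _)) (cornerQuot_mul _ _ _ (mk_sumIdem _ _)) h

/-- Malgrange's isomorphism for the algebras `A(t,-)`. -/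
lemma exists_rht : ∃ Φ : Nbhd (paramBett P) k ≃ₐ[ℂ] Nbhd (paramdRt P) k, ∀ x y, Related k x y →
    Φ (feasibleNbhd P (projBet_orthogonal P) paramBet k x) =
      feasibleNbhd P (projdR_orthogonal P) paramdR k y := by
  refine exists_cornerQuot_equiv k P fun x y h => ?_
  refine (feasibleNbhd_eq_zero_iff P (projBet_orthogonal P) paramBet_comm k x).trans
    (Iff.trans ?_ (feasibleNbhd_eq_zero_iff P (projdR_orthogonal P) paramdR_comm k y).symm)
  have := mem_span_rel_iff k P (T := ∅) (T' := ∅) (by simp) (by simp)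
    (rhEquiv_corner k (𝓕 P) h)
  rwa [Set.empty_union, Set.empty_union] at this

lemma exists_rhtm_aux (hB : ∀ w ∈ monomials (paramBettm P) (k + 1), w = 0)
    (hdR : ∀ w ∈ monomials (paramdRtm P) (k + 1), w = 0) :
    ∃ Φ : ABettm P ≃ₐ[ℂ] AdRtm P, ∀ x y, Related k x y →
      Φ (boundedClass P (projBet_orthogonal P) x) = boundedClass P (projdR_orthogonal P) y := by
  refine exists_cornerQuot_equiv k P fun x y h => ?_
  refine (boundedClass_eq_zero_iff P (projBet_orthogonal P) paramBet_comm idemBet_orthogonal hB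
    x).trans (Iff.trans ?_ (boundedClass_eq_zero_iff P (projdR_orthogonal P) paramdR_comm
      idemdR_orthogonal hdR y).symm)
  refine mem_span_rel_iff k P (fun f hm hf t ht => ?_) (fun f hf t ht => ?_)
    (rhEquiv_corner k (𝓕 P) h) <;> rw [Set.mem_singleton_iff.1 ht]
  · exact (nilMalgrange_sumIdem k _ _ _).trans (hf _ rfl)
  · exact (logHom_sumIdem f _ _).trans (hf _ rfl)

lemma toBounded_comm {A : Type} [Ring A] [Algebra ℂ A] {S : Set A} {E : SignVector n → A}
    (hE : OrthogonalIdempotents (quo S ∘ E)) {w : A} (hw : ∀ a, Commute w a)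
    (b : BoundedAlg P hE) : Commute (toBounded P hE (quo S w)) b := by
  obtain ⟨c, rfl⟩ := mk_surjective _ b
  refine Commute.map (toCorner_comm _ (fun a => ?_) c) (quo {unboundedIdem P hE})
  obtain ⟨a, rfl⟩ := mk_surjective S a
  exact (hw a).map _

/-- Malgrange's isomorphism for the algebras `A(t,m)`, where the parameters are nilpotent. -/
lemma exists_rhtm (D : CategoryODatum n) : let P := D.toPolarizedArrangement
    ∃ (k0 : ℕ) (Φ : ABettm P ≃ₐ[ℂ] AdRtm P),
      (∀ w ∈ monomials (paramdRtm P) (k0 + 1), w = 0) ∧ ∀ k, k0 ≤ k → ∀ x y, Related k x y →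
        Φ (boundedClass P (projBet_orthogonal P) x) = boundedClass P (projdR_orthogonal P) y := by
  intro P
  obtain ⟨N, hN⟩ := exists_pow_paramBettm D
  obtain ⟨N', hN'⟩ := exists_pow_paramdRtm D
  obtain ⟨m, hm⟩ := exists_monomials_eq_zero (w := paramBettm P)
    (fun i => toBounded_comm P (projBet_orthogonal P) (paramBet_comm i)) fun i => ⟨N, hN i⟩
  obtain ⟨m', hm'⟩ := exists_monomials_eq_zero (w := paramdRtm P)
    (fun i => toBounded_comm P (projdR_orthogonal P) (paramdR_comm i)) fun i => ⟨N', hN' i⟩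
  have h := hm' (max m m' + 1) ((le_max_right _ _).trans (Nat.le_succ _))
  obtain ⟨Φ, hΦ⟩ := exists_rhtm_aux (max m m') P (hm _ ((le_max_left _ _).trans (Nat.le_succ _))) h
  exact ⟨max m m', Φ, h, fun k hk x y h => hΦ x y (rhEquiv_of_le hk h)⟩

end MalgrangeIso

/-! ### Derived adjunctions between exact functors -/

section ExactAdjunction

variable {C E : Type 1} [Category.{0} C] [Abelian C] [HasDerivedCategory.{1} C]
  [Category.{0} E] [Abelian E] [HasDerivedCategory.{1} E]

/-- A natural transformation of exact functors which is an isomorphism on the cohomology of `K`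
induces a quasi-isomorphism. -/
lemma quasiIso_of_isIso_app {F G : C ⥤ E} [F.Additive] [PreservesFiniteLimits F]
    [PreservesFiniteColimits F] [G.Additive] [PreservesFiniteLimits G] [PreservesFiniteColimits G]
    (τ : F ⟶ G) (K : CochainComplex C ℤ) (φ : (cpx F).obj K ⟶ (cpx G).obj K)
    (hφ : ∀ n, φ.f n = τ.app (K.X n)) (h : ∀ n, IsIso (τ.app (K.homology n))) : QuasiIso φ where
  quasiIsoAt n := by
    rw [quasiIsoAt_iff_isIso_homologyMap]
    have h1 := NatTrans.app_homology τ (K.sc n)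
    have h2 : IsIso (τ.app (K.sc n).homology) := h n
    rw [h1] at h2
    have h3 : (HomologicalComplex.shortComplexFunctor E (.up ℤ) n).map φ =
        (K.sc n).mapNatTrans τ := by
      ext <;> exact hφ _
    change IsIso (ShortComplex.homologyMap
      ((HomologicalComplex.shortComplexFunctor E (.up ℤ) n).map φ))
    rw [h3]
    rwa [isIso_comp_left_iff, isIso_comp_right_iff] at h2

variable {J : C ⥤ E} {R : E ⥤ C} [J.Additive] [R.Additive] [PreservesFiniteLimits J]
  [PreservesFiniteColimits J] [PreservesFiniteLimits R] [PreservesFiniteColimits R] (adj : J ⊣ R)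

/-- An adjunction between exact functors induces an adjunction between derived categories. -/
def derivedAdj : J.mapDerivedCategory ⊣ R.mapDerivedCategory :=
  letI : CatCommSq (cpx J) Q Q J.mapDerivedCategory := ⟨J.mapDerivedCategoryFactors.symm⟩
  letI : CatCommSq (cpx R) Q Q R.mapDerivedCategory := ⟨R.mapDerivedCategoryFactors.symm⟩
  (cpxAdj adj).localization Q
    (quasiIso C (.up ℤ)) Q
    (quasiIso E (.up ℤ)) J.mapDerivedCategory R.mapDerivedCategory

lemma isIso_derivedAdj_unit (X : DerivedCategory C)
    (h : ∀ k, IsIso (adj.unit.app ((homologyFunctor C k).obj X))) :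
    IsIso ((derivedAdj adj).unit.app X) := by
  let K := Q.objPreimage X
  let e : Q.obj K ≅ X := Q.objObjPreimageIso X
  rw [← NatTrans.isIso_app_iff_of_iso _ e]
  let : CatCommSq (cpx J) Q Q J.mapDerivedCategory := ⟨J.mapDerivedCategoryFactors.symm⟩
  let : CatCommSq (cpx R) Q Q R.mapDerivedCategory := ⟨R.mapDerivedCategoryFactors.symm⟩
  rw [derivedAdj, Adjunction.localization_unit_app]
  have : QuasiIso ((cpxAdj adj).unit.app K) :=
    quasiIso_of_isIso_app adj.unit K ((cpxAdj adj).unit.app K) (fun _ => rfl) fun n => by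
      exact (NatTrans.isIso_app_iff_of_iso adj.unit
        (((homologyFunctorFactors C n).app K).symm ≪≫ (homologyFunctor C n).mapIso e)).2 (h n)
  have := (isIso_Q_map_iff_quasiIso _ ((cpxAdj adj).unit.app K)).2 this
  infer_instance

lemma isIso_derivedAdj_counit (X : DerivedCategory E)
    (h : ∀ k, IsIso (adj.counit.app ((homologyFunctor E k).obj X))) :
    IsIso ((derivedAdj adj).counit.app X) := by
  let K := Q.objPreimage X
  let e : Q.obj K ≅ X := Q.objObjPreimageIso X
  rw [← NatTrans.isIso_app_iff_of_iso _ e]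
  let : CatCommSq (cpx J) Q Q J.mapDerivedCategory := ⟨J.mapDerivedCategoryFactors.symm⟩
  let : CatCommSq (cpx R) Q Q R.mapDerivedCategory := ⟨R.mapDerivedCategoryFactors.symm⟩
  rw [derivedAdj, Adjunction.localization_counit_app]
  have : QuasiIso ((cpxAdj adj).counit.app K) :=
    quasiIso_of_isIso_app adj.counit K ((cpxAdj adj).counit.app K) (fun _ => rfl) fun n => by
      exact (NatTrans.isIso_app_iff_of_iso adj.counit
        (((homologyFunctorFactors E n).app K).symm ≪≫ (homologyFunctor E n).mapIso e)).2 (h n)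
  have := (isIso_Q_map_iff_quasiIso _ ((cpxAdj adj).counit.app K)).2 this
  infer_instance

end ExactAdjunction

/-- A right adjoint restricts to an equivalence between full subcategories on which unit and
counit are isomorphisms. -/
lemma isEquivalence_lift_of_adjunction {C E : Type 1} [Category.{1} C] [Category.{1} E] {L : C ⥤ E}
    {F : E ⥤ C} (adj : L ⊣ F) (P : ObjectProperty C) [P.IsClosedUnderIsomorphisms]
    (Q : ObjectProperty E)
    (hQ : ∀ X, P (F.obj X) ↔ Q X) (hP₁ : ∀ X, P X → IsIso (adj.unit.app X))
    (hQ₁ : ∀ X, Q X → IsIso (adj.counit.app X)) :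
    (P.lift (Q.ι ⋙ F) fun X => (hQ _).2 X.property).IsEquivalence where
  faithful := ⟨fun {X Y} f g h => by
    have := hQ₁ _ X.property
    have h' : F.map f.hom = F.map g.hom := congrArg (fun φ => φ.hom) h
    ext
    exact (cancel_epi (adj.counit.app X.obj)).1 ((adj.counit_naturality f.hom).symm.trans
      ((congrArg (fun φ => L.map φ ≫ adj.counit.app Y.obj) h').trans
        (adj.counit_naturality g.hom)))⟩
  full := ⟨fun {X Y} f => by
    have := hQ₁ _ X.property
    have := hP₁ _ ((hQ _).2 X.property)
    let f' : F.obj X.obj ⟶ F.obj Y.obj := f.hom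
    refine ⟨⟨inv (adj.counit.app X.obj) ≫ L.map f' ≫ adj.counit.app Y.obj⟩, ?_⟩
    ext
    change F.map (inv (adj.counit.app X.obj) ≫ L.map f' ≫ adj.counit.app Y.obj) = f'
    have h1 := adj.right_triangle_components X.obj
    have h2 := adj.right_triangle_components Y.obj
    rw [Functor.map_comp, Functor.map_comp, Functor.map_inv, IsIso.inv_comp_eq,
      ← cancel_epi (adj.unit.app (F.obj X.obj)), reassoc_of% h1,
      ← assoc]
    exact (congrArg (· ≫ F.map (adj.counit.app Y.obj)) (adj.unit_naturality f')).trans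
      ((assoc _ _ _).trans ((congrArg (f' ≫ ·) h2).trans (comp_id f')))⟩
  essSurj := ⟨fun X => by
    have := hP₁ _ X.property
    have h : P (F.obj (L.obj X.obj)) := P.prop_of_iso (asIso (adj.unit.app X.obj)) X.property
    exact ⟨⟨L.obj X.obj, (hQ _).1 h⟩, ⟨P.isoMk (asIso (adj.unit.app X.obj)).symm⟩⟩⟩

/-! ### Base change of modules over noncommutative algebras -/

namespace BaseChange

variable {R : Type} [CommRing R] {B : Type} [Ring B] [Algebra R B]

scoped instance (M : ModuleCat.{0} B) : Module R M := Module.restrictScalars R B M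

scoped instance (M : ModuleCat.{0} B) : IsScalarTower R B M := IsScalarTower.restrictScalars R B M

end BaseChange

open scoped BaseChange

variable {R : Type} [CommRing R] {S : Type} [CommRing S] [Algebra R S] {B : Type} [Ring B]
  [Algebra R B] {C : Type} [Ring C] (θ : S ⊗[R] B ≃+* C)

/-- The base change `S ⊗ M` of a `B`-module `M`, as a module over a ring `C` isomorphic to
`S ⊗ B`. -/
def BaseChange (_ : S ⊗[R] B ≃+* C) (M : ModuleCat.{0} B) : Type := S ⊗[R] M

namespace BaseChange

instance (M : ModuleCat.{0} B) : AddCommGroup (BaseChange θ M) :=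
  inferInstanceAs (AddCommGroup (S ⊗[R] M))

/-- The action of `S ⊗ B` on `S ⊗ M`. -/
def action (S : Type) [CommRing S] [Algebra R S] (M : ModuleCat.{0} B) :
    S ⊗[R] B →ₐ[R] Module.End R (S ⊗[R] M) :=
  (Module.endTensorEndAlgHom (R := R) (S := R) (A := R) (M := S) (N := M)).comp
    (Algebra.TensorProduct.map (Algebra.lmul R S) (Algebra.lsmul R R M))

instance (M : ModuleCat.{0} B) : Module C (BaseChange θ M) :=
  Module.compHom (S ⊗[R] M) ((action S M).toRingHom.comp (θ.symm : C →+* S ⊗[R] B))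

/-- The element `s ⊗ m`. -/
def tmul {M : ModuleCat.{0} B} (s : S) (m : M) : BaseChange θ M := s ⊗ₜ[R] m

lemma smul_tmul {M : ModuleCat.{0} B} (s t : S) (b : B) (m : M) :
    θ (t ⊗ₜ[R] b) • tmul θ s m = tmul θ (t * s) (b • m) := by
  change action S M (θ.symm (θ (t ⊗ₜ[R] b))) (s ⊗ₜ[R] m) = _
  rw [θ.symm_apply_apply]
  rfl

variable {θ}

lemma induction {M : ModuleCat.{0} B} {p : BaseChange θ M → Prop}
    (h : ∀ s m, p (tmul θ s m)) (h' : ∀ x y, p x → p y → p (x + y)) (x : BaseChange θ M) : p x := by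
  refine TensorProduct.induction_on x ?_ h h'
  rw [← TensorProduct.tmul_zero M (0 : S)]
  exact h 0 0

lemma addHom_ext {M : ModuleCat.{0} B} {X : Type} [AddCommGroup X]
    {φ ψ : BaseChange θ M →+ X} (h : ∀ s m, φ (tmul θ s m) = ψ (tmul θ s m)) : φ = ψ :=
  AddMonoidHom.ext fun x => induction (p := fun x => φ x = ψ x) h
    (fun x y hx hy => by rw [map_add, map_add, hx, hy]) x

/-- A homomorphism of groups on `S ⊗ M` is linear if it is so on pure tensors. -/
def linearMap {M : ModuleCat.{0} B} {X : Type} [AddCommGroup X] [Module C X]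
    (φ : BaseChange θ M →+ X)
    (h : ∀ (t s : S) (b : B) (m : M), φ (tmul θ (t * s) (b • m)) = θ (t ⊗ₜ[R] b) • φ (tmul θ s m)) :
    BaseChange θ M →ₗ[C] X where
  toFun := φ
  map_add' := map_add _
  map_smul' c x := by
    obtain ⟨c, rfl⟩ := θ.surjective c
    refine induction (p := fun x => φ (θ c • x) = θ c • φ x) (fun s m => ?_) (fun x y hx hy => ?_) x
    · induction c with
      | zero => rw [map_zero, zero_smul, map_zero, zero_smul]
      | tmul t b => exact (congrArg φ (smul_tmul θ s t b m)).trans (h t s b m)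
      | add t t' h h' => rw [map_add, add_smul, map_add, h, h', add_smul]
    · rw [smul_add, map_add, hx, hy, map_add, smul_add]

variable (θ)

/-- The functor `M ↦ S ⊗ M` from `B`-modules to `C`-modules. -/
def functor : ModuleCat.{0} B ⥤ ModuleCat.{0} C where
  obj M := ModuleCat.of _ (BaseChange θ M)
  map {M N} f := ofHom (linearMap (X := BaseChange θ N)
    (LinearMap.lTensor S (f.hom.restrictScalars R)).toAddMonoidHom fun t s b m =>
      (congrArg (tmul θ (t * s)) (map_smul f.hom b m)).trans (smul_tmul θ s t b (f.hom m)).symm)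
  map_id M := by
    ext x
    exact DFunLike.congr_fun (LinearMap.lTensor_id S M) x
  map_comp f g := by
    ext x
    exact DFunLike.congr_fun (LinearMap.lTensor_comp S (g.hom.restrictScalars R)
      (f.hom.restrictScalars R)) x

instance : (functor θ).Additive where
  map_add {M N f g} := by
    ext x
    exact DFunLike.congr_fun (LinearMap.lTensor_add S (f.hom.restrictScalars R)
      (g.hom.restrictScalars R)) x

instance [Module.Flat R S] : (functor θ).PreservesHomology := by
  have h : ∀ (T : ShortComplex (ModuleCat.{0} B)), T.Exact → (T.map (functor θ)).Exact := by
    intro T hT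
    rw [ShortComplex.ShortExact.moduleCat_exact_iff_function_exact] at hT ⊢
    exact Module.Flat.lTensor_exact S (f := T.f.hom.restrictScalars R)
      (g := T.g.hom.restrictScalars R) hT
  exact ((functor θ).exact_tfae.out 1 2).1 h

instance [Module.Flat R S] : PreservesFiniteLimits (functor θ) :=
  (functor θ).preservesFiniteLimits_of_preservesHomology

instance [Module.Flat R S] : PreservesFiniteColimits (functor θ) :=
  (functor θ).preservesFiniteColimits_of_preservesHomology

variable {g : B →+* C} (hg : ∀ b, θ (1 ⊗ₜ[R] b) = g b)

/-- Multiplication `S ⊗ N → N` for a `C`-module `N`. -/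
def mulMap (N : ModuleCat.{0} C) :
    BaseChange θ ((restrictScalars.{0} g).obj N) →+ N :=
  TensorProduct.liftAddHom
    { toFun := fun s => DistribSMul.toAddMonoidHom N (θ (s ⊗ₜ[R] (1 : B)))
      map_zero' := AddMonoidHom.ext fun (x : N) => by
        change θ (0 ⊗ₜ[R] (1 : B)) • x = 0
        rw [TensorProduct.zero_tmul, map_zero, zero_smul]
      map_add' := fun s t => AddMonoidHom.ext fun (x : N) => by
        change θ ((s + t) ⊗ₜ[R] (1 : B)) • x = θ (s ⊗ₜ[R] 1) • x + θ (t ⊗ₜ[R] 1) • x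
        rw [TensorProduct.add_tmul, map_add, add_smul] }
    fun r s (x : N) => by
      change θ ((r • s) ⊗ₜ[R] (1 : B)) • x = θ (s ⊗ₜ[R] (1 : B)) • g (algebraMap R B r) • x
      rw [← hg, ← mul_smul, ← map_mul, Algebra.TensorProduct.tmul_mul_tmul, mul_one, one_mul,
        Algebra.algebraMap_eq_smul_one, TensorProduct.tmul_smul, TensorProduct.smul_tmul']

/-- Base change is left adjoint to restriction. -/
def adj : functor θ ⊣ restrictScalars.{0} g :=
  Adjunction.mkOfUnitCounit
    { unit :=
        { app := fun M => ofHom (Y := (restrictScalars.{0} g).obj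
            ((functor θ).obj M))
            { toFun := fun m => tmul θ 1 m
              map_add' := fun x y => TensorProduct.tmul_add _ _ _
              map_smul' := fun b x => by
                change _ = g b • tmul θ 1 x
                rw [← hg, smul_tmul, one_mul] }
          naturality := fun M N f => rfl }
      counit :=
        { app := fun N => ofHom (linearMap (mulMap θ hg N) fun t s b (m : N) => by
            change θ ((t * s) ⊗ₜ[R] (1 : B)) • g b • m = θ (t ⊗ₜ[R] b) • θ (s ⊗ₜ[R] (1 : B)) • m
            rw [← hg, ← mul_smul, ← mul_smul, ← map_mul, ← map_mul,
              Algebra.TensorProduct.tmul_mul_tmul, Algebra.TensorProduct.tmul_mul_tmul, one_mul,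
              mul_one, mul_one])
          naturality := fun M N f => by
            ext x
            exact DFunLike.congr_fun (addHom_ext (X := N) (φ := (mulMap θ hg N).comp
              ((functor θ).map ((restrictScalars.{0} g).map f)).hom.toAddMonoidHom)
              (ψ := f.hom.toAddMonoidHom.comp (mulMap θ hg M))
              fun s m => (map_smul f.hom (θ (s ⊗ₜ[R] (1 : B))) m).symm) x }
      left_triangle := by
        ext M x
        exact DFunLike.congr_fun (addHom_ext (X := BaseChange θ M)
          (φ := (mulMap θ hg ((functor θ).obj M)).comp (LinearMap.lTensor S _).toAddMonoidHom)
          (ψ := AddMonoidHom.id _) fun s m => by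
            refine (smul_tmul θ 1 s (1 : B) m).trans ?_
            rw [mul_one, one_smul]
            rfl) x
      right_triangle := by
        ext N x
        change N at x
        change θ (1 ⊗ₜ[R] 1) • x = x
        rw [← Algebra.TensorProduct.one_def, map_one, one_smul] }

/-- Where `m ↦ 1 ⊗ m` is bijective, the unit and the counit are isomorphisms. -/
lemma isIso_unit {M : ModuleCat.{0} B}
    (h : Bijective fun m : M => (1 : S) ⊗ₜ[R] m) : IsIso ((adj θ hg).unit.app M) :=
  (ConcreteCategory.isIso_iff_bijective _).2 h

lemma isIso_counit {N : ModuleCat.{0} C} (h : Bijective fun m :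
    (restrictScalars.{0} g).obj N => (1 : S) ⊗ₜ[R] m) :
    IsIso ((adj θ hg).counit.app N) := by
  have h1 := isIso_unit θ hg h
  have h2 : IsIso ((restrictScalars.{0} g).map ((adj θ hg).counit.app N)) :=
    (IsIso.of_isIso_fac_left ((adj θ hg).right_triangle_components N))
  exact isIso_of_reflects_iso _ (restrictScalars.{0} g)

end BaseChange

/-! ### Completion of algebras finite over a noetherian ring -/

section Completion

variable {R : Type} [CommRing R] [IsNoetherianRing R] (I : Ideal R)

/-- Modules on which `I` is locally nilpotent do not change under completion. -/
lemma bijective_one_tmul {M : Type} [AddCommGroup M] [Module R M]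
    (hM : ∀ m : M, ∃ k, ∀ r ∈ I ^ k, r • m = 0) :
    Bijective fun m : M => (1 : AdicCompletion I R) ⊗ₜ[R] m := by
  constructor
  · refine (injective_iff_map_eq_zero (TensorProduct.mk R (AdicCompletion I R) M 1)).2 fun m hm => ?_
    obtain ⟨k, hk⟩ := hM m
    let N := Submodule.span R {m}
    let m' : N := ⟨m, Submodule.mem_span_singleton_self m⟩
    have h1 : (1 : AdicCompletion I R) ⊗ₜ[R] m' = 0 :=
      Module.Flat.lTensor_preserves_injective_linearMap (M := AdicCompletion I R) N.subtype
        N.subtype_injective (hm.trans (map_zero _).symm)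
    have h2 := congrArg (fun x => (AdicCompletion.ofTensorProduct I N x).val k) h1
    simp only [AdicCompletion.ofTensorProduct_tmul, one_smul, map_zero] at h2
    have h3 : m' ∈ (I ^ k • ⊤ : Submodule R N) := (Submodule.Quotient.mk_eq_zero _).1 h2
    have h4 : (I ^ k • ⊤ : Submodule R N) ≤ ⊥ := Submodule.smul_le.2 fun r hr x _ => by
      obtain ⟨c, hc⟩ := Submodule.mem_span_singleton.1 x.2
      refine Subtype.ext ?_
      change r • x.1 = 0
      rw [← hc, smul_comm, hk r hr, smul_zero]
    exact congrArg Subtype.val (h4 h3)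
  · intro x
    induction x with
    | zero => exact ⟨0, TensorProduct.tmul_zero _ _⟩
    | add x y hx hy =>
      obtain ⟨⟨a, rfl⟩, b, rfl⟩ := And.intro hx hy
      exact ⟨a + b, TensorProduct.tmul_add _ _ _⟩
    | tmul s m =>
      obtain ⟨k, hk⟩ := hM m
      obtain ⟨r, hr⟩ := Submodule.Quotient.mk_surjective _ (AdicCompletion.eval I R k s)
      have h1 : s - AdicCompletion.of I R r ∈ (I ^ k • ⊤ : Submodule R (AdicCompletion I R)) := by
        rw [AdicCompletion.pow_smul_top_eq_ker_eval (IsNoetherian.noetherian I), LinearMap.mem_ker,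
          map_sub, ← hr]
        exact sub_self _
      have h2 : (s - AdicCompletion.of I R r) ⊗ₜ[R] m = 0 := by
        refine smul_induction_on h1 (fun a ha t _ => ?_) fun a b ha hb => ?_
        · rw [TensorProduct.smul_tmul, hk a ha, TensorProduct.tmul_zero]
        · rw [TensorProduct.add_tmul, ha, hb, add_zero]
      refine ⟨r • m, ?_⟩
      rw [TensorProduct.sub_tmul, sub_eq_zero] at h2
      change (1 : AdicCompletion I R) ⊗ₜ[R] (r • m) = s ⊗ₜ[R] m
      rw [h2, ← TensorProduct.smul_tmul, ← Algebra.algebraMap_eq_smul_one]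
      rfl

variable {I} {B : Type} [Ring B] [Algebra R B] [Module.Finite R B] {C : Type} [Ring C]
  (g : B →+* C) {Q : ℕ → Type} [∀ k, Ring (Q k)] (q : ∀ k, C →+* Q k)

/-- If `C` is the inverse limit of the rings `B / I^{k+1} B`, it is the base change of `B` to the
completion of `R`. -/
lemma exists_completion_equiv
    (hker : ∀ k b, q k (g b) = 0 ↔ b ∈ (I ^ (k + 1) • ⊤ : Submodule R B))
    (hinj : ∀ x, (∀ k, q k x = 0) → x = 0) (hsurj : ∀ k x, ∃ b, q k x = q k (g b))
    (hle : ∀ k l, k ≤ l → ∀ x, q l x = 0 → q k x = 0)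
    (hlim : ∀ b : ℕ → B, (∀ k l, k ≤ l → q k (g (b k)) = q k (g (b l))) →
      ∃ x, ∀ k, q k x = q k (g (b k))) :
    ∃ θ : AdicCompletion I R ⊗[R] B ≃+* C, ∀ b, θ (1 ⊗ₜ[R] b) = g b := by
  have ext : ∀ x y, (∀ k, q k x = q k y) → x = y := fun x y h =>
    sub_eq_zero.1 (hinj _ fun k => by rw [map_sub, h, sub_self])
  have hcomm : ∀ r x, Commute (g (algebraMap R B r)) x := fun r x => ext _ _ fun k => by
    obtain ⟨b, hb⟩ := hsurj k x
    rw [map_mul, map_mul, hb, ← map_mul, ← map_mul, ← map_mul, ← map_mul, Algebra.commutes]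
  let : Algebra R C := (g.comp (algebraMap R B)).toAlgebra' fun r x => (hcomm r x).eq
  let g' : B →ₐ[R] C := { g with commutes' := fun r => rfl }
  have hr : ∀ k r, r ∈ I ^ (k + 1) → q k (g (algebraMap R B r)) = 0 := fun k r h => by
    rw [hker, Algebra.algebraMap_eq_smul_one]
    exact smul_mem_smul h trivial
  have hmk : ∀ k (s : AdicCompletion I R) r r', s.val (k + 1) = Submodule.Quotient.mk r →
      s.val (k + 1) = Submodule.Quotient.mk r' →
      q k (g (algebraMap R B r)) = q k (g (algebraMap R B r')) := fun k s r r' h h' => by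
    rw [← sub_eq_zero, ← map_sub, ← map_sub, ← map_sub]
    refine hr _ _ ?_
    have := (Submodule.Quotient.eq _).1 (h.symm.trans h')
    rwa [smul_eq_mul, Ideal.mul_top] at this
  -- the map from the completion of `R`
  have hσ : ∀ s : AdicCompletion I R, ∃ x, ∀ k r, s.val (k + 1) = Submodule.Quotient.mk r →
      q k x = q k (g (algebraMap R B r)) := fun s => by
    choose r hr' using fun k => Submodule.Quotient.mk_surjective _ (s.val (k + 1))
    obtain ⟨x, hx⟩ := hlim (fun k => algebraMap R B (r k)) fun k l hkl => by
      refine hmk k s _ _ (hr' k).symm ?_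
      exact (s.2 (Nat.succ_le_succ hkl)).symm.trans (congrArg _ (hr' l).symm)
    exact ⟨x, fun k r h => (hx k).trans (hmk k s _ _ (hr' k).symm h)⟩
  choose σ hσ using hσ
  have rep : ∀ k (s : AdicCompletion I R), ∃ r : R, s.val (k + 1) = Submodule.Quotient.mk r :=
    fun k s => (Submodule.Quotient.mk_surjective _ (s.val (k + 1))).imp fun r h => h.symm
  have hσr : ∀ r, σ (algebraMap R _ r) = g (algebraMap R B r) := fun r => ext _ _ fun k =>
    hσ _ k r rfl
  let σ' : AdicCompletion I R →ₐ[R] C :=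
    { toFun := σ
      map_one' := by rw [← map_one (algebraMap R (AdicCompletion I R)), hσr, map_one, map_one]
      map_zero' := by rw [← map_zero (algebraMap R (AdicCompletion I R)), hσr, map_zero, map_zero]
      map_add' := fun s t => ext _ _ fun k => by
        obtain ⟨⟨a, ha⟩, b, hb⟩ := And.intro (rep k s) (rep k t)
        rw [map_add, hσ s k a ha, hσ t k b hb, hσ (s + t) k (a + b)
          (by rw [AdicCompletion.val_add, Pi.add_apply, ha, hb]; rfl)]
        simp only [map_add]
      map_mul' := fun s t => ext _ _ fun k => by
        obtain ⟨⟨a, ha⟩, b, hb⟩ := And.intro (rep k s) (rep k t)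
        rw [map_mul, hσ s k a ha, hσ t k b hb, hσ (s * t) k (a * b)
          (by rw [AdicCompletion.val_mul, ha, hb]; rfl)]
        simp only [map_mul]
      commutes' := hσr }
  let Θ : AdicCompletion I R ⊗[R] B →ₐ[R] C := Algebra.TensorProduct.lift σ' g' fun s b =>
    ext _ _ fun k => by
      obtain ⟨a, ha⟩ := rep k s
      change q k (σ s * g b) = q k (g b * σ s)
      rw [map_mul, map_mul, hσ s k a ha]
      exact ((hcomm a (g b)).map (q k)).eq
  have hΘt : ∀ s b, Θ (s ⊗ₜ b) = σ s * g b := fun s b => Algebra.TensorProduct.lift_tmul _ _ _ s b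
  -- the map `Θ` is compatible with the comparison map to the completion of `B`
  have hΘ : ∀ t k b, (AdicCompletion.ofTensorProduct I B t).val (k + 1) = Submodule.Quotient.mk b →
      q k (Θ t) = q k (g b) := fun t => by
    have key : ∀ k, ∃ b, (AdicCompletion.ofTensorProduct I B t).val (k + 1) =
        Submodule.Quotient.mk b ∧ q k (Θ t) = q k (g b) := fun k => by
      induction t with
      | zero => exact ⟨0, by rw [map_zero]; rfl, by simp only [map_zero]⟩
      | tmul s b =>
        obtain ⟨a, ha⟩ := rep k s
        refine ⟨a • b, ?_, ?_⟩
        · rw [AdicCompletion.ofTensorProduct_tmul]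
          change s.val (k + 1) • _ = _
          rw [ha]
          rfl
        · rw [hΘt, map_mul, hσ s k a ha, ← map_mul, ← map_mul, Algebra.smul_def]
      | add x y hx hy =>
        obtain ⟨⟨a, ha, ha'⟩, b, hb, hb'⟩ := And.intro hx hy
        refine ⟨a + b, ?_, ?_⟩
        · rw [map_add, AdicCompletion.val_add, Pi.add_apply, ha, hb]
          rfl
        · rw [map_add, map_add, ha', hb', map_add, map_add]
    intro k b hb
    obtain ⟨b', h, h'⟩ := key k
    rw [h', ← sub_eq_zero, ← map_sub, ← map_sub, hker]
    exact (Submodule.Quotient.eq _).1 (h.symm.trans hb)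
  have hbij := AdicCompletion.ofTensorProduct_bijective_of_finite_of_isNoetherian I B
  refine ⟨RingEquiv.ofBijective Θ ⟨?_, fun x => ?_⟩, fun b => ?_⟩
  · refine (injective_iff_map_eq_zero Θ).2 fun t ht => hbij.1 ?_
    rw [map_zero]
    refine AdicCompletion.ext fun k => ?_
    obtain ⟨b, hb⟩ := Submodule.Quotient.mk_surjective _
      ((AdicCompletion.ofTensorProduct I B t).val (k + 1))
    have h1 := hΘ t k b hb.symm
    rw [ht, map_zero, eq_comm, hker] at h1
    exact ((AdicCompletion.ofTensorProduct I B t).2 (Nat.le_succ k)).symm.trans ((congrArg _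
      (hb.symm.trans ((Submodule.Quotient.mk_eq_zero _).2 h1))).trans (map_zero _))
  · choose b hb using fun k => hsurj k x
    have hb' : ∀ k l, k ≤ l → q k (g (b k)) = q k (g (b l)) := fun k l hkl => by
      rw [← hb, ← sub_eq_zero, ← map_sub]
      exact hle k l hkl _ (by rw [map_sub, hb l, sub_self])
    let β : AdicCompletion.AdicCauchySequence I B := AdicCompletion.AdicCauchySequence.mk I B b
      fun k => by
        rw [SModEq.sub_mem]
        refine Submodule.smul_mono_left (Ideal.pow_le_pow_right (Nat.le_succ k)) ((hker k _).1 ?_)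
        rw [map_sub, map_sub, hb' k (k + 1) (Nat.le_succ k), sub_self]
    obtain ⟨t, ht⟩ := hbij.2 (AdicCompletion.mk I B β)
    refine ⟨t, ext _ _ fun k => ?_⟩
    rw [hb, hb' k (k + 1) (Nat.le_succ k)]
    exact hΘ t k _ (congrArg (fun s => s.val (k + 1)) ht)
  · refine (hΘt 1 b).trans ?_
    rw [show σ 1 = 1 from map_one σ', one_mul]

end Completion

/-! ### Monodromic objects over a completion -/

section MonodromicCompletion

variable {n : ℕ} {A : Type} [Ring A] [Algebra ℂ A] {C : Type} [Ring C]

/-- The ring `C` is the completion of `A` at the ideal generated by the `z_i`, via `f : A → C` and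
`p_k : C → A / I^{k+1}`. -/
structure IsCompletion (z : Fin n → A) (f : A →+* C) (p : ∀ k, C →+* Nbhd z k) : Prop where
  comp_eq : ∀ k a, p k (f a) = quo _ a
  eq_zero : ∀ x, (∀ k, p k x = 0) → x = 0
  eq_zero_of_le : ∀ k l, k ≤ l → ∀ x, p l x = 0 → p k x = 0
  exists_lim : ∀ a : ℕ → A, (∀ k l, k ≤ l →
    quo (monomials z (k + 1)) (a k) = quo (monomials z (k + 1)) (a l)) →
      ∃ x, ∀ k, p k x = quo _ (a k)

lemma isMonodromic_of_res (f : A →+* C) {z : Fin n → A} {X : DMod C}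
    (hX : IsMonodromic z ((res f).obj X)) : IsMonodromic (fun i => f (z i)) X := by
  intro k x i
  obtain ⟨N, hN⟩ := IsMonodromicModule.of_iso (homology_res f X k).some.symm (hX k) x i
  refine ⟨N, ?_⟩
  change op (f (z i) ^ N) • x = 0
  rw [← map_pow]
  exact hN

section

variable {R : Type} [CommRing R] [Algebra R A] {r : Fin n → R} {z : Fin n → A}
  (hr : ∀ i, algebraMap R A (r i) = z i)

include hr

lemma mk_eq_zero_iff_mem_pow (k : ℕ) (a : A) : quo (monomials z (k + 1)) a = 0 ↔
    op a ∈ (Ideal.span (Set.range r) ^ (k + 1) • ⊤ : Submodule R Aᵐᵒᵖ) := by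
  have hprod : ∀ s : Fin (k + 1) → Fin n, (ofFn fun j => z (s j)).prod =
      algebraMap R A (ofFn fun j => r (s j)).prod := fun s => by
    rw [map_list_prod, map_ofFn]
    exact congrArg (fun s => (ofFn s).prod) (funext fun j => (hr _).symm)
  constructor
  · intro h
    let N := (Ideal.span (Set.range r) ^ (k + 1) • ⊤ : Submodule R Aᵐᵒᵖ)
    have hmul : ∀ x b, x ∈ N → x * b ∈ N ∧ b * x ∈ N := fun x b hx => by
      refine smul_induction_on hx (fun c hc y _ => ?_) fun x y hx hy => ?_
      · rw [smul_mul_assoc, mul_smul_comm]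
        exact ⟨smul_mem_smul hc trivial, smul_mem_smul hc trivial⟩
      · rw [add_mul, mul_add]
        exact ⟨N.add_mem hx.1 hy.1, N.add_mem hx.2 hy.2⟩
    let K : TwoSidedIdeal A := .mk' {a | op a ∈ N} N.zero_mem N.add_mem N.neg_mem
      (fun {x y} hy => (hmul _ (op x) hy).1)
      fun {x y} hx => (hmul _ (op y) hx).2
    have hK : ∀ a, a ∈ K ↔ op a ∈ N := fun a => mem_mk' ..
    refine (hK a).1 (TwoSidedIdeal.span_le.2 ?_ (mk_eq_zero_iff.1 h))
    rintro _ ⟨s, rfl⟩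
    refine (hK _).2 ?_
    have h1 : (ofFn fun j => r (s j)).prod ∈ Ideal.span (Set.range r) ^ (k + 1) := by
      rw [Ideal.span, Submodule.span_pow]
      exact Submodule.subset_span (Set.mem_pow.2 ⟨fun j => ⟨r (s j), s j, rfl⟩, rfl⟩)
    have h2 := smul_mem_smul h1 (Submodule.mem_top (x := (1 : Aᵐᵒᵖ)))
    rwa [← Algebra.algebraMap_eq_smul_one, MulOpposite.algebraMap_apply, ← hprod] at h2
  · intro h
    refine smul_induction_on (p := fun x => quo (monomials z (k + 1)) x.unop = 0)
      h (fun c hc y _ => ?_) fun x y hx hy => ?_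
    · rw [Algebra.smul_def, MulOpposite.unop_mul, map_mul]
      refine (congrArg (_ * ·) ?_).trans (mul_zero _)
      rw [Ideal.span, Submodule.span_pow] at hc
      refine span_induction (p := fun c _ => quo (monomials z (k + 1))
        (algebraMap R A c) = 0) (fun c hc => ?_) ?_ (fun x y _ _ hx hy => ?_)
        (fun a x _ hx => ?_) hc
      · obtain ⟨s, rfl⟩ := Set.mem_pow.1 hc
        choose t ht using fun j => (s j).2
        refine mk_eq_zero ⟨t, ?_⟩
        refine (hprod t).trans (congrArg (fun s => algebraMap R A (ofFn s).prod) (funext ht))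
      · rw [map_zero, map_zero]
      · rw [map_add, map_add, hx, hy, add_zero]
      · rw [smul_eq_mul, map_mul, map_mul, hx, mul_zero]
    · rw [MulOpposite.unop_add, map_add, hx, hy, add_zero]

open scoped BaseChange in
lemma IsMonodromicModule.exists_pow {M : RMod A} (hM : IsMonodromicModule z M) (m : M) :
    ∃ k, ∀ c ∈ Ideal.span (Set.range r) ^ k, c • m = 0 := by
  refine Exists.imp (fun k h c hc => ?_) (Ideal.exists_pow_le_of_le_radical_of_fg (I :=
    Ideal.span (Set.range r)) (J := (LinearMap.toSpanSingleton R M m).ker) (Ideal.span_le.2 ?_)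
    (Submodule.fg_span (Set.finite_range r)))
  · exact LinearMap.mem_ker.1 (h hc)
  · rintro _ ⟨i, rfl⟩
    obtain ⟨N, hN⟩ := hM m i
    refine ⟨N, ?_⟩
    change algebraMap R Aᵐᵒᵖ (r i ^ N) • m = 0
    rw [MulOpposite.algebraMap_apply, map_pow, hr]
    exact hN

end

open scoped BaseChange in
/-- Let `A` be finite over a noetherian ring whose image is central and contains the `z_i`. Then
monodromic objects over `A` and over its completion are the same. -/
lemma isEquivalence_monRes {z : Fin n → A} {f : A →+* C} {p : ∀ k, C →+* Nbhd z k}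
    (h : IsCompletion z f p) {R : Type} [CommRing R] [IsNoetherianRing R] (ρ : R →+* A)
    (hρ : ∀ c a, Commute (ρ c) a) (r : Fin n → R) (hr : ∀ i, ρ (r i) = z i)
    {ι : Type} [Finite ι] (u : ι → A)
    (hu : ∀ a, a ∈ AddSubgroup.closure {x | ∃ c i, x = ρ c * u i}) :
    (monRes f (z := z) (w := fun i => f (z i)) fun _ => rfl).IsEquivalence := by
  let : Algebra R A := ρ.toAlgebra' fun c a => (hρ c a).eq
  have : Module.Finite R A := by
    have h : (AddSubgroup.closure {x | ∃ c i, x = ρ c * u i}) ≤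
        (Submodule.span R (Set.range u)).toAddSubgroup := by
      rw [AddSubgroup.closure_le]
      rintro _ ⟨c, i, rfl⟩
      exact smul_mem _ c (Submodule.subset_span ⟨i, rfl⟩)
    refine ⟨?_⟩
    rw [← (eq_top_iff.2 fun a _ => h (hu a) : Submodule.span R (Set.range u) = ⊤)]
    exact Submodule.fg_span (Set.finite_range u)
  have : Module.Finite R Aᵐᵒᵖ := Module.Finite.equiv (MulOpposite.opLinearEquiv R)
  obtain ⟨θ, hθ⟩ := exists_completion_equiv (I := Ideal.span (Set.range r)) (RingHom.op f)
    (Q := fun k => (Nbhd z k)ᵐᵒᵖ) (fun k => RingHom.op (p k))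
    (fun k b => by
      rw [← MulOpposite.op_unop b, ← mk_eq_zero_iff_mem_pow hr, ← h.comp_eq]
      exact MulOpposite.op_eq_zero_iff _)
    (fun x hx => MulOpposite.unop_injective (h.eq_zero x.unop fun k => congrArg unop (hx k)))
    (fun k x => by
      obtain ⟨a, ha⟩ := mk_surjective _ (p k x.unop)
      exact ⟨op a, congrArg op (ha.symm.trans (h.comp_eq k a).symm)⟩)
    (fun k l hkl x hx => congrArg op (h.eq_zero_of_le k l hkl x.unop (congrArg unop hx)))
    (fun b hb => by
      obtain ⟨x, hx⟩ := h.exists_lim (fun k => (b k).unop) fun k l hkl => by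
        rw [← h.comp_eq, ← h.comp_eq]
        exact congrArg unop (hb k l hkl)
      exact ⟨op x, fun k => congrArg op ((hx k).trans (h.comp_eq k _).symm)⟩)
  refine isEquivalence_lift_of_adjunction (derivedAdj (BaseChange.adj θ hθ)) (IsMonodromic z)
    (IsMonodromic fun i => f (z i)) (fun X => ⟨isMonodromic_of_res f, isMonodromic_res f fun _ => rfl⟩)
    (fun X hX => isIso_derivedAdj_unit _ X fun k => BaseChange.isIso_unit θ hθ
      (bijective_one_tmul _ ((hX k).exists_pow hr)))
    (fun X hX => isIso_derivedAdj_counit _ X fun k => BaseChange.isIso_counit θ hθ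
      (bijective_one_tmul _ (IsMonodromicModule.exists_pow hr fun x i => ?_)))
  obtain ⟨N, hN⟩ := hX k x i
  refine ⟨N, ?_⟩
  rwa [← map_pow] at hN

end MonodromicCompletion

/-! ### Finiteness over the parameters -/

section Finiteness

variable {n : ℕ}

lemma mem_closure_bettiPath (x : ABet n) : x ∈ AddSubgroup.closure {x | ∃ (c : Laurent n)
    (p : SignVector n × SignVector n), x = torusAction c * bettiPath p.1 p.2} := by
  rw [← bettiInv_bettiHom x, bettiInv_apply]
  exact sum_mem fun a _ => sum_mem fun b _ => AddSubgroup.subset_closure ⟨_, (a, b), rfl⟩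

lemma PathAlg.exists_eq_sum (x : PathAlg) : ∃ φ : Bool × Bool → Polynomial ℂ,
    x = ∑ p, aeval loop (φ p) * arrow p.1 p.2 := by
  have hc : ∀ (φ : Polynomial ℂ) x, Commute (aeval loop φ) x := fun φ x => by
    induction φ using Polynomial.induction_on' with
    | add φ ψ h h' => rw [map_add]; exact h.add_left h'
    | monomial k c =>
      rw [Polynomial.aeval_monomial]
      exact (show Commute _ x from Algebra.commutes c x).mul_left ((loop_comm x).pow_left k)
  let : Algebra (Polynomial ℂ) PathAlg := (aeval loop).toRingHom.toAlgebra' fun φ x => (hc φ x).eq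
  let N := Submodule.span (Polynomial ℂ) (Set.range fun p : Bool × Bool => arrow p.1 p.2)
  have harrow : ∀ s t, arrow s t ∈ N := fun s t => Submodule.subset_span ⟨(s, t), rfl⟩
  have hmul : ∀ s t y, y ∈ N → arrow s t * y ∈ N := fun s t y hy => by
    refine (Submodule.span_le (p := N.comap (LinearMap.mulLeft _ (arrow s t)))).2 ?_ hy
    rintro _ ⟨⟨a, b⟩, rfl⟩
    change arrow s t * arrow a b ∈ N
    by_cases h : t = a
    · subst h
      rw [arrow_mul_arrow]
      split_ifs
      · have := N.smul_mem Polynomial.X (harrow s b)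
        rwa [Algebra.smul_def, show algebraMap (Polynomial ℂ) PathAlg Polynomial.X = loop from
          aeval_X _] at this
      · rw [one_mul]
        exact harrow s b
    · rw [arrow_mul_arrow_of_ne s b h]
      exact N.zero_mem
  let T : Subalgebra ℂ PathAlg :=
    { carrier := {x | ∀ y ∈ N, x * y ∈ N}
      add_mem' := fun ha hb y hy => by
        rw [add_mul]
        exact N.add_mem (ha y hy) (hb y hy)
      mul_mem' := fun ha hb y hy => by
        rw [mul_assoc]
        exact ha _ (hb y hy)
      algebraMap_mem' := fun c y hy => by
        have := N.smul_mem (Polynomial.C c) hy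
        rwa [Algebra.smul_def, show algebraMap (Polynomial ℂ) PathAlg (Polynomial.C c) = algebraMap ℂ _ c
          from Polynomial.aeval_C _ _] at this }
  have h1 : (1 : PathAlg) ∈ N := by
    rw [← e_complete]
    exact N.add_mem (harrow true true) (harrow false false)
  have hx : x ∈ T := PathAlg.mem_of_gen T (fun s y hy => arrow_self s ▸ hmul s s y hy)
    (hmul true false) (hmul false true) x
  obtain ⟨φ, hφ⟩ := (Submodule.mem_span_range_iff_exists_fun _).1 (hx 1 h1)
  exact ⟨φ, (mul_one x).symm.trans hφ.symm⟩

/-- The action of polynomials in the `d_i` on `A^dR_n`. -/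
def polyAction : MvPolynomial (Fin n) ℂ →ₐ[ℂ] AdR n :=
  (Subalgebra.val _).comp (MvPolynomial.aeval centraldR)

lemma polyAction_X (i : Fin n) : polyAction (MvPolynomial.X i) = paramdR i :=
  congrArg Subtype.val (MvPolynomial.aeval_X centraldR i)

lemma polyAction_comm (c : MvPolynomial (Fin n) ℂ) (a : AdR n) : Commute (polyAction c) a :=
  (Subalgebra.mem_center_iff.1 (MvPolynomial.aeval centraldR c).2 a).symm

lemma mem_closure_deRhamPath (x : AdR n) : x ∈ AddSubgroup.closure
    {x | ∃ (c : MvPolynomial (Fin n) ℂ) (p : SignVector n × SignVector n),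
      x = polyAction c * deRhamPath p.1 p.2} := by
  induction x using PiTensorProduct.induction_on with
  | add x y hx hy => exact add_mem hx hy
  | smul_tprod r b =>
    choose φ hφ using fun i => PathAlg.exists_eq_sum (b i)
    rw [show b = fun i => _ from funext hφ, MultilinearMap.map_sum, smul_sum]
    refine sum_mem fun σ _ => AddSubgroup.subset_closure
      ⟨r • ∏ i, aeval (MvPolynomial.X i) (φ i (σ i)), (fun i => (σ i).1, fun i => (σ i).2), ?_⟩
    have h : polyAction (∏ i, aeval (MvPolynomial.X i) (φ i (σ i))) =
        pureTensor fun i => aeval loop (φ i (σ i)) := by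
      refine map_prod_eq_pureTensor _ fun i => ?_
      rw [← aeval_algHom_apply, polyAction_X]
      exact (aeval_algHom_apply (inFactorHom i) loop _)
    rw [map_smul, h, smul_mul_assoc]
    exact congrArg _ (pureTensor_mul_eq fun i => rfl).symm

/-- Monodromic objects over `A(t,-)` and over its completion are the same. -/
lemma isEquivalence_monRes_feasible (P : PolarizedArrangement n) {A : Type} [Ring A] [Algebra ℂ A]
    {S : Set A} {E : SignVector n → A} (hE : OrthogonalIdempotents (quo S ∘ E))
    {R : Type} [CommRing R] [IsNoetherianRing R] [Algebra ℂ R] (θ : R →ₐ[ℂ] A)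
    (hθ : ∀ c a, Commute (θ c) a) {z : Fin n → A} {r : Fin n → R} (hr : ∀ i, θ (r i) = z i)
    {ι : Type} [Finite ι] {u : ι → A} (hu : ∀ a, a ∈ AddSubgroup.closure {x | ∃ c i, x = θ c * u i})
    {C : Type} [Ring C] {f : FeasibleAlg P hE →+* C}
    {p : ∀ k, C →+* Nbhd (fun i => toFeasible P hE (quo S (z i))) k}
    (h : IsCompletion _ f p) :
    (monRes f (z := fun i => toFeasible P hE (quo S (z i))) fun _ => rfl).IsEquivalence := by
  let he := sumIdem_idem hE (𝓕 P)
  have hc : ∀ c a, Commute ((quo S).comp θ c) a := fun c a => by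
    obtain ⟨a, rfl⟩ := mk_surjective S a
    exact (hθ c a).map (quo S)
  let ρ : R →ₐ[ℂ] FeasibleAlg P hE := cornerHom he ((quo S).comp θ) fun c => hc c _
  refine isEquivalence_monRes h ρ.toRingHom (fun c => toCorner_comm he (hc c)) r
    (fun i => congrArg (fun x => toFeasible P hE (quo S x)) (hr i))
    (fun i => toFeasible P hE (quo S (u i))) fun a => ?_
  obtain ⟨b, rfl⟩ := toCorner_surjective he a
  obtain ⟨x, rfl⟩ := mk_surjective S b
  let κ : A →+ FeasibleAlg P hE := ((cornerLinear he).comp (quo S).toLinearMap).toAddMonoidHom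
  refine (AddSubgroup.closure_le (AddSubgroup.comap κ (AddSubgroup.closure {x | ∃ c i,
    x = ρ.toRingHom c * toFeasible P hE (quo S (u i))}))).2 ?_ (hu x)
  rintro _ ⟨c, i, rfl⟩
  refine AddSubgroup.subset_closure ⟨c, i, ?_⟩
  exact (congrArg (toCorner he) (map_mul (quo S) _ _)).trans (toCorner_mul he (hc c _) _).symm

instance : IsNoetherianRing (Laurent n) := by
  have : Algebra.FiniteType ℂ (Laurent n) := finiteType_of_fg ..
  exact Algebra.FiniteType.isNoetherianRing ℂ _

end Finiteness

/-! ### The completed algebra -/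

section Completion

variable {n : ℕ} {A : Type} [Ring A] [Algebra ℂ A]

lemma mk_eq_of_le {z : Fin n → A} {k l : ℕ} (hkl : k ≤ l) {a b : A}
    (h : quo (monomials z (l + 1)) a = quo _ b) :
    quo (monomials z (k + 1)) a = quo _ b := by
  rw [← sub_eq_zero, ← map_sub] at h ⊢
  exact QuotientBy.map_eq_zero_of_mem _ (mk_monomials_of_le hkl) (mk_eq_zero_iff.1 h)

/-- The inverse limit of the algebras `A / I^{k+1}`, where `I` is generated by the `z_i`. -/
def completion (z : Fin n → A) : Subalgebra ℂ (∀ k, Nbhd z k) where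
  carrier := {x | ∀ k l, k ≤ l → ∃ a, x l = quo _ a ∧ x k = quo _ a}
  add_mem' {x y} hx hy k l hkl := by
    obtain ⟨⟨a, ha, ha'⟩, b, hb, hb'⟩ := And.intro (hx k l hkl) (hy k l hkl)
    exact ⟨a + b, by rw [map_add, ← ha, ← hb]; rfl, by rw [map_add, ← ha', ← hb']; rfl⟩
  mul_mem' {x y} hx hy k l hkl := by
    obtain ⟨⟨a, ha, ha'⟩, b, hb, hb'⟩ := And.intro (hx k l hkl) (hy k l hkl)
    exact ⟨a * b, by rw [map_mul, ← ha, ← hb]; rfl, by rw [map_mul, ← ha', ← hb']; rfl⟩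
  algebraMap_mem' c k l _ := ⟨algebraMap ℂ A c, ((quo _).commutes c).symm,
    ((quo _).commutes c).symm⟩

/-- The projection from the completion. -/
def completionProj (z : Fin n → A) (k : ℕ) : completion z →ₐ[ℂ] Nbhd z k :=
  (Pi.evalAlgHom ℂ (fun k => Nbhd z k) k).comp (completion z).val

/-- The homomorphism to the completion defined by homomorphisms to the algebras `A / I^{k+1}`. -/
def toCompletion {z : Fin n → A} {B : Type} [Ring B] [Algebra ℂ B] (φ : ∀ k, B →ₐ[ℂ] Nbhd z k)
    (h : ∀ k l, k ≤ l → ∀ b, ∃ a, φ l b = quo _ a ∧ φ k b = quo _ a) :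
    B →ₐ[ℂ] completion z :=
  (AlgHom.pi φ).codRestrict (completion z) fun b k l hkl => h k l hkl b

lemma isUnit_completion {z : Fin n → A} (x : completion z) (h : ∀ k, IsUnit (x.1 k)) :
    IsUnit x := by
  choose u hu using h
  have hy : (fun k => ((u k)⁻¹ : (Nbhd z k)ˣ).1) ∈ completion z := fun k l hkl => by
    obtain ⟨a, ha, ha'⟩ := x.2 k l hkl
    obtain ⟨b, hb⟩ := mk_surjective _ (((u l)⁻¹ : (Nbhd z l)ˣ) : Nbhd z l)
    refine ⟨b, hb.symm, (Units.inv_eq_of_mul_eq_one_right ?_)⟩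
    rw [hu, ha', ← map_mul, ← map_one (quo _)]
    refine mk_eq_of_le hkl ?_
    rw [map_mul, ← ha, hb, map_one, ← hu, Units.mul_inv]
  refine ⟨⟨x, ⟨_, hy⟩, Subtype.ext (funext fun k => ?_), Subtype.ext (funext fun k => ?_)⟩, rfl⟩
  · change x.1 k * ((u k)⁻¹ : (Nbhd z k)ˣ).1 = 1
    rw [← hu, Units.mul_inv]
  · change ((u k)⁻¹ : (Nbhd z k)ˣ).1 * x.1 k = 1
    rw [← hu, Units.inv_mul]

/-- An algebra `B` with compatible isomorphisms of the quotients `B / I^{k+1}` and `A / I^{k+1}` has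
the same completion as `A`. -/
lemma isCompletion_toCompletion {z : Fin n → A} {B : Type} [Ring B] [Algebra ℂ B] {w : Fin n → B}
    (Φ : ∀ k, Nbhd w k ≃ₐ[ℂ] Nbhd z k)
    (h : ∀ k l, k ≤ l → ∀ b, ∃ a, Φ l (quo _ b) = quo _ a ∧ Φ k (quo _ b) = quo _ a) :
    IsCompletion w (toCompletion (fun k => (Φ k : Nbhd w k →ₐ[ℂ] Nbhd z k).comp (quo _))
      h).toRingHom
      fun k => (((Φ k).symm : Nbhd z k →ₐ[ℂ] Nbhd w k).comp (completionProj z k)).toRingHom where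
  comp_eq k b := (Φ k).symm_apply_apply _
  eq_zero x hx := Subtype.ext (funext fun k => (map_eq_zero_iff _ (Φ k).symm.injective).1 (hx k))
  eq_zero_of_le k l hkl x hx := by
    obtain ⟨a, ha, ha'⟩ := x.2 k l hkl
    have h1 : x.1 l = 0 := (map_eq_zero_iff _ (Φ l).symm.injective).1 hx
    refine (map_eq_zero_iff _ (Φ k).symm.injective).2 (ha'.trans ?_)
    rw [← map_zero (quo _)]
    exact mk_eq_of_le hkl (by rw [← ha, h1, map_zero])
  exists_lim b hb := by
    refine ⟨⟨fun k => Φ k (quo _ (b k)), fun k l hkl => ?_⟩, fun k => (Φ k).symm_apply_apply _⟩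
    obtain ⟨a, ha, ha'⟩ := h k l hkl (b l)
    exact ⟨a, ha, (congrArg (Φ k) (hb k l hkl)).trans ha'⟩

end Completion

/-! ### Equivalences between categories of monodromic objects -/

section Equivalences

variable {n : ℕ} {A B C : Type} [Ring A] [Algebra ℂ A] [Ring B] [Algebra ℂ B] [Ring C] [Algebra ℂ C]

lemma IsMonodromic.of_mul {z w : Fin n → A} (c : Fin n → A) (hc : ∀ i, Commute (z i) (c i))
    (h : ∀ i, z i * c i = w i) {X : DMod A} (hX : IsMonodromic z X) : IsMonodromic w X := by
  intro k x i
  obtain ⟨N, hN⟩ := hX k x i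
  refine ⟨N, ?_⟩
  rw [← h, (hc i).mul_pow, op_mul, mul_smul, hN, smul_zero]

/-- Elements which differ by units define the same monodromic objects. -/
lemma isMonodromic_eq_of_units {z w : Fin n → A} (c : Fin n → A) (hc : ∀ i, Commute (z i) (c i))
    (hu : ∀ i, IsUnit (c i)) (h : ∀ i, z i * c i = w i) : IsMonodromic w = IsMonodromic z := by
  choose u hu using hu
  funext X
  refine propext ⟨fun hX => hX.of_mul (fun i => ((u i)⁻¹ : Aˣ).1) (fun i => ?_) fun i => ?_,
    fun hX => hX.of_mul c hc h⟩
  · rw [← h, ← hu]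
    exact ((hu i ▸ hc i).mul_left (Commute.refl _)).units_inv_right
  · rw [← h, ← hu, Units.mul_inv_cancel_right]

instance (f : A →ₐ[ℂ] B) : (res f.toRingHom).Linear ℂ := by
  have : (restrictScalars.{0} (RingHom.op f.toRingHom)).Linear ℂ :=
    inferInstanceAs ((restrictScalars.{0} (AlgHom.op f).toRingHom).Linear ℂ)
  exact inferInstanceAs ((restrictScalars.{0} (RingHom.op f.toRingHom)).mapDerivedCategory.Linear ℂ)

/-- Restriction along `f`, from a category of monodromic objects given as a property `Q`. -/
abbrev monResOf (f : A →ₐ[ℂ] C) {z : Fin n → A} (Q : ObjectProperty (DMod C))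
    (hQ : ∀ X, Q X → IsMonodromic z ((res f.toRingHom).obj X)) :
    Q.FullSubcategory ⥤ MonDMod z :=
  (IsMonodromic z).lift (Q.ι ⋙ res f.toRingHom) fun X => hQ _ X.property

instance (f : A →ₐ[ℂ] C) {z : Fin n → A} (Q : ObjectProperty (DMod C)) [Q.IsTriangulated]
    (hQ : ∀ X, Q X → IsMonodromic z ((res f.toRingHom).obj X)) : (monResOf f Q hQ).Linear ℂ where
  map_smul g r := by
    ext
    exact (res f.toRingHom).map_smul r g.hom

section AsEquivalence

variable {X Y : Type 1} [Category.{1} X] [Category.{1} Y] [Preadditive X] [Preadditive Y]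
  [HasShift X ℤ] [HasShift Y ℤ] [HasZeroObject X] [HasZeroObject Y]
  [∀ k : ℤ, (shiftFunctor X k).Additive] [∀ k : ℤ, (shiftFunctor Y k).Additive]
  [Pretriangulated X] [Pretriangulated Y] [CategoryTheory.Linear ℂ X] [CategoryTheory.Linear ℂ Y]
  (F : X ⥤ Y) [F.IsEquivalence] [F.CommShift ℤ] [F.IsTriangulated] [F.Linear ℂ]

instance : F.asEquivalence.functor.CommShift ℤ := inferInstanceAs (F.CommShift ℤ)

instance : F.asEquivalence.functor.IsTriangulated := inferInstanceAs F.IsTriangulated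

instance : F.asEquivalence.functor.Linear ℂ := inferInstanceAs (F.Linear ℂ)

instance : F.asEquivalence.inverse.CommShift ℤ := F.asEquivalence.commShiftInverse ℤ

instance : F.asEquivalence.CommShift ℤ := F.asEquivalence.commShift_of_functor ℤ

instance : F.asEquivalence.IsTriangulated := .mk' F.asEquivalence inferInstance

end AsEquivalence

/-- The correspondence `D(A)^mon ≃ D(B)^mon` defined by linear triangulated equivalences from a third
category. -/
def MonEquiv.ofSpan {z : Fin n → A} {w : Fin n → B} {Q : ObjectProperty (DMod C)} [Q.IsTriangulated]
    (F : Q.FullSubcategory ⥤ MonDMod z) (G : Q.FullSubcategory ⥤ MonDMod w)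
    [F.IsEquivalence] [F.CommShift ℤ] [F.IsTriangulated] [F.Linear ℂ]
    [G.IsEquivalence] [G.CommShift ℤ] [G.IsTriangulated] [G.Linear ℂ] : MonEquiv z w :=
  { equiv := F.asEquivalence.symm.trans G.asEquivalence
    commShift := inferInstanceAs ((F.asEquivalence.inverse ⋙ G).CommShift ℤ)
    isTriangulated := inferInstanceAs ((F.asEquivalence.inverse ⋙ G).IsTriangulated)
    linear := inferInstanceAs ((F.asEquivalence.inverse ⋙ G).Linear ℂ) }

end Equivalences

/-! ### The Riemann-Hilbert correspondence -/

section Correspondence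

/-- Functors to a full subcategory are isomorphic if they are so in the ambient category. -/
def isoOfCompι {X Y : Type 1} [Category.{1} X] [Category.{1} Y] {Q : ObjectProperty Y}
    {F G : X ⥤ Q.FullSubcategory} (e : F ⋙ Q.ι ≅ G ⋙ Q.ι) : F ≅ G :=
  NatIso.ofComponents (fun x => Q.isoMk (e.app x)) fun f => by
    ext
    exact e.hom.naturality f

/-- A functor into the apex of a span of equivalences determines what the correspondence does. -/
def spanIso {X Y Z W : Type 1} [Category.{1} X] [Category.{1} Y] [Category.{1} Z] [Category.{1} W]
    (E : Y ≌ Z) (G : Y ≌ W) (K : X ⥤ Y) {H : X ⥤ Z} {H' : X ⥤ W} (e : K ⋙ E.functor ≅ H)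
    (e' : K ⋙ G.functor ≅ H') : H ⋙ (E.symm.trans G).functor ≅ H' :=
  Functor.isoWhiskerRight e.symm _ ≪≫ Functor.isoWhiskerLeft K
    (Functor.isoWhiskerRight E.unitIso.symm G.functor ≪≫ G.functor.leftUnitor) ≪≫ e'

variable {n : ℕ} (P : PolarizedArrangement n)

/-- The isomorphism `A^Bet_G(t,-) / I^{k+1} ≃ A^dR_G(t,-) / J^{k+1}`. -/
def rhtEquiv (k : ℕ) : Nbhd (paramBett P) k ≃ₐ[ℂ] Nbhd (paramdRt P) k := (exists_rht k P).choose

lemma rhtEquiv_related (k : ℕ) {x : ABet n} {y : AdR n}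
    (h : rhEquiv k (quo _ x) = quo _ y) :
    rhtEquiv P k (quo _ (toFeasible P (projBet_orthogonal P) (projBet P x))) =
      quo _ (toFeasible P (projdR_orthogonal P) (projdR P y)) :=
  (exists_rht k P).choose_spec x y h

lemma exists_toFeasible_eq (b : ABett P) :
    ∃ x, toFeasible P (projBet_orthogonal P) (projBet P x) = b := by
  obtain ⟨x, rfl⟩ := toCorner_surjective (sumIdem_idem (projBet_orthogonal P) (𝓕 P)) b
  obtain ⟨x, rfl⟩ := projBet_surjective P x
  exact ⟨x, rfl⟩

lemma exists_related (k : ℕ) (x : ABet n) :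
    ∃ y, ∀ l, l ≤ k → rhEquiv l (quo _ x) = quo _ y := by
  obtain ⟨y, hy⟩ := mk_surjective _ (rhEquiv k (quo _ x))
  exact ⟨y, fun l hl => rhEquiv_of_le hl hy.symm⟩

lemma rhtEquiv_compat (k l : ℕ) (hkl : k ≤ l) (b : ABett P) :
    ∃ a, rhtEquiv P l (quo _ b) = quo _ a ∧ rhtEquiv P k (quo _ b) = quo _ a := by
  obtain ⟨x, rfl⟩ := exists_toFeasible_eq P b
  obtain ⟨y, hy⟩ := exists_related l x
  exact ⟨_, rhtEquiv_related P l (hy l le_rfl), rhtEquiv_related P k (hy k hkl)⟩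

/-- The completion of `A^dR_G(t,-)`. -/
def fromdR : AdRt P →ₐ[ℂ] completion (paramdRt P) :=
  toCompletion (fun _ => (AlgEquiv.refl : _ ≃ₐ[ℂ] _).toAlgHom.comp (quo _))
    fun _ _ _ a => ⟨a, rfl, rfl⟩

/-- The homomorphism from `A^Bet_G(t,-)` to the completion of `A^dR_G(t,-)`. -/
def fromBet : ABett P →ₐ[ℂ] completion (paramdRt P) :=
  toCompletion (fun k => (rhtEquiv P k).toAlgHom.comp (quo _)) (rhtEquiv_compat P)

/-- The monodromic objects over the completion. -/
abbrev monCompletion : ObjectProperty (DMod (completion (paramdRt P))) :=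
  IsMonodromic fun i => fromdR P (paramdRt P i)

lemma rhtEquiv_paramBett (k : ℕ) (i : Fin n) : rhtEquiv P k (quo _ (paramBett P i)) =
    quo _ (paramdRt P i) * malgrangeSeries k (quo _ (paramdRt P i)) := by
  have hmap : ∀ {A B : Type} [Ring A] [Algebra ℂ A] [Ring B] [Algebra ℂ B] (f : A →ₐ[ℂ] B) (x : A),
      f (malgrangeSeries k x) = malgrangeSeries k (f x) := fun f x => by
    rw [← aeval_malgrangePoly, aeval_algHom, aeval_malgrangePoly]
  let ρ : MvPolynomial (Fin n) ℂ →ₐ[ℂ] AdRt P :=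
    cornerHom (sumIdem_idem (projdR_orthogonal P) (𝓕 P)) ((projdR P).comp polyAction)
      fun c => by
        obtain ⟨a, ha⟩ := mk_surjective _ (sumIdem (projdR P ∘ idemdR) (𝓕 P))
        rw [← ha]
        exact (polyAction_comm c a).map (projdR P)
  have hρ : ρ (MvPolynomial.X i) = paramdRt P i :=
    congrArg (fun x => toFeasible P (projdR_orthogonal P) (projdR P x)) (polyAction_X i)
  refine (rhtEquiv_related P k (y := polyAction (MvPolynomial.X i *
    malgrangeSeries k (MvPolynomial.X i))) ?_).trans ?_
  · rw [map_mul, hmap, polyAction_X, map_mul, hmap]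
    exact malgrangeHom_paramBet (quo _) k (pow_eq_zero_of_monomials
      (quo (monomials (paramdR (n := n)) (k + 1))) (mk_monomials k subset_rfl)) i
  · change quo _ (ρ (MvPolynomial.X i * malgrangeSeries k (MvPolynomial.X i))) = _
    rw [map_mul, map_mul, hmap, hmap, hρ]

lemma monCompletion_eq : monCompletion P = IsMonodromic fun i => fromBet P (paramBett P i) := by
  have hmem : ∀ i, (fun k => malgrangeSeries k (quo _ (paramdRt P i))) ∈
      completion (paramdRt P) := fun i k l hkl => by
    refine ⟨malgrangeSeries l (paramdRt P i), ?_, ?_⟩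
    · change malgrangeSeries l (quo _ (paramdRt P i)) = _
      rw [← aeval_malgrangePoly, ← aeval_malgrangePoly, aeval_algHom]
    · change malgrangeSeries k (quo _ (paramdRt P i)) = _
      rw [← aeval_malgrangePoly, ← aeval_malgrangePoly, aeval_algHom, aeval_malgrangePoly,
        aeval_malgrangePoly, malgrangeSeries_eq_of_le hkl (Nbhd.pow_eq_zero _ k i)]
  refine (isMonodromic_eq_of_units (fun i => ⟨_, hmem i⟩) (fun i => ?_) (fun i => ?_)
    fun i => ?_).symm
  · refine Subtype.ext (funext fun k => ?_)
    change quo _ _ * malgrangeSeries k (quo _ _) = malgrangeSeries k (quo _ _) * quo _ _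
    have := aeval_comm (quo (monomials (paramdRt P) (k + 1)) (paramdRt P i)) Polynomial.X
      (malgrangePoly k)
    rw [aeval_malgrangePoly, aeval_X] at this
    exact this.eq
  · exact isUnit_completion _ fun k => isUnit_malgrangeSeries (Nbhd.pow_eq_zero _ k i)
  · exact Subtype.ext (funext fun k => (rhtEquiv_paramBett P k i).symm)

lemma monodromic_fromdR (X) (hX : monCompletion P X) :
    IsMonodromic (paramdRt P) ((res (fromdR P).toRingHom).obj X) :=
  isMonodromic_res _ (fun _ => rfl) hX

lemma monodromic_fromBet (X) (hX : monCompletion P X) :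
    IsMonodromic (paramBett P) ((res (fromBet P).toRingHom).obj X) :=
  isMonodromic_res _ (fun _ => rfl) ((monCompletion_eq P) ▸ hX)

instance : (monResOf (fromdR P) (monCompletion P) (monodromic_fromdR P)).IsEquivalence :=
  isEquivalence_monRes_feasible P (projdR_orthogonal P) polyAction polyAction_comm polyAction_X
    mem_closure_deRhamPath (isCompletion_toCompletion (fun _ => AlgEquiv.refl)
      fun _ _ _ a => ⟨a, rfl, rfl⟩)

lemma isEquivalence_monResOf_of_eq {A C : Type} [Ring A] [Algebra ℂ A] [Ring C] [Algebra ℂ C]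
    {f : A →ₐ[ℂ] C} {z : Fin n → A} {w : Fin n → C} {hw : ∀ i, f.toRingHom (z i) = w i}
    (h : (monRes f.toRingHom hw).IsEquivalence) {Q : ObjectProperty (DMod C)}
    (hQ : Q = IsMonodromic w) (hQ' : ∀ X, Q X → IsMonodromic z ((res f.toRingHom).obj X)) :
    (monResOf f Q hQ').IsEquivalence := by
  subst hQ
  exact h

instance : (monResOf (fromBet P) (monCompletion P) (monodromic_fromBet P)).IsEquivalence :=
  isEquivalence_monResOf_of_eq (hw := fun _ => rfl)
    (isEquivalence_monRes_feasible P (projBet_orthogonal P) torusAction torusAction_comm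
      torusAction_coordZ' mem_closure_bettiPath
      (isCompletion_toCompletion (rhtEquiv P) (rhtEquiv_compat P))) (monCompletion_eq P) _

/-- The equivalence `D(A^dR_G(t,-))^mon ≃ D(A^Bet_G(t,-))^mon` through the common completion. -/
def rhMon : MonEquiv (paramdRt P) (paramBett P) :=
  MonEquiv.ofSpan (monResOf (fromdR P) (monCompletion P) (monodromic_fromdR P))
    (monResOf (fromBet P) (monCompletion P) (monodromic_fromBet P))

/-- A homomorphism `h` from the completion computes `rhMon` on restrictions along `h ∘ fromdR`. -/
def rhMonIso {B : Type} [Ring B] (h : completion (paramdRt P) →+* B) {X : Type 1} [Category.{1} X]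
    (T : X ⥤ DMod B) (hT : ∀ x, monCompletion P ((res h).obj (T.obj x)))
    {H : X ⥤ MonDMod (paramdRt P)} {H' : X ⥤ MonDMod (paramBett P)}
    (e : T ⋙ res (h.comp (fromdR P).toRingHom) ≅ H ⋙ (IsMonodromic (paramdRt P)).ι)
    (e' : T ⋙ res (h.comp (fromBet P).toRingHom) ≅ H' ⋙ (IsMonodromic (paramBett P)).ι) :
    H ⋙ (rhMon P).equiv.functor ≅ H' :=
  spanIso (monResOf (fromdR P) (monCompletion P) (monodromic_fromdR P)).asEquivalence
    (monResOf (fromBet P) (monCompletion P) (monodromic_fromBet P)).asEquivalence ((monCompletion P).lift (T ⋙ res h) hT)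
    (isoOfCompι (Functor.isoWhiskerLeft T (resComp (fromdR P).toRingHom h) ≪≫ e))
    (isoOfCompι (Functor.isoWhiskerLeft T (resComp (fromBet P).toRingHom h) ≪≫ e'))

end Correspondence

section Assembly

variable {n : ℕ}

lemma rhEquiv_vertex (k : ℕ) (i : Fin n) (s : Bool) :
    rhEquiv k (quo _ (inFactor i (toABet1 (PathAlg.e s)))) = quo _ (inFactor i (PathAlg.e s)) :=
  (nilMalgrange_inFactor k _ (mk_monomials k subset_rfl) i _).trans
    (congrArg (fun x => quo _ (inFactor i x)) (twist_e _ s))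

lemma rhEquiv_down (k : ℕ) (i : Fin n) :
    rhEquiv k (quo _ (inFactor i (toABet1 PathAlg.down))) = quo _ (inFactor i PathAlg.down) :=
  (nilMalgrange_inFactor k _ (mk_monomials k subset_rfl) i _).trans
    (congrArg (fun x => quo _ (inFactor i x)) (twist_down _))

lemma rhEquiv_up (k : ℕ) (i : Fin n) :
    rhEquiv k (quo _ (inFactor i (toABet1 PathAlg.up))) =
      quo _ (malgrangeSeries k (paramdR i) * inFactor i PathAlg.up) := by
  refine (nilMalgrange_inFactor k _ (mk_monomials k subset_rfl) i _).trans (congrArg (quo _) ?_)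
  rw [twist_up]
  refine (map_mul (inFactorHom i) _ _).trans (congrArg (· * _) ?_)
  exact (inFactor_aeval i _ _).trans (aeval_malgrangePoly _ _)

variable (P : PolarizedArrangement n)

/-- The equivalence `RHt` on modules over an infinitesimal neighbourhood. -/
def rhMonNbhd (k : ℕ) : nbhdRes (paramdRt P) k ⋙ (rhMon P).equiv.functor ≅
    res (rhtEquiv P k).toAlgHom.toRingHom ⋙ nbhdRes (paramBett P) k :=
  rhMonIso P (completionProj _ k).toRingHom (𝟭 _)
    (fun X => isMonodromic_res (completionProj _ k).toRingHom
      (w := fun i => quo _ (paramdRt P i)) (fun _ => rfl)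
      (isMonodromic_of_pow_eq_zero (k + 1) (Nbhd.pow_eq_zero _ k) X))
    (Iso.refl _)
    (resComp (quo (monomials (paramBett P) (k + 1))).toRingHom
      (rhtEquiv P k).toAlgHom.toRingHom).symm

section Bounded

variable {P} (Φ : ABettm P ≃ₐ[ℂ] AdRtm P) (hN : ∃ N, ∀ i, paramdRtm P i ^ N = 0)
  (hB : ∃ N, ∀ i, paramBettm P i ^ N = 0)

/-- Restriction along an isomorphism `A^Bet_G(t,m) ≃ A^dR_G(t,m)`, on monodromic objects. -/
abbrev resBounded : MonDMod (paramdRtm P) ⥤ MonDMod (paramBettm P) :=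
  monResOf Φ.toAlgHom (IsMonodromic (paramdRtm P)) fun _ _ =>
    isMonodromic_of_pow_eq_zero _ hB.choose_spec _

include hN in
lemma isEquivalence_resBounded : (resBounded Φ hB).IsEquivalence := by
  have := isEquivalence_ι_of_pow_eq_zero hB
  have := isEquivalence_ι_of_pow_eq_zero hN
  have := isEquivalence_res Φ.toAlgHom.toRingHom Φ.bijective
  have : (resBounded Φ hB ⋙ (IsMonodromic (paramBettm P)).ι).IsEquivalence :=
    inferInstanceAs ((IsMonodromic (paramdRtm P)).ι ⋙ res Φ.toAlgHom.toRingHom).IsEquivalence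
  exact Functor.isEquivalence_of_comp_right _ (IsMonodromic (paramBettm P)).ι

/-- The equivalence `D(A^dR_G(t,m))^mon ≃ D(A^Bet_G(t,m))^mon` given by restriction. -/
def rhMonBounded : MonEquiv (paramdRtm P) (paramBettm P) :=
  haveI := isEquivalence_resBounded Φ hN hB
  { equiv := (resBounded Φ hB).asEquivalence
    commShift := inferInstanceAs ((resBounded Φ hB).CommShift ℤ)
    isTriangulated := inferInstanceAs ((resBounded Φ hB).IsTriangulated)
    linear := inferInstanceAs ((resBounded Φ hB).Linear ℂ) }

variable {k0 : ℕ} (hk₀ : ∀ w ∈ monomials (paramdRtm P) (k0 + 1), w = 0)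

include hk₀ in
lemma mk_eq_zero_of_monomial {w : AdRt P} (hw : w ∈ monomials (paramdRt P) (k0 + 1)) :
    quo {unboundedIdem P (projdR_orthogonal P)} w = 0 := by
  obtain ⟨s, rfl⟩ := hw
  refine hk₀ _ ⟨s, ?_⟩
  rw [map_list_prod, map_ofFn]
  rfl

/-- The homomorphism from the completion to `A^dR_G(t,m)`. -/
def completionToBounded : completion (paramdRt P) →ₐ[ℂ] AdRtm P :=
  (QuotientBy.lift (quo {unboundedIdem P (projdR_orthogonal P)})
    fun _ => mk_eq_zero_of_monomial hk₀).comp (completionProj _ k0)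

lemma completionToBounded_fromBet
    (hΦ : ∀ x y, rhEquiv k0 (quo _ x) = quo _ y →
      Φ (boundedClass P (projBet_orthogonal P) x) = boundedClass P (projdR_orthogonal P) y) :
    (completionToBounded hk₀).toRingHom.comp (fromBet P).toRingHom =
      Φ.toAlgHom.toRingHom.comp (iBet P) := by
  refine RingHom.ext fun b => ?_
  obtain ⟨x, rfl⟩ := exists_toFeasible_eq P b
  obtain ⟨y, hy⟩ := exists_related k0 x
  exact (congrArg (QuotientBy.lift (quo {unboundedIdem P (projdR_orthogonal P)})
    fun _ => mk_eq_zero_of_monomial hk₀) (rhtEquiv_related P k0 (hy k0 le_rfl))).trans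
    (hΦ x y (hy k0 le_rfl)).symm

/-- The Riemann-Hilbert equivalences intertwine the restriction functors `i_*`. -/
def rhSquare (hΦ : ∀ x y, rhEquiv k0 (quo _ x) = quo _ y →
      Φ (boundedClass P (projBet_orthogonal P) x) = boundedClass P (projdR_orthogonal P) y) :
    (rhMonBounded Φ hN hB).equiv.functor ⋙ iBetMon P ≅ idRMon P ⋙ (rhMon P).equiv.functor :=
  (rhMonIso P (completionToBounded hk₀).toRingHom (IsMonodromic (paramdRtm P)).ι
    (fun X => isMonodromic_res (completionToBounded hk₀).toRingHom (w := paramdRtm P) (fun _ => rfl) X.property)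
    (Iso.refl _)
    (Functor.isoWhiskerLeft _ (eqToIso (congrArg res (completionToBounded_fromBet Φ hk₀ hΦ)) ≪≫
      (resComp (iBet P) Φ.toAlgHom.toRingHom).symm))).symm

lemma rhtm_compat (hΦ : ∀ k, k0 ≤ k → ∀ x y, rhEquiv k (quo _ x) = quo _ y →
      Φ (boundedClass P (projBet_orthogonal P) x) = boundedClass P (projdR_orthogonal P) y)
    (k : ℕ) (x : ABet n) (y : AdR n) (h : rhEquiv k (quo _ x) = quo _ y) :
    quo (monomials (paramdRtm P) (k + 1))
        (Φ (toBounded P (projBet_orthogonal P) (projBet P x))) =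
      quo (monomials (paramdRtm P) (k + 1)) (toBounded P (projdR_orthogonal P) (projdR P y)) := by
  obtain ⟨y', hy'⟩ := exists_related (max k k0) x
  have h1 := hΦ _ (le_max_right k k0) x y' (hy' _ le_rfl)
  have h2 := (rhtEquiv_related P k (hy' k (le_max_left k k0))).symm.trans (rhtEquiv_related P k h)
  let f : Nbhd (paramdRt P) k →ₐ[ℂ] Nbhd (paramdRtm P) k :=
    QuotientBy.lift ((quo _).comp (quo {unboundedIdem P (projdR_orthogonal P)}))
      (by
        rintro _ ⟨s, rfl⟩
        refine mk_eq_zero ⟨s, ?_⟩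
        rw [map_list_prod, map_ofFn]
        rfl)
  exact (congrArg (quo _) h1).trans (congrArg f h2)

end Bounded

lemma nonempty_riemannHilbert (D : CategoryODatum n) :
    Nonempty (RiemannHilbert D.toPolarizedArrangement) := by
  obtain ⟨k0, Φ, hk₀, hΦ⟩ := exists_rhtm D
  have hN := exists_pow_paramdRtm D
  have hB := exists_pow_paramBettm D
  exact ⟨{
    rh := rhEquiv
    rh_vertex := rhEquiv_vertex
    rh_down := rhEquiv_down
    rh_up := rhEquiv_up
    rht := rhtEquiv _
    rht_compat := fun k _ _ => rhtEquiv_related _ k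
    rhtm := Φ
    rhtm_compat := rhtm_compat Φ hΦ
    RHt := rhMon _
    RHtm := rhMonBounded Φ hN hB
    square := rhSquare Φ hN hB hk₀ (hΦ k0 le_rfl)
    RHt_nbhd := rhMonNbhd _
    RHtm_iso := Iso.refl _
    isEquivalence := isEquivalence_res _ Φ.bijective }⟩

end Assembly

end HypertoricO

end

theorem mainTheorem4 {n : ℕ} (P : HypertoricO.CategoryODatum n) :
    HypertoricO.IsStratifying (HypertoricO.idemUBet P.toPolarizedArrangement) ∧
    Nonempty (HypertoricO.Recollement
      (HypertoricO.res (HypertoricO.iBet P.toPolarizedArrangement))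
      (HypertoricO.cornerRes (HypertoricO.unboundedIdem_idem P.toPolarizedArrangement
        (HypertoricO.projBet_orthogonal P.toPolarizedArrangement)))) ∧
    (HypertoricO.IsMonodromic (HypertoricO.paramBettm P.toPolarizedArrangement)).ι.IsEquivalence ∧
    (HypertoricO.IsMonodromic (HypertoricO.paramdRtm P.toPolarizedArrangement)).ι.IsEquivalence ∧
    Nonempty (HypertoricO.RiemannHilbert P.toPolarizedArrangement) := by
  have h := HypertoricO.isStrat_iBet_of_tRegular P.toPolarizedArrangement P.tRegular
  refine ⟨⟨h.full, h.faithful⟩, h.recollement _ fun _ => HypertoricO.QuotientBy.mk_eq_zero_iff, ?_, ?_, ?_⟩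
  · exact HypertoricO.isEquivalence_ι_of_pow_eq_zero (HypertoricO.exists_pow_paramBettm P)
  · exact HypertoricO.isEquivalence_ι_of_pow_eq_zero (HypertoricO.exists_pow_paramdRtm P)
  · exact HypertoricO.nonempty_riemannHilbert P
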